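/- **Setting.** Let $d\ge 3$, $\langle x\rangle=(|x|^2+1)^{1/2}$ and $\log^*t=\max\{1,\log t\}$. Let $e,\omega:\mathbb R^d\to[0,\infty)$ and $Q:\mathbb R^d\to\mathbb R$ be even functions of class $C^{2d}$, let $\beta>0$, $\mu\in\mathbb R$, and put $\Phi_\sigma(p,k)=e(k+p)+\sigma\omega(k)$ for $\sigma\in\{\pm\}=\{\pm1\}$. Assume that with constants $C_1,\dots,C_8$ and $\tilde\varrho$ (where $C_3,C_5,C_6,\tilde\varrho>0$) * $|\nabla^\ell e(k)|\le C_1(1+\langle k\rangle^{2-\ell})$, $|\nabla^\ell\omega(k)|\le C_2(1+\langle k\rangle^{2-\ell})$, $|\nabla^\ell Q(k)|\le C_7\langle k\rangle^{-2d-12}$ for $0\le\ell\le 2d$; * $\Phi_\pm(p,k)\to\infty$ as $k\to\infty$, and $C_3\le \mathrm{Hess}_k\,\Phi_\pm(p,k)\le C_4$; * (transversality) for each sign $\sigma$, all $0<\delta_1,\delta_2\le\tilde\varrho$, all $\theta_1,\theta_2\in\mathbb R$, $q\in\mathbb R^d$ and $p_1\ne p_2$, the set of $k\in B(q,\tilde\varrho)$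 with $|\Phi_\sigma(p_1,k)-\theta_1|\le\delta_1$ and $|\Phi_\sigma(p_2,k)-\theta_2|\le\delta_2$ has Lebesgue measure at most $C_5\,\delta_1\delta_2/|p_1-p_2|$; * $\inf_k\omega(k)-\mu\beta^{-1}\ge C_6$. Let $\mathcal N(k)=e^{-\beta\omega(k)+\mu}/(1-e^{-\beta\omega(k)+\mu})$ and $M(k,\sigma)=|Q(k)|^2\big(\mathcal N(k)+\frac{\sigma+1}{2}\big)$. For $L>0$ let $\Lambda_L^*=(\sqrt{2\pi}L^{-1}\mathbb Z)^d$, $\int_{\Lambda_L^*}f(k)\,dk=L^{-d}\sum_{k\in\Lambda_L^*}f(k)$, and let $\delta(k)=L^d$ if $k=0$ and $0$ otherwise. For every $L$ let $\widehat\gamma_e=\widehat\gamma_{e,L}$ be a positive semidefinite kernel on $\Lambda_L^*\times\Lambda_L^*$ with $\int_{\Lambda_L^*}\widehat\gamma_e(p,p)\,dp=1$, such that $\limsup_{L\to\infty}\int_{\Lambda_L^*}\langle p\rangle^{3d+12}\,\widehat\gamma_e(p,p)\,dp\le C_8$. **The contribution of a pairing.** Let $\mathcal M(n,N)$ be the set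 of $\underline m=(m_0,\dots,m_n)\in\mathbb N_0^{n+1}$ with $n+2\sum_j m_j=N$. For such $\underline m$ put $\mu(j)=j+2\sum_{i<j}m_i$, $I_j=\{\mu(j)+1,\mu(j)+3,\dots,\mu(j)+2m_j-1\}$, $I_j^c=\{\mu(j),\mu(j)+2,\dots,\mu(j)+2m_j\}$, and let $\tilde I_j,\tilde I_j^c$ be the sets belonging to $\underline{\tilde m}$. Write $$\int_0^{t*}[ds_b]_0^N=\int_{[0,t]^{N+1}}\Big(\prod_{b=0}^N ds_b\Big)\,\delta\Big(t-\sum_{b=0}^N s_b\Big),\qquad \Theta(s,p,\Omega)=\sum_{\sigma\in\{\pm\}}\int_{\Lambda_L^*}e^{-is[\Phi_\sigma(p,k)+\Omega]}M(k,\sigma)\,dk .$$ For a permutation $\pi$ of $\{1,\dots,n\}$, momenta $p_n,\tilde p_n,k_j,\tilde k_j$ and signs $\sigma_j$ $(1\le j\le n)$, put $$p_j=p_n+\sum_{\ell>j}k_\ell,\qquad \Omega_j=\sum_{\ell>j}\sigma_\ell\,\omega(k_\ell),\qquad \tilde p_j=\tilde p_n+\sum_{\ell>j}\tilde k_\ell,\qquad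 \tilde\Omega_j=\sum_{\ell>j}\sigma_{\pi^{-1}(\ell)}\,\omega(\tilde k_\ell),$$ $$Y=\int_0^{t*}[ds_b]_0^N\prod_{j=0}^n\Big[\prod_{b\in I_j^c}e^{-is_b[e(p_j)+\Omega_j]}\prod_{b\in I_j}\Theta(s_b,p_j,\Omega_j)\Big]\;\int_0^{t*}[d\tilde s_b]_0^N\prod_{j=0}^n\Big[\prod_{b\in\tilde I_j^c}e^{i\tilde s_b[e(\tilde p_j)+\tilde\Omega_j]}\prod_{b\in\tilde I_j}\overline{\Theta(\tilde s_b,\tilde p_j,\tilde\Omega_j)}\Big].$$ For $\lambda\in\mathbb R$ and $\underline m,\underline{\tilde m}\in\mathcal M(n,N)$ define, all momenta ranging over $\Lambda_L^*$, $$C_{\underline m,\underline{\tilde m},\pi}(t)=\lambda^{2N}\sum_{\sigma\in\{\pm\}^n}\int\Big(\prod_{j=1}^nM(k_j,\sigma_j)\,\delta(k_j-\tilde k_{\pi(j)})\,dk_j\,d\tilde k_j\Big)\,dp_n\,d\tilde p_n\,\delta(p_n-\tilde p_n)\,\widehat\gamma_e(p_n,\tilde p_n)\;Y .$$ **Staircases.**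 A *peak* of $\pi$ is an $a$ with $1<a<n$ and $\pi(a-1)<\pi(a)>\pi(a+1)$. An *up-stair* (*down-stair*) is a run $a,a+1,\dots,a+h$ in $\{1,\dots,n\}$, $h\ge1$, along which $\pi$ increases (decreases). An *increasing $\kappa$-staircase* ($\kappa\ge1$) consists of $\kappa$ up-stairs $a_j,\dots,a_j+h_j$ such that each $a_j+h_j$ is a peak and, for $1\le j<\kappa$: $a_j+h_j<a_{j+1}$; $\pi(a_j+h_j)<\pi(a_{j+1}+h_{j+1})$; no peak $p$ with $a_j<p<a_{j+1}$ has $\pi(p)>\pi(a_j+h_j)$; and $\pi(a_{j+1}+1)>\pi(a_j+h_j)>\pi(a_{j+1})$. A *decreasing $\kappa$-staircase* consists of $\kappa$ down-stairs $a_j,\dots,a_j+h_j$ such that each $a_j$ is a peak and, for $1\le j<\kappa$: $a_j+h_j<a_{j+1}$; $\pi(a_j)>\pi(a_{j+1})$; no peak $p$ with $a_j<p<a_{j+1}$ has $\pi(p)>\pi(a_{j+1})$; and $\pi(a_j+h_j-1)>\pi(a_{j+1})>\pi(a_j+h_j)$. **Proposition.** There is a constant $C$, depending only on $d$, $\beta$,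 $C_1,\dots,C_8$ and $\tilde\varrho$, such that under the assumptions above, if $\omega$ is not constant, then for all $n\le N$, all $\underline m,\underline{\tilde m}\in\mathcal M(n,N)$, all $\kappa\ge1$, every permutation $\pi$ of $\{1,\dots,n\}$ that has an increasing or a decreasing $\kappa$-staircase, all $\lambda\in\mathbb R$ and all $t>0$, $$\limsup_{L\to\infty}\big|C_{\underline m,\underline{\tilde m},\pi}(t)\big|\;\le\; t^{-\kappa+2}\,(C\lambda^2t)^N\,(\log^*t)^{n+\kappa+2}.$$ -/

import Mathlib

open scoped BigOperators ENNReal ComplexOrder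
open Filter MeasureTheory

noncomputable section

namespace Phonon

/-! ### Basic notation -/

/-- Momentum space `ℝ^d` with its Euclidean norm. -/
abbrev Mom (d : ℕ) : Type := EuclideanSpace ℝ (Fin d)

/-- Index set of the dual lattice `Λ_L^* = (√(2π) L⁻¹ ℤ)^d`. -/
abbrev DualLat (d : ℕ) : Type := Fin d → ℤ

/-- The Japanese bracket `⟨x⟩ = (|x|² + 1)^{1/2}`. -/
def bracket {d : ℕ} (x : Mom d) : ℝ := Real.sqrt (‖x‖ ^ 2 + 1)

/-- `log^* t = max {1, log t}`. -/
def logStar (t : ℝ) : ℝ := max 1 (Real.log t)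

/-- The sign `σ ∈ {+1, -1}` as a real number. -/
def sgn (σ : ℤˣ) : ℝ := ((σ : ℤ) : ℝ)

/-- The point of `Λ_L^*` with index `z`. -/
def latPt {d : ℕ} (L : ℝ) (z : DualLat d) : Mom d :=
  WithLp.toLp 2 (fun i => Real.sqrt (2 * Real.pi) / L * (z i : ℝ))

/-- The lattice delta function: `L^d` at zero and `0` elsewhere. -/
def latDelta {d : ℕ} (L : ℝ) (z : DualLat d) : ℝ := if z = 0 then L ^ d else 0

/-- `∫_{Λ^*} f(k) dk = L^{-d} ∑_{k ∈ Λ_L^*} f(k)`. -/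
def latIntegral {d : ℕ} (L : ℝ) (f : Mom d → ℂ) : ℂ :=
  ((L : ℂ) ^ d)⁻¹ * ∑' z : DualLat d, f (latPt L z)

/-- `∫_0^{t*} [ds_j]_0^N f(s_0, …, s_N)`, the integral over `s_j ≥ 0` against
`δ(t - ∑ s_j) ∏ ds_j`; the delta function is used to integrate out `s_0`. -/
def timeIntegral (N : ℕ) (t : ℝ) (f : (Fin (N + 1) → ℝ) → ℂ) : ℂ :=
  ∫ s in {s : Fin N → ℝ | (∀ i, 0 ≤ s i) ∧ ∑ i, s i ≤ t},
    f (Fin.cons (t - ∑ i, s i) s)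

/-! ### The electron-phonon model and its assumptions -/

/-- The data of the model: electron and phonon dispersion relations, interaction function,
inverse temperature and chemical potential. -/
structure Model (d : ℕ) where
  e : Mom d → ℝ
  ω : Mom d → ℝ
  Q : Mom d → ℝ
  β : ℝ
  μ : ℝ

namespace Model

variable {d : ℕ} (S : Model d)

/-- `Φ_σ(p, k) = e(k + p) + σ ω(k)`. -/
def Phi (σ : ℤˣ) (p k : Mom d) : ℝ := S.e (k + p) + sgn σ * S.ω k

/-- `E_σ(p, θ, δ) = {k : |Φ_σ(p, k) - θ| ≤ δ}`. -/
def levelShell (σ : ℤˣ) (p : Mom d) (θ δ : ℝ) : Set (Mom d) := {k | |S.Phi σ p k - θ| ≤ δ}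

/-- The mean number of phonons in the mode `k`. -/
def occupation (k : Mom d) : ℝ :=
  Real.exp (-S.β * S.ω k + S.μ) / (1 - Real.exp (-S.β * S.ω k + S.μ))

/-- `M(k, σ) = |Q(k)|² (𝒩(k) + (σ + 1)/2)`. -/
def M (k : Mom d) (σ : ℤˣ) : ℝ := |S.Q k| ^ 2 * (S.occupation k + (sgn σ + 1) / 2)

end Model

/-- The constants that quantify the assumptions; `c₈` bounds the moment of the electron state and
`ρ` is the length scale of the transversality condition. -/
structure Constants where
  c₁ : ℝ
  c₂ : ℝ
  c₃ : ℝ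
  c₄ : ℝ
  c₅ : ℝ
  c₆ : ℝ
  c₇ : ℝ
  c₈ : ℝ
  ρ : ℝ

/-- The assumptions on the dispersion relations, the interaction and the phonon state. -/
structure Assumptions {d : ℕ} (K : Constants) (S : Model d) : Prop where
  β_pos : 0 < S.β
  e_nonneg : ∀ k, 0 ≤ S.e k
  ω_nonneg : ∀ k, 0 ≤ S.ω k
  e_even : ∀ k, S.e (-k) = S.e k
  ω_even : ∀ k, S.ω (-k) = S.ω k
  e_smooth : ContDiff ℝ ((2 * d : ℕ) : ℕ∞) S.e
  e_bound : ∀ l : ℕ, l ≤ 2 * d → ∀ k,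
    ‖iteratedFDeriv ℝ l S.e k‖ ≤ K.c₁ * (1 + bracket k ^ (2 - (l : ℤ)))
  ω_smooth : ContDiff ℝ ((2 * d : ℕ) : ℕ∞) S.ω
  ω_bound : ∀ l : ℕ, l ≤ 2 * d → ∀ k,
    ‖iteratedFDeriv ℝ l S.ω k‖ ≤ K.c₂ * (1 + bracket k ^ (2 - (l : ℤ)))
  Phi_lim : ∀ (σ : ℤˣ) (p : Mom d), Tendsto (S.Phi σ p) (cocompact (Mom d)) atTop
  c₃_pos : 0 < K.c₃
  hess_lower : ∀ (σ : ℤˣ) (p k v : Mom d),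
    K.c₃ * ‖v‖ ^ 2 ≤ iteratedFDeriv ℝ 2 (S.Phi σ p) k ![v, v]
  hess_upper : ∀ (σ : ℤˣ) (p k v : Mom d),
    iteratedFDeriv ℝ 2 (S.Phi σ p) k ![v, v] ≤ K.c₄ * ‖v‖ ^ 2
  c₅_pos : 0 < K.c₅
  ρ_pos : 0 < K.ρ
  /-- The transversality condition, the same sign being taken in both shells. -/
  transversal : ∀ (σ : ℤˣ) (δ₁ δ₂ : ℝ), 0 < δ₁ → δ₁ ≤ K.ρ → 0 < δ₂ → δ₂ ≤ K.ρ →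
    ∀ p₁ p₂ : Mom d, p₁ ≠ p₂ → ∀ (θ₁ θ₂ : ℝ) (q : Mom d),
      volume (S.levelShell σ p₁ θ₁ δ₁ ∩ S.levelShell σ p₂ θ₂ δ₂ ∩ Metric.ball q K.ρ)
        ≤ ENNReal.ofReal (K.c₅ * δ₁ * δ₂ / ‖p₁ - p₂‖)
  c₆_pos : 0 < K.c₆
  gap : ∀ k, K.c₆ ≤ S.ω k - S.μ / S.β
  Q_even : ∀ k, S.Q (-k) = S.Q k
  Q_smooth : ContDiff ℝ ((2 * d : ℕ) : ℕ∞) S.Q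
  Q_decay : ∀ l : ℕ, l ≤ 2 * d → ∀ k,
    ‖iteratedFDeriv ℝ l S.Q k‖ ≤ K.c₇ * bracket k ^ (-(2 * (d : ℤ) + 12))

/-- `g` is the momentum-space kernel `γ̂_e(p, p')` on `Λ_L^* × Λ_L^*` of an electron density matrix:
positive semidefinite with `Tr γ_e = ∫_{Λ^*} γ̂_e(p, p) dp = 1`. -/
structure IsDensityMatrix {d : ℕ} (L : ℝ) (g : DualLat d → DualLat d → ℂ) : Prop where
  posSemidef : (Matrix.of g).PosSemidef
  trace : HasSum (fun p => (g p p).re / L ^ d) 1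

/-- `∫_{Λ^*} ⟨p⟩^{3d+12} γ̂_e(p, p) dp ∈ [0, ∞]`. -/
def moment {d : ℕ} (L : ℝ) (g : DualLat d → DualLat d → ℂ) : ℝ≥0∞ :=
  ∑' p : DualLat d, ENNReal.ofReal (bracket (latPt L p) ^ (3 * d + 12) * (g p p).re / L ^ d)

/-! ### Immediate reabsorption patterns -/

/-- `ℳ(n, N)`: tuples `(m_0, …, m_n)` with `n + 2 ∑ m_j = N`. -/
def patterns (n N : ℕ) : Set (Fin (n + 1) → ℕ) := {m | n + 2 * ∑ j, m j = N}

/-- `μ(j) = j + 2 ∑_{i < j} m_i`. -/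
def position {n : ℕ} (m : Fin (n + 1) → ℕ) (j : Fin (n + 1)) : ℕ :=
  (j : ℕ) + 2 * ∑ i ∈ Finset.univ.filter (fun i => i < j), m i

/-- `I_j = {μ(j) + 1, μ(j) + 3, …, μ(j) + 2 m_j - 1}`. -/
def innerIdx {n : ℕ} (N : ℕ) (m : Fin (n + 1) → ℕ) (j : Fin (n + 1)) : Finset (Fin (N + 1)) :=
  Finset.univ.filter fun b => ∃ i, i < m j ∧ (b : ℕ) = position m j + 2 * i + 1

/-- `I_j^c = {μ(j), μ(j) + 2, …, μ(j) + 2 m_j}`. -/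
def outerIdx {n : ℕ} (N : ℕ) (m : Fin (n + 1) → ℕ) (j : Fin (n + 1)) : Finset (Fin (N + 1)) :=
  Finset.univ.filter fun b => ∃ i, i ≤ m j ∧ (b : ℕ) = position m j + 2 * i

/-! ### The value of a pairing graph -/

/-- `p_j = p_n + ∑_{l = j+1}^n k_l`; the list `k_1, …, k_n` is indexed by `Fin n`, so that `k_l` is
the entry with index `l - 1`. -/
def momentum {d n : ℕ} (p : Mom d) (k : Fin n → Mom d) (j : Fin (n + 1)) : Mom d :=
  p + ∑ l ∈ Finset.univ.filter (fun l : Fin n => (j : ℕ) ≤ (l : ℕ)), k l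

namespace Model

variable {d : ℕ} (S : Model d)

/-- `Ω_j(k, σ) = ∑_{l = j+1}^n σ_l ω(k_l)`. -/
def Omega {n : ℕ} (k : Fin n → Mom d) (σ : Fin n → ℤˣ) (j : Fin (n + 1)) : ℝ :=
  ∑ l ∈ Finset.univ.filter (fun l : Fin n => (j : ℕ) ≤ (l : ℕ)), sgn (σ l) * S.ω (k l)

/-- `Θ(s, p, Ω) = ∑_σ ∫_{Λ^*} e^{-is[Φ_σ(p, k) + Ω]} M(k, σ) dk`. -/
def Theta (L s : ℝ) (p : Mom d) (Ω : ℝ) : ℂ :=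
  ∑ σ : ℤˣ, latIntegral L fun k =>
    Complex.exp (-Complex.I * (s : ℂ) * ((S.Phi σ p k + Ω : ℝ) : ℂ)) * (S.M k σ : ℂ)

/-- The time integral of one electron history,
`∫_0^{t*} [ds_b]_0^N ∏_j [∏_{b ∈ I_j^c} e^{-i s_b [e(p_j) + Ω_j]} ∏_{b ∈ I_j} Θ(s_b, p_j, Ω_j)]`. -/
def history {n : ℕ} (N : ℕ) (L : ℝ) (m : Fin (n + 1) → ℕ) (t : ℝ) (p : Mom d)
    (k : Fin n → Mom d) (σ : Fin n → ℤˣ) : ℂ :=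
  timeIntegral N t fun s => ∏ j : Fin (n + 1),
    ((∏ b ∈ outerIdx N m j,
        Complex.exp (-Complex.I * (s b : ℂ) *
          ((S.e (momentum p k j) + S.Omega k σ j : ℝ) : ℂ))) *
      ∏ b ∈ innerIdx N m j, S.Theta L (s b) (momentum p k j) (S.Omega k σ j))

/-- The time integral of the conjugate electron history,
`∫_0^{t*} [ds_b]_0^N ∏_j [∏_{b ∈ I_j^c} e^{i s_b [e(p_j) + Ω_j]} ∏_{b ∈ I_j} Θ̄(s_b, p_j, Ω_j)]`. -/
def conjHistory {n : ℕ} (N : ℕ) (L : ℝ) (m : Fin (n + 1) → ℕ) (t : ℝ) (p : Mom d)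
    (k : Fin n → Mom d) (σ : Fin n → ℤˣ) : ℂ :=
  timeIntegral N t fun s => ∏ j : Fin (n + 1),
    ((∏ b ∈ outerIdx N m j,
        Complex.exp (Complex.I * (s b : ℂ) *
          ((S.e (momentum p k j) + S.Omega k σ j : ℝ) : ℂ))) *
      ∏ b ∈ innerIdx N m j, star (S.Theta L (s b) (momentum p k j) (S.Omega k σ j)))

/-- `Y_{m, m̃, π}(t; p_n, p̃_n, k, k̃, σ)`; the signs of the second history are `σ ∘ π⁻¹`. -/
def Y {n : ℕ} (N : ℕ) (L : ℝ) (m m' : Fin (n + 1) → ℕ) (π : Equiv.Perm (Fin n)) (t : ℝ)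
    (p p' : Mom d) (k k' : Fin n → Mom d) (σ : Fin n → ℤˣ) : ℂ :=
  S.history N L m t p k σ * S.conjHistory N L m' t p' k' (fun l => σ (π.symm l))

/-- The contribution of a pairing in the box of size `L`,
`C_{m, m̃, π}(t) = λ^{2N} ∑_σ ∫ dν_π(p_n, p̃_n, k, k̃, σ) Y_{m, m̃, π}(t; p_n, p̃_n, k, k̃, σ)` with
`dν_π = ∏_j M(k_j, σ_j) δ(k_j - k̃_{π(j)}) dk_j dk̃_j · δ(p_n - p̃_n) γ̂_e(p_n, p̃_n) dp_n dp̃_n`. -/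
def pairingValue {n : ℕ} (N : ℕ) (L : ℝ) (g : DualLat d → DualLat d → ℂ) (lam : ℝ)
    (m m' : Fin (n + 1) → ℕ) (π : Equiv.Perm (Fin n)) (t : ℝ) : ℂ :=
  (lam : ℂ) ^ (2 * N) * ∑ σ : Fin n → ℤˣ,
    (((L : ℂ) ^ d)⁻¹) ^ (2 * n + 2) *
      ∑' x : DualLat d × DualLat d × (Fin n → DualLat d) × (Fin n → DualLat d),
        (∏ j : Fin n, (S.M (latPt L (x.2.2.1 j)) (σ j) : ℂ) *
            (latDelta L (x.2.2.1 j - x.2.2.2 (π j)) : ℂ)) *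
          ((latDelta L (x.1 - x.2.1) : ℂ) * g x.1 x.2.1) *
          S.Y N L m m' π t (latPt L x.1) (latPt L x.2.1)
            (fun j => latPt L (x.2.2.1 j)) (fun j => latPt L (x.2.2.2 j)) σ

end Model

/-! ### Stairs and staircases of a permutation of `{1, …, n}` -/

/-- The permutation in the labelling `1, …, n`: the value `π(a) ∈ {1, …, n}` for `1 ≤ a ≤ n`
(and `0` for other `a`, which never enters below). -/
def height {n : ℕ} (π : Equiv.Perm (Fin n)) (a : ℕ) : ℕ :=
  if h : 1 ≤ a ∧ a ≤ n then (π ⟨a - 1, by omega⟩ : ℕ) + 1 else 0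

/-- `a` is a peak: `1 < a < n` and `π(a - 1) < π(a) > π(a + 1)`. -/
def IsPeak {n : ℕ} (π : Equiv.Perm (Fin n)) (a : ℕ) : Prop :=
  1 < a ∧ a < n ∧ height π (a - 1) < height π a ∧ height π (a + 1) < height π a

/-- `a, a + 1, …, a + h` is an up-stair of length `h ≥ 1`. -/
def IsUpStair {n : ℕ} (π : Equiv.Perm (Fin n)) (a h : ℕ) : Prop :=
  1 ≤ h ∧ 1 ≤ a ∧ a + h ≤ n ∧ ∀ i < h, height π (a + i) < height π (a + i + 1)

/-- `a, a + 1, …, a + h` is a down-stair of length `h ≥ 1`. -/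
def IsDownStair {n : ℕ} (π : Equiv.Perm (Fin n)) (a h : ℕ) : Prop :=
  1 ≤ h ∧ 1 ≤ a ∧ a + h ≤ n ∧ ∀ i < h, height π (a + i + 1) < height π (a + i)

/-- The stairs `a_j, …, a_j + h_j`, `j = 1, …, κ`, form an increasing `κ`-staircase. -/
structure IsIncreasingStaircase {n : ℕ} (π : Equiv.Perm (Fin n)) (κ : ℕ) (a h : Fin κ → ℕ) :
    Prop where
  stair : ∀ j, IsUpStair π (a j) (h j)
  disjoint : ∀ i j : Fin κ, (i : ℕ) + 1 = j → a i + h i < a j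
  peak : ∀ j, IsPeak π (a j + h j)
  increasing : ∀ i j : Fin κ, (i : ℕ) + 1 = j →
    height π (a i + h i) < height π (a j + h j)
  no_peak : ∀ i j : Fin κ, (i : ℕ) + 1 = j →
    ¬ ∃ p, IsPeak π p ∧ a i < p ∧ p < a j ∧ height π (a i + h i) < height π p
  overlap : ∀ i j : Fin κ, (i : ℕ) + 1 = j →
    height π (a i + h i) < height π (a j + 1) ∧ height π (a j) < height π (a i + h i)

/-- The stairs `a_j, …, a_j + h_j`, `j = 1, …, κ`, form a decreasing `κ`-staircase. -/
structure IsDecreasingStaircase {n : ℕ} (π : Equiv.Perm (Fin n)) (κ : ℕ) (a h : Fin κ → ℕ) :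
    Prop where
  stair : ∀ j, IsDownStair π (a j) (h j)
  disjoint : ∀ i j : Fin κ, (i : ℕ) + 1 = j → a i + h i < a j
  peak : ∀ j, IsPeak π (a j)
  decreasing : ∀ i j : Fin κ, (i : ℕ) + 1 = j → height π (a j) < height π (a i)
  no_peak : ∀ i j : Fin κ, (i : ℕ) + 1 = j →
    ¬ ∃ p, IsPeak π p ∧ a i < p ∧ p < a j ∧ height π (a j) < height π p
  overlap : ∀ i j : Fin κ, (i : ℕ) + 1 = j →
    height π (a j) < height π (a i + h i - 1) ∧ height π (a i + h i) < height π (a j)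

end Phonon

end

open Phonon

noncomputable section

namespace Phonon

/-! ### The bracket -/

section Bracket

variable {d : ℕ}

/-! Continuum limit. The delta functions leave a sum over the electron momentum p, the phonon
momenta k and the signs. A lattice sum is the integral of the summand composed with rounding to the
corner of a lattice cell, and for fixed t and N a history changes under rounding by O(1/L) times a
polynomial weight in the momenta (`Assumptions.norm_histMap_sub_le`, `Assumptions.momSum_le`). It
therefore suffices to bound a continuum integral over k by a constant times ⟨p⟩^16, which the moment
of order 3d + 12 of the electron state absorbs.

Resolvents. A time integral over the simplex is a convolution of N + 1 functions evaluated at t.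
Damping each of them by e^{-s/t} and inverting the Fourier transform bounds it by e times the
integral over α of the product of the moduli of the Laplace transforms (`enorm_timeIntegral_le`). A
free factor contributes |α - E + i/t|^{-1}. A factor Θ contributes a quantity bounded uniformly in t
(`norm_lap_theta_le`), because its phase is uniformly convex and d ≥ 3. Hence every immediate
reabsorption costs one factor t, which makes N - n such factors for the two histories together, and
n + 1 resolvents remain in each history.

Two chains. Let x be the foot of the first stair of an increasing staircase, or of the last stair of
a decreasing one, and split the resolvents of the first history at x. A product of resolvents is
essentially constant on the scale 1/t, so the two groups can be given separate variables α at the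
cost of one factor t. The right group has energies built up from k_n, k_{n-1}, … starting at p. By
evenness of e, the left group has energies built up from k_1, k_2, … starting at the momentum y = p
+ ∑ k of the other end. With y as a variable in place of k_x, both groups are chains in which every
resolvent brings in one new momentum, and each integration costs a logarithm (`one_resolvent_bound`,
which rests on `coarea_bound`).

Gain at the peaks. In the conjugate history the resolvents at p and at the κ peaks are kept, and the
other n - κ are bounded by O(t). The energy at a peak b involves exactly the k_i with π(i) ≥ π(b).
It contains v = k_b, but neither the neighbour u of k_b on the side away from x, nor any chain
variable between b and x, nor k_x; this is what a staircase guarantees (`exists_peaks`). Integrating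
over u first, one meets two resolvents of the first history with the same sign and with momenta
differing by v. Transversality bounds them by log² t (1 + |v|^{-1}) (`two_resolvent_bound`), and the
point singularity is harmless in the integral over v against the resolvent of the peak
(`resolvent_integrals`). Three resolvents thus cost three logarithms and no power of t;
`chain_elimination` organises these integrations.

Count. For t ≥ 1 the powers of t are t^{N-n} · t · t^{n-κ} = t^{N+1-κ}, one better than required.
The logarithms come from the n - 1 chain variables, the κ peaks and the three integrals over α. For
t < 1 the trivial bound by t^{2N} is enough. -/

lemma bracket_sq (x : Mom d) : bracket x ^ 2 = ‖x‖ ^ 2 + 1 :=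
  Real.sq_sqrt (by positivity)

lemma one_le_bracket (x : Mom d) : 1 ≤ bracket x :=
  Real.one_le_sqrt.2 (by nlinarith [sq_nonneg ‖x‖])

lemma bracket_pos (x : Mom d) : 0 < bracket x := lt_of_lt_of_le one_pos (one_le_bracket x)

lemma norm_le_bracket (x : Mom d) : ‖x‖ ≤ bracket x :=
  Real.le_sqrt_of_sq_le (by linarith)

lemma bracket_le_one_add (x : Mom d) : bracket x ≤ 1 + ‖x‖ := by
  refine Real.sqrt_le_iff.2 ⟨by positivity, ?_⟩
  nlinarith [norm_nonneg x]

@[simp] lemma bracket_neg (x : Mom d) : bracket (-x) = bracket x := by simp [bracket]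

lemma bracket_mono {x y : Mom d} (h : ‖x‖ ≤ ‖y‖) : bracket x ≤ bracket y :=
  Real.sqrt_le_sqrt (by gcongr)

lemma bracket_add_le (x y : Mom d) : bracket (x + y) ≤ 2 * bracket x * bracket y := by
  have hx := bracket_pos x
  have hy := bracket_pos y
  refine (sq_le_sq₀ (bracket_pos _).le (by positivity)).1 ?_
  have h : ‖x + y‖ ^ 2 ≤ (‖x‖ + ‖y‖) ^ 2 := by gcongr; exact norm_add_le x y
  rw [mul_pow, mul_pow, bracket_sq, bracket_sq, bracket_sq]
  nlinarith [sq_nonneg (‖x‖ - ‖y‖), mul_nonneg (sq_nonneg ‖x‖) (sq_nonneg ‖y‖)]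

lemma continuous_bracket : Continuous (bracket : Mom d → ℝ) := by
  unfold bracket; fun_prop

@[fun_prop] lemma _root_.Continuous.bracket {X : Type*} [TopologicalSpace X] {f : X → Mom d}
    (hf : Continuous f) : Continuous fun x => bracket (f x) := continuous_bracket.comp hf

lemma bracket_sum_le {ι : Type*} (s : Finset ι) (k : ι → Mom d) :
    bracket (∑ i ∈ s, k i) ≤ ∏ i ∈ s, (2 * bracket (k i)) := by
  classical
  induction s using Finset.induction_on with
  | empty => simp [bracket]
  | insert a s ha ih =>
    rw [Finset.sum_insert ha, Finset.prod_insert ha]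
    refine (bracket_add_le _ _).trans ?_
    have := bracket_pos (k a)
    gcongr

/-- The decaying weight `⟨k⟩^{-a}`. -/
def wt (a : ℕ) (k : Mom d) : ℝ := (bracket k ^ a)⁻¹

lemma wt_pos (a : ℕ) (k : Mom d) : 0 < wt a k := by
  have := bracket_pos k; unfold wt; positivity

lemma wt_le_one (a : ℕ) (k : Mom d) : wt a k ≤ 1 :=
  inv_le_one_of_one_le₀ (one_le_pow₀ (one_le_bracket k))

lemma wt_anti {a b : ℕ} (h : a ≤ b) (k : Mom d) : wt b k ≤ wt a k := by
  have := bracket_pos k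
  exact inv_anti₀ (by positivity) (pow_le_pow_right₀ (one_le_bracket k) h)

lemma wt_add (a b : ℕ) (k : Mom d) : wt (a + b) k = wt a k * wt b k := by
  simp [wt, pow_add, mul_comm]

lemma wt_mul_pow (a b : ℕ) (k : Mom d) : wt (a + b) k * bracket k ^ b = wt a k := by
  have := bracket_pos k
  rw [wt_add, wt, wt]; field_simp

@[fun_prop] lemma continuous_wt (a : ℕ) : Continuous (wt a : Mom d → ℝ) := by
  unfold wt
  exact Continuous.inv₀ (by fun_prop) fun x => (pow_pos (bracket_pos x) _).ne'

lemma integrable_wt {a : ℕ} (h : d < a) : Integrable (wt a : Mom d → ℝ) := by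
  have h1 := integrable_one_add_norm (E := Mom d) (μ := volume) (r := a) (by simpa using h)
  refine (h1.const_mul ((2:ℝ) ^ a)).mono' (continuous_wt a).aestronglyMeasurable
    (Eventually.of_forall fun k => ?_)
  rw [Real.norm_of_nonneg (wt_pos a k).le, wt, Real.rpow_neg (by positivity), Real.rpow_natCast]
  have h2 : 1 + ‖k‖ ≤ 2 * bracket k := by linarith [norm_le_bracket k, one_le_bracket k]
  have := bracket_pos k
  rw [← div_eq_mul_inv, le_div_iff₀ (by positivity), inv_mul_le_iff₀ (by positivity),
    ← mul_pow, mul_comm]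
  gcongr

/-- Peetre's inequality. It moves weights within a ball, under rounding, and along rays. -/
lemma wt_add_le (a : ℕ) (x y : Mom d) : wt a x ≤ (2 * bracket y) ^ a * wt a (x + y) := by
  have h : bracket (x + y) ≤ 2 * bracket x * bracket y := bracket_add_le x y
  have h1 := bracket_pos x
  have h2 := bracket_pos y
  have h3 := bracket_pos (x + y)
  unfold wt
  rw [← div_eq_mul_inv, le_div_iff₀ (by positivity), inv_mul_le_iff₀ (by positivity), ← mul_pow]
  gcongr; nlinarith

end Bracket

/-! ### Functions with quadratic growth -/

/-- `|∇^ℓ f| ≤ c (1 + ⟨k⟩^{2 - ℓ})` for `ℓ ≤ 2`, the part of the regularity assumption on the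
dispersion relations that is used. -/
structure QuadGrowth {d : ℕ} (c : ℝ) (f : Mom d → ℝ) : Prop where
  nonneg : 0 ≤ c
  smooth : ContDiff ℝ 2 f
  bound0 : ∀ k, |f k| ≤ c * bracket k ^ 2
  bound1 : ∀ k, ‖fderiv ℝ f k‖ ≤ c * bracket k
  bound2 : ∀ k, ‖iteratedFDeriv ℝ 2 f k‖ ≤ c

/-- Since ⟨k⟩ ≥ 1, the summand 1 in 1 + ⟨k⟩^{2-ℓ} is absorbed by doubling the constant. -/
lemma quadGrowth_of_bounds {d : ℕ} (hd : 3 ≤ d) {c : ℝ} {f : Mom d → ℝ}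
    (hs : ContDiff ℝ ((2 * d : ℕ) : ℕ∞) f)
    (hb : ∀ l : ℕ, l ≤ 2 * d → ∀ k,
      ‖iteratedFDeriv ℝ l f k‖ ≤ c * (1 + bracket k ^ (2 - (l : ℤ)))) :
    QuadGrowth (2 * c) f := by
  have hc : 0 ≤ c := by
    have h := (norm_nonneg _).trans (hb 2 (by omega) 0)
    norm_num at h; linarith
  refine ⟨by linarith, hs.of_le ?_, fun k => ?_, fun k => ?_, fun k => ?_⟩
  · have h2 : ((2 : ℕ) : ℕ∞) ≤ ((2 * d : ℕ) : ℕ∞) := Nat.cast_le.2 (by omega)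
    exact WithTop.coe_le_coe.2 h2
  · have h := hb 0 (by omega) k
    rw [norm_iteratedFDeriv_zero] at h
    norm_num at h
    have h1 := one_le_bracket k
    nlinarith [mul_nonneg hc (sub_nonneg.2 (one_le_pow₀ h1 (n := 2)))]
  · have h := hb 1 (by omega) k
    rw [norm_iteratedFDeriv_one] at h
    norm_num at h
    nlinarith [one_le_bracket k]
  · have h := hb 2 (by omega) k
    norm_num at h; linarith

namespace QuadGrowth

variable {d : ℕ} {c : ℝ} {f : Mom d → ℝ} (h : QuadGrowth c f)
include h

lemma differentiable : Differentiable ℝ f := h.smooth.differentiable (by norm_num)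

lemma continuous : Continuous f := h.smooth.continuous

/-- Mean value inequality on the segment; there the norm, being convex, is largest at an end. -/
lemma sub_le (x y : Mom d) : |f x - f y| ≤ c * (bracket x + bracket y) * ‖x - y‖ := by
  have key := Convex.norm_image_sub_le_of_norm_fderiv_le (f := f) (𝕜 := ℝ)
    (s := segment ℝ y x) (C := c * (bracket x + bracket y)) (x := y) (y := x)
    (fun z _ => h.differentiable z) (fun z hz => (h.bound1 z).trans ?_)
    (convex_segment y x) (left_mem_segment ℝ y x) (right_mem_segment ℝ y x)
  · simpa using key
  · have hc := h.nonneg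
    have hz' : ‖z‖ ≤ max ‖y‖ ‖x‖ :=
      (convexOn_norm (convex_univ (𝕜 := ℝ) (E := Mom d))).le_on_segment (Set.mem_univ _) (Set.mem_univ _) hz
    have hb : bracket z ≤ bracket x + bracket y := by
      rcases le_max_iff.1 hz' with h1 | h1
      · linarith [bracket_mono h1, bracket_pos x]
      · linarith [bracket_mono h1, bracket_pos y]
    gcongr

end QuadGrowth

/-! ### Consequences of the assumptions for the functions of the model -/

lemma sgn_eq_one_or (σ : ℤˣ) : sgn σ = 1 ∨ sgn σ = -1 := by
  rcases Int.units_eq_one_or σ with rfl | rfl <;> simp [sgn]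

@[simp] lemma abs_sgn (σ : ℤˣ) : |sgn σ| = 1 := by
  rcases sgn_eq_one_or σ with h | h <;> simp [h]

@[simp] lemma sgn_neg (σ : ℤˣ) : sgn (-σ) = -sgn σ := by simp [sgn]

/-- A bound for `x / (1 - x)` when `0 ≤ x ≤ x₀ = e^{-β c₆}`. -/
def occBound (K : Constants) (β : ℝ) : ℝ := (1 - Real.exp (-(β * K.c₆)))⁻¹

/-- A constant for the size and the gradient of `M`. -/
def mBound (K : Constants) (β : ℝ) : ℝ :=
  K.c₇ ^ 2 * (2 * (occBound K β + 1) + β * (2 * |K.c₂|) * occBound K β ^ 2) + 1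

/-- A constant for the growth of `e` and `ω`. -/
def growthBound (K : Constants) : ℝ := 2 * (|K.c₁| + |K.c₂|) + 1

lemma growthBound_pos (K : Constants) : 0 < growthBound K := by
  unfold growthBound; positivity

lemma QuadGrowth.mono {d : ℕ} {c c' : ℝ} {f : Mom d → ℝ} (h : QuadGrowth c f) (hc : c ≤ c') :
    QuadGrowth c' f where
  nonneg := h.nonneg.trans hc
  smooth := h.smooth
  bound0 k := (h.bound0 k).trans (by gcongr)
  bound1 k := (h.bound1 k).trans (by have := bracket_pos k; gcongr)
  bound2 k := (h.bound2 k).trans hc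

/-- Nonnegative functions of class `C¹` that decay with their gradient. -/
structure SmoothDecay {d : ℕ} (c : ℝ) (a : ℕ) (f : Mom d → ℝ) : Prop where
  smooth : ContDiff ℝ 1 f
  nonneg : ∀ k, 0 ≤ f k
  bound0 : ∀ k, f k ≤ c * wt a k
  bound1 : ∀ k, ‖fderiv ℝ f k‖ ≤ c * wt a k

namespace Assumptions

variable {d : ℕ} {K : Constants} {S : Model d} (A : Assumptions K S) (hd : 3 ≤ d)
include A

include hd in
lemma e_growth : QuadGrowth (growthBound K) S.e :=
  (quadGrowth_of_bounds hd A.e_smooth A.e_bound).mono (by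
    unfold growthBound; linarith [le_abs_self K.c₁, abs_nonneg K.c₂])

include hd in
lemma ω_growth : QuadGrowth (growthBound K) S.ω :=
  (quadGrowth_of_bounds hd A.ω_smooth A.ω_bound).mono (by
    unfold growthBound; linarith [le_abs_self K.c₂, abs_nonneg K.c₁])

lemma exp_le (k : Mom d) : Real.exp (-S.β * S.ω k + S.μ) ≤ Real.exp (-(S.β * K.c₆)) := by
  apply Real.exp_le_exp.2
  have h := mul_le_mul_of_nonneg_left (A.gap k) A.β_pos.le
  have : S.β * (S.μ / S.β) = S.μ := mul_div_cancel₀ _ A.β_pos.ne'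
  nlinarith

lemma exp_lt_one : Real.exp (-(S.β * K.c₆)) < 1 := by
  have := mul_pos A.β_pos A.c₆_pos
  exact (Real.exp_lt_exp.2 (by linarith)).trans_eq Real.exp_zero

lemma occupation_eq (k : Mom d) :
    S.occupation k = (1 - Real.exp (-S.β * S.ω k + S.μ))⁻¹ - 1 := by
  have h1 := A.exp_le k
  have h2 := A.exp_lt_one
  have : (1 - Real.exp (-S.β * S.ω k + S.μ)) ≠ 0 := by linarith
  rw [Model.occupation, eq_sub_iff_add_eq, inv_eq_one_div, div_add_one this]
  congr 1; ring

lemma occBound_pos : 1 ≤ occBound K S.β :=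
  (one_le_inv₀ (by linarith [A.exp_lt_one])).2 (by linarith [Real.exp_pos (-(S.β * K.c₆))])

lemma inv_le_occBound (k : Mom d) :
    (1 - Real.exp (-S.β * S.ω k + S.μ))⁻¹ ≤ occBound K S.β :=
  inv_anti₀ (by linarith [A.exp_lt_one]) (by linarith [A.exp_le k])

lemma occupation_nonneg (k : Mom d) : 0 ≤ S.occupation k :=
  div_nonneg (Real.exp_pos _).le (by linarith [A.exp_le k, A.exp_lt_one])

lemma Q_le (k : Mom d) : |S.Q k| ≤ K.c₇ * wt (2 * d + 12) k := by
  have h := A.Q_decay 0 (by omega) k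
  rw [norm_iteratedFDeriv_zero, zpow_neg] at h
  exact_mod_cast h

include hd in
lemma fderiv_Q_le (k : Mom d) : ‖fderiv ℝ S.Q k‖ ≤ K.c₇ * wt (2 * d + 12) k := by
  have h := A.Q_decay 1 (by omega) k
  rw [norm_iteratedFDeriv_one, zpow_neg] at h
  exact_mod_cast h

include hd in
lemma hasFDerivAt_occupation (k : Mom d) :
    HasFDerivAt S.occupation (-((-((1 - Real.exp (-S.β * S.ω k + S.μ)) ^ 2)⁻¹) •
      (Real.exp (-S.β * S.ω k + S.μ) • (-S.β • fderiv ℝ S.ω k)))) k := by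
  have h2 : 1 - Real.exp (-S.β * S.ω k + S.μ) ≠ 0 := by
    linarith [A.exp_le k, A.exp_lt_one]
  have h0 := (((A.ω_growth hd).differentiable k).hasFDerivAt.const_mul (-S.β)).add_const S.μ
  have h1 := (h0.exp.const_sub 1)
  have h3 := ((hasDerivAt_inv h2).comp_hasFDerivAt k h1).sub_const 1
  have h4 : S.occupation = fun k => (1 - Real.exp (-S.β * S.ω k + S.μ))⁻¹ - 1 :=
    funext A.occupation_eq
  rw [h4]
  refine h3.congr_fderiv ?_
  simp [smul_neg]

include hd in
lemma fderiv_occupation_le (k : Mom d) :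
    ‖fderiv ℝ S.occupation k‖ ≤ S.β * (2 * |K.c₂|) * occBound K S.β ^ 2 * bracket k := by
  rw [(A.hasFDerivAt_occupation hd k).fderiv, norm_neg, norm_smul, norm_smul, norm_smul]
  have h1 := (quadGrowth_of_bounds hd A.ω_smooth A.ω_bound).bound1 k
  have h2 := A.inv_le_occBound k
  have h3 : 0 < 1 - Real.exp (-S.β * S.ω k + S.μ) := by linarith [A.exp_le k, A.exp_lt_one]
  have h4 : Real.exp (-S.β * S.ω k + S.μ) ≤ 1 := by linarith
  have h5 := bracket_pos k
  have h6 : ‖fderiv ℝ S.ω k‖ ≤ 2 * |K.c₂| * bracket k :=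
    h1.trans (by gcongr; exact le_abs_self _)
  have h7 := A.β_pos
  rw [norm_neg, norm_inv, norm_pow, Real.norm_of_nonneg h3.le, Real.norm_of_nonneg (Real.exp_pos _).le,
    norm_neg, Real.norm_of_nonneg h7.le, ← inv_pow]
  have h8 : 0 < (1 - Real.exp (-S.β * S.ω k + S.μ))⁻¹ := by positivity
  calc _ ≤ occBound K S.β ^ 2 * (1 * (S.β * (2 * |K.c₂| * bracket k))) := by gcongr
    _ = _ := by ring

include hd in
lemma contDiff_occupation : ContDiff ℝ 1 S.occupation := by
  have h4 : S.occupation = fun k => (1 - Real.exp (-S.β * S.ω k + S.μ))⁻¹ - 1 :=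
    funext A.occupation_eq
  rw [h4]
  have hω : ContDiff ℝ 1 S.ω := (A.ω_growth hd).smooth.of_le (by norm_num)
  refine ContDiff.sub (ContDiff.inv ?_ fun k => ?_) contDiff_const
  · fun_prop
  · linarith [A.exp_le k, A.exp_lt_one]

-- The exponent is 4d + 24 from |Q|² less one, since ∇ω in the gradient of the occupation number
-- grows like ⟨k⟩. The gap condition keeps the Bose denominator away from 0, and this is how β
-- enters the constants.
include hd in
lemma M_decay (σ : ℤˣ) : SmoothDecay (mBound K S.β) (4 * d + 23) (fun k => S.M k σ) := by
  have hQ : ContDiff ℝ 1 S.Q := A.Q_smooth.of_le (by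
    have h2 : ((1 : ℕ) : ℕ∞) ≤ ((2 * d : ℕ) : ℕ∞) := Nat.cast_le.2 (by omega)
    exact WithTop.coe_le_coe.2 h2)
  have hO := A.contDiff_occupation hd
  have hs0 : 0 ≤ (sgn σ + 1) / 2 := by rcases sgn_eq_one_or σ with h | h <;> norm_num [h]
  have hs1 : (sgn σ + 1) / 2 ≤ 1 := by rcases sgn_eq_one_or σ with h | h <;> norm_num [h]
  have hM : (fun k => S.M k σ) = fun k => S.Q k ^ 2 * (S.occupation k + (sgn σ + 1) / 2) := by
    funext k; rw [Model.M, sq_abs]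
  have hocc : ∀ k, S.occupation k + (sgn σ + 1) / 2 ≤ occBound K S.β + 1 := fun k => by
    rw [A.occupation_eq]; linarith [A.inv_le_occBound k]
  have hocc0 : ∀ k, 0 ≤ S.occupation k + (sgn σ + 1) / 2 := fun k => by
    linarith [A.occupation_nonneg k]
  have hob := A.occBound_pos
  have hw : ∀ k : Mom d, wt (2 * d + 12) k ^ 2 * bracket k = wt (4 * d + 23) k := fun k => by
    rw [← wt_mul_pow (4 * d + 23) 1 k, show 4 * d + 23 + 1 = (2 * d + 12) + (2 * d + 12) by ring,
      wt_add (2 * d + 12), pow_one, sq]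
  have hβ := A.β_pos
  have hQ2 : ∀ k, S.Q k ^ 2 ≤ K.c₇ ^ 2 * wt (2 * d + 12) k ^ 2 := fun k => by
    rw [← sq_abs, ← mul_pow]; gcongr; exact A.Q_le k
  refine ⟨?_, fun k => ?_, fun k => ?_, fun k => ?_⟩
  · rw [hM]; fun_prop
  · rw [Model.M]; exact mul_nonneg (by positivity) (hocc0 k)
  · have h1 := one_le_bracket k
    have hw0 := wt_pos (2 * d + 12) k
    rw [← hw, Model.M, sq_abs]
    calc _ ≤ K.c₇ ^ 2 * wt (2 * d + 12) k ^ 2 * (occBound K S.β + 1) :=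
          mul_le_mul (hQ2 k) (hocc k) (hocc0 k) (by positivity)
      _ = K.c₇ ^ 2 * (occBound K S.β + 1) * (wt (2 * d + 12) k ^ 2 * 1) := by ring
      _ ≤ mBound K S.β * (wt (2 * d + 12) k ^ 2 * bracket k) := by
          refine mul_le_mul ?_ (by gcongr) (by positivity) ?_
          · unfold mBound
            have : 0 ≤ K.c₇ ^ 2 * (occBound K S.β + 1 + S.β * (2 * |K.c₂|) * occBound K S.β ^ 2) := by
              positivity
            linarith
          · unfold mBound; positivity
  · have hw0 := wt_pos (2 * d + 12) k
    have h1 := one_le_bracket k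
    have hdQ : HasFDerivAt S.Q (fderiv ℝ S.Q k) k := (hQ.differentiable (by norm_num) k).hasFDerivAt
    have hdO : HasFDerivAt S.occupation (fderiv ℝ S.occupation k) k :=
      (hO.differentiable (by norm_num) k).hasFDerivAt
    have hdM := (hdQ.pow 2).mul (hdO.add_const ((sgn σ + 1) / 2))
    rw [hM, ← hw]
    refine (le_of_eq (congrArg norm hdM.fderiv)).trans ?_
    refine (norm_add_le _ _).trans ?_
    rw [norm_smul, norm_smul, Real.norm_of_nonneg (hocc0 k), norm_smul, norm_pow, Real.norm_eq_abs]
    have hc7 : 0 ≤ K.c₇ * wt (2 * d + 12) k := (abs_nonneg _).trans (A.Q_le k)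
    have e1 : ‖(2 • S.Q k ^ (2 - 1) : ℝ)‖ ≤ 2 * (K.c₇ * wt (2 * d + 12) k) := by
      simp only [nsmul_eq_mul, norm_mul, Real.norm_eq_abs]
      norm_num; exact A.Q_le k
    have e2 := hocc k
    calc _ ≤ (K.c₇ * wt (2 * d + 12) k) ^ 2 *
            (S.β * (2 * |K.c₂|) * occBound K S.β ^ 2 * bracket k) +
          (occBound K S.β + 1) * (2 * (K.c₇ * wt (2 * d + 12) k) * (K.c₇ * wt (2 * d + 12) k)) := by
          refine add_le_add (mul_le_mul ?_ (A.fderiv_occupation_le hd k) (norm_nonneg _)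
            (by positivity)) (mul_le_mul e2 (mul_le_mul e1 (A.fderiv_Q_le hd k) (norm_nonneg _)
            (by positivity)) (by positivity) (by positivity))
          exact pow_le_pow_left₀ (abs_nonneg _) (A.Q_le k) 2
      _ = K.c₇ ^ 2 * (S.β * (2 * |K.c₂|) * occBound K S.β ^ 2) * (wt (2 * d + 12) k ^ 2 * bracket k) +
          K.c₇ ^ 2 * (2 * (occBound K S.β + 1)) * (wt (2 * d + 12) k ^ 2 * 1) := by ring
      _ ≤ K.c₇ ^ 2 * (S.β * (2 * |K.c₂|) * occBound K S.β ^ 2) * (wt (2 * d + 12) k ^ 2 * bracket k) +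
          K.c₇ ^ 2 * (2 * (occBound K S.β + 1)) * (wt (2 * d + 12) k ^ 2 * bracket k) := by gcongr
      _ ≤ mBound K S.β * (wt (2 * d + 12) k ^ 2 * bracket k) := by
          rw [← add_mul]; gcongr; unfold mBound; linarith

end Assumptions

/-! ### Product integrals -/

theorem lintegral_pi_prod {X : Type*} [MeasureSpace X] [SigmaFinite (volume : Measure X)]
    (n : ℕ) (f : Fin n → X → ℝ≥0∞) (hf : ∀ i, Measurable (f i)) :
    ∫⁻ y : Fin n → X, ∏ i, f i (y i) = ∏ i, ∫⁻ x, f i x := by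
  induction n with
  | zero => simp [lintegral_unique, volume_pi]
  | succ n ih =>
    have h := ((volume_preserving_piFinSuccAbove (fun _ : Fin (n + 1) => X) 0).symm).lintegral_comp
      (f := fun y : Fin (n + 1) → X => ∏ i, f i (y i)) (by fun_prop)
    rw [← h]
    have h2 : ∀ z : X × (Fin n → X), ∏ i, f i
        ((MeasurableEquiv.piFinSuccAbove (fun _ : Fin (n + 1) => X) 0).symm z i) =
        f 0 z.1 * ∏ i : Fin n, f i.succ (z.2 i) := fun z => by
      rw [Fin.prod_univ_succ]; simp [MeasurableEquiv.piFinSuccAbove]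
    simp_rw [h2]
    have hg : Measurable fun y : Fin n → X => ∏ i, f i.succ (y i) :=
      Finset.measurable_fun_prod Finset.univ fun i _ => (hf i.succ).comp (measurable_pi_apply i)
    rw [Fin.prod_univ_succ, ← ih (fun i => f i.succ) fun i => hf i.succ]
    exact lintegral_prod_mul (hf 0).aemeasurable hg.aemeasurable

/-! ### Polar coordinates -/

section Polar

variable {d : ℕ}

abbrev USphere (d : ℕ) : Type := Metric.sphere (0 : Mom d) 1

abbrev sphereMeasure (d : ℕ) : Measure (USphere d) := (volume : Measure (Mom d)).toSphere

lemma nontrivial_mom (hd : 3 ≤ d) : Nontrivial (Mom d) := by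
  have : Nonempty (Fin d) := ⟨⟨0, by omega⟩⟩
  infer_instance

theorem lintegral_polar (hd : 3 ≤ d) {f : Mom d → ℝ≥0∞} (hf : Measurable f) :
    ∫⁻ x, f x = ∫⁻ u, (∫⁻ r in Set.Ioi (0 : ℝ),
      ENNReal.ofReal (r ^ (d - 1)) * f (r • (u : Mom d))) ∂(sphereMeasure d) := by
  have := nontrivial_mom hd
  have h1 : ∫⁻ x, f x = ∫⁻ x : ({(0 : Mom d)}ᶜ : Set (Mom d)), f x ∂(Measure.comap (Subtype.val : ({(0 : Mom d)}ᶜ : Set (Mom d)) → Mom d) volume) := by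
    rw [lintegral_subtype_comap (measurableSet_singleton (0 : Mom d)).compl f,
      restrict_compl_singleton]
  have hm : Measurable fun p : USphere d × Set.Ioi (0 : ℝ) => f (p.2.1 • p.1.1) :=
    hf.comp (by fun_prop)
  have h2 := (volume : Measure (Mom d)).measurePreserving_homeomorphUnitSphereProd.lintegral_comp hm
  have h3 : ∀ x : ({(0 : Mom d)}ᶜ : Set (Mom d)),
      (homeomorphUnitSphereProd (Mom d) x).2.1 • (homeomorphUnitSphereProd (Mom d) x).1.1 = x :=
    fun x => by
      have : (x : Mom d) ≠ 0 := x.2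
      simp [homeomorphUnitSphereProd, smul_smul, this]
  simp_rw [h3] at h2
  rw [h1, h2, lintegral_prod _ hm.aemeasurable]
  refine lintegral_congr fun u => ?_
  have hg : Measurable fun y : Set.Ioi (0 : ℝ) => f (y.1 • (u : Mom d)) := hf.comp (by fun_prop)
  rw [Measure.volumeIoiPow]
  refine (lintegral_withDensity_eq_lintegral_mul _ (by fun_prop) hg).trans ?_
  rw [← lintegral_subtype_comap measurableSet_Ioi]
  simp [finrank_euclideanSpace]

theorem integral_polar (hd : 3 ≤ d) {f : Mom d → ℝ} (hf : Integrable f) :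
    ∫ x, f x = ∫ u, (∫ r in Set.Ioi (0 : ℝ), r ^ (d - 1) * f (r • (u : Mom d))) ∂(sphereMeasure d) := by
  have := nontrivial_mom hd
  have h1 : ∫ x, f x = ∫ x : ({(0 : Mom d)}ᶜ : Set (Mom d)), f x ∂(Measure.comap (Subtype.val : ({(0 : Mom d)}ᶜ : Set (Mom d)) → Mom d) volume) := by
    rw [integral_subtype_comap (measurableSet_singleton (0 : Mom d)).compl f,
      restrict_compl_singleton]
  have hi : Integrable (fun x : ({(0 : Mom d)}ᶜ : Set (Mom d)) => f x)
      (Measure.comap Subtype.val volume) := by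
    have := hf.integrableOn (s := ({(0 : Mom d)}ᶜ : Set (Mom d)))
    rwa [integrableOn_iff_comap_subtypeVal (measurableSet_singleton _).compl] at this
  have h3 : ∀ x : ({(0 : Mom d)}ᶜ : Set (Mom d)),
      (homeomorphUnitSphereProd (Mom d) x).2.1 • (homeomorphUnitSphereProd (Mom d) x).1.1 = x :=
    fun x => by
      have : (x : Mom d) ≠ 0 := x.2
      simp [homeomorphUnitSphereProd, smul_smul, this]
  have hmp := (volume : Measure (Mom d)).measurePreserving_homeomorphUnitSphereProd
  have h2 := hmp.integral_comp (Homeomorph.measurableEmbedding _)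
    (fun p : USphere d × Set.Ioi (0 : ℝ) => f (p.2.1 • p.1.1))
  have hi2 := (hmp.integrable_comp_emb (Homeomorph.measurableEmbedding _)
    (g := fun p : USphere d × Set.Ioi (0 : ℝ) => f (p.2.1 • p.1.1))).1 (by
      simpa only [Function.comp_def, h3] using hi)
  simp_rw [h3] at h2
  rw [h1, h2, integral_prod _ hi2]
  refine integral_congr_ae (Eventually.of_forall fun u => ?_)
  simp only [Measure.volumeIoiPow, ENNReal.ofReal]
  rw [integral_withDensity_eq_integral_smul (measurable_subtype_coe.pow_const _).real_toNNReal,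
    ← integral_subtype_comap measurableSet_Ioi]
  refine integral_congr_ae (Eventually.of_forall fun r => ?_)
  have := r.2.out
  simp only [finrank_euclideanSpace, Fintype.card_fin, NNReal.smul_def, smul_eq_mul]
  rw [Real.coe_toNNReal _ (by positivity)]

/-- The norm of the component of `x` orthogonal to `v`. -/
def perp (v x : Mom d) : ℝ := ‖(ℝ ∙ v)ᗮ.starProjection x‖

lemma continuous_perp (v : Mom d) : Continuous (perp v) := by unfold perp; fun_prop

lemma perp_nonneg (v x : Mom d) : 0 ≤ perp v x := norm_nonneg _

lemma perp_le_norm (v x : Mom d) : perp v x ≤ ‖x‖ :=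
  Submodule.norm_starProjection_apply_le _ x

lemma perp_smul (v x : Mom d) {r : ℝ} (hr : 0 ≤ r) : perp v (r • x) = r * perp v x := by
  rw [perp, map_smul, norm_smul, Real.norm_of_nonneg hr, perp]

/-- Projection orthogonal to v removes v and leaves the transverse part of r u, so a ray stays away
from the origin in proportion to r. -/
lemma mul_perp_le (v u : Mom d) {r : ℝ} (hr : 0 ≤ r) : r * perp v u ≤ ‖v + r • u‖ := by
  have h : perp v (v + r • u) = perp v (r • u) := by
    rw [perp, perp, map_add]
    rw [Submodule.starProjection_orthogonal_apply_eq_zero (Submodule.mem_span_singleton_self v), zero_add]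
  rw [← perp_smul v u hr, ← h]; exact perp_le_norm _ _

lemma abs_inner_le_perp {v w : Mom d} (hw : inner ℝ v w = 0) (hw1 : ‖w‖ = 1) (x : Mom d) :
    |inner ℝ w x| ≤ perp v x := by
  have hm : w ∈ (ℝ ∙ v)ᗮ := Submodule.mem_orthogonal_singleton_iff_inner_right.2 hw
  have h : inner ℝ w x = inner ℝ w ((ℝ ∙ v)ᗮ.starProjection x) := by
    conv_lhs => rw [← Submodule.starProjection_eq_self_iff.2 hm]
    rw [Submodule.inner_starProjection_left_eq_right]
  rw [h]
  refine (abs_real_inner_le_norm _ _).trans ?_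
  rw [hw1, one_mul, perp]

/-- The exponent `d - 3/2` of the singularity on the unit sphere. -/
def sExp (d : ℕ) : ℝ := (d : ℝ) - 3 / 2

/-- The weight `sin(u, v)^{-(d - 3/2)}`. -/
def sWeight (v x : Mom d) : ℝ≥0∞ := (ENNReal.ofReal (perp v x) ^ sExp d)⁻¹

lemma measurable_sWeight (v : Mom d) : Measurable (sWeight v) := by
  have := (continuous_perp v).measurable
  unfold sWeight; fun_prop

lemma sExp_pos (hd : 3 ≤ d) : 1 < sExp d := by
  have : (3 : ℝ) ≤ d := by exact_mod_cast hd
  unfold sExp; linarith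

lemma lintegral_ball_rpow_lt_top {b : ℝ} (hb : b < 1) (hb0 : 0 < b) :
    ∫⁻ x : ℝ in Metric.ball 0 1, (ENNReal.ofReal |x| ^ b)⁻¹ < ⊤ := by
  have h1 : IntegrableOn (fun x : ℝ => ‖x‖ ^ (-b)) (Metric.ball 0 1) := by
    refine (integrableOn_fun_norm_addHaar (E := ℝ) volume (f := fun y => y ^ (-b)) (r := 1)).2 ?_
    simp only [Module.finrank_self, tsub_self, pow_zero, one_smul]
    have := (intervalIntegral.intervalIntegrable_rpow' (a := 0) (b := 1) (r := -b) (by linarith)).1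
    exact this.mono_set Set.Ioo_subset_Ioc_self
  refine lt_of_le_of_lt (lintegral_mono_ae ?_) h1.2
  have : ∀ᵐ x : ℝ, x ≠ 0 := by simp [ae_iff]
  filter_upwards [ae_restrict_of_ae this] with x hx
  have hx' : 0 < |x| := abs_pos.2 hx
  rw [ENNReal.ofReal_rpow_of_pos hx', ← ENNReal.ofReal_inv_of_pos (by positivity),
    ← Real.rpow_neg (abs_nonneg x), ← Real.norm_eq_abs x]
  exact Real.ofReal_le_enorm _

/-- The exponent d - 3/2 is below the dimension d - 1 of the transverse directions. After a
reflection taking v to a coordinate axis, the transverse norm dominates each of the d - 1 other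
coordinates, so the weight is at most a product of powers |x_i|^{-b} with b < 1. This product is
integrable over the unit cube, and homogeneity transfers the bound from the ball to the sphere. -/
lemma sphere_weight_bound (hd : 3 ≤ d) : ∃ C : ℝ≥0∞, C ≠ ⊤ ∧ ∀ v : Mom d,
    ∫⁻ u, sWeight v u ∂(sphereMeasure d) ≤ C := by
  set i0 : Fin d := ⟨0, by omega⟩
  set b : ℝ := sExp d / (d - 1 : ℕ) with hbdef
  have hdR : (3 : ℝ) ≤ d := by exact_mod_cast hd
  have hd1 : (((d - 1 : ℕ)) : ℝ) = d - 1 := by rw [Nat.cast_sub (by omega)]; simp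
  have hb0 : 0 < b := div_pos (by linarith [sExp_pos hd]) (by rw [hd1]; linarith)
  have hb1 : b < 1 := by
    rw [hbdef, div_lt_one (by rw [hd1]; linarith), hd1]; unfold sExp; linarith
  set h : Fin d → ℝ → ℝ≥0∞ := fun i => (Metric.ball (0 : ℝ) 1).indicator
    (fun x => if i = i0 then 1 else (ENNReal.ofReal |x| ^ b)⁻¹) with hh
  have hmeas : ∀ i, Measurable (h i) := fun i => by
    refine Measurable.indicator ?_ measurableSet_ball
    split_ifs <;> fun_prop
  have hfin : ∏ i, ∫⁻ x, h i x ≠ ⊤ := by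
    refine ENNReal.prod_ne_top fun i _ => ?_
    rw [hh]; simp only
    rw [lintegral_indicator measurableSet_ball]
    split_ifs
    · simp [Real.volume_ball]
    · exact (lintegral_ball_rpow_lt_top hb1 hb0).ne
  refine ⟨d * ∏ i, ∫⁻ x, h i x, ENNReal.mul_ne_top (by simp) hfin, fun v => ?_⟩
  have key : ∫⁻ x in Metric.ball (0 : Mom d) 1, sWeight v x ≤ ∏ i, ∫⁻ x, h i x := by
    -- The reflection exchanging v and w preserves volume; it reduces any direction of v to the axis
    -- i0.
    set w : Mom d := ‖v‖ • EuclideanSpace.single i0 (1 : ℝ) with hw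
    have hvw : ‖v‖ = ‖w‖ := by simp [hw, norm_smul]
    set ρ := (ℝ ∙ (v - w))ᗮ.reflection with hρ
    have hρv : ρ v = w := Submodule.reflection_sub hvw
    have hle : ∀ x : Mom d, (Metric.ball (0 : Mom d) 1).indicator (sWeight v) x ≤
        ∏ i, h i (ρ x i) := fun x => by
      by_cases hx : x ∈ Metric.ball (0 : Mom d) 1
      · rw [Set.indicator_of_mem hx]
        have hx1 : ‖x‖ < 1 := by simpa using hx
        have hxi : ∀ i, ρ x i ∈ Metric.ball (0 : ℝ) 1 := fun i => by
          rw [mem_ball_zero_iff]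
          refine lt_of_le_of_lt (PiLp.norm_apply_le _ _) ?_
          rwa [LinearIsometryEquiv.norm_map]
        have hperp : ∀ i, i ≠ i0 → |ρ x i| ≤ perp v x := fun i hi => by
          have h1 := abs_inner_le_perp (v := v) (w := ρ.symm (EuclideanSpace.single i (1 : ℝ)))
            (by
              rw [← LinearIsometryEquiv.inner_map_map ρ, LinearIsometryEquiv.apply_symm_apply, hρv,
                hw, inner_smul_left, EuclideanSpace.inner_single_left]
              simp [Ne.symm hi])
            (by rw [LinearIsometryEquiv.norm_map]; simp) x
          rw [← LinearIsometryEquiv.inner_map_map ρ, LinearIsometryEquiv.apply_symm_apply,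
            EuclideanSpace.inner_single_left] at h1
          simpa using h1
        have e1 : ∏ i, h i (ρ x i) = ∏ i ∈ Finset.univ.erase i0, (ENNReal.ofReal |ρ x i| ^ b)⁻¹ := by
          rw [← Finset.mul_prod_erase Finset.univ _ (Finset.mem_univ i0)]
          have : h i0 (ρ x i0) = 1 := by
            rw [hh]; simp only; rw [Set.indicator_of_mem (hxi i0)]; simp
          rw [this, one_mul]
          refine Finset.prod_congr rfl fun i hi => ?_
          rw [hh]; simp only; rw [Set.indicator_of_mem (hxi i), if_neg (Finset.ne_of_mem_erase hi)]
        rw [e1, ← ENNReal.prod_inv_distrib, sWeight, ENNReal.inv_le_inv]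
        · calc ∏ i ∈ Finset.univ.erase i0, ENNReal.ofReal |ρ x i| ^ b
              ≤ ∏ i ∈ Finset.univ.erase i0, ENNReal.ofReal (perp v x) ^ b := by
                refine Finset.prod_le_prod' fun i hi => ?_
                exact ENNReal.rpow_le_rpow (ENNReal.ofReal_le_ofReal
                  (hperp i (Finset.ne_of_mem_erase hi))) hb0.le
            _ = ENNReal.ofReal (perp v x) ^ sExp d := by
                rw [Finset.prod_const, Finset.card_erase_of_mem (Finset.mem_univ _),
                  Finset.card_univ, Fintype.card_fin, ← ENNReal.rpow_natCast, ← ENNReal.rpow_mul,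
                  hbdef, div_mul_cancel₀]
                rw [hd1]; linarith
        · intro i _ j _ _
          right
          exact ENNReal.rpow_ne_top_of_nonneg hb0.le ENNReal.ofReal_ne_top
      · rw [Set.indicator_of_notMem hx]; exact zero_le
    have hH : Measurable fun y : Fin d → ℝ => ∏ i, h i (y i) :=
      Finset.measurable_fun_prod _ fun i _ => (hmeas i).comp (measurable_pi_apply i)
    have hH2 : Measurable fun y : Mom d => ∏ i, h i (y i) :=
      hH.comp (PiLp.volume_preserving_ofLp (Fin d)).measurable
    rw [← lintegral_indicator measurableSet_ball]
    refine (lintegral_mono hle).trans ?_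
    rw [ρ.measurePreserving.lintegral_comp hH2,
      (PiLp.volume_preserving_ofLp (Fin d)).lintegral_comp hH, lintegral_pi_prod d h hmeas]
  have hind : Measurable ((Metric.ball (0 : Mom d) 1).indicator (sWeight v)) :=
    (measurable_sWeight v).indicator measurableSet_ball
  rw [← lintegral_indicator measurableSet_ball, lintegral_polar hd hind] at key
  -- Inside the ball r ≤ 1, so the weight at r u is at least the weight at u; the radial integral of
  -- r^{d-1} contributes the factor 1/d.
  have h2 : ∀ u : USphere d, sWeight v u * (d : ℝ≥0∞)⁻¹ ≤ ∫⁻ r in Set.Ioi (0 : ℝ),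
      ENNReal.ofReal (r ^ (d - 1)) * (Metric.ball (0 : Mom d) 1).indicator (sWeight v) (r • (u : Mom d)) := by
    intro u
    have h3 : ∫⁻ r in Set.Ioo (0 : ℝ) 1, ENNReal.ofReal (r ^ (d - 1)) = (d : ℝ≥0∞)⁻¹ := by
      rw [Measure.restrict_congr_set Ioo_ae_eq_Ioc,
        ← ofReal_integral_eq_lintegral_ofReal (intervalIntegral.intervalIntegrable_pow _).1,
        ← intervalIntegral.integral_of_le zero_le_one]
      · have : d - 1 + 1 = d := by omega
        rw [integral_pow, this, hd1]
        simp
        rw [zero_pow (by omega), sub_zero, one_div, ENNReal.ofReal_inv_of_pos (by linarith)]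
        simp
      · filter_upwards [ae_restrict_mem measurableSet_Ioc] with y hy
        exact pow_nonneg hy.1.le _
    rw [← h3, ← lintegral_const_mul _ (by fun_prop)]
    refine (setLIntegral_mono_ae' measurableSet_Ioo (Eventually.of_forall fun r hr => ?_)).trans
      (lintegral_mono_set Set.Ioo_subset_Ioi_self)
    have hu : ‖(u : Mom d)‖ = 1 := by simp
    rw [Set.indicator_of_mem, mul_comm]
    · gcongr
      unfold sWeight
      refine ENNReal.inv_le_inv.2 (ENNReal.rpow_le_rpow (ENNReal.ofReal_le_ofReal ?_)
        (by linarith [sExp_pos hd]))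
      rw [perp_smul _ _ hr.1.le]
      exact mul_le_of_le_one_left (perp_nonneg _ _) hr.2.le
    · rw [mem_ball_zero_iff, norm_smul, hu, mul_one, Real.norm_of_nonneg hr.1.le]
      exact hr.2
  have h4 : (∫⁻ u, sWeight v u ∂(sphereMeasure d)) * (d : ℝ≥0∞)⁻¹ ≤ ∏ i, ∫⁻ x, h i x := by
    refine (lintegral_mul_const _ ((measurable_sWeight v).comp measurable_subtype_coe)).symm.trans_le ?_
    exact (lintegral_mono h2).trans key
  rwa [← div_eq_mul_inv, ENNReal.div_le_iff' (by simp; omega) (by simp)] at h4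

end Polar

/-! ### Uniformly convex phases -/

/-- A phase of class `C²` with Hessian between `c₃` and `c₄` and critical point `k₀`. -/
structure ConvexPhase {d : ℕ} (c₃ c₄ : ℝ) (Φ : Mom d → ℝ) (k₀ : Mom d) : Prop where
  smooth : ContDiff ℝ 2 Φ
  pos : 0 < c₃
  lower : ∀ k v, c₃ * ‖v‖ ^ 2 ≤ fderiv ℝ (fderiv ℝ Φ) k v v
  upper : ∀ k v, fderiv ℝ (fderiv ℝ Φ) k v v ≤ c₄ * ‖v‖ ^ 2
  crit : fderiv ℝ Φ k₀ = 0

lemma Assumptions.Phi_contDiff {d : ℕ} {K : Constants} {S : Model d} (A : Assumptions K S)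
    (hd : 3 ≤ d) (σ : ℤˣ) (p : Mom d) : ContDiff ℝ 2 (S.Phi σ p) := by
  have h1 := (A.e_growth hd).smooth
  have h2 := (A.ω_growth hd).smooth
  unfold Model.Phi
  fun_prop

/-- Coercivity provides a minimiser. Nothing is known about its location, so later estimates have to
be uniform in k₀. -/
lemma Assumptions.exists_convexPhase {d : ℕ} {K : Constants} {S : Model d} (A : Assumptions K S)
    (hd : 3 ≤ d) (σ : ℤˣ) (p : Mom d) : ∃ k₀, ConvexPhase K.c₃ K.c₄ (S.Phi σ p) k₀ := by
  have hs := A.Phi_contDiff hd σ p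
  obtain ⟨k₀, hk⟩ := hs.continuous.exists_forall_le (A.Phi_lim σ p)
  refine ⟨k₀, hs, A.c₃_pos, fun k v => ?_, fun k v => ?_, ?_⟩
  · simpa [iteratedFDeriv_two_apply] using A.hess_lower σ p k v
  · simpa [iteratedFDeriv_two_apply] using A.hess_upper σ p k v
  · exact IsLocalMin.fderiv_eq_zero (Eventually.of_forall hk)

namespace ConvexPhase

variable {d : ℕ} {c₃ c₄ : ℝ} {Φ : Mom d → ℝ} {k₀ : Mom d} (h : ConvexPhase c₃ c₄ Φ k₀)
include h

lemma hasDerivAt_radial (u : Mom d) (r : ℝ) :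
    HasDerivAt (fun r : ℝ => Φ (k₀ + r • u)) (fderiv ℝ Φ (k₀ + r • u) u) r := by
  have h1 : HasDerivAt (fun r : ℝ => k₀ + r • u) u r := by
    simpa using ((hasDerivAt_id r).smul_const u).const_add k₀
  exact ((h.smooth.differentiable (by norm_num)) _).hasFDerivAt.comp_hasDerivAt r h1

lemma hasDerivAt_radial' (u : Mom d) (r : ℝ) :
    HasDerivAt (fun r : ℝ => fderiv ℝ Φ (k₀ + r • u) u)
      (fderiv ℝ (fderiv ℝ Φ) (k₀ + r • u) u u) r := by
  have h1 : HasDerivAt (fun r : ℝ => k₀ + r • u) u r := by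
    simpa using ((hasDerivAt_id r).smul_const u).const_add k₀
  have h2 : ContDiff ℝ 1 (fderiv ℝ Φ) := h.smooth.fderiv_right (by norm_num)
  have h3 := ((h2.differentiable (by norm_num)) (k₀ + r • u)).hasFDerivAt.comp_hasDerivAt r h1
  simpa using h3.clm_apply (hasDerivAt_const r u)

/-- The radial derivative vanishes at k₀ and increases with slope at least c₃. -/
lemma le_radial' {u : Mom d} (hu : ‖u‖ = 1) {r : ℝ} (hr : 0 ≤ r) :
    c₃ * r ≤ fderiv ℝ Φ (k₀ + r • u) u := by
  have h1 := mul_sub_le_image_sub_of_le_deriv (f := fun r : ℝ => fderiv ℝ Φ (k₀ + r • u) u)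
    (C := c₃) (fun r => (h.hasDerivAt_radial' u r).differentiableAt)
    (fun r => by rw [(h.hasDerivAt_radial' u r).deriv]; simpa [hu] using h.lower (k₀ + r • u) u) hr
  simpa [h.crit] using h1

lemma strictMonoOn_radial {u : Mom d} (hu : ‖u‖ = 1) :
    StrictMonoOn (fun r : ℝ => Φ (k₀ + r • u)) (Set.Ici 0) := by
  refine strictMonoOn_of_deriv_pos (convex_Ici 0)
    (fun r _ => (h.hasDerivAt_radial u r).continuousAt.continuousWithinAt) fun r hr => ?_
  rw [interior_Ici] at hr
  rw [(h.hasDerivAt_radial u r).deriv]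
  exact lt_of_lt_of_le (mul_pos h.pos hr) (h.le_radial' hu (le_of_lt hr))

/-- Substitution of the value of Φ for r, which is injective along a ray; the Jacobian is at least
c₃ r. -/
lemma lintegral_radial_le {u : Mom d} (hu : ‖u‖ = 1) (ψ : ℝ → ℝ≥0∞) (hψ : Measurable ψ) :
    ∫⁻ r in Set.Ioi (0 : ℝ), ENNReal.ofReal r * ψ (Φ (k₀ + r • u)) ≤
      ENNReal.ofReal c₃⁻¹ * ∫⁻ x, ψ x := by
  have h1 := lintegral_image_eq_lintegral_abs_deriv_mul (s := Set.Ioi (0 : ℝ)) measurableSet_Ioi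
    (fun r _ => (h.hasDerivAt_radial u r).hasDerivWithinAt)
    ((h.strictMonoOn_radial hu).injOn.mono Set.Ioi_subset_Ici_self) ψ
  have h2 : ∫⁻ x in (fun r : ℝ => Φ (k₀ + r • u)) '' Set.Ioi 0, ψ x ≤ ∫⁻ x, ψ x :=
    setLIntegral_le_lintegral _ _
  have hc : Continuous fun r : ℝ => Φ (k₀ + r • u) := by
    have := h.smooth.continuous; fun_prop
  have hc' : Continuous fun r : ℝ => fderiv ℝ Φ (k₀ + r • u) u :=
    continuous_iff_continuousAt.2 fun r => (h.hasDerivAt_radial' u r).continuousAt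
  refine le_trans ?_ (mul_le_mul_right (h1 ▸ h2) _)
  have hm : Measurable fun r : ℝ => ENNReal.ofReal |fderiv ℝ Φ (k₀ + r • u) u| *
      ψ (Φ (k₀ + r • u)) := (hc'.abs.measurable.ennreal_ofReal).mul (hψ.comp hc.measurable)
  rw [← lintegral_const_mul _ hm]
  refine setLIntegral_mono' measurableSet_Ioi fun r hr => ?_
  have hr' : (0:ℝ) < r := hr
  rw [← mul_assoc, ← ENNReal.ofReal_mul (by have := h.pos; positivity)]
  gcongr
  rw [inv_mul_eq_div, le_div_iff₀ h.pos, mul_comm]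
  exact (h.le_radial' hu hr'.le).trans (le_abs_self _)

end ConvexPhase

/-- The ratio r / ‖v + r u‖ is at most the inverse of the transverse part of u. That part is at most
1, so the exponent d - 2 may be raised to d - 3/2. If it vanishes, the right side is infinite. -/
lemma pow_div_le_sWeight {d : ℕ} (hd : 3 ≤ d) (v : Mom d) {u : Mom d} (hu : ‖u‖ = 1) {r : ℝ}
    (hr : 0 < r) :
    ENNReal.ofReal (r ^ (d - 2)) * (ENNReal.ofReal ‖v + r • u‖ ^ (d - 2))⁻¹ ≤ sWeight v u := by
  rcases (perp_nonneg v u).eq_or_lt with h0 | h0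
  · rw [sWeight, ← h0, ENNReal.ofReal_zero, ENNReal.zero_rpow_of_pos (by linarith [sExp_pos hd])]
    simp
  · have h1 := mul_perp_le v u hr.le
    have h2 : 0 < r * perp v u := by positivity
    have h3 : perp v u ≤ 1 := (perp_le_norm v u).trans hu.le
    rw [sWeight, ← div_eq_mul_inv, ENNReal.ofReal_pow hr.le]
    refine ENNReal.div_le_of_le_mul ?_
    have h4 : ENNReal.ofReal r ^ (d - 2) * ENNReal.ofReal (perp v u) ^ sExp d ≤
        ENNReal.ofReal ‖v + r • u‖ ^ (d - 2) := by
      calc _ ≤ ENNReal.ofReal r ^ (d - 2) * ENNReal.ofReal (perp v u) ^ ((d - 2 : ℕ) : ℝ) := by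
            refine mul_le_mul_right ?_ _
            refine ENNReal.rpow_le_rpow_of_exponent_ge (ENNReal.ofReal_le_one.2 h3) ?_
            rw [Nat.cast_sub (by omega)]; unfold sExp; push_cast; linarith
        _ = ENNReal.ofReal (r * perp v u) ^ (d - 2) := by
            rw [ENNReal.rpow_natCast, ENNReal.ofReal_mul hr.le, mul_pow]
        _ ≤ _ := by gcongr
    rw [mul_comm, ← div_eq_mul_inv]
    rw [ENNReal.le_div_iff_mul_le]
    · exact h4
    · left
      rw [ENNReal.ofReal_rpow_of_pos h0]
      simp; positivity
    · left
      exact ENNReal.rpow_ne_top_of_nonneg (by linarith [sExp_pos hd]) ENNReal.ofReal_ne_top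

/-- Level sets of uniformly convex phases carry finite mass, uniformly, with respect to the
weight `|k|^{-(d-2)}`. -/
theorem coarea_bound {d : ℕ} (hd : 3 ≤ d) : ∃ C : ℝ, 0 < C ∧
    ∀ (c₃ c₄ : ℝ) (Φ : Mom d → ℝ) (k₀ : Mom d), ConvexPhase c₃ c₄ Φ k₀ →
    ∀ ψ : ℝ → ℝ≥0∞, Measurable ψ →
      ∫⁻ k, (ENNReal.ofReal ‖k‖ ^ (d - 2))⁻¹ * ψ (Φ k) ≤ ENNReal.ofReal (C / c₃) * ∫⁻ x, ψ x := by
  obtain ⟨C, hC, hs⟩ := sphere_weight_bound hd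
  refine ⟨C.toReal + 1, by positivity, fun c₃ c₄ Φ k₀ h ψ hψ => ?_⟩
  have hΦ := h.smooth.continuous
  have hm : Measurable fun k => (ENNReal.ofReal ‖k‖ ^ (d - 2))⁻¹ * ψ (Φ k) :=
    Measurable.mul (by fun_prop) (hψ.comp hΦ.measurable)
  have hm' : Measurable fun k => (ENNReal.ofReal ‖k₀ + k‖ ^ (d - 2))⁻¹ * ψ (Φ (k₀ + k)) :=
    hm.comp (measurable_const_add k₀)
  -- Polar coordinates are centred at the critical point, whereas the singularity of the weight
  -- stays at the origin.
  rw [← lintegral_add_left_eq_self _ k₀, lintegral_polar hd hm']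
  -- In r^{d-1} |k|^{-(d-2)} = r · (r/|k|)^{d-2} the first factor is what the substitution along the
  -- ray needs, and the second is bounded by the angular weight.
  have key : ∀ u : USphere d, (∫⁻ r in Set.Ioi (0 : ℝ), ENNReal.ofReal (r ^ (d - 1)) *
      ((ENNReal.ofReal ‖k₀ + r • (u : Mom d)‖ ^ (d - 2))⁻¹ * ψ (Φ (k₀ + r • (u : Mom d))))) ≤
      sWeight k₀ u * (ENNReal.ofReal c₃⁻¹ * ∫⁻ x, ψ x) := fun u => by
    have hu : ‖(u : Mom d)‖ = 1 := by simp
    have hc : Continuous fun r : ℝ => Φ (k₀ + r • (u : Mom d)) := by fun_prop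
    refine le_trans ?_ (mul_le_mul_right (h.lintegral_radial_le hu ψ hψ) _)
    have hm1 : Measurable fun r : ℝ => ENNReal.ofReal r * ψ (Φ (k₀ + r • (u : Mom d))) :=
      Measurable.mul (by fun_prop) (hψ.comp hc.measurable)
    rw [← lintegral_const_mul _ hm1]
    refine setLIntegral_mono' measurableSet_Ioi fun r hr => ?_
    have hr' : (0:ℝ) < r := hr
    have h1 := pow_div_le_sWeight hd k₀ hu hr'
    have h2 : r ^ (d - 1) = r ^ (d - 2) * r := by rw [← pow_succ]; congr 1; omega
    rw [h2, ENNReal.ofReal_mul (by positivity)]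
    calc _ = (ENNReal.ofReal (r ^ (d - 2)) * (ENNReal.ofReal ‖k₀ + r • (u : Mom d)‖ ^ (d - 2))⁻¹) *
          (ENNReal.ofReal r * ψ (Φ (k₀ + r • (u : Mom d)))) := by ring
      _ ≤ _ := by gcongr
  refine (lintegral_mono key).trans ?_
  have hm2 : Measurable fun u : USphere d => sWeight k₀ u :=
    (measurable_sWeight k₀).comp measurable_subtype_coe
  rw [lintegral_mul_const _ hm2, ← mul_assoc]
  gcongr
  calc _ ≤ C * ENNReal.ofReal c₃⁻¹ := by gcongr; exact hs k₀
    _ ≤ ENNReal.ofReal (C.toReal + 1) * ENNReal.ofReal c₃⁻¹ := by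
        gcongr
        conv_lhs => rw [← ENNReal.ofReal_toReal hC]
        exact ENNReal.ofReal_le_ofReal (by linarith)
    _ = _ := by rw [← ENNReal.ofReal_mul (by positivity), div_eq_mul_inv]

/-! ### Resolvents -/

/-- `|x + i/t|^{-1}`. -/
def rr (t x : ℝ) : ℝ := (Real.sqrt (x ^ 2 + t⁻¹ ^ 2))⁻¹

/-- `1 + |x + i/t|^{-1}`. -/
def rh (t x : ℝ) : ℝ := 1 + rr t x

lemma rr_nonneg (t x : ℝ) : 0 ≤ rr t x := inv_nonneg.2 (Real.sqrt_nonneg _)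

lemma sqrt_pos_of_pos {t : ℝ} (ht : 0 < t) (x : ℝ) : 0 < Real.sqrt (x ^ 2 + t⁻¹ ^ 2) :=
  Real.sqrt_pos.2 (by positivity)

lemma continuous_rr {t : ℝ} (ht : 0 < t) : Continuous (rr t) := by
  unfold rr
  exact Continuous.inv₀ (by fun_prop) fun x => (sqrt_pos_of_pos ht x).ne'

lemma continuous_rh {t : ℝ} (ht : 0 < t) : Continuous (rh t) :=
  continuous_const.add (continuous_rr ht)

lemma rr_le_of_le {t x m : ℝ} (hm : 0 < m) (h : m ≤ |x| ∨ m ≤ t⁻¹) : rr t x ≤ m⁻¹ := by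
  refine inv_anti₀ hm ?_
  rcases h with h | h
  · refine Real.le_sqrt_of_sq_le ?_
    rw [← sq_abs x]; nlinarith [sq_nonneg t⁻¹]
  · refine Real.le_sqrt_of_sq_le ?_
    nlinarith [sq_nonneg x]

lemma rr_le {t : ℝ} (ht : 0 < t) (x : ℝ) : rr t x ≤ t := by
  have := rr_le_of_le (t := t) (x := x) (inv_pos.2 ht) (Or.inr le_rfl)
  rwa [inv_inv] at this

@[simp] lemma rr_neg (t x : ℝ) : rr t (-x) = rr t x := by simp [rr]

/-- `∫_{1/t}^ρ δ^{-2} 1(|x| ≤ δ) dδ`. -/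
def logKernel (ρ t x : ℝ) : ℝ≥0∞ :=
  ∫⁻ δ in Set.Ioc t⁻¹ ρ, if |x| ≤ δ then ENNReal.ofReal (δ ^ 2)⁻¹ else 0

lemma measurable_shell : Measurable fun p : ℝ × ℝ =>
    if |p.1| ≤ p.2 then ENNReal.ofReal (p.2 ^ 2)⁻¹ else 0 :=
  Measurable.ite (measurableSet_le (by fun_prop) (by fun_prop)) (by fun_prop) measurable_const

lemma measurable_logKernel (ρ t : ℝ) : Measurable (logKernel ρ t) :=
  measurable_shell.lintegral_prod_right'

lemma lintegral_Ioc_inv_sq {a b : ℝ} (ha : 0 < a) (hab : a ≤ b) :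
    ∫⁻ δ in Set.Ioc a b, ENNReal.ofReal (δ ^ 2)⁻¹ = ENNReal.ofReal (a⁻¹ - b⁻¹) := by
  have hne : ∀ x ∈ Set.uIcc a b, x ≠ 0 := fun x hx => by
    rw [Set.uIcc_of_le hab] at hx; linarith [hx.1]
  have hc : ContinuousOn (fun x : ℝ => (x ^ 2)⁻¹) (Set.uIcc a b) :=
    ContinuousOn.inv₀ (by fun_prop) fun x hx => pow_ne_zero 2 (hne x hx)
  rw [← ofReal_integral_eq_lintegral_ofReal hc.intervalIntegrable.1,
    ← intervalIntegral.integral_of_le hab]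
  · congr 1
    rw [intervalIntegral.integral_eq_sub_of_hasDerivAt (f := fun x => -x⁻¹) (fun x hx => ?_)
      hc.intervalIntegrable]
    · ring
    · exact (hasDerivAt_inv (hne x hx)).fun_neg.congr_deriv (by simp)
  · exact Eventually.of_forall fun x => by positivity

lemma lintegral_Ioc_inv_le {ρ t : ℝ} (hρ : 0 < ρ) (ht : 1 ≤ t) :
    ∫⁻ δ in Set.Ioc t⁻¹ ρ, ENNReal.ofReal δ⁻¹ ≤ ENNReal.ofReal ((|Real.log ρ| + 1) * logStar t) := by
  have ht0 : 0 < t⁻¹ := by positivity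
  rcases le_or_gt t⁻¹ ρ with hab | hab
  · have hne : ∀ x ∈ Set.uIcc t⁻¹ ρ, x ≠ 0 := fun x hx => by
      rw [Set.uIcc_of_le hab] at hx; linarith [hx.1]
    have hc : ContinuousOn (fun x : ℝ => x⁻¹) (Set.uIcc t⁻¹ ρ) :=
      ContinuousOn.inv₀ (by fun_prop) hne
    rw [← ofReal_integral_eq_lintegral_ofReal hc.intervalIntegrable.1,
      ← intervalIntegral.integral_of_le hab, integral_inv_of_pos ht0 hρ]
    · refine ENNReal.ofReal_le_ofReal ?_
      rw [div_inv_eq_mul, Real.log_mul hρ.ne' (by positivity)]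
      have h1 : 1 ≤ logStar t := le_max_left _ _
      have h2 : Real.log t ≤ logStar t := le_max_right _ _
      nlinarith [le_abs_self (Real.log ρ), abs_nonneg (Real.log ρ)]
    · filter_upwards [ae_restrict_mem measurableSet_Ioc] with x hx
      exact inv_nonneg.2 (ht0.le.trans hx.1.le)
  · rw [Set.Ioc_eq_empty (by linarith)]; simp

/-- Layer cake formula: for m = max(|x|, 1/t) < ρ one has 1/m = 1/ρ + ∫_m^ρ δ^{-2} dδ, and |x| ≤ δ
on this range. It turns bounds on volumes of energy shells into bounds on integrals of resolvents.
-/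
lemma rr_le_logKernel {ρ t : ℝ} (hρ : 0 < ρ) (ht : 0 < t) (x : ℝ) :
    ENNReal.ofReal (rr t x) ≤ ENNReal.ofReal ρ⁻¹ + logKernel ρ t x := by
  set m := max |x| t⁻¹ with hm
  have hm0 : 0 < m := lt_max_of_lt_right (by positivity)
  have h1 : rr t x ≤ m⁻¹ := rr_le_of_le hm0 (le_max_iff.1 le_rfl)
  rcases le_or_gt ρ m with h | h
  · refine le_trans (ENNReal.ofReal_le_ofReal (h1.trans ?_)) le_self_add
    exact inv_anti₀ hρ h
  · have h2 : ENNReal.ofReal (m⁻¹ - ρ⁻¹) ≤ logKernel ρ t x := by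
      rw [← lintegral_Ioc_inv_sq hm0 h.le]
      have hsub : Set.Ioc m ρ ⊆ Set.Ioc t⁻¹ ρ := Set.Ioc_subset_Ioc_left (le_max_right _ _)
      refine le_trans (setLIntegral_mono' measurableSet_Ioc fun δ hδ => ?_)
        (lintegral_mono_set hsub)
      rw [if_pos ((le_max_left _ _).trans hδ.1.le)]
    refine le_trans (ENNReal.ofReal_le_ofReal h1) ?_
    calc ENNReal.ofReal m⁻¹ = ENNReal.ofReal (ρ⁻¹ + (m⁻¹ - ρ⁻¹)) := by congr 1; ring
      _ ≤ _ := by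
        rw [ENNReal.ofReal_add (by positivity) (sub_nonneg.2 (inv_anti₀ hm0 h.le))]
        gcongr

lemma rh_le_logKernel {ρ t : ℝ} (hρ : 0 < ρ) (ht : 0 < t) (x : ℝ) :
    ENNReal.ofReal (rh t x) ≤ ENNReal.ofReal (1 + ρ⁻¹) + logKernel ρ t x := by
  rw [rh, ENNReal.ofReal_add zero_le_one (rr_nonneg t x),
    ENNReal.ofReal_add zero_le_one (by positivity), add_assoc]
  gcongr
  exact rr_le_logKernel hρ ht x

/-- A shell of half-width δ has length 2δ, which leaves ∫ δ^{-1} dδ, a logarithm of t. -/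
lemma lintegral_logKernel_le {ρ t : ℝ} (hρ : 0 < ρ) (ht : 1 ≤ t) (θ : ℝ) :
    ∫⁻ x, logKernel ρ t (θ - x) ≤ ENNReal.ofReal (2 * ((|Real.log ρ| + 1) * logStar t)) := by
  have h1 : ∫⁻ x, logKernel ρ t (θ - x) = ∫⁻ x, logKernel ρ t x :=
    lintegral_sub_left_eq_self (fun x => logKernel ρ t x) θ
  rw [h1]
  unfold logKernel
  rw [lintegral_lintegral_swap measurable_shell.aemeasurable]
  have h2 : ∀ δ ∈ Set.Ioc t⁻¹ ρ, ∫⁻ x : ℝ, (if |x| ≤ δ then ENNReal.ofReal (δ ^ 2)⁻¹ else 0) =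
      2 * ENNReal.ofReal δ⁻¹ := fun δ hδ => by
    have hδ0 : 0 < δ := lt_trans (by positivity) hδ.1
    have h3 : (fun x : ℝ => if |x| ≤ δ then ENNReal.ofReal (δ ^ 2)⁻¹ else 0) =
        (Set.Icc (-δ) δ).indicator fun _ => ENNReal.ofReal (δ ^ 2)⁻¹ := by
      funext x; simp [Set.indicator, abs_le]
    rw [h3, lintegral_indicator measurableSet_Icc, setLIntegral_const, Real.volume_Icc,
      ← ENNReal.ofReal_mul (by positivity), show (2 : ℝ≥0∞) = ENNReal.ofReal 2 by simp,
      ← ENNReal.ofReal_mul (by norm_num)]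
    congr 1; field_simp; ring
  rw [setLIntegral_congr_fun measurableSet_Ioc h2, lintegral_const_mul _ (by fun_prop),
    ENNReal.ofReal_mul (by norm_num), show (2 : ℝ≥0∞) = ENNReal.ofReal 2 by simp]
  gcongr
  exact lintegral_Ioc_inv_le hρ ht

/-! ### Integrals of one and of two resolvents -/

section Shells

variable {d : ℕ}

/-- The weight `⟨k⟩^{-(d+1)} (1 + |k|^{-1})`. -/
def sing (k : Mom d) : ℝ≥0∞ := ENNReal.ofReal (wt (d + 1) k) * (1 + (ENNReal.ofReal ‖k‖)⁻¹)

lemma measurable_sing : Measurable (sing : Mom d → ℝ≥0∞) := by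
  have := (continuous_wt (d := d) (d + 1)).measurable
  unfold sing; fun_prop

lemma wt_le_sing (k : Mom d) : ENNReal.ofReal (wt (d + 1) k) ≤ sing k :=
  le_mul_of_one_le_right' le_self_add

/-- For d ≥ 3 the singularity |k|^{-1} is no worse than |k|^{-(d-2)}, the weight of `coarea_bound`;
the decay of `wt` makes the comparison global. -/
lemma sing_le (hd : 3 ≤ d) (k : Mom d) : sing k ≤ ENNReal.ofReal 2 * (ENNReal.ofReal ‖k‖ ^ (d - 2))⁻¹ := by
  rcases eq_or_ne k 0 with rfl | hk
  · have : d - 2 ≠ 0 := by omega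
    simp [this, ENNReal.mul_top]
  · have hk0 : 0 < ‖k‖ := norm_pos_iff.2 hk
    have hb := norm_le_bracket k
    have hb0 := bracket_pos k
    rw [sing, ← ENNReal.ofReal_inv_of_pos hk0, ← ENNReal.ofReal_pow hk0.le,
      ← ENNReal.ofReal_inv_of_pos (by positivity), show (1 : ℝ≥0∞) = ENNReal.ofReal 1 by simp,
      ← ENNReal.ofReal_add (by norm_num) (by positivity), ← ENNReal.ofReal_mul (wt_pos _ _).le,
      ← ENNReal.ofReal_mul (by norm_num)]
    refine ENNReal.ofReal_le_ofReal ?_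
    have h1 : wt (d + 1) k ≤ (‖k‖ ^ (d - 2))⁻¹ :=
      (wt_anti (show d - 2 ≤ d + 1 by omega) k).trans (inv_anti₀ (by positivity) (by gcongr))
    have h2 : wt (d + 1) k ≤ (‖k‖ ^ (d - 3))⁻¹ :=
      (wt_anti (show d - 3 ≤ d + 1 by omega) k).trans (inv_anti₀ (by positivity) (by gcongr))
    have h3 : (‖k‖ ^ (d - 3))⁻¹ * ‖k‖⁻¹ = (‖k‖ ^ (d - 2))⁻¹ := by
      rw [← mul_inv, ← pow_succ]; congr 2; omega
    have h4 : wt (d + 1) k * ‖k‖⁻¹ ≤ (‖k‖ ^ (d - 2))⁻¹ := by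
      rw [← h3]; gcongr
    linarith

lemma lintegral_sing_lt_top (hd : 3 ≤ d) : ∫⁻ k : Mom d, sing k < ⊤ := by
  have := nontrivial_mom hd
  have h1 : ∫⁻ k : Mom d, ENNReal.ofReal (wt (d + 1) k) < ⊤ := by
    have := (integrable_wt (d := d) (a := d + 1) (by omega)).2
    refine lt_of_le_of_lt (lintegral_mono fun k => ?_) this
    exact Real.ofReal_le_enorm _
  have h2 : ∫⁻ k : Mom d in Metric.ball 0 1, (ENNReal.ofReal ‖k‖)⁻¹ < ⊤ := by
    have h : IntegrableOn (fun x : Mom d => ‖x‖⁻¹) (Metric.ball 0 1) := by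
      refine (integrableOn_fun_norm_addHaar (E := Mom d) volume (f := fun y => y⁻¹) (r := 1)).2 ?_
      have hc : IntegrableOn (fun y : ℝ => y ^ (d - 2)) (Set.Ioo 0 1) :=
        ((continuous_pow (d - 2)).intervalIntegrable 0 1).1.mono_set Set.Ioo_subset_Ioc_self
      refine hc.congr_fun (fun y hy => ?_) measurableSet_Ioo
      have hy0 : y ≠ 0 := hy.1.ne'
      simp only [finrank_euclideanSpace, Fintype.card_fin, smul_eq_mul]
      rw [show d - 1 = d - 2 + 1 by omega, pow_succ, mul_assoc, mul_inv_cancel₀ hy0, mul_one]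
    refine lt_of_le_of_lt (lintegral_mono_ae ?_) h.2
    have : ∀ᵐ x : Mom d, x ≠ 0 := by simp [ae_iff]
    filter_upwards [ae_restrict_of_ae this] with x hx
    rw [← ENNReal.ofReal_inv_of_pos (norm_pos_iff.2 hx)]
    exact Real.ofReal_le_enorm _
  have h3 : ∀ k : Mom d, sing k ≤ 2 * ENNReal.ofReal (wt (d + 1) k) +
      (Metric.ball (0 : Mom d) 1).indicator (fun k => (ENNReal.ofReal ‖k‖)⁻¹) k := fun k => by
    rw [sing, mul_add, mul_one, two_mul, add_assoc]
    gcongr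
    by_cases hk : k ∈ Metric.ball (0 : Mom d) 1
    · rw [Set.indicator_of_mem hk]
      refine le_trans ?_ le_add_self
      exact mul_le_of_le_one_left' (ENNReal.ofReal_le_one.2 (wt_le_one _ _))
    · refine le_trans ?_ le_self_add
      refine mul_le_of_le_one_right' (ENNReal.inv_le_one.2 ?_)
      rw [mem_ball_zero_iff, not_lt] at hk
      exact ENNReal.one_le_ofReal.2 hk
  refine lt_of_le_of_lt (lintegral_mono h3) ?_
  have hmw := (continuous_wt (d := d) (d + 1)).measurable
  rw [lintegral_add_left (by fun_prop), lintegral_indicator measurableSet_ball,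
    lintegral_const_mul _ (by fun_prop)]
  exact ENNReal.add_lt_top.2 ⟨ENNReal.mul_lt_top (by simp) h1, h2⟩

lemma logStar_ge_one (t : ℝ) : 1 ≤ logStar t := le_max_left _ _

lemma lintegral_sing_logKernel (hd : 3 ≤ d) (K : Constants) : ∃ C : ℝ, 0 < C ∧
    ∀ S : Model d, Assumptions K S → ∀ (σ : ℤˣ) (p : Mom d) (θ t : ℝ), 1 ≤ t →
      ∫⁻ k, sing k * logKernel K.ρ t (θ - S.Phi σ p k) ≤ ENNReal.ofReal (C * logStar t) := by
  obtain ⟨C, hC, h⟩ := coarea_bound hd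
  refine ⟨2 * (C / |K.c₃|) * (2 * (|Real.log K.ρ| + 1)) + 1, by positivity,
    fun S A σ p θ t ht => ?_⟩
  obtain ⟨k₀, hk⟩ := A.exists_convexPhase hd σ p
  have h1 := h _ _ _ _ hk (fun x => logKernel K.ρ t (θ - x))
    ((measurable_logKernel _ _).comp (by fun_prop))
  have hΦ := (A.Phi_contDiff hd σ p).continuous.measurable
  have hX := measurable_logKernel K.ρ t
  calc _ ≤ ∫⁻ k, ENNReal.ofReal 2 * ((ENNReal.ofReal ‖k‖ ^ (d - 2))⁻¹ * logKernel K.ρ t (θ - S.Phi σ p k)) := by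
        refine lintegral_mono fun k => ?_
        rw [← mul_assoc]; gcongr; exact sing_le hd k
    _ = ENNReal.ofReal 2 * ∫⁻ k, (ENNReal.ofReal ‖k‖ ^ (d - 2))⁻¹ * logKernel K.ρ t (θ - S.Phi σ p k) :=
        lintegral_const_mul _ (Measurable.mul (by fun_prop) (hX.comp (by fun_prop)))
    _ ≤ ENNReal.ofReal 2 * (ENNReal.ofReal (C / K.c₃) *
          ENNReal.ofReal (2 * ((|Real.log K.ρ| + 1) * logStar t))) := by
        gcongr
        exact h1.trans (by gcongr; exact lintegral_logKernel_le A.ρ_pos ht θ)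
    _ ≤ _ := by
        have := A.c₃_pos
        have hl := logStar_ge_one t
        rw [← ENNReal.ofReal_mul (by positivity), ← ENNReal.ofReal_mul (by positivity),
          abs_of_pos this]
        refine ENNReal.ofReal_le_ofReal ?_
        have : (0:ℝ) ≤ 1 * logStar t := by linarith
        linarith

/-- One resolvent, integrated against a weight with a point singularity. -/
theorem one_resolvent_bound (hd : 3 ≤ d) (K : Constants) : ∃ C : ℝ, 1 ≤ C ∧
    ∀ S : Model d, Assumptions K S → ∀ (σ : ℤˣ) (p : Mom d) (θ t : ℝ), 1 ≤ t →
      ∫⁻ k, sing k * ENNReal.ofReal (rh t (θ - S.Phi σ p k)) ≤ ENNReal.ofReal (C * logStar t) := by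
  obtain ⟨C, hC, h⟩ := lintegral_sing_logKernel hd K
  have hfin := (lintegral_sing_lt_top hd).ne
  set I := (∫⁻ k : Mom d, sing k).toReal with hI
  refine ⟨(1 + |K.ρ|⁻¹) * I + C + 1, by have : 0 ≤ I := ENNReal.toReal_nonneg
                                        -- The constant is chosen before any model is given, so the
                                        -- sign of K.ρ is not yet known; absolute values keep it
                                        -- positive.
                                        have h2 : 0 ≤ (1 + |K.ρ|⁻¹) * I := by positivity
                                        linarith, fun S A σ p θ t ht => ?_⟩
  have hI0 : 0 ≤ I := ENNReal.toReal_nonneg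
  have hρ := A.ρ_pos
  have hl := logStar_ge_one t
  have hΦ := (A.Phi_contDiff hd σ p).continuous.measurable
  have hX := measurable_logKernel K.ρ t
  have hm := measurable_sing (d := d)
  calc _ ≤ ∫⁻ k, (sing k * ENNReal.ofReal (1 + K.ρ⁻¹) +
        sing k * logKernel K.ρ t (θ - S.Phi σ p k)) := by
        refine lintegral_mono fun k => ?_
        rw [← mul_add]; gcongr; exact rh_le_logKernel hρ (by linarith) _
    _ = (∫⁻ k : Mom d, sing k) * ENNReal.ofReal (1 + K.ρ⁻¹) +
        ∫⁻ k, sing k * logKernel K.ρ t (θ - S.Phi σ p k) := by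
        rw [lintegral_add_left (by fun_prop), lintegral_mul_const _ hm]
    _ ≤ ENNReal.ofReal I * ENNReal.ofReal (1 + K.ρ⁻¹) + ENNReal.ofReal (C * logStar t) := by
        rw [hI, ENNReal.ofReal_toReal hfin]; gcongr; exact h S A σ p θ t ht
    _ ≤ _ := by
        rw [← ENNReal.ofReal_mul (by positivity), ← ENNReal.ofReal_add (by positivity) (by positivity),
          abs_of_pos hρ]
        refine ENNReal.ofReal_le_ofReal ?_
        have h1 : I * (1 + K.ρ⁻¹) * 1 ≤ I * (1 + K.ρ⁻¹) * logStar t := by gcongr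
        nlinarith

/-- Transversality controls a set only inside balls of radius ρ. Averaging the indicator of a ball
over its centre q, and using that the weight varies by a bounded factor within a ball, turns this
local control into a weighted global one. -/
lemma setLIntegral_wt_le {ρ : ℝ} (hρ : 0 < ρ) : ∃ C : ℝ, 0 < C ∧
    ∀ (s : Set (Mom d)), MeasurableSet s → ∀ V : ℝ≥0∞,
      (∀ q, volume (s ∩ Metric.ball q ρ) ≤ V) →
      ∫⁻ k in s, ENNReal.ofReal (wt (d + 1) k) ≤ ENNReal.ofReal C * V := by
  have h1 : ∫⁻ k : Mom d, ENNReal.ofReal (wt (d + 1) k) ≠ ⊤ := by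
    have := (integrable_wt (d := d) (a := d + 1) (by omega)).2
    refine (lt_of_le_of_lt (lintegral_mono fun k => ?_) this).ne
    exact Real.ofReal_le_enorm _
  set v := volume (Metric.ball (0 : Mom d) ρ) with hv
  have hv0 : v ≠ 0 := (Metric.measure_ball_pos volume _ hρ).ne'
  have hvt : v ≠ ⊤ := measure_ball_lt_top.ne
  set I := ∫⁻ k : Mom d, ENNReal.ofReal (wt (d + 1) k)
  set D := v⁻¹ * (ENNReal.ofReal ((2 * (1 + ρ)) ^ (d + 1)) * I) with hD
  have hDt : D ≠ ⊤ := ENNReal.mul_ne_top (ENNReal.inv_ne_top.2 hv0)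
    (ENNReal.mul_ne_top ENNReal.ofReal_ne_top h1)
  have hmw := (continuous_wt (d := d) (d + 1)).measurable
  refine ⟨D.toReal + 1, by positivity, fun s hs V hV => ?_⟩
  have key : v * ∫⁻ k in s, ENNReal.ofReal (wt (d + 1) k) ≤
      ENNReal.ofReal ((2 * (1 + ρ)) ^ (d + 1)) * I * V := by
    calc v * ∫⁻ k in s, ENNReal.ofReal (wt (d + 1) k)
        = ∫⁻ k in s, ∫⁻ q : Mom d, (if dist k q < ρ then ENNReal.ofReal (wt (d + 1) k) else 0) := by
          rw [← lintegral_const_mul _ (by fun_prop)]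
          refine lintegral_congr fun k => ?_
          have : (fun q : Mom d => if dist k q < ρ then ENNReal.ofReal (wt (d + 1) k) else 0) =
              (Metric.ball k ρ).indicator fun _ => ENNReal.ofReal (wt (d + 1) k) := by
            funext q; simp [Set.indicator, dist_comm]
          rw [this, lintegral_indicator measurableSet_ball, setLIntegral_const, mul_comm, hv,
            Measure.addHaar_ball_center volume k]
      _ = ∫⁻ q : Mom d, ∫⁻ k in s, (if dist k q < ρ then ENNReal.ofReal (wt (d + 1) k) else 0) := by
          refine lintegral_lintegral_swap (Measurable.aemeasurable ?_)
          exact Measurable.ite (measurableSet_lt (by fun_prop) (by fun_prop)) (by fun_prop)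
            measurable_const
      _ ≤ ∫⁻ q : Mom d, ENNReal.ofReal ((2 * (1 + ρ)) ^ (d + 1)) *
            ENNReal.ofReal (wt (d + 1) q) * V := by
          refine lintegral_mono fun q => ?_
          have hle : ∀ k : Mom d, (if dist k q < ρ then ENNReal.ofReal (wt (d + 1) k) else 0) ≤
              (Metric.ball q ρ).indicator (fun _ => ENNReal.ofReal ((2 * (1 + ρ)) ^ (d + 1)) *
                ENNReal.ofReal (wt (d + 1) q)) k := fun k => by
            by_cases hk : dist k q < ρ
            · rw [if_pos hk, Set.indicator_of_mem (by simpa using hk),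
                ← ENNReal.ofReal_mul (by positivity)]
              refine ENNReal.ofReal_le_ofReal ?_
              have h2 := wt_add_le (d + 1) k (q - k)
              rw [add_sub_cancel] at h2
              refine h2.trans ?_
              have h3 := wt_pos (d + 1) q
              have h4 : bracket (q - k) ≤ 1 + ρ := by
                refine (bracket_le_one_add _).trans ?_
                rw [← dist_eq_norm, dist_comm]; linarith
              have := bracket_pos (q - k)
              gcongr
            · rw [if_neg hk]; exact zero_le
          refine (lintegral_mono hle).trans ?_
          rw [lintegral_indicator measurableSet_ball, setLIntegral_const,
            Measure.restrict_apply measurableSet_ball, Set.inter_comm]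
          gcongr
          exact hV q
      _ = _ := by
          rw [lintegral_mul_const _ (by fun_prop), lintegral_const_mul _ (by fun_prop)]
  have h5 : ∫⁻ k in s, ENNReal.ofReal (wt (d + 1) k) ≤ D * V := by
    rw [hD, mul_assoc, ← ENNReal.div_eq_inv_mul]
    refine (ENNReal.le_div_iff_mul_le (Or.inl hv0) (Or.inl hvt)).2 ?_
    rwa [mul_comm]
  refine h5.trans (mul_le_mul_left ?_ _)
  conv_lhs => rw [← ENNReal.ofReal_toReal hDt]
  exact ENNReal.ofReal_le_ofReal (by linarith)

end Shells

/-! ### Two resolvents, by transversality -/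

section Shells

variable {d : ℕ}

/-- The integrand of `logKernel`. -/
def shellKernel (x δ : ℝ) : ℝ≥0∞ := if |x| ≤ δ then ENNReal.ofReal (δ ^ 2)⁻¹ else 0

lemma measurable_shellKernel : Measurable fun p : ℝ × ℝ => shellKernel p.1 p.2 := measurable_shell

lemma lintegral_logKernel_mul {X : Type*} [MeasurableSpace X] {m : Measure X} [SFinite m]
    {a : X → ℝ≥0∞} {f g : X → ℝ} (ha : Measurable a) (hf : Measurable f) (hg : Measurable g)
    (ρ t : ℝ) :
    ∫⁻ k, a k * (logKernel ρ t (f k) * logKernel ρ t (g k)) ∂m =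
      ∫⁻ δ₁ in Set.Ioc t⁻¹ ρ, ∫⁻ δ₂ in Set.Ioc t⁻¹ ρ,
        ∫⁻ k, a k * (shellKernel (f k) δ₁ * shellKernel (g k) δ₂) ∂m := by
  have hsm1 : ∀ x, Measurable fun δ => shellKernel x δ := fun x =>
    measurable_shellKernel.comp (measurable_const.prodMk measurable_id)
  have hl : ∀ x, logKernel ρ t x = ∫⁻ δ in Set.Ioc t⁻¹ ρ, shellKernel x δ := fun x => rfl
  have hm3 : Measurable fun q : (X × ℝ) × ℝ =>
      a q.1.1 * (shellKernel (f q.1.1) q.1.2 * shellKernel (g q.1.1) q.2) :=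
    Measurable.mul (by fun_prop) (Measurable.mul
      (measurable_shellKernel.comp (f := fun q : (X × ℝ) × ℝ => (f q.1.1, q.1.2)) (by fun_prop))
      (measurable_shellKernel.comp (f := fun q : (X × ℝ) × ℝ => (g q.1.1, q.2)) (by fun_prop)))
  have e1 : ∀ k, a k * (logKernel ρ t (f k) * logKernel ρ t (g k)) =
      ∫⁻ δ₁ in Set.Ioc t⁻¹ ρ, ∫⁻ δ₂ in Set.Ioc t⁻¹ ρ,
        a k * (shellKernel (f k) δ₁ * shellKernel (g k) δ₂) := fun k => by
    have : ∀ δ₁, ∫⁻ δ₂ in Set.Ioc t⁻¹ ρ, a k * (shellKernel (f k) δ₁ * shellKernel (g k) δ₂) =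
        a k * (shellKernel (f k) δ₁ * logKernel ρ t (g k)) := fun δ₁ => by
      rw [lintegral_const_mul _ ((hsm1 _).const_mul _), lintegral_const_mul _ (hsm1 _), hl]
    rw [lintegral_congr this, lintegral_const_mul _ ((hsm1 _).mul_const _),
      lintegral_mul_const _ (hsm1 _), hl]
  rw [lintegral_congr e1, lintegral_lintegral_swap (Measurable.aemeasurable
    (hm3.lintegral_prod_right' (ν := volume.restrict (Set.Ioc t⁻¹ ρ))))]
  refine lintegral_congr fun δ₁ => ?_
  exact lintegral_lintegral_swap (Measurable.aemeasurable
    (hm3.comp (show Measurable fun q : X × ℝ => ((q.1, δ₁), q.2) by fun_prop)))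

lemma lintegral_two_shells {K : Constants} {C : ℝ} (hC : 0 < C)
    (h : ∀ (s : Set (Mom d)), MeasurableSet s → ∀ V : ℝ≥0∞,
      (∀ q, volume (s ∩ Metric.ball q K.ρ) ≤ V) →
      ∫⁻ k in s, ENNReal.ofReal (wt (d + 1) k) ≤ ENNReal.ofReal C * V)
    {S : Model d} (hd : 3 ≤ d) (A : Assumptions K S) (σ : ℤˣ) {p₁ p₂ : Mom d} (hp : p₁ ≠ p₂)
    (θ₁ θ₂ : ℝ) {δ₁ δ₂ : ℝ} (h10 : 0 < δ₁) (h1 : δ₁ ≤ K.ρ) (h20 : 0 < δ₂) (h2 : δ₂ ≤ K.ρ) :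
    ∫⁻ k, ENNReal.ofReal (wt (d + 1) k) *
      (shellKernel (θ₁ - S.Phi σ p₁ k) δ₁ * shellKernel (θ₂ - S.Phi σ p₂ k) δ₂) ≤
    ENNReal.ofReal (C * |K.c₅| / ‖p₁ - p₂‖) * (ENNReal.ofReal δ₁⁻¹ * ENNReal.ofReal δ₂⁻¹) := by
  have hp0 : 0 < ‖p₁ - p₂‖ := norm_pos_iff.2 (sub_ne_zero.2 hp)
  have hΦ₁ := (A.Phi_contDiff hd σ p₁).continuous.measurable
  have hΦ₂ := (A.Phi_contDiff hd σ p₂).continuous.measurable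
  have hmw := (continuous_wt (d := d) (d + 1)).measurable
  set E : Set (Mom d) := S.levelShell σ p₁ θ₁ δ₁ ∩ S.levelShell σ p₂ θ₂ δ₂ with hE
  have hEm : MeasurableSet E := MeasurableSet.inter
    (measurableSet_le (by fun_prop) measurable_const) (measurableSet_le (by fun_prop) measurable_const)
  set D := ENNReal.ofReal (δ₁ ^ 2)⁻¹ * ENNReal.ofReal (δ₂ ^ 2)⁻¹ with hD
  have h3 : ∀ k, ENNReal.ofReal (wt (d + 1) k) *
      (shellKernel (θ₁ - S.Phi σ p₁ k) δ₁ * shellKernel (θ₂ - S.Phi σ p₂ k) δ₂) =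
      E.indicator (fun k => ENNReal.ofReal (wt (d + 1) k) * D) k := fun k => by
    have g1 : |θ₁ - S.Phi σ p₁ k| ≤ δ₁ ↔ k ∈ S.levelShell σ p₁ θ₁ δ₁ := by
      rw [abs_sub_comm]; rfl
    have g2 : |θ₂ - S.Phi σ p₂ k| ≤ δ₂ ↔ k ∈ S.levelShell σ p₂ θ₂ δ₂ := by
      rw [abs_sub_comm]; rfl
    rw [shellKernel, shellKernel]
    by_cases hk1 : k ∈ S.levelShell σ p₁ θ₁ δ₁
    · by_cases hk2 : k ∈ S.levelShell σ p₂ θ₂ δ₂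
      · rw [Set.indicator_of_mem (show k ∈ E from ⟨hk1, hk2⟩), if_pos (g1.2 hk1), if_pos (g2.2 hk2)]
      · rw [Set.indicator_of_notMem (show k ∉ E from fun hh => hk2 hh.2), if_neg (mt g2.1 hk2),
          mul_zero, mul_zero]
    · rw [Set.indicator_of_notMem (show k ∉ E from fun hh => hk1 hh.1), if_neg (mt g1.1 hk1),
        zero_mul, mul_zero]
  rw [lintegral_congr h3, lintegral_indicator hEm, lintegral_mul_const _ (by fun_prop)]
  have h4 := h E hEm (ENNReal.ofReal (K.c₅ * δ₁ * δ₂ / ‖p₁ - p₂‖)) fun q =>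
    A.transversal σ δ₁ δ₂ h10 h1 h20 h2 p₁ p₂ hp θ₁ θ₂ q
  refine (mul_le_mul_left h4 _).trans ?_
  have h5 := A.c₅_pos
  rw [hD, ← ENNReal.ofReal_mul hC.le, ← ENNReal.ofReal_mul (by positivity),
    ← ENNReal.ofReal_mul (by positivity), ← ENNReal.ofReal_mul (by positivity),
    ← ENNReal.ofReal_mul (by positivity)]
  refine ENNReal.ofReal_le_ofReal (le_of_eq ?_)
  rw [abs_of_pos h5]; field_simp

lemma lintegral_two_logKernel (K : Constants) : ∃ C : ℝ, 0 < C ∧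
    ∀ S : Model d, 3 ≤ d → Assumptions K S → ∀ (σ : ℤˣ) (p₁ p₂ : Mom d), p₁ ≠ p₂ →
      ∀ (θ₁ θ₂ t : ℝ), 1 ≤ t →
      ∫⁻ k, ENNReal.ofReal (wt (d + 1) k) * (logKernel K.ρ t (θ₁ - S.Phi σ p₁ k) *
        logKernel K.ρ t (θ₂ - S.Phi σ p₂ k)) ≤
        ENNReal.ofReal (C * logStar t ^ 2) * (ENNReal.ofReal ‖p₁ - p₂‖)⁻¹ := by
  -- If K.ρ is not positive, no model satisfies the assumptions and any constant serves.
  by_cases hρ : 0 < K.ρ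
  swap
  · exact ⟨1, one_pos, fun S _ A => absurd A.ρ_pos hρ⟩
  obtain ⟨C, hC, h⟩ := setLIntegral_wt_le (d := d) hρ
  refine ⟨C * |K.c₅| * (|Real.log K.ρ| + 1) ^ 2 + 1, by positivity,
    fun S hd A σ p₁ p₂ hp θ₁ θ₂ t ht => ?_⟩
  have hp0 : 0 < ‖p₁ - p₂‖ := norm_pos_iff.2 (sub_ne_zero.2 hp)
  have hΦ₁ := (A.Phi_contDiff hd σ p₁).continuous.measurable
  have hΦ₂ := (A.Phi_contDiff hd σ p₂).continuous.measurable
  have hmw := (continuous_wt (d := d) (d + 1)).measurable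
  rw [lintegral_logKernel_mul (by fun_prop) (by fun_prop) (by fun_prop)]
  set D : ℝ := C * |K.c₅| / ‖p₁ - p₂‖ with hD
  have ht0 : 0 < t⁻¹ := by positivity
  have hl := logStar_ge_one t
  have hJ := lintegral_Ioc_inv_le hρ ht
  set J := ∫⁻ δ in Set.Ioc t⁻¹ K.ρ, ENNReal.ofReal δ⁻¹
  set b := (|Real.log K.ρ| + 1) * logStar t with hb
  have hb0 : 0 ≤ b := by positivity
  calc _ ≤ ∫⁻ δ₁ in Set.Ioc t⁻¹ K.ρ, ∫⁻ δ₂ in Set.Ioc t⁻¹ K.ρ,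
        ENNReal.ofReal D * (ENNReal.ofReal δ₁⁻¹ * ENNReal.ofReal δ₂⁻¹) :=
        setLIntegral_mono' measurableSet_Ioc fun δ₁ h1 =>
          setLIntegral_mono' measurableSet_Ioc fun δ₂ h2 =>
            lintegral_two_shells hC h hd A σ hp θ₁ θ₂ (ht0.trans h1.1) h1.2 (ht0.trans h2.1) h2.2
    _ = ENNReal.ofReal D * (J * J) := by
        have : ∀ δ₁ : ℝ, ∫⁻ δ₂ in Set.Ioc t⁻¹ K.ρ,
            ENNReal.ofReal D * (ENNReal.ofReal δ₁⁻¹ * ENNReal.ofReal δ₂⁻¹) =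
            ENNReal.ofReal D * (ENNReal.ofReal δ₁⁻¹ * J) := fun δ₁ => by
          rw [lintegral_const_mul _ (by fun_prop), lintegral_const_mul _ (by fun_prop)]
        simp_rw [this]
        rw [lintegral_const_mul _ (by fun_prop), lintegral_mul_const _ (by fun_prop)]
    _ ≤ ENNReal.ofReal D * (ENNReal.ofReal b * ENNReal.ofReal b) :=
        mul_le_mul_right (mul_le_mul' hJ hJ) _
    _ ≤ _ := by
        rw [← ENNReal.ofReal_inv_of_pos hp0, ← ENNReal.ofReal_mul hb0,
          ← ENNReal.ofReal_mul (by positivity), ← ENNReal.ofReal_mul (by positivity)]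
        refine ENNReal.ofReal_le_ofReal ?_
        rw [hD, div_eq_mul_inv, hb]
        have : 0 ≤ 1 * logStar t ^ 2 * ‖p₁ - p₂‖⁻¹ := by positivity
        linarith

/-- Two resolvents with the same sign of the phonon energy. -/
theorem two_resolvent_bound (hd : 3 ≤ d) (K : Constants) : ∃ C : ℝ, 1 ≤ C ∧
    ∀ S : Model d, Assumptions K S → ∀ (σ : ℤˣ) (p₁ p₂ : Mom d), p₁ ≠ p₂ →
      ∀ (θ₁ θ₂ t : ℝ), 1 ≤ t →
      ∫⁻ k, ENNReal.ofReal (wt (d + 1) k) * (ENNReal.ofReal (rh t (θ₁ - S.Phi σ p₁ k)) *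
        ENNReal.ofReal (rh t (θ₂ - S.Phi σ p₂ k))) ≤
        ENNReal.ofReal (C * logStar t ^ 2) * (1 + (ENNReal.ofReal ‖p₁ - p₂‖)⁻¹) := by
  obtain ⟨C₁, hC₁, h₁⟩ := one_resolvent_bound (d := d) hd K
  obtain ⟨C₂, hC₂, h₂⟩ := lintegral_two_logKernel (d := d) K
  obtain ⟨C₃, hC₃, h₃⟩ := lintegral_sing_logKernel (d := d) hd K
  set b : ℝ := 1 + |K.ρ|⁻¹ with hb
  have hb0 : 0 < b := by positivity
  refine ⟨b * C₁ + b * C₃ + C₂ + 1, by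
    have : 0 ≤ b * C₁ + b * C₃ + C₂ := by positivity
    linarith, fun S A σ p₁ p₂ hp θ₁ θ₂ t ht => ?_⟩
  have hρ := A.ρ_pos
  have hl := logStar_ge_one t
  have hΦ₁ := (A.Phi_contDiff hd σ p₁).continuous.measurable
  have hΦ₂ := (A.Phi_contDiff hd σ p₂).continuous.measurable
  have hmw := (continuous_wt (d := d) (d + 1)).measurable
  have hX := measurable_logKernel K.ρ t
  have hR := (continuous_rh (t := t) (by linarith)).measurable
  have hms := measurable_sing (d := d)
  -- Both resolvents are expanded as a constant plus a shell integral. Only the product of the two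
  -- shell integrals needs transversality, and only this term carries |p₁ - p₂|^{-1}.
  have e : ∀ k, ENNReal.ofReal (wt (d + 1) k) * (ENNReal.ofReal (rh t (θ₁ - S.Phi σ p₁ k)) *
        ENNReal.ofReal (rh t (θ₂ - S.Phi σ p₂ k))) ≤
      ENNReal.ofReal b * (sing k * ENNReal.ofReal (rh t (θ₁ - S.Phi σ p₁ k))) +
      ENNReal.ofReal b * (sing k * logKernel K.ρ t (θ₂ - S.Phi σ p₂ k)) +
      ENNReal.ofReal (wt (d + 1) k) * (logKernel K.ρ t (θ₁ - S.Phi σ p₁ k) *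
        logKernel K.ρ t (θ₂ - S.Phi σ p₂ k)) := fun k => by
    have g1 := rh_le_logKernel hρ (by linarith : 0 < t) (θ₁ - S.Phi σ p₁ k)
    have g2 := rh_le_logKernel hρ (by linarith : 0 < t) (θ₂ - S.Phi σ p₂ k)
    rw [show 1 + K.ρ⁻¹ = b by rw [hb, abs_of_pos hρ]] at g1 g2
    set x1 := ENNReal.ofReal (rh t (θ₁ - S.Phi σ p₁ k))
    set x2 := ENNReal.ofReal (rh t (θ₂ - S.Phi σ p₂ k))
    set y1 := logKernel K.ρ t (θ₁ - S.Phi σ p₁ k)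
    set y2 := logKernel K.ρ t (θ₂ - S.Phi σ p₂ k)
    set w := ENNReal.ofReal (wt (d + 1) k)
    have hw : w ≤ sing k := wt_le_sing k
    calc w * (x1 * x2) ≤ w * (x1 * (ENNReal.ofReal b + y2)) := by gcongr
      _ = ENNReal.ofReal b * (w * x1) + w * (x1 * y2) := by ring
      _ ≤ ENNReal.ofReal b * (w * x1) + w * ((ENNReal.ofReal b + y1) * y2) := by gcongr
      _ = ENNReal.ofReal b * (w * x1) + ENNReal.ofReal b * (w * y2) + w * (y1 * y2) := by ring
      _ ≤ _ := by gcongr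
  refine (lintegral_mono e).trans ?_
  rw [lintegral_add_left (by fun_prop), lintegral_add_left (by fun_prop),
    lintegral_const_mul _ (by fun_prop), lintegral_const_mul _ (by fun_prop)]
  set Δ := (ENNReal.ofReal ‖p₁ - p₂‖)⁻¹
  calc _ ≤ ENNReal.ofReal b * ENNReal.ofReal (C₁ * logStar t) +
        ENNReal.ofReal b * ENNReal.ofReal (C₃ * logStar t) +
        ENNReal.ofReal (C₂ * logStar t ^ 2) * Δ := by
        gcongr
        · exact h₁ S A σ p₁ θ₁ t ht
        · exact h₃ S A σ p₂ θ₂ t ht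
        · exact h₂ S hd A σ p₁ p₂ hp θ₁ θ₂ t ht
    _ ≤ ENNReal.ofReal ((b * C₁ + b * C₃ + C₂ + 1) * logStar t ^ 2) * 1 +
        ENNReal.ofReal ((b * C₁ + b * C₃ + C₂ + 1) * logStar t ^ 2) * Δ := by
        rw [← ENNReal.ofReal_mul hb0.le, ← ENNReal.ofReal_mul hb0.le, mul_one,
          ← ENNReal.ofReal_add (by positivity) (by positivity)]
        have h5 : logStar t ≤ logStar t ^ 2 := by nlinarith
        gcongr ENNReal.ofReal ?_ + ENNReal.ofReal ?_ * Δ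
        · have : b * (C₁ * logStar t) + b * (C₃ * logStar t) = (b * C₁ + b * C₃) * logStar t := by ring
          rw [this]
          have h6 : (b * C₁ + b * C₃) * logStar t ≤ (b * C₁ + b * C₃) * logStar t ^ 2 := by gcongr
          have : 0 ≤ (C₂ + 1) * logStar t ^ 2 := by positivity
          linarith
        · have h7 : 0 ≤ (b * C₁ + b * C₃ + 1) * logStar t ^ 2 := by positivity
          linarith
    _ = _ := by rw [mul_add]

end Shells

/-! ### Successive integration along a chain of variables -/

section Chain

variable {ι X : Type*} [DecidableEq ι] [MeasurableSpace X]

/-- `f` does not depend on the coordinate `i`. -/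
def IndepOf {Y : Type*} (f : (ι → X) → Y) (i : ι) : Prop := ∀ k v, f (Function.update k i v) = f k

lemma IndepOf.mul {f g : (ι → X) → ℝ≥0∞} {i : ι} (hf : IndepOf f i) (hg : IndepOf g i) :
    IndepOf (fun k => f k * g k) i := fun k v => by simp only [hf k v, hg k v]

lemma IndepOf.prod {α : Type*} {s : Finset α} {f : α → (ι → X) → ℝ≥0∞} {i : ι}
    (hf : ∀ a ∈ s, IndepOf (f a) i) : IndepOf (fun k => ∏ a ∈ s, f a k) i := fun k v =>
  Finset.prod_congr rfl fun a ha => hf a ha k v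

/-- The variables `c 0, …, c (m - 1)` are integrated from the top down. Each variable `c q` comes
with a factor `f q` that does not involve the later ones; an additional factor `g b` is integrated
together with `f (b - 1)` and `f b`. -/
theorem chain_elimination {ν : Measure X} [SigmaFinite ν] {c : ℕ → ι} {M : ℕ}
    (hc : Set.InjOn c (Set.Iio M)) {f g : ℕ → (ι → X) → ℝ≥0∞} {B : Finset ℕ} {A : ℝ≥0∞}
    (hB : ∀ b ∈ B, 1 ≤ b ∧ b - 1 ∉ B)
    (hfm : ∀ q, Measurable (f q)) (hgm : ∀ q, Measurable (g q))
    (hf : ∀ q i, q < i → i < M → IndepOf (f q) (c i))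
    (hg : ∀ b ∈ B, ∀ i, b < i → i < M → IndepOf (g b) (c i))
    (h2 : ∀ q < M, ∀ k, ∫⁻ v, f q (Function.update k (c q) v) ∂ν ≤ A)
    (h3 : ∀ b ∈ B, b < M → ∀ k, ∫⁻ v, ∫⁻ u,
      (fun k => f (b - 1) k * f b k * g b k)
        (Function.update (Function.update k (c b) v) (c (b - 1)) u) ∂ν ∂ν ≤ A ^ 3) :
    ∀ m ≤ M, ∀ R : (ι → X) → ℝ≥0∞, Measurable R → (∀ q < m, IndepOf R (c q)) → ∀ k,
      lmarginal (fun _ => ν) ((Finset.range m).image c)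
        (fun k => R k * ((∏ q ∈ Finset.range m, f q k) * ∏ b ∈ B with b < m, g b k)) k ≤
        A ^ (m + (B.filter (· < m)).card) * R k := by
  -- The spectator R collects the constants of the variables already integrated. Strong induction is
  -- needed because a special position removes two variables at once.
  intro m
  induction m using Nat.strong_induction_on with
  | _ m ih =>
  intro hm R hR hRi k
  rcases m with _ | m
  · simp
  have hprodm : ∀ s : Finset ℕ, Measurable fun k => ∏ q ∈ s, f q k := fun s =>
    Finset.measurable_fun_prod s fun q _ => hfm q
  have hprodg : ∀ s : Finset ℕ, Measurable fun k => ∏ q ∈ s, g q k := fun s =>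
    Finset.measurable_fun_prod s fun q _ => hgm q
  have hnot : ∀ q ≤ m, c q ∉ (Finset.range q).image c := fun q hq hh => by
    obtain ⟨a, ha, hac⟩ := Finset.mem_image.1 hh
    have ha' := Finset.mem_range.1 ha
    have := hc (show a ∈ Set.Iio M by simp; omega) (show q ∈ Set.Iio M by simp; omega) hac
    omega
  -- At a special top position, c m and c (m - 1) are integrated together. The cube of A accounts
  -- for the two chain factors and the additional one; as m - 1 is not special, no other additional
  -- factor is involved.
  by_cases hmB : m ∈ B
  · obtain ⟨hm1, hmB'⟩ := hB m hmB
    obtain ⟨l, rfl⟩ : ∃ l, m = l + 1 := ⟨m - 1, by omega⟩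
    rw [Nat.add_sub_cancel] at hmB'
    have hfil : B.filter (· < l + 1 + 1) = insert (l + 1) (B.filter (· < l)) := by
      ext b
      simp only [Finset.mem_filter, Finset.mem_insert]
      constructor
      · rintro ⟨hb, hlt⟩
        by_cases h : b = l + 1
        · exact Or.inl h
        · have : b ≠ l := fun hh => hmB' (hh ▸ hb)
          exact Or.inr ⟨hb, by omega⟩
      · rintro (rfl | ⟨hb, hlt⟩)
        · exact ⟨hmB, by omega⟩
        · exact ⟨hb, by omega⟩
    have hnm : l + 1 ∉ B.filter (· < l) := by simp
    have himg : (Finset.range (l + 1 + 1)).image c =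
        insert (c l) (insert (c (l + 1)) ((Finset.range l).image c)) := by
      rw [Finset.range_add_one, Finset.range_add_one, Finset.image_insert, Finset.image_insert,
        Finset.insert_comm]
    have hn1 : c (l + 1) ∉ (Finset.range l).image c := fun hh =>
      hnot (l + 1) le_rfl (Finset.image_subset_image (by simp) hh)
    have hn2 : c l ∉ insert (c (l + 1)) ((Finset.range l).image c) := fun hh => by
      rcases Finset.mem_insert.1 hh with h | h
      · have := hc (show l ∈ Set.Iio M by simp; omega) (show l + 1 ∈ Set.Iio M by simp; omega) h
        omega
      · exact hnot l (by omega) h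
    have hF : Measurable fun k => R k * ((∏ q ∈ Finset.range (l + 1 + 1), f q k) *
        ∏ b ∈ B with b < l + 1 + 1, g b k) := hR.mul ((hprodm _).mul (hprodg _))
    have hF2 : Measurable fun k : ι → X => ∫⁻ u, (fun k => R k *
        ((∏ q ∈ Finset.range (l + 1 + 1), f q k) * ∏ b ∈ B with b < l + 1 + 1, g b k))
          (Function.update k (c l) u) ∂ν := by
      have := hF.lmarginal (μ := fun _ : ι => ν) (s := {c l})
      simpa only [lmarginal_singleton] using this
    -- The inner integral is the one over c l, in which the factor g (l + 1) is constant when it is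
    -- applied to peaks.
    rw [himg, lmarginal_insert' _ hF hn2, lmarginal_insert' _ hF2 hn1]
    set P : (ι → X) → ℝ≥0∞ := fun k =>
      R k * ((∏ q ∈ Finset.range l, f q k) * ∏ b ∈ B with b < l, g b k) with hP
    have hPi : ∀ j, l ≤ j → j < l + 1 + 1 → IndepOf P (c j) := fun j hj hj2 =>
      (hRi j hj2).mul ((IndepOf.prod fun q hq => hf q j
        (by have := Finset.mem_range.1 hq; omega) (by omega)).mul
        (IndepOf.prod fun b hb => hg b (Finset.mem_filter.1 hb).1 j
          (by have := (Finset.mem_filter.1 hb).2; omega) (by omega)))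
    have hsplit : ∀ k, R k * ((∏ q ∈ Finset.range (l + 1 + 1), f q k) *
        ∏ b ∈ B with b < l + 1 + 1, g b k) = P k * (f l k * f (l + 1) k * g (l + 1) k) := fun k => by
      rw [hfil, Finset.prod_insert hnm, Finset.prod_range_succ, Finset.prod_range_succ]; ring
    have hle : ∀ k : ι → X, ∫⁻ v, ∫⁻ u, (fun k => R k * ((∏ q ∈ Finset.range (l + 1 + 1), f q k) *
        ∏ b ∈ B with b < l + 1 + 1, g b k))
          (Function.update (Function.update k (c (l + 1)) v) (c l) u) ∂ν ∂ν ≤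
        (fun k => (A ^ 3 * R k) * ((∏ q ∈ Finset.range l, f q k) * ∏ b ∈ B with b < l, g b k)) k := by
      intro k
      have h4 := h3 (l + 1) hmB (by omega) k
      simp only [hsplit]
      rw [Nat.add_sub_cancel] at h4
      have hm4 : Measurable fun k => f l k * f (l + 1) k * g (l + 1) k :=
        ((hfm _).mul (hfm _)).mul (hgm _)
      have e : ∀ v u, P (Function.update (Function.update k (c (l + 1)) v) (c l) u) = P k :=
        fun v u => by
          rw [hPi l le_rfl (by omega), hPi (l + 1) (by omega) (by omega)]
      simp only [e]
      have e2 : ∀ v, ∫⁻ u, P k * (f l (Function.update (Function.update k (c (l + 1)) v) (c l) u) *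
          f (l + 1) (Function.update (Function.update k (c (l + 1)) v) (c l) u) *
          g (l + 1) (Function.update (Function.update k (c (l + 1)) v) (c l) u)) ∂ν =
          P k * ∫⁻ u, (fun k => f l k * f (l + 1) k * g (l + 1) k)
            (Function.update (Function.update k (c (l + 1)) v) (c l) u) ∂ν := fun v =>
        lintegral_const_mul _ (hm4.comp (measurable_update _))
      simp only [e2]
      have hm5 : Measurable fun v => ∫⁻ u, (fun k => f l k * f (l + 1) k * g (l + 1) k)
            (Function.update (Function.update k (c (l + 1)) v) (c l) u) ∂ν := by
        have := (hm4.lmarginal (μ := fun _ : ι => ν) (s := {c l}))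
        simp only [lmarginal_singleton] at this
        exact this.comp (measurable_update k)
      rw [lintegral_const_mul _ hm5]
      refine (mul_le_mul_right h4 _).trans (le_of_eq ?_)
      simp only [hP]; ring
    refine (lmarginal_mono hle k).trans ?_
    refine (ih l (by omega) (by omega) (fun k => A ^ 3 * R k) (hR.const_mul _)
      (fun q hq k v => by simp only [hRi q (by omega) k v]) k).trans (le_of_eq ?_)
    rw [hfil, Finset.card_insert_of_notMem hnm]; ring
  · have hfil : B.filter (· < m + 1) = B.filter (· < m) := by
      ext b
      simp only [Finset.mem_filter]
      refine and_congr_right fun hb => ?_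
      have : b ≠ m := fun hh => hmB (hh ▸ hb)
      omega
    have hF : Measurable fun k => R k * ((∏ q ∈ Finset.range (m + 1), f q k) *
        ∏ b ∈ B with b < m + 1, g b k) := hR.mul ((hprodm _).mul (hprodg _))
    rw [Finset.range_add_one, Finset.image_insert, ← Finset.range_add_one,
      lmarginal_insert' _ hF (hnot m le_rfl)]
    set P : (ι → X) → ℝ≥0∞ := fun k =>
      R k * ((∏ q ∈ Finset.range m, f q k) * ∏ b ∈ B with b < m, g b k) with hP
    have hPi : IndepOf P (c m) :=
      (hRi m (by omega)).mul ((IndepOf.prod fun q hq => hf q m (Finset.mem_range.1 hq)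
        (by omega)).mul (IndepOf.prod fun b hb => hg b (Finset.mem_filter.1 hb).1 m
          (Finset.mem_filter.1 hb).2 (by omega)))
    have hle : ∀ k : ι → X, ∫⁻ v, (fun k => R k * ((∏ q ∈ Finset.range (m + 1), f q k) *
        ∏ b ∈ B with b < m + 1, g b k)) (Function.update k (c m) v) ∂ν ≤
        (fun k => (A * R k) * ((∏ q ∈ Finset.range m, f q k) * ∏ b ∈ B with b < m, g b k)) k := by
      intro k
      have hsplit : ∀ k, R k * ((∏ q ∈ Finset.range (m + 1), f q k) *
          ∏ b ∈ B with b < m + 1, g b k) = P k * f m k := fun k => by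
        rw [hfil, Finset.prod_range_succ]; ring
      simp only [hsplit, hPi k]
      have hfu : Measurable fun v => f m (Function.update k (c m) v) :=
        (hfm m).comp (measurable_update k)
      rw [lintegral_const_mul _ hfu]
      refine (mul_le_mul_right (h2 m (by omega) k) _).trans (le_of_eq ?_)
      simp only [hP]; ring
    refine (lmarginal_mono hle k).trans ?_
    refine (ih m (by omega) (by omega) (fun k => A * R k) (hR.const_mul _)
      (fun q hq k v => by simp only [hRi q (by omega) k v]) k).trans (le_of_eq ?_)
    rw [hfil]; ring

end Chain

/-! ### Energies along a chain -/

/-- The energy `e(P + ∑_{i ∈ A} k_i) + ∑_{i ∈ A} s_i ω(k_i)`. -/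
def Model.En {d : ℕ} {ι : Type*} (S : Model d) (P : Mom d) (A : Finset ι) (s : ι → ℤˣ)
    (k : ι → Mom d) : ℝ :=
  S.e (P + ∑ i ∈ A, k i) + ∑ i ∈ A, sgn (s i) * S.ω (k i)

section Chain

variable {d : ℕ} {ι : Type*} [DecidableEq ι] {S : Model d}

lemma En_update_of_notMem {P : Mom d} {A : Finset ι} {s : ι → ℤˣ} {k : ι → Mom d} {i : ι}
    (hi : i ∉ A) (v : Mom d) : S.En P A s (Function.update k i v) = S.En P A s k := by
  have h : ∀ j ∈ A, Function.update k i v j = k j := fun j hj =>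
    Function.update_of_ne (by rintro rfl; exact hi hj) _ _
  have h2 : ∀ j ∈ A, sgn (s j) * S.ω (Function.update k i v j) = sgn (s j) * S.ω (k j) :=
    fun j hj => by rw [h j hj]
  unfold Model.En
  rw [Finset.sum_congr rfl h, Finset.sum_congr rfl h2]

/-- As a function of a single momentum, every energy is a phase Φ with shifted electron momentum
plus a constant, so the estimates in one variable apply. -/
lemma En_update_of_mem {P : Mom d} {A : Finset ι} {s : ι → ℤˣ} {k : ι → Mom d} {i : ι}
    (hi : i ∈ A) (v : Mom d) : S.En P A s (Function.update k i v) =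
      S.Phi (s i) (P + ∑ j ∈ A.erase i, k j) v + ∑ j ∈ A.erase i, sgn (s j) * S.ω (k j) := by
  have h : ∀ j ∈ A.erase i, Function.update k i v j = k j := fun j hj =>
    Function.update_of_ne (Finset.ne_of_mem_erase hj) _ _
  have h2 : ∀ j ∈ A.erase i, sgn (s j) * S.ω (Function.update k i v j) = sgn (s j) * S.ω (k j) :=
    fun j hj => by rw [h j hj]
  unfold Model.En Model.Phi
  rw [← Finset.add_sum_erase A _ hi, ← Finset.add_sum_erase A _ hi, Finset.sum_congr rfl h,
    Finset.sum_congr rfl h2, Function.update_self]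
  rw [show P + (v + ∑ j ∈ A.erase i, k j) = v + (P + ∑ j ∈ A.erase i, k j) by abel]
  ring

lemma continuous_En {K : Constants} (A : Assumptions K S) (hd : 3 ≤ d) {Y : Type*}
    [TopologicalSpace Y] {P : Y → Mom d} (hP : Continuous P) {k : Y → ι → Mom d}
    (hk : Continuous k) (T : Finset ι) (s : ι → ℤˣ) :
    Continuous fun y => S.En (P y) T s (k y) := by
  have h1 := (A.e_growth hd).continuous
  have h2 := (A.ω_growth hd).continuous
  unfold Model.En
  fun_prop

/-- The resolvent with energy `E(k)`. -/
def res (t α : ℝ) (E : (ι → Mom d) → ℝ) (k : ι → Mom d) : ℝ≥0∞ := ENNReal.ofReal (rh t (α - E k))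

/-- One factor of a chain: the weight of the variable `c q` and the resolvent of the set
`{c 0, …, c q}`. -/
def chainFactor (S : Model d) (t α : ℝ) (P : (ι → Mom d) → Mom d) (s : ι → ℤˣ) (c : ℕ → ι)
    (q : ℕ)     (k : ι → Mom d) : ℝ≥0∞ :=
  ENNReal.ofReal (wt (d + 1) (k (c q))) *
    res t α (fun k => S.En (P k) ((Finset.range (q + 1)).image c) s k) k

lemma measurable_res {K : Constants} (A : Assumptions K S) (hd : 3 ≤ d) [Fintype ι] {t : ℝ} (ht : 0 < t) (α : ℝ)
    {P : (ι → Mom d) → Mom d} (hP : Continuous P) (T : Finset ι) (s : ι → ℤˣ) :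
    Measurable (res t α fun k => S.En (P k) T s k) :=
  (((continuous_rh ht).comp (continuous_const.sub
    (continuous_En A hd hP continuous_id T s))).measurable).ennreal_ofReal

/-- The integral bounds needed for the elimination of a chain. -/
theorem resolvent_integrals (hd : 3 ≤ d) (K : Constants) : ∃ C : ℝ, 1 ≤ C ∧
    ∀ S : Model d, Assumptions K S → ∀ t : ℝ, 1 ≤ t →
      (∀ (σ : ℤˣ) (p : Mom d) (θ : ℝ), ∫⁻ k, ENNReal.ofReal (wt (d + 1) k) *
        ENNReal.ofReal (rh t (θ - S.Phi σ p k)) ≤ ENNReal.ofReal (C * logStar t)) ∧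
      (∀ (σ τ : ℤˣ) (p p' : Mom d) (θ θ' : Mom d → ℝ) (θ'' : ℝ), ∫⁻ v, ∫⁻ u,
        (ENNReal.ofReal (wt (d + 1) u) * ENNReal.ofReal (rh t (θ v - S.Phi σ p u))) *
        (ENNReal.ofReal (wt (d + 1) v) * ENNReal.ofReal (rh t (θ' v - S.Phi σ (p + v) u))) *
        ENNReal.ofReal (rh t (θ'' - S.Phi τ p' v)) ≤ ENNReal.ofReal (C * logStar t) ^ 3) := by
  obtain ⟨C₁, hC₁, h₁⟩ := one_resolvent_bound (d := d) hd K
  obtain ⟨C₂, hC₂, h₂⟩ := two_resolvent_bound (d := d) hd K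
  have hnt := nontrivial_mom hd
  refine ⟨C₁ + C₂, by linarith, fun S A t ht => ⟨fun σ p θ => ?_, fun σ τ p p' θ θ' θ'' => ?_⟩⟩
  · have hl := logStar_ge_one t
    refine (lintegral_mono fun k => mul_le_mul_left (wt_le_sing k) _).trans
      ((h₁ S A σ p θ t ht).trans (ENNReal.ofReal_le_ofReal ?_))
    gcongr; linarith
  · have hl := logStar_ge_one t
    have hΦ := fun σ p => (A.Phi_contDiff hd σ p).continuous.measurable
    have hR := (continuous_rh (t := t) (by linarith)).measurable
    have hmw := (continuous_wt (d := d) (d + 1)).measurable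
    have hms := measurable_sing (d := d)
    -- Transversality requires different momenta, here p and p + v.
    have hne : ∀ᵐ v : Mom d, v ≠ 0 := by simp [ae_iff]
    -- For fixed v, the integral over u of two resolvents with the same sign gives 1 + |v|^{-1}.
    -- Together with the weight of v this is `sing v`, which one resolvent in v tolerates.
    calc _ ≤ ∫⁻ v, ENNReal.ofReal (C₂ * logStar t ^ 2) *
          (sing v * ENNReal.ofReal (rh t (θ'' - S.Phi τ p' v))) := by
          refine lintegral_mono_ae (hne.mono fun v hv => ?_)
          have h3 := h₂ S A σ p (p + v) (by simpa using hv) (θ v) (θ' v) t ht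
          rw [sub_add_cancel_left, norm_neg] at h3
          have hm3 : Measurable fun u => ENNReal.ofReal (wt (d + 1) u) *
            (ENNReal.ofReal (rh t (θ v - S.Phi σ p u)) *
            ENNReal.ofReal (rh t (θ' v - S.Phi σ (p + v) u))) := by
            have := hΦ σ p
            have := hΦ σ (p + v)
            fun_prop
          have e : ∀ u, (ENNReal.ofReal (wt (d + 1) u) * ENNReal.ofReal (rh t (θ v - S.Phi σ p u))) *
              (ENNReal.ofReal (wt (d + 1) v) * ENNReal.ofReal (rh t (θ' v - S.Phi σ (p + v) u))) *
              ENNReal.ofReal (rh t (θ'' - S.Phi τ p' v)) =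
              (ENNReal.ofReal (wt (d + 1) v) * ENNReal.ofReal (rh t (θ'' - S.Phi τ p' v))) *
              (ENNReal.ofReal (wt (d + 1) u) * (ENNReal.ofReal (rh t (θ v - S.Phi σ p u)) *
              ENNReal.ofReal (rh t (θ' v - S.Phi σ (p + v) u)))) := fun u => by ring
          rw [lintegral_congr e, lintegral_const_mul _ hm3]
          refine (mul_le_mul_right h3 _).trans (le_of_eq ?_)
          rw [sing]; ring
      _ = ENNReal.ofReal (C₂ * logStar t ^ 2) *
          ∫⁻ v, sing v * ENNReal.ofReal (rh t (θ'' - S.Phi τ p' v)) := by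
          have := hΦ τ p'
          exact lintegral_const_mul _ (by fun_prop)
      _ ≤ ENNReal.ofReal (C₂ * logStar t ^ 2) * ENNReal.ofReal (C₁ * logStar t) :=
          mul_le_mul_right (h₁ S A τ p' θ'' t ht) _
      _ ≤ _ := by
          rw [← ENNReal.ofReal_mul (by positivity), ← ENNReal.ofReal_pow (by positivity)]
          refine ENNReal.ofReal_le_ofReal ?_
          have h5 : C₂ * C₁ ≤ (C₁ + C₂) ^ 3 := by
            nlinarith [mul_nonneg (sub_nonneg.2 hC₁) (sub_nonneg.2 hC₂),
              one_le_pow₀ (show 1 ≤ C₁ + C₂ by linarith) (n := 2), sq_nonneg (C₁ - C₂),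
              mul_pos (show 0 < C₁ by linarith) (show 0 < C₂ by linarith)]
          calc C₂ * logStar t ^ 2 * (C₁ * logStar t) = (C₂ * C₁) * logStar t ^ 3 := by ring
            _ ≤ (C₁ + C₂) ^ 3 * logStar t ^ 3 := by gcongr
            _ = _ := by ring

/-- The integral of a chain with special positions `B`. -/
theorem chain_bound (hd : 3 ≤ d) (K : Constants) : ∃ C : ℝ, 1 ≤ C ∧
    ∀ S : Model d, Assumptions K S → ∀ t : ℝ, 1 ≤ t →
    ∀ {ι : Type} [Fintype ι] [DecidableEq ι] (c : ℕ → ι) (M : ℕ), Set.InjOn c (Set.Iio M) →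
    ∀ (P : (ι → Mom d) → Mom d), Continuous P → (∀ q < M, IndepOf P (c q)) →
    ∀ (s s' : ι → ℤˣ) (p : Mom d) (α α' : ℝ) (B : Finset ℕ) (T : ℕ → Finset ι),
      (∀ b ∈ B, 1 ≤ b ∧ b - 1 ∉ B ∧ c b ∈ T b ∧ c (b - 1) ∉ T b ∧
        ∀ i, b < i → i < M → c i ∉ T b) → (∀ b ∈ B, b < M) →
    ∀ R : (ι → Mom d) → ℝ≥0∞, Measurable R → (∀ q < M, IndepOf R (c q)) → ∀ k,
      lmarginal (fun _ => volume) ((Finset.range M).image c)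
        (fun k => R k * ((∏ q ∈ Finset.range M, chainFactor S t α P s c q k) *
          ∏ b ∈ B, res t α' (S.En p (T b) s') k)) k ≤
        ENNReal.ofReal (C * logStar t) ^ (M + B.card) * R k := by
  obtain ⟨C, hC, h⟩ := resolvent_integrals (d := d) hd K
  refine ⟨C, hC, fun S A t ht ι _ _ c M hc P hP hPi s s' p α α' B T hB hBM R hR hRi k => ?_⟩
  have ht0 : 0 < t := by linarith
  have hmw := (continuous_wt (d := d) (d + 1)).measurable
  obtain ⟨ha, hb⟩ := h S A t ht
  have hfil : B.filter (· < M) = B := Finset.filter_true_of_mem hBM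
  have hnotim : ∀ q i, q < i → i < M → c i ∉ (Finset.range (q + 1)).image c := by
    intro q i hqi hi hh
    obtain ⟨a, ha, hac⟩ := Finset.mem_image.1 hh
    have ha' := Finset.mem_range.1 ha
    have := hc (show a ∈ Set.Iio M by simp; omega) (show i ∈ Set.Iio M from hi) hac
    omega
  have hcne : ∀ q i, q < i → i < M → c q ≠ c i := fun q i hqi hi hh =>
    hnotim q i hqi hi (hh ▸ Finset.mem_image_of_mem c (by simp))
  have key := chain_elimination (ν := (volume : Measure (Mom d))) hc (B := B)
    (f := chainFactor S t α P s c) (g := fun b => res t α' (S.En p (T b) s'))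
    (A := ENNReal.ofReal (C * logStar t)) (fun b hb => ⟨(hB b hb).1, (hB b hb).2.1⟩)
    (fun q => Measurable.mul (by fun_prop) (measurable_res A hd ht0 α hP _ s))
    (fun q => measurable_res A hd ht0 α' continuous_const _ s')
    (fun q i hqi hi k v => by
      have hn := hnotim q i hqi hi
      simp only [chainFactor, res]
      rw [hPi i hi, En_update_of_notMem hn, Function.update_of_ne (hcne q i hqi hi)])
    (fun b hb i hbi hi k v => by
      simp only [res]
      rw [En_update_of_notMem ((hB b hb).2.2.2.2 i hbi hi)])
    (fun q hq k => by
      simp only [chainFactor, res]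
      have hm : c q ∈ (Finset.range (q + 1)).image c := Finset.mem_image_of_mem c (by simp)
      have e : ∀ v, ENNReal.ofReal (wt (d + 1) (Function.update k (c q) v (c q))) *
          ENNReal.ofReal (rh t (α - S.En (P (Function.update k (c q) v))
            ((Finset.range (q + 1)).image c) s (Function.update k (c q) v))) =
          ENNReal.ofReal (wt (d + 1) v) * ENNReal.ofReal (rh t
            ((α - ∑ j ∈ ((Finset.range (q + 1)).image c).erase (c q), sgn (s j) * S.ω (k j)) -
            S.Phi (s (c q)) (P k + ∑ j ∈ ((Finset.range (q + 1)).image c).erase (c q), k j) v)) :=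
        fun v => by
          rw [hPi q hq, En_update_of_mem hm, Function.update_self]
          congr 3; ring
      rw [lintegral_congr e]
      exact ha _ _ _)
    (fun b hbB hbM k => by
      obtain ⟨hb1, hb2, hb3, hb4, hb5⟩ := hB b hbB
      obtain ⟨l, rfl⟩ : ∃ l, b = l + 1 := ⟨b - 1, by omega⟩
      rw [Nat.add_sub_cancel] at *
      have hne : c l ≠ c (l + 1) := hcne l (l + 1) (by omega) hbM
      set I := (Finset.range (l + 1)).image c with hI
      have hI' : (Finset.range (l + 1 + 1)).image c = insert (c (l + 1)) I := by
        rw [Finset.range_add_one, Finset.image_insert]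
      have hlI : c l ∈ I := Finset.mem_image_of_mem c (by simp)
      have hnI : c (l + 1) ∉ I := hnotim l (l + 1) (by omega) hbM
      have her : (insert (c (l + 1)) I).erase (c l) = insert (c (l + 1)) (I.erase (c l)) :=
        Finset.erase_insert_of_ne hne.symm
      have hnI' : c (l + 1) ∉ I.erase (c l) := fun hh => hnI (Finset.mem_of_mem_erase hh)
      have hsum : ∀ v, ∀ j ∈ I.erase (c l), Function.update k (c (l + 1)) v j = k j := fun v j hj =>
        Function.update_of_ne (fun hh => hnI' (by rw [← hh]; exact hj)) _ _
      have hsum2 : ∀ v, ∀ j ∈ I.erase (c l), sgn (s j) * S.ω (Function.update k (c (l + 1)) v j) =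
          sgn (s j) * S.ω (k j) := fun v j hj => by rw [hsum v j hj]
      -- Seen from u = k (c l), the energies at positions l and l + 1 are phases with the same sign
      -- and with momenta that differ by exactly v = k (c (l + 1)). The additional energy involves v
      -- but not u.
      refine le_trans (le_of_eq ?_) (hb (s (c l)) (s' (c (l + 1))) (P k + ∑ j ∈ I.erase (c l), k j)
        (p + ∑ j ∈ (T (l + 1)).erase (c (l + 1)), k j)
        (fun v => α - ∑ j ∈ I.erase (c l), sgn (s j) * S.ω (k j))
        (fun v => α - (sgn (s (c (l + 1))) * S.ω v + ∑ j ∈ I.erase (c l), sgn (s j) * S.ω (k j)))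
        (α' - ∑ j ∈ (T (l + 1)).erase (c (l + 1)), sgn (s' j) * S.ω (k j)))
      refine lintegral_congr fun v => lintegral_congr fun u => ?_
      simp only [chainFactor, res]
      rw [hPi l (by omega), hPi (l + 1) hbM, En_update_of_mem hlI, hI',
        En_update_of_mem (Finset.mem_insert_of_mem hlI), En_update_of_notMem hb4,
        En_update_of_mem hb3, Function.update_self, Function.update_of_ne hne.symm,
        Function.update_self, her, Finset.sum_insert hnI', Finset.sum_insert hnI',
        Finset.sum_congr rfl (hsum v), Finset.sum_congr rfl (hsum2 v),
        Function.update_self]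
      congr 1
      · congr 1
        · congr 3; ring
        · congr 3
          rw [show P k + (v + ∑ j ∈ I.erase (c l), k j) = P k + ∑ j ∈ I.erase (c l), k j + v by abel]
          ring
      · congr 2; ring)
    M le_rfl R hR hRi k
  rw [hfil] at key
  exact key

end Chain

/-! ### Pointwise estimates for products of resolvents -/

/-- `(1 + α²)^{-1}`. -/
def jw (α : ℝ) : ℝ := (1 + α ^ 2)⁻¹

lemma jw_pos (α : ℝ) : 0 < jw α := by unfold jw; positivity

@[fun_prop] lemma continuous_jw : Continuous jw := by
  unfold jw
  exact Continuous.inv₀ (by fun_prop) fun x => by positivity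

lemma lintegral_jw : ∫⁻ α, ENNReal.ofReal (jw α) = ENNReal.ofReal Real.pi := by
  unfold jw
  rw [← ofReal_integral_eq_lintegral_ofReal integrable_inv_one_add_sq
    (Eventually.of_forall fun x => by positivity), integral_univ_inv_one_add_sq]

lemma inv_one_add_abs_sq_le (α : ℝ) : ((1 + |α|)⁻¹) ^ 2 ≤ jw α := by
  unfold jw
  rw [inv_pow]
  refine inv_anti₀ (by positivity) ?_
  nlinarith [abs_nonneg α, sq_abs α]

lemma jw_shift (a Ω : ℝ) : jw (a + Ω) ≤ 2 * (1 + Ω ^ 2) * jw a := by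
  unfold jw
  rw [← div_eq_mul_inv, le_div_iff₀ (by positivity), inv_mul_le_iff₀ (by positivity)]
  nlinarith [sq_nonneg (a + 2 * Ω), mul_nonneg (sq_nonneg Ω) (sq_nonneg (a + Ω)), sq_nonneg (a + Ω)]

lemma jw_harnack {a b : ℝ} (h : |a - b| ≤ 1) : jw a ≤ 4 * jw b := by
  obtain ⟨h1, h2⟩ := abs_le.1 h
  unfold jw
  rw [← div_eq_mul_inv, le_div_iff₀ (by positivity), inv_mul_le_iff₀ (by positivity)]
  nlinarith [sq_nonneg (a - b), sq_nonneg (2 * a - b)]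

lemma rr_harnack {t a b : ℝ} (ht : 0 < t) (h : |a - b| ≤ t⁻¹) : rr t a ≤ 2 * rr t b := by
  obtain ⟨h1, h2⟩ := abs_le.1 h
  have ht' : 0 < t⁻¹ := by positivity
  unfold rr
  rw [← div_eq_mul_inv, le_div_iff₀ (sqrt_pos_of_pos ht b), inv_mul_le_iff₀ (sqrt_pos_of_pos ht a)]
  refine Real.sqrt_le_iff.2 ⟨by positivity, ?_⟩
  rw [mul_pow, Real.sq_sqrt (by positivity)]
  nlinarith [mul_nonneg (sub_nonneg.2 h1) (sub_nonneg.2 h2), sq_nonneg (2 * a - b)]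

lemma rh_harnack {t a b : ℝ} (ht : 0 < t) (h : |a - b| ≤ t⁻¹) : rh t a ≤ 2 * rh t b := by
  unfold rh; linarith [rr_harnack ht h]

lemma rr_le_rh (t x : ℝ) : rr t x ≤ rh t x := by unfold rh; linarith

lemma rh_le {t : ℝ} (ht : 1 ≤ t) (x : ℝ) : rh t x ≤ 2 * t := by
  unfold rh; linarith [rr_le (t := t) (by linarith) x]

/-- For |α| > 2B the distance from α to E is at least |α|/2, and for smaller α the constant
suffices. A power of the energy bound buys decay in α while the resolvent is kept in the form `rh`.
-/
lemma rr_decay {t α E B : ℝ} (hB : 1 ≤ B) (hE : |E| ≤ B) :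
    rr t (α - E) ≤ 4 * B * (1 + |α|)⁻¹ * rh t (α - E) := by
  have h0 := rr_nonneg t (α - E)
  have h1 : 0 ≤ |α| := abs_nonneg α
  rw [mul_right_comm, ← div_eq_mul_inv, le_div_iff₀ (by positivity)]
  unfold rh
  rcases le_or_gt |α| (2 * B) with h | h
  · nlinarith [mul_nonneg h0 h1, mul_nonneg h0 (sub_nonneg.2 h), mul_nonneg h0 (sub_nonneg.2 hB)]
  · have h2 : |α| / 2 ≤ |α - E| := by
      have := abs_sub_abs_le_abs_sub α E
      linarith
    have h3 := rr_le_of_le (t := t) (x := α - E) (show 0 < |α| / 2 by linarith) (Or.inl h2)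
    have h4 : rr t (α - E) * |α| ≤ 2 := by
      have : (|α| / 2)⁻¹ * |α| = 2 := by field_simp [show |α| ≠ 0 by linarith]
      nlinarith
    nlinarith

/-- `∫ (1 + α²)^{-1} (1 + |α - E + i/t|^{-1}) dα` grows at most logarithmically. -/
lemma lintegral_jw_rh {t : ℝ} (ht : 1 ≤ t) (E : ℝ) :
    ∫⁻ α, ENNReal.ofReal (jw α) * ENNReal.ofReal (rh t (α - E)) ≤
      ENNReal.ofReal (10 * logStar t) := by
  have hlk := measurable_logKernel 1 t
  have hl := logStar_ge_one t
  calc _ ≤ ∫⁻ α, (ENNReal.ofReal 2 * ENNReal.ofReal (jw α) + logKernel 1 t (E - α)) := by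
        refine lintegral_mono fun α => ?_
        have h1 := rh_le_logKernel (ρ := 1) one_pos (show 0 < t by linarith) (E - α)
        have h2 : rh t (α - E) = rh t (E - α) := by
          unfold rh; rw [← rr_neg, neg_sub]
        have h3 : ENNReal.ofReal (jw α) ≤ 1 := ENNReal.ofReal_le_one.2 (by
          unfold jw; exact inv_le_one_of_one_le₀ (by nlinarith [sq_nonneg α]))
        rw [h2]
        refine (mul_le_mul_right h1 _).trans ?_
        rw [mul_add]
        refine add_le_add (le_of_eq ?_) (mul_le_of_le_one_left (by simp) h3)
        rw [mul_comm]; norm_num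
    _ = ENNReal.ofReal 2 * ENNReal.ofReal Real.pi + ∫⁻ α, logKernel 1 t (E - α) := by
        rw [lintegral_add_left (by fun_prop), lintegral_const_mul _ (by fun_prop), lintegral_jw]
    _ ≤ ENNReal.ofReal 2 * ENNReal.ofReal Real.pi +
          ENNReal.ofReal (2 * ((|Real.log 1| + 1) * logStar t)) :=
        add_le_add_right (lintegral_logKernel_le one_pos ht E) _
    _ ≤ _ := by
        rw [← ENNReal.ofReal_mul (by norm_num), ← ENNReal.ofReal_add (by positivity)
          (by positivity)]
        refine ENNReal.ofReal_le_ofReal ?_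
        rw [Real.log_one, abs_zero]
        nlinarith [Real.pi_le_four]

lemma prod_le_pow_mul_prod {ι : Type*} {s : Finset ι} {f g : ι → ℝ≥0∞} {c : ℝ≥0∞} {m : ℕ}
    (hm : m ≤ s.card) (h1 : ∀ i ∈ s, f i ≤ c * g i) (h2 : ∀ i ∈ s, f i ≤ g i) :
    ∏ i ∈ s, f i ≤ c ^ m * ∏ i ∈ s, g i := by
  classical
  obtain ⟨r, hr, rfl⟩ := Finset.exists_subset_card_eq hm
  rw [← Finset.prod_sdiff hr, ← Finset.prod_sdiff hr]
  calc _ ≤ (∏ i ∈ s \ r, g i) * ∏ i ∈ r, (c * g i) :=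
        mul_le_mul' (Finset.prod_le_prod' fun i hi => h2 i (Finset.mem_sdiff.1 hi).1)
          (Finset.prod_le_prod' fun i hi => h1 i (hr hi))
    _ = _ := by rw [Finset.prod_mul_distrib, Finset.prod_const]; ring

/-- The product `∏_{i ∈ s} (1 + |α - f_i + i/t|^{-1})`. -/
def resProd {ι : Type*} (t : ℝ) (s : Finset ι) (f : ι → ℝ) (α : ℝ) : ℝ≥0∞ :=
  ∏ i ∈ s, ENNReal.ofReal (rh t (α - f i))

/-- The integral of `resProd` against `(1 + α²)^{-1}`. -/
def resInt {ι : Type*} (t : ℝ) (s : Finset ι) (f : ι → ℝ) : ℝ≥0∞ :=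
  ∫⁻ α, ENNReal.ofReal (jw α) * resProd t s f α

section

variable {ι : Type*} {t : ℝ}

lemma measurable_resProd (ht : 0 < t) (s : Finset ι) (f : ι → ℝ) : Measurable (resProd t s f) := by
  unfold resProd
  have := (continuous_rh ht).measurable
  fun_prop

/-- Every factor changes at most by a constant when α moves by 1/t, so a value is bounded by t times
an integral. This is how a group of resolvents acquires its own variable α, at the cost of one
factor t. -/
lemma resProd_le_lintegral (ht : 1 ≤ t) (s : Finset ι) (f : ι → ℝ) (α : ℝ) :
    ENNReal.ofReal (jw α) * resProd t s f α ≤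
      ENNReal.ofReal (t * 2 ^ (s.card + 1)) * resInt t s f := by
  have ht0 : 0 < t := by linarith
  have hm := measurable_resProd ht0 s f
  have hle : ∀ a ∈ Set.Icc (α - t⁻¹) (α + t⁻¹), ENNReal.ofReal (jw α) * resProd t s f α ≤
      ENNReal.ofReal (2 ^ (s.card + 2)) * (ENNReal.ofReal (jw a) * resProd t s f a) := by
    intro a ha
    have hd : |α - a| ≤ t⁻¹ := by rw [abs_le]; constructor <;> linarith [ha.1, ha.2]
    have h1 : ENNReal.ofReal (jw α) ≤ ENNReal.ofReal 4 * ENNReal.ofReal (jw a) := by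
      rw [← ENNReal.ofReal_mul (by norm_num)]
      exact ENNReal.ofReal_le_ofReal (jw_harnack (hd.trans (inv_le_one_of_one_le₀ ht)))
    have h2 : resProd t s f α ≤ ENNReal.ofReal 2 ^ s.card * resProd t s f a := by
      unfold resProd
      rw [← Finset.prod_const, ← Finset.prod_mul_distrib]
      refine Finset.prod_le_prod' fun i _ => ?_
      rw [← ENNReal.ofReal_mul (by norm_num)]
      exact ENNReal.ofReal_le_ofReal (rh_harnack ht0 (by rwa [sub_sub_sub_cancel_right]))
    refine (mul_le_mul' h1 h2).trans (le_of_eq ?_)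
    rw [pow_add, ENNReal.ofReal_mul (by positivity), ENNReal.ofReal_pow (by norm_num)]
    norm_num
    ring
  have key : ENNReal.ofReal (jw α) * resProd t s f α * ENNReal.ofReal (2 * t⁻¹) ≤
      ENNReal.ofReal (2 ^ (s.card + 2)) * resInt t s f := by
    calc _ = ∫⁻ _ in Set.Icc (α - t⁻¹) (α + t⁻¹), ENNReal.ofReal (jw α) * resProd t s f α := by
          rw [setLIntegral_const, Real.volume_Icc]; congr 2; ring
      _ ≤ ∫⁻ a in Set.Icc (α - t⁻¹) (α + t⁻¹), ENNReal.ofReal (2 ^ (s.card + 2)) *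
            (ENNReal.ofReal (jw a) * resProd t s f a) := setLIntegral_mono' measurableSet_Icc hle
      _ ≤ _ := (setLIntegral_le_lintegral _ _).trans
          (le_of_eq (lintegral_const_mul _ (by fun_prop)))
  have h5 : ENNReal.ofReal (2 * t⁻¹) * ENNReal.ofReal (t / 2) = 1 := by
    rw [← ENNReal.ofReal_mul (by positivity)]; field_simp; simp
  calc _ = ENNReal.ofReal (jw α) * resProd t s f α * ENNReal.ofReal (2 * t⁻¹) *
        ENNReal.ofReal (t / 2) := by rw [mul_assoc _ (ENNReal.ofReal (2 * t⁻¹)), h5, mul_one]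
    _ ≤ ENNReal.ofReal (2 ^ (s.card + 2)) * resInt t s f * ENNReal.ofReal (t / 2) :=
        mul_le_mul_left key _
    _ = _ := by
        rw [mul_right_comm, ← ENNReal.ofReal_mul (by positivity)]
        congr 2; ring

/-- A common shift of the energies is a translation of α that only the weight `jw` notices. It is
applied to the total phonon energy, in order to view the history from its left end. -/
lemma resInt_shift (ht : 0 < t) (s : Finset ι) (f : ι → ℝ) (Ω : ℝ) :
    resInt t s f ≤ ENNReal.ofReal (2 * (1 + Ω ^ 2)) * resInt t s fun i => f i - Ω := by
  have hm := measurable_resProd ht s fun i => f i - Ω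
  unfold resInt
  rw [← lintegral_add_right_eq_self _ Ω, ← lintegral_const_mul _ (by fun_prop)]
  refine lintegral_mono fun a => ?_
  have h1 : resProd t s f (a + Ω) = resProd t s (fun i => f i - Ω) a :=
    Finset.prod_congr rfl fun i _ => by congr 2; ring
  rw [h1, ← mul_assoc, ← ENNReal.ofReal_mul (by positivity)]
  exact mul_le_mul_left (ENNReal.ofReal_le_ofReal (jw_shift a Ω)) _

/-- A product of at least `2 m` resolvents with energies bounded by `B` decays like
`(1 + α²)^{-m}`. -/
lemma prod_rr_le {B : ℝ} (hB : 1 ≤ B) {s : Finset ι} {f : ι → ℝ} (hf : ∀ i ∈ s, |f i| ≤ B) {m : ℕ}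
    (hm : 2 * m ≤ s.card) (α : ℝ) :
    ∏ i ∈ s, ENNReal.ofReal (rr t (α - f i)) ≤
      ENNReal.ofReal ((4 * B) ^ (2 * m)) * (ENNReal.ofReal (jw α) ^ m * resProd t s f α) := by
  have h := prod_le_pow_mul_prod (s := s) (f := fun i => ENNReal.ofReal (rr t (α - f i)))
    (g := fun i => ENNReal.ofReal (rh t (α - f i))) (c := ENNReal.ofReal (4 * B * (1 + |α|)⁻¹)) hm
    (fun i hi => by
      rw [← ENNReal.ofReal_mul (by positivity)]
      exact ENNReal.ofReal_le_ofReal (rr_decay hB (hf i hi)))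
    (fun i _ => ENNReal.ofReal_le_ofReal (rr_le_rh _ _))
  refine h.trans ?_
  rw [← mul_assoc]
  refine mul_le_mul_left ?_ _
  rw [← ENNReal.ofReal_pow (by positivity), ← ENNReal.ofReal_pow (jw_pos α).le,
    ← ENNReal.ofReal_mul (by positivity)]
  refine ENNReal.ofReal_le_ofReal ?_
  rw [mul_pow, pow_mul (1 + |α|)⁻¹]
  gcongr
  exact inv_one_add_abs_sq_le α

end

/-- The two resolvent products of a pairing. The first product is split into two groups, with an
additional integration; in the second one only the factors in `T` are kept. -/
theorem resolvent_products_le {t : ℝ} (ht : 1 ≤ t) {n x : ℕ} (hn : 3 ≤ n) (hx : x < n)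
    {E E' : ℕ → ℝ} {B Ω : ℝ} (hB : 1 ≤ B) (hΩ : |Ω| ≤ B) (hE : ∀ j, |E j| ≤ B)
    (hE' : ∀ j, |E' j| ≤ B) {T : Finset ℕ} (hT : T ⊆ Finset.range (n + 1)) :
    (∫⁻ α, ∏ j ∈ Finset.range (n + 1), ENNReal.ofReal (rr t (α - E j))) *
      (∫⁻ α, ∏ j ∈ Finset.range (n + 1), ENNReal.ofReal (rr t (α - E' j))) ≤
    ENNReal.ofReal (4 ^ (2 * n + 8) * B ^ 8 * t ^ (n + 2 - T.card)) *
      (resInt t (Finset.range (x + 1)) (fun j => E j - Ω) * resInt t (Finset.Ico (x + 1) (n + 1)) E *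
        resInt t T E') := by
  have ht0 : 0 < t := by linarith
  have hTc : T.card ≤ n + 1 := by simpa using Finset.card_le_card hT
  have hm1 := measurable_resProd ht0 (Finset.Ico (x + 1) (n + 1)) E
  have hm2 := measurable_resProd ht0 T E'
  have first : (∫⁻ α, ∏ j ∈ Finset.range (n + 1), ENNReal.ofReal (rr t (α - E j))) ≤
      ENNReal.ofReal ((4 * B) ^ 4 * (t * 2 ^ (n + 1)) * (4 * B ^ 2)) *
        (resInt t (Finset.range (x + 1)) (fun j => E j - Ω) *
          resInt t (Finset.Ico (x + 1) (n + 1)) E) := by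
    have hpt : ∀ α, ∏ j ∈ Finset.range (n + 1), ENNReal.ofReal (rr t (α - E j)) ≤
        (ENNReal.ofReal ((4 * B) ^ 4) * (ENNReal.ofReal (t * 2 ^ (n + 1)) *
          resInt t (Finset.range (x + 1)) E)) *
          (ENNReal.ofReal (jw α) * resProd t (Finset.Ico (x + 1) (n + 1)) E α) := fun α => by
      -- Four of the n + 1 ≥ 4 resolvents yield two factors `jw`, one for each of the two
      -- integrations over α; this is where n ≥ 3 is needed.
      refine (prod_rr_le (m := 2) hB (fun j _ => hE j) (by simp; omega) α).trans ?_
      have hsplit : resProd t (Finset.range (n + 1)) E α = resProd t (Finset.range (x + 1)) E α *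
          resProd t (Finset.Ico (x + 1) (n + 1)) E α :=
        (Finset.prod_range_mul_prod_Ico _ (by omega)).symm
      have hG := resProd_le_lintegral ht (Finset.range (x + 1)) E α
      have hG' : ENNReal.ofReal (jw α) * resProd t (Finset.range (x + 1)) E α ≤
          ENNReal.ofReal (t * 2 ^ (n + 1)) * resInt t (Finset.range (x + 1)) E := by
        refine hG.trans (mul_le_mul_left (ENNReal.ofReal_le_ofReal ?_) _)
        rw [Finset.card_range]
        gcongr
        · norm_num
        · omega
      rw [hsplit]
      calc _ = ENNReal.ofReal ((4 * B) ^ 4) *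
            (ENNReal.ofReal (jw α) * resProd t (Finset.range (x + 1)) E α) *
            (ENNReal.ofReal (jw α) * resProd t (Finset.Ico (x + 1) (n + 1)) E α) := by ring
        _ ≤ _ := mul_le_mul_left (mul_le_mul_right hG' _) _
    refine (lintegral_mono hpt).trans ?_
    rw [lintegral_const_mul _ (by fun_prop)]
    have hs : resInt t (Finset.range (x + 1)) E ≤ ENNReal.ofReal (4 * B ^ 2) *
        resInt t (Finset.range (x + 1)) (fun j => E j - Ω) := by
      refine (resInt_shift ht0 _ _ Ω).trans (mul_le_mul_left (ENNReal.ofReal_le_ofReal ?_) _)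
      nlinarith [sq_abs Ω, abs_nonneg Ω, mul_self_le_mul_self (abs_nonneg Ω) hΩ]
    calc _ ≤ (ENNReal.ofReal ((4 * B) ^ 4) * (ENNReal.ofReal (t * 2 ^ (n + 1)) *
          (ENNReal.ofReal (4 * B ^ 2) * resInt t (Finset.range (x + 1)) (fun j => E j - Ω)))) *
            resInt t (Finset.Ico (x + 1) (n + 1)) E :=
          mul_le_mul_left (mul_le_mul_right (mul_le_mul_right hs _) _) _
      _ = _ := by
        rw [ENNReal.ofReal_mul (p := (4 * B) ^ 4 * (t * 2 ^ (n + 1))) (by positivity),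
          ENNReal.ofReal_mul (p := (4 * B) ^ 4) (by positivity)]
        ring
  have second : (∫⁻ α, ∏ j ∈ Finset.range (n + 1), ENNReal.ofReal (rr t (α - E' j))) ≤
      ENNReal.ofReal ((4 * B) ^ 2 * (2 * t) ^ (n + 1 - T.card)) * resInt t T E' := by
    have hpt : ∀ α, ∏ j ∈ Finset.range (n + 1), ENNReal.ofReal (rr t (α - E' j)) ≤
        ENNReal.ofReal ((4 * B) ^ 2 * (2 * t) ^ (n + 1 - T.card)) *
          (ENNReal.ofReal (jw α) * resProd t T E' α) := fun α => by
      refine (prod_rr_le (m := 1) hB (fun j _ => hE' j) (by simp; omega) α).trans ?_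
      have h1 : resProd t (Finset.range (n + 1)) E' α ≤
          ENNReal.ofReal ((2 * t) ^ (n + 1 - T.card)) * resProd t T E' α := by
        unfold resProd
        rw [← Finset.prod_sdiff hT]
        -- Each discarded resolvent costs 2t; these are the powers of t that the peaks save.
        refine mul_le_mul_left ((Finset.prod_le_prod' (g := fun _ => ENNReal.ofReal (2 * t))
          fun j _ => ENNReal.ofReal_le_ofReal (rh_le ht _)).trans (le_of_eq ?_)) _
        rw [Finset.prod_const, Finset.card_sdiff_of_subset hT, Finset.card_range,
          ENNReal.ofReal_pow (by positivity)]
      rw [pow_one, mul_one, ENNReal.ofReal_mul (by positivity)]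
      calc _ ≤ ENNReal.ofReal ((4 * B) ^ 2) * (ENNReal.ofReal (jw α) *
            (ENNReal.ofReal ((2 * t) ^ (n + 1 - T.card)) * resProd t T E' α)) := by gcongr
        _ = _ := by ring
    refine (lintegral_mono hpt).trans (le_of_eq ?_)
    rw [lintegral_const_mul _ (by fun_prop), resInt]
  refine (mul_le_mul' first second).trans ?_
  have hc : (4 * B) ^ 4 * (t * 2 ^ (n + 1)) * (4 * B ^ 2) *
      ((4 * B) ^ 2 * (2 * t) ^ (n + 1 - T.card)) ≤
      4 ^ (2 * n + 8) * B ^ 8 * t ^ (n + 2 - T.card) := by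
    have e1 : n + 2 - T.card = n + 1 - T.card + 1 := by omega
    have e2 : (2 : ℝ) ^ (n + 1 - T.card) ≤ 2 ^ (n + 1) :=
      pow_le_pow_right₀ (by norm_num) (by omega)
    have e3 : (4 : ℝ) ^ (2 * n + 8) = 4 ^ 7 * (2 ^ (n + 1) * 2 ^ (n + 1)) * 4 ^ n := by
      rw [← mul_pow]; norm_num; ring
    have e4 : (1 : ℝ) ≤ 4 ^ n := one_le_pow₀ (by norm_num)
    calc _ = 4 ^ 7 * (2 ^ (n + 1) * 2 ^ (n + 1 - T.card)) * 1 * (B ^ 8 *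
          t ^ (n + 1 - T.card + 1)) := by rw [mul_pow, mul_pow, mul_pow]; ring
      _ ≤ 4 ^ 7 * (2 ^ (n + 1) * 2 ^ (n + 1)) * 4 ^ n * (B ^ 8 *
          t ^ (n + 1 - T.card + 1)) := by gcongr
      _ = _ := by rw [e3, e1]; ring
  calc _ = ENNReal.ofReal ((4 * B) ^ 4 * (t * 2 ^ (n + 1)) * (4 * B ^ 2) *
      ((4 * B) ^ 2 * (2 * t) ^ (n + 1 - T.card))) *
      (resInt t (Finset.range (x + 1)) (fun j => E j - Ω) * resInt t (Finset.Ico (x + 1) (n + 1)) E *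
        resInt t T E') := by
        rw [ENNReal.ofReal_mul (p := (4 * B) ^ 4 * (t * 2 ^ (n + 1)) * (4 * B ^ 2)) (by positivity)]
        ring
    _ ≤ _ := mul_le_mul_left (ENNReal.ofReal_le_ofReal hc) _

/-! ### Two chains -/

/-- The integral of two chains that meet in the variable `x`; the first one has special positions
`B`. -/
theorem two_chain_bound {d : ℕ} (hd : 3 ≤ d) (K : Constants) : ∃ C : ℝ, 1 ≤ C ∧
    ∀ S : Model d, Assumptions K S → ∀ t : ℝ, 1 ≤ t →
    ∀ {ι : Type} [Fintype ι] [DecidableEq ι] (x : ι) (c c' : ℕ → ι) (M M' : ℕ),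
      Set.InjOn c (Set.Iio M) → Set.InjOn c' (Set.Iio M') → (∀ q < M, c q ≠ x) →
      (∀ q < M', c' q ≠ x) → (∀ q < M, ∀ r < M', c q ≠ c' r) →
      (∀ i, i = x ∨ (∃ q < M, c q = i) ∨ ∃ q < M', c' q = i) →
    ∀ P P' : Mom d → Mom d, Continuous P → Continuous P' →
    ∀ (s s' s'' : ι → ℤˣ) (p : Mom d) (α α' α'' : ℝ) (B : Finset ℕ) (T : ℕ → Finset ι),
      (∀ b ∈ B, 1 ≤ b ∧ b - 1 ∉ B ∧ c b ∈ T b ∧ c (b - 1) ∉ T b ∧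
        ∀ i, b < i → i < M → c i ∉ T b) → (∀ b ∈ B, b < M) →
    ∀ r : Mom d → ℝ≥0∞, Measurable r →
      ∫⁻ k : ι → Mom d, (r (k x) *
        ∏ q ∈ Finset.range M', chainFactor S t α' (fun k => P' (k x)) s' c' q k) *
        ((∏ q ∈ Finset.range M, chainFactor S t α (fun k => P (k x)) s c q k) *
          ∏ b ∈ B, res t α'' (S.En p (T b) s'') k) ≤
        ENNReal.ofReal (C * logStar t) ^ (M + M' + B.card) * ∫⁻ y, r y := by
  obtain ⟨C, hC, h⟩ := chain_bound (d := d) hd K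
  refine ⟨C, hC, ?_⟩
  intro S A t ht ι _ _ x c c' M M' hc hc' hcx hcx' hdisj hcov P P' hP hP' s s' s'' p α α' α'' B T
    hB hBM r hr
  have ht0 : 0 < t := by linarith
  have hmw := (continuous_wt (d := d) (d + 1)).measurable
  have hcf : ∀ (c : ℕ → ι) (P : Mom d → Mom d) (_ : Continuous P) (s : ι → ℤˣ) (α : ℝ) (q : ℕ),
      Measurable (chainFactor S t α (fun k => P (k x)) s c q) := fun c P hP s α q =>
    Measurable.mul (by fun_prop) (measurable_res A hd ht0 α (by fun_prop) _ s)
  have hm1 : Measurable fun k : ι → Mom d =>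
      ∏ q ∈ Finset.range M', chainFactor S t α' (fun k => P' (k x)) s' c' q k :=
    Finset.measurable_fun_prod _ fun q _ => hcf c' P' hP' s' α' q
  have hm2 : Measurable fun k : ι → Mom d =>
      ∏ q ∈ Finset.range M, chainFactor S t α (fun k => P (k x)) s c q k :=
    Finset.measurable_fun_prod _ fun q _ => hcf c P hP s α q
  have hm3 : Measurable fun k : ι → Mom d => ∏ b ∈ B, res t α'' (S.En p (T b) s'') k :=
    Finset.measurable_fun_prod _ fun b _ => measurable_res A hd ht0 α'' continuous_const _ s''
  have hrx : Measurable fun k : ι → Mom d => r (k x) := hr.comp (measurable_pi_apply x)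
  set I := (Finset.range M).image c with hI
  set I' := (Finset.range M').image c' with hI'
  have hu : (Finset.univ : Finset ι) = ({x} ∪ I') ∪ I := by
    ext i
    simp only [Finset.mem_univ, Finset.mem_union, Finset.mem_singleton, hI, hI',
      Finset.mem_image, Finset.mem_range, true_iff]
    exact (hcov i).elim (fun h => .inl (.inl h)) fun h => h.elim .inr fun h => .inl (.inr h)
  have hd1 : Disjoint ({x} ∪ I') I := by
    rw [Finset.disjoint_left]
    intro i hi hi'
    obtain ⟨q, hq, rfl⟩ := Finset.mem_image.1 hi'
    rw [Finset.mem_union, Finset.mem_singleton] at hi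
    rcases hi with hi | hi
    · exact hcx q (Finset.mem_range.1 hq) hi
    · obtain ⟨r, hr, hrq⟩ := Finset.mem_image.1 hi
      exact hdisj q (Finset.mem_range.1 hq) r (Finset.mem_range.1 hr) hrq.symm
  have hd2 : Disjoint {x} I' := by
    rw [Finset.disjoint_singleton_left]
    intro hi
    obtain ⟨r, hr, hrq⟩ := Finset.mem_image.1 hi
    exact hcx' r (Finset.mem_range.1 hr) hrq
  have hix : ∀ (F : Mom d → ℝ≥0∞) (i : ι), i ≠ x → IndepOf (fun k : ι → Mom d => F (k x)) i :=
    fun F i hi k v => by simp only [Function.update_of_ne hi.symm]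
  have hix' : ∀ (F : Mom d → Mom d) (i : ι), i ≠ x → IndepOf (fun k : ι → Mom d => F (k x)) i :=
    fun F i hi k v => by simp only [Function.update_of_ne hi.symm]
  have hR1 : ∀ q < M, IndepOf (fun k : ι → Mom d => r (k x) *
      ∏ q ∈ Finset.range M', chainFactor S t α' (fun k => P' (k x)) s' c' q k) (c q) := by
    intro q hq
    refine IndepOf.mul (hix r _ (hcx q hq)) (IndepOf.prod fun j hj => ?_)
    have hj' := Finset.mem_range.1 hj
    intro k v
    have hn : c q ∉ (Finset.range (j + 1)).image c' := fun hh => by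
      obtain ⟨a, ha, hac⟩ := Finset.mem_image.1 hh
      have ha' := Finset.mem_range.1 ha
      exact hdisj q hq a (by omega) hac.symm
    simp only [chainFactor, res]
    rw [Function.update_of_ne (hcx q hq).symm, En_update_of_notMem hn,
      Function.update_of_ne (hdisj q hq j hj').symm]
  let k₀ : ι → Mom d := fun _ => 0
  have hmF : Measurable fun k : ι → Mom d => (r (k x) *
      ∏ q ∈ Finset.range M', chainFactor S t α' (fun k => P' (k x)) s' c' q k) *
      ((∏ q ∈ Finset.range M, chainFactor S t α (fun k => P (k x)) s c q k) *
        ∏ b ∈ B, res t α'' (S.En p (T b) s'') k) := (hrx.mul hm1).mul (hm2.mul hm3)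
  -- The chain with special positions goes first, with the other chain as spectator. The other chain
  -- follows with no special positions, and the common variable x comes last.
  rw [volume_pi, lintegral_eq_lmarginal_univ k₀, hu, lmarginal_union _ _ hmF hd1]
  have hmR : Measurable fun k : ι → Mom d => r (k x) *
      ∏ q ∈ Finset.range M', chainFactor S t α' (fun k => P' (k x)) s' c' q k := hrx.mul hm1
  have step1 := h S A t ht c M hc (fun k => P (k x)) (by fun_prop) (fun q hq => hix' P _ (hcx q hq))
    s s'' p α α'' B T hB hBM _ hmR hR1
  refine (lmarginal_mono step1 k₀).trans ?_
  have hfe : (fun k : ι → Mom d => ENNReal.ofReal (C * logStar t) ^ (M + B.card) * (r (k x) *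
      ∏ q ∈ Finset.range M', chainFactor S t α' (fun k => P' (k x)) s' c' q k)) =
      fun k => (ENNReal.ofReal (C * logStar t) ^ (M + B.card) * r (k x)) *
        ((∏ q ∈ Finset.range M', chainFactor S t α' (fun k => P' (k x)) s' c' q k) *
          ∏ b ∈ (∅ : Finset ℕ), res t α'' (S.En p (T b) s'') k) := by
    funext k; rw [Finset.prod_empty, mul_one, mul_assoc]
  have hmF' : Measurable fun k : ι → Mom d =>
      (ENNReal.ofReal (C * logStar t) ^ (M + B.card) * r (k x)) *
        ((∏ q ∈ Finset.range M', chainFactor S t α' (fun k => P' (k x)) s' c' q k) *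
          ∏ b ∈ (∅ : Finset ℕ), res t α'' (S.En p (T b) s'') k) :=
    (hrx.const_mul _).mul (hm1.mul (by simp))
  rw [hfe, lmarginal_union _ _ hmF' hd2]
  have step2 := h S A t ht c' M' hc' (fun k => P' (k x)) (by fun_prop)
    (fun q hq => hix' P' _ (hcx' q hq)) s' s'' p α' α'' ∅ T (by simp) (by simp)
    (fun k => ENNReal.ofReal (C * logStar t) ^ (M + B.card) * r (k x)) (hrx.const_mul _)
    (fun q hq => hix (fun y => ENNReal.ofReal (C * logStar t) ^ (M + B.card) * r y) _ (hcx' q hq))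
  refine (lmarginal_mono step2 k₀).trans (le_of_eq ?_)
  rw [lmarginal_singleton]
  simp only [Function.update_self]
  rw [lintegral_const_mul _ (hr.const_mul _), lintegral_const_mul _ hr, Finset.card_empty]
  ring

/-! ### A shear of the momenta -/

/-- With the other momenta fixed, the map is a translation in k_x. Its purpose is to use the
momentum at the left end of the history as an integration variable. -/
lemma lintegral_shear {d : ℕ} {ι : Type} [Fintype ι] [DecidableEq ι] (x : ι) (p : Mom d)
    {H : (ι → Mom d) → ℝ≥0∞} (hH : Measurable H) :
    ∫⁻ k : ι → Mom d, H (Function.update k x (p + ∑ i, k i)) = ∫⁻ k, H k := by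
  have hm : Measurable fun k : ι → Mom d => Function.update k x (p + ∑ i, k i) := by
    refine measurable_pi_lambda _ fun i => ?_
    by_cases hi : i = x
    · subst hi; simp only [Function.update_self]; fun_prop
    · simp only [Function.update_of_ne hi]; fun_prop
  let k₀ : ι → Mom d := fun _ => 0
  have hHm : Measurable fun k : ι → Mom d => H (Function.update k x (p + ∑ i, k i)) := hH.comp hm
  rw [volume_pi, lintegral_eq_lmarginal_univ k₀, lintegral_eq_lmarginal_univ k₀,
    lmarginal_erase' _ hHm (Finset.mem_univ x), lmarginal_erase' _ hH (Finset.mem_univ x)]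
  congr 1
  funext k
  simp only [Function.update_idem]
  have e : ∀ v : Mom d, p + ∑ i, Function.update k x v i = v + (p + ∑ i ∈ Finset.univ.erase x, k i) := by
    intro v
    rw [← Finset.add_sum_erase _ _ (Finset.mem_univ x), Function.update_self,
      Finset.sum_congr rfl fun i hi => Function.update_of_ne (Finset.ne_of_mem_erase hi) _ _]
    abel
  simp only [e]
  exact lintegral_add_right_eq_self (fun v => H (Function.update k x v)) _

/-! ### Bounds on energies and weights -/

section

variable {d : ℕ} {ι : Type*}

/-- Products are preferred to sums because they factorise over the momenta and can be absorbed by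
the weights one variable at a time. -/
lemma sum_le_prod_four_mul {s : Finset ι} {f : ι → ℝ} (hf : ∀ i, 1 ≤ f i) :
    ∑ i ∈ s, f i ≤ ∏ i ∈ s, 4 * f i := by
  classical
  induction s using Finset.induction_on with
  | empty => simp
  | insert a s ha ih =>
    rw [Finset.sum_insert ha, Finset.prod_insert ha]
    have h1 : 1 ≤ ∏ i ∈ s, 4 * f i := Finset.one_le_prod fun i _ => by linarith [hf i]
    nlinarith [hf a]

lemma prod_le_prod_univ_four [Fintype ι] (s : Finset ι) {f : ι → ℝ} (hf : ∀ i, 1 ≤ f i) :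
    ∏ i ∈ s, 4 * f i ≤ ∏ i, 4 * f i :=
  Finset.prod_le_prod_of_subset_of_one_le (Finset.subset_univ s)
    (fun i _ => by linarith [hf i]) fun i _ _ => by linarith [hf i]

/-- A bound for all energies that occur in a history. -/
def energyBound (K : Constants) [Fintype ι] (p : Mom d) (k : ι → Mom d) : ℝ :=
  (5 * growthBound K + 1) * bracket p ^ 2 * ∏ i, 4 * bracket (k i) ^ 2

variable [Fintype ι] {S : Model d} {K : Constants}

lemma one_le_sq_bracket (p : Mom d) : 1 ≤ bracket p ^ 2 := one_le_pow₀ (one_le_bracket p)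

lemma one_le_prod_bracket (k : ι → Mom d) : 1 ≤ ∏ i, 4 * bracket (k i) ^ 2 :=
  Finset.one_le_prod fun i _ => by linarith [one_le_sq_bracket (k i)]

lemma one_le_energyBound (p : Mom d) (k : ι → Mom d) : 1 ≤ energyBound K p k := by
  have h0 := growthBound_pos K
  have h1 := one_le_sq_bracket p
  have h2 := one_le_prod_bracket k
  have h3 : 1 ≤ 5 * growthBound K + 1 := by linarith
  unfold energyBound
  exact one_le_mul_of_one_le_of_one_le (one_le_mul_of_one_le_of_one_le h3 h1) h2

lemma abs_sum_sgn_le (A : Assumptions K S) (hd : 3 ≤ d) (T : Finset ι) (s : ι → ℤˣ) (k : ι → Mom d) :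
    |∑ i ∈ T, sgn (s i) * S.ω (k i)| ≤ growthBound K * ∏ i, 4 * bracket (k i) ^ 2 := by
  have h0 := growthBound_pos K
  calc _ ≤ ∑ i ∈ T, |sgn (s i) * S.ω (k i)| := Finset.abs_sum_le_sum_abs _ _
    _ ≤ ∑ i ∈ T, growthBound K * bracket (k i) ^ 2 := Finset.sum_le_sum fun i _ => by
        rw [abs_mul, abs_sgn, one_mul]
        have := (A.ω_growth hd).bound0 (k i)
        have h2 := A.ω_nonneg (k i)
        rw [abs_of_nonneg h2]
        exact (le_abs_self _).trans (by simpa using this)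
    _ ≤ growthBound K * ∏ i ∈ T, 4 * bracket (k i) ^ 2 := by
        rw [← Finset.mul_sum]
        exact mul_le_mul_of_nonneg_left
          (sum_le_prod_four_mul fun i => one_le_sq_bracket (k i)) h0.le
    _ ≤ _ := mul_le_mul_of_nonneg_left
        (prod_le_prod_univ_four T fun i => one_le_sq_bracket (k i)) h0.le

lemma abs_sum_sgn_le_energyBound (A : Assumptions K S) (hd : 3 ≤ d) (T : Finset ι) (s : ι → ℤˣ)
    (p : Mom d) (k : ι → Mom d) : |∑ i ∈ T, sgn (s i) * S.ω (k i)| ≤ energyBound K p k := by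
  have h0 := growthBound_pos K
  refine (abs_sum_sgn_le A hd T s k).trans ?_
  unfold energyBound
  refine mul_le_mul_of_nonneg_right ?_ (zero_le_one.trans (one_le_prod_bracket k))
  nlinarith [one_le_sq_bracket p]

lemma abs_En_le (A : Assumptions K S) (hd : 3 ≤ d) (T : Finset ι) (s : ι → ℤˣ)
    (p : Mom d) (k : ι → Mom d) : |S.En p T s k| ≤ energyBound K p k := by
  have h0 := growthBound_pos K
  have h2 := one_le_prod_bracket k
  have he : |S.e (p + ∑ i ∈ T, k i)| ≤
      4 * growthBound K * bracket p ^ 2 * ∏ i, 4 * bracket (k i) ^ 2 := by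
    have h1 : bracket (p + ∑ i ∈ T, k i) ≤ 2 * bracket p * ∏ i ∈ T, 2 * bracket (k i) :=
      (bracket_add_le _ _).trans (mul_le_mul_of_nonneg_left (bracket_sum_le T k)
        (by have := bracket_pos p; positivity))
    have h3 := (A.e_growth hd).bound0 (p + ∑ i ∈ T, k i)
    have h4 : bracket (p + ∑ i ∈ T, k i) ^ 2 ≤ 4 * bracket p ^ 2 * ∏ i ∈ T, 4 * bracket (k i) ^ 2 := by
      refine (pow_le_pow_left₀ (bracket_pos _).le h1 2).trans (le_of_eq ?_)
      rw [mul_pow, mul_pow, ← Finset.prod_pow]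
      congr 1
      · norm_num
      · exact Finset.prod_congr rfl fun i _ => by ring
    have h5 : |S.e (p + ∑ i ∈ T, k i)| ≤ growthBound K * bracket (p + ∑ i ∈ T, k i) ^ 2 := by
      simpa using h3
    refine h5.trans ((mul_le_mul_of_nonneg_left h4 h0.le).trans ?_)
    have h6 := prod_le_prod_univ_four T fun i => one_le_sq_bracket (k i)
    calc _ = 4 * growthBound K * bracket p ^ 2 * ∏ i ∈ T, 4 * bracket (k i) ^ 2 := by ring
      _ ≤ _ := mul_le_mul_of_nonneg_left h6 (by positivity)
  have hs := abs_sum_sgn_le A hd T s k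
  unfold Model.En energyBound
  refine (abs_add_le _ _).trans ((add_le_add he hs).trans ?_)
  have h3 := one_le_sq_bracket p
  have h4 : 0 ≤ ∏ i, 4 * bracket (k i) ^ 2 := zero_le_one.trans h2
  nlinarith [mul_nonneg (mul_nonneg h0.le (sub_nonneg.2 h3)) h4, mul_nonneg (zero_le_one.trans h3) h4]

/-- The weight of the phonon momenta absorbs the powers of the energy bound. -/
lemma prod_wt_mul_energyBound_le (p : Mom d) (k : ι → Mom d) (hd : 3 ≤ d) :
    (∏ i, wt (4 * d + 23) (k i)) * energyBound K p k ^ 8 ≤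
      (5 * growthBound K + 1) ^ 8 * bracket p ^ 16 * (4 ^ 8 * 2 ^ (d + 1)) ^ Fintype.card ι *
        ((∏ i, wt (d + 1) (k i)) * wt (d + 1) (∑ i, k i)) := by
  have h0 := growthBound_pos K
  have hb := bracket_pos p
  have e1 : energyBound K p k ^ 8 = (5 * growthBound K + 1) ^ 8 * bracket p ^ 16 *
      ∏ i, 4 ^ 8 * bracket (k i) ^ 16 := by
    unfold energyBound
    rw [mul_pow, mul_pow, ← Finset.prod_pow, ← pow_mul]
    congr 1
    exact Finset.prod_congr rfl fun i _ => by ring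
  -- Sixteen powers of ⟨k_i⟩ leave the exponent 4d + 7 ≥ 2(d + 1). One half keeps the integral over
  -- k_i finite, and the other is traded for decay in ∑ k.
  have e2 : (∏ i, wt (4 * d + 23) (k i)) * ∏ i, 4 ^ 8 * bracket (k i) ^ 16 ≤
      (4 ^ 8) ^ Fintype.card ι * ((∏ i, wt (d + 1) (k i)) * ∏ i, wt (d + 1) (k i)) := by
    rw [← Finset.prod_mul_distrib, ← Finset.prod_mul_distrib, ← Finset.card_univ, ← Finset.prod_const,
      ← Finset.prod_mul_distrib]
    refine Finset.prod_le_prod (fun i _ => ?_) fun i _ => ?_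
    · have := wt_pos (4 * d + 23) (k i); have := bracket_pos (k i); positivity
    · have h1 : wt (4 * d + 23) (k i) * bracket (k i) ^ 16 = wt (4 * d + 7) (k i) :=
        wt_mul_pow (4 * d + 7) 16 (k i)
      have h2 : wt (4 * d + 7) (k i) ≤ wt (d + 1) (k i) * wt (d + 1) (k i) := by
        rw [← wt_add]; exact wt_anti (by omega) _
      calc _ = 4 ^ 8 * (wt (4 * d + 23) (k i) * bracket (k i) ^ 16) := by ring
        _ ≤ _ := by rw [h1]; gcongr
  have e3 : ∏ i, wt (d + 1) (k i) ≤ (2 ^ (d + 1)) ^ Fintype.card ι * wt (d + 1) (∑ i, k i) := by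
    have h1 := bracket_sum_le Finset.univ k
    have h3 : 0 < ∏ i, bracket (k i) := Finset.prod_pos fun i _ => bracket_pos _
    unfold wt
    rw [Finset.prod_inv_distrib, Finset.prod_pow, ← div_eq_mul_inv,
      le_div_iff₀ (pow_pos (bracket_pos _) _), inv_mul_le_iff₀ (pow_pos h3 _)]
    refine (pow_le_pow_left₀ (bracket_pos _).le h1 _).trans (le_of_eq ?_)
    rw [Finset.prod_mul_distrib, Finset.prod_const, Finset.card_univ]
    ring
  have h4 : 0 ≤ ∏ i, wt (d + 1) (k i) := Finset.prod_nonneg fun i _ => (wt_pos _ _).le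
  rw [e1]
  calc _ = (5 * growthBound K + 1) ^ 8 * bracket p ^ 16 *
        ((∏ i, wt (4 * d + 23) (k i)) * ∏ i, 4 ^ 8 * bracket (k i) ^ 16) := by ring
    _ ≤ (5 * growthBound K + 1) ^ 8 * bracket p ^ 16 * ((4 ^ 8) ^ Fintype.card ι *
        ((∏ i, wt (d + 1) (k i)) * ((2 ^ (d + 1)) ^ Fintype.card ι * wt (d + 1) (∑ i, k i)))) := by
        refine mul_le_mul_of_nonneg_left (e2.trans ?_) (by positivity)
        gcongr
    _ = _ := by rw [mul_pow (4 ^ 8 : ℝ)]; ring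

end

/-! ### The momentum integral of a pairing -/

section

variable {d n : ℕ}

/-- The entry with index `q`, and `x` if there is none. -/
def finOf (x : Fin n) (q : ℕ) : Fin n := if h : q < n then ⟨q, h⟩ else x

lemma finOf_val {x : Fin n} {q : ℕ} (h : q < n) : (finOf x q : ℕ) = q := by simp [finOf, h]

lemma finOf_coe (x i : Fin n) : finOf x i = i := by simp [finOf]

/-- The indices `l ≥ j`. -/
def tailSet (n j : ℕ) : Finset (Fin n) := Finset.univ.filter fun l => j ≤ (l : ℕ)

/-- The indices `i` with `π i ≥ j`. -/
def permTail (π : Equiv.Perm (Fin n)) (j : ℕ) : Finset (Fin n) :=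
  Finset.univ.filter fun i => j ≤ (π i : ℕ)

lemma image_finOf_range (x : Fin n) {q : ℕ} (hq : q < n) :
    (Finset.range (q + 1)).image (finOf x) = (tailSet n (q + 1))ᶜ := by
  ext i
  simp only [Finset.mem_image, Finset.mem_range, Finset.mem_compl, tailSet, Finset.mem_filter,
    Finset.mem_univ, true_and, not_le]
  constructor
  · rintro ⟨a, ha, rfl⟩
    rw [finOf_val (by omega)]; exact ha
  · exact fun h => ⟨i, h, finOf_coe x i⟩

lemma image_finOf_reflect (x : Fin n) {q : ℕ} (hq : q < n) :
    (Finset.range (q + 1)).image (fun q => finOf x (n - 1 - q)) = tailSet n (n - 1 - q) := by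
  ext i
  simp only [Finset.mem_image, Finset.mem_range, tailSet, Finset.mem_filter,
    Finset.mem_univ, true_and]
  constructor
  · rintro ⟨a, ha, rfl⟩
    rw [finOf_val (by omega)]; omega
  · intro h
    refine ⟨n - 1 - i, by omega, ?_⟩
    rw [show n - 1 - (n - 1 - (i : ℕ)) = i by omega]
    exact finOf_coe x i

lemma prod_fin_split {R : Type*} [CommMonoid R] (x : Fin n) (f : Fin n → R) :
    ∏ i, f i = f x * ((∏ q ∈ Finset.range x, f (finOf x q)) *
      ∏ q ∈ Finset.range (n - 1 - x), f (finOf x (n - 1 - q))) := by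
  have h1 : ∏ i, f i = ∏ q ∈ Finset.range n, f (finOf x q) := by
    rw [← Fin.prod_univ_eq_prod_range (fun q => f (finOf x q))]
    simp only [finOf_coe]
  have hx := x.2
  rw [h1, ← Finset.prod_range_mul_prod_Ico _ (show (x : ℕ) + 1 ≤ n by omega), Finset.prod_range_succ,
    finOf_coe, Finset.prod_Ico_eq_prod_range, show n - ((x : ℕ) + 1) = n - 1 - x by omega,
    ← Finset.prod_range_reflect (fun k => f (finOf x (x + 1 + k)))]
  have h2 : ∏ j ∈ Finset.range (n - 1 - x), f (finOf x (x + 1 + (n - 1 - x - 1 - j))) =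
      ∏ q ∈ Finset.range (n - 1 - x), f (finOf x (n - 1 - q)) :=
    Finset.prod_congr rfl fun j hj => by
      have := Finset.mem_range.1 hj
      congr 2; omega
  rw [h2, mul_comm (∏ q ∈ Finset.range x, _) (f x), mul_assoc]

lemma prod_Ico_split {R : Type*} [CommMonoid R] (x : Fin n) (f : ℕ → R) :
    ∏ j ∈ Finset.Ico ((x : ℕ) + 1) (n + 1), f j =
      f n * ∏ q ∈ Finset.range (n - 1 - x), f (n - 1 - q) := by
  have hx := x.2
  rw [Finset.prod_Ico_eq_prod_range, show n + 1 - ((x : ℕ) + 1) = n - 1 - x + 1 by omega,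
    Finset.prod_range_succ, ← Finset.prod_range_reflect, mul_comm]
  congr 1
  · congr 1; omega
  · exact Finset.prod_congr rfl fun j hj => by
      have := Finset.mem_range.1 hj
      congr 1; omega

variable {S : Model d} {K : Constants}

/-- The energies of a history seen from its left end. -/
lemma En_tailSet_sub (A : Assumptions K S) (p : Mom d) (σ : Fin n → ℤˣ) (k : Fin n → Mom d) (j : ℕ) :
    S.En p (tailSet n j) σ k - ∑ i, sgn (σ i) * S.ω (k i) =
      S.En (-(p + ∑ i, k i)) (tailSet n j)ᶜ (fun i => -σ i) k := by
  have h1 := Finset.sum_add_sum_compl (tailSet n j) k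
  have h2 := Finset.sum_add_sum_compl (tailSet n j) fun i => sgn (σ i) * S.ω (k i)
  unfold Model.En
  -- Evenness of e permits reversing the momentum, which then reads as the negative left-end
  -- momentum plus the momenta to the left of j.
  rw [← h1, ← h2, ← A.e_even (p + ∑ i ∈ tailSet n j, k i)]
  simp only [sgn_neg, neg_mul, Finset.sum_neg_distrib]
  rw [show -(p + (∑ i ∈ tailSet n j, k i + ∑ i ∈ (tailSet n j)ᶜ, k i)) + ∑ i ∈ (tailSet n j)ᶜ, k i =
    -(p + ∑ i ∈ tailSet n j, k i) by abel]
  ring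

/-- The position `x` and the set `P` of peaks to its right at which the conjugate history gains. -/
def RightPeaks (π : Equiv.Perm (Fin n)) (x : Fin n) (P : Finset (Fin n)) : Prop :=
  ∀ b ∈ P, x < b ∧ (b : ℕ) + 1 < n ∧ (∀ i, x ≤ i → i < b → π i < π b) ∧
    ∀ i : Fin n, (i : ℕ) = b + 1 → π i < π b

/-- The position `x` and the set `P` of peaks to its left at which the conjugate history gains. -/
def LeftPeaks (π : Equiv.Perm (Fin n)) (x : Fin n) (P : Finset (Fin n)) : Prop :=
  ∀ b ∈ P, b < x ∧ 1 ≤ (b : ℕ) ∧ (∀ i, b < i → i ≤ x → π i < π b) ∧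
    ∀ i : Fin n, (i : ℕ) + 1 = b → π i < π b

/-- The part of the integrand that depends on the momentum `k x` only. -/
def rootFactor (S : Model d) (t : ℝ) (p : Mom d) (a : ℝ × ℝ × ℝ) (y : Mom d) : ℝ≥0∞ :=
  ENNReal.ofReal (wt (d + 1) (y - p)) *
    ((ENNReal.ofReal (jw a.1) * ENNReal.ofReal (rh t (a.1 - S.e (-y)))) *
      ((ENNReal.ofReal (jw a.2.1) * ENNReal.ofReal (rh t (a.2.1 - S.e p))) *
        (ENNReal.ofReal (jw a.2.2) * ENNReal.ofReal (rh t (a.2.2 - S.e p)))))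

/-- The integrand in the variables in which `k x` is the momentum at the left end. -/
def treeIntegrand (S : Model d) (t : ℝ) (π : Equiv.Perm (Fin n)) (x : Fin n) (P : Finset (Fin n))
    (σ : Fin n → ℤˣ) (p : Mom d) (a : ℝ × ℝ × ℝ) (k : Fin n → Mom d) : ℝ≥0∞ :=
  rootFactor S t p a (k x) *
    ((∏ q ∈ Finset.range x,
      chainFactor S t a.1 (fun k => -(k x)) (fun i => -σ i) (finOf x) q k) *
    ((∏ q ∈ Finset.range (n - 1 - x),
      chainFactor S t a.2.1 (fun _ => p) σ (fun q => finOf x (n - 1 - q)) q k) *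
    ∏ b ∈ P, res t a.2.2 (S.En p (permTail π (π b)) σ) k))

variable {t : ℝ}

lemma measurable_treeIntegrand (A : Assumptions K S) (hd : 3 ≤ d) (ht : 0 < t)
    (π : Equiv.Perm (Fin n)) (x : Fin n) (P : Finset (Fin n)) (σ : Fin n → ℤˣ) (p : Mom d) :
    Measurable fun y : (ℝ × ℝ × ℝ) × (Fin n → Mom d) => treeIntegrand S t π x P σ p y.1 y.2 := by
  have h1 := (A.e_growth hd).continuous
  have h2 := continuous_rh ht
  have hE : ∀ (Q : (Fin n → Mom d) → Mom d) (_ : Continuous Q) (T : Finset (Fin n)) (s : Fin n → ℤˣ)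
      (g : ℝ × ℝ × ℝ → ℝ) (_ : Continuous g), Measurable fun y : (ℝ × ℝ × ℝ) × (Fin n → Mom d) =>
        res t (g y.1) (fun k => S.En (Q k) T s k) y.2 := fun Q hQ T s g hg => by
    have := continuous_En A hd (hQ.comp (continuous_snd (X := ℝ × ℝ × ℝ))) continuous_snd T s
    unfold res
    exact (h2.comp ((hg.comp continuous_fst).sub this)).measurable.ennreal_ofReal
  unfold treeIntegrand
  refine Measurable.mul ?_ (Measurable.mul ?_ (Measurable.mul ?_ ?_))
  · unfold rootFactor
    have := h1.measurable
    have := h2.measurable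
    fun_prop
  · refine Finset.measurable_fun_prod _ fun q _ => ?_
    unfold chainFactor
    exact Measurable.mul (by fun_prop) (hE (fun k => -(k x)) (by fun_prop) _ _ (fun a => a.1)
      (by fun_prop))
  · refine Finset.measurable_fun_prod _ fun q _ => ?_
    unfold chainFactor
    exact Measurable.mul (by fun_prop) (hE (fun _ => p) (by fun_prop) _ _ (fun a => a.2.1)
      (by fun_prop))
  · exact Finset.measurable_fun_prod _ fun b _ => hE (fun _ => p) (by fun_prop) _ _ (fun a => a.2.2)
      (by fun_prop)

/-- The weight is integrable in y - p, and for fixed y each of the three integrals over α costs one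
logarithm. -/
lemma lintegral_rootFactor_le (A : Assumptions K S) (hd : 3 ≤ d) (ht : 1 ≤ t) (p : Mom d) :
    ∫⁻ a, ∫⁻ y, rootFactor S t p a y ≤
      (∫⁻ y : Mom d, ENNReal.ofReal (wt (d + 1) y)) * ENNReal.ofReal (10 * logStar t) ^ 3 := by
  have ht0 : 0 < t := by linarith
  have h1 := (A.e_growth hd).continuous.measurable
  have h2 := (continuous_rh ht0).measurable
  have hm : Measurable fun z : (ℝ × ℝ × ℝ) × Mom d => rootFactor S t p z.1 z.2 := by
    unfold rootFactor; fun_prop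
  rw [lintegral_lintegral_swap (f := fun a y => rootFactor S t p a y) hm.aemeasurable,
    ← lintegral_sub_right_eq_self (fun y : Mom d => ENNReal.ofReal (wt (d + 1) y)) p,
    ← lintegral_mul_const _ (by fun_prop)]
  refine lintegral_mono fun y => ?_
  unfold rootFactor
  have hj : ∀ E : ℝ, Measurable fun a : ℝ => ENNReal.ofReal (jw a) * ENNReal.ofReal (rh t (a - E)) :=
    fun E => by fun_prop
  have hq : ∀ E E' : ℝ, Measurable fun a : ℝ × ℝ =>
      (ENNReal.ofReal (jw a.1) * ENNReal.ofReal (rh t (a.1 - E))) *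
      (ENNReal.ofReal (jw a.2) * ENNReal.ofReal (rh t (a.2 - E'))) :=
    fun E E' => by fun_prop
  rw [lintegral_const_mul _ (by fun_prop)]
  refine mul_le_mul_right ?_ _
  rw [Measure.volume_eq_prod, lintegral_prod_mul (hj _).aemeasurable (hq _ _).aemeasurable,
    Measure.volume_eq_prod, lintegral_prod_mul (hj _).aemeasurable (hj _).aemeasurable, pow_succ' _ 2, sq]
  exact mul_le_mul' (lintegral_jw_rh ht _) (mul_le_mul' (lintegral_jw_rh ht _) (lintegral_jw_rh ht _))

/-- The integral of `treeIntegrand` over all momenta. -/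
theorem lintegral_treeIntegrand_le (hd : 3 ≤ d) (K : Constants) : ∃ C : ℝ, 1 ≤ C ∧
    ∀ S : Model d, Assumptions K S → ∀ t : ℝ, 1 ≤ t → ∀ (n : ℕ) (π : Equiv.Perm (Fin n)) (x : Fin n)
      (P : Finset (Fin n)), RightPeaks π x P ∨ LeftPeaks π x P → ∀ (σ : Fin n → ℤˣ) (p : Mom d)
      (a : ℝ × ℝ × ℝ), ∫⁻ k, treeIntegrand S t π x P σ p a k ≤
        ENNReal.ofReal (C * logStar t) ^ (n - 1 + P.card) * ∫⁻ y, rootFactor S t p a y := by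
  obtain ⟨C, hC, h⟩ := two_chain_bound (d := d) hd K
  refine ⟨C, hC, fun S A t ht n π x P hP σ p a => ?_⟩
  have ht0 : 0 < t := by linarith
  have h1 := (A.e_growth hd).continuous.measurable
  have h2 := (continuous_rh ht0).measurable
  have hx := x.2
  have hr : Measurable (rootFactor S t p a) := by unfold rootFactor; fun_prop
  have hL : Set.InjOn (finOf x) (Set.Iio (x : ℕ)) := fun q hq r hr hqr => by
    have hq' : q < x := hq
    have hr' : r < x := hr
    have := congrArg Fin.val hqr
    rwa [finOf_val (by omega), finOf_val (by omega)] at this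
  have hR : Set.InjOn (fun q => finOf x (n - 1 - q)) (Set.Iio (n - 1 - (x : ℕ))) :=
    fun q hq r hr hqr => by
    have hq' : q < n - 1 - x := hq
    have hr' : r < n - 1 - x := hr
    have := congrArg Fin.val hqr
    simp only [] at this
    rw [finOf_val (by omega), finOf_val (by omega)] at this
    omega
  have hLx : ∀ q < (x : ℕ), finOf x q ≠ x := fun q hq hh => by
    have := congrArg Fin.val hh
    rw [finOf_val (by omega)] at this; omega
  have hRx : ∀ q < n - 1 - (x : ℕ), finOf x (n - 1 - q) ≠ x := fun q hq hh => by
    have := congrArg Fin.val hh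
    rw [finOf_val (by omega)] at this; omega
  have hLR : ∀ q < (x : ℕ), ∀ r < n - 1 - (x : ℕ), finOf x q ≠ finOf x (n - 1 - r) :=
    fun q hq r hr hh => by
    have := congrArg Fin.val hh
    rw [finOf_val (by omega), finOf_val (by omega)] at this; omega
  have hcovL : ∀ i : Fin n, i < x → ∃ q < (x : ℕ), finOf x q = i := fun i hi =>
    ⟨i, hi, finOf_coe x i⟩
  have hcovR : ∀ i : Fin n, x < i → ∃ q < n - 1 - (x : ℕ), finOf x (n - 1 - q) = i := fun i hi => by
    have h3 : (x : ℕ) < i := hi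
    refine ⟨n - 1 - i, by omega, ?_⟩
    rw [show n - 1 - (n - 1 - (i : ℕ)) = i by omega]
    exact finOf_coe x i
  have hmem : ∀ (b i : Fin n), i ∈ permTail π (π b) ↔ π b ≤ π i := fun b i => by
    rw [permTail, Finset.mem_filter, Fin.le_def]
    exact and_iff_right (Finset.mem_univ i)
  rcases hP with hP | hP
  · have hval : ∀ b ∈ P, finOf x (n - 1 - (n - 1 - (b : ℕ))) = b := fun b hb => by
      rw [show n - 1 - (n - 1 - (b : ℕ)) = b by omega]; exact finOf_coe x b
    have hinj : Set.InjOn (fun b : Fin n => n - 1 - (b : ℕ)) (P : Set (Fin n)) := fun b hb b' hb' hbb => by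
      have h3 : n - 1 - (b : ℕ) = n - 1 - (b' : ℕ) := hbb
      exact Fin.ext (by omega)
    -- Peaks to the right lie on the right chain, where index b has position n - 1 - b and is
    -- preceded by b + 1.
    have key := h S A t ht x (fun q => finOf x (n - 1 - q)) (finOf x) (n - 1 - x) x hR hL hRx hLx
      (fun q hq r hr => (hLR r hr q hq).symm)
      (fun i => by
        rcases lt_trichotomy i x with h3 | h3 | h3
        · exact .inr (.inr (hcovL i h3))
        · exact .inl h3
        · exact .inr (.inl (hcovR i h3)))
      (fun _ => p) (fun y => -y) (by fun_prop) (by fun_prop) σ (fun i => -σ i) σ p a.2.1 a.1 a.2.2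
      (P.image fun b : Fin n => n - 1 - (b : ℕ)) (fun β => permTail π (π (finOf x (n - 1 - β))))
      (fun β hβ => by
        obtain ⟨b, hb, rfl⟩ := Finset.mem_image.1 hβ
        obtain ⟨h3, h4, h5, h6⟩ := hP b hb
        have h3' : (x : ℕ) < b := h3
        simp only [hval b hb, hmem]
        have hnext : (finOf x (n - 1 - (n - 1 - (b : ℕ) - 1)) : ℕ) = b + 1 := by
          rw [finOf_val (by omega)]; omega
        refine ⟨by omega, fun hh => ?_, le_rfl, (h6 _ hnext).not_ge, fun i hi hiM => ?_⟩
        · obtain ⟨b', hb', hbb⟩ := Finset.mem_image.1 hh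
          -- Peaks are never adjacent: if b + 1 were in P as well, the height of b would have to be
          -- below that of b + 1, while b + 1 lies below b.
          have hb1 : (b' : ℕ) = b + 1 := by omega
          have h7 := (hP b' hb').2.2.1 b h3.le (by rw [Fin.lt_def]; omega)
          exact (h6 b' hb1).not_gt h7
        · refine (h5 _ ?_ ?_).not_ge
          · rw [Fin.le_def, finOf_val (by omega)]; omega
          · rw [Fin.lt_def, finOf_val (by omega)]; omega)
      (fun β hβ => by
        obtain ⟨b, hb, rfl⟩ := Finset.mem_image.1 hβ
        have h3' : (x : ℕ) < b := (hP b hb).1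
        omega) (rootFactor S t p a) hr
    rw [Finset.card_image_of_injOn hinj, show n - 1 - (x : ℕ) + x = n - 1 by omega] at key
    refine le_trans (le_of_eq (lintegral_congr fun k => ?_)) key
    rw [Finset.prod_image hinj, treeIntegrand]
    have e : ∏ b ∈ P, res t a.2.2 (S.En p (permTail π (π (finOf x (n - 1 - (n - 1 - (b : ℕ)))))) σ) k =
        ∏ b ∈ P, res t a.2.2 (S.En p (permTail π (π b)) σ) k :=
      Finset.prod_congr rfl fun b hb => by rw [hval b hb]
    rw [e]; ring
  · have hinj : Set.InjOn (fun b : Fin n => (b : ℕ)) (P : Set (Fin n)) := fun b hb b' hb' hbb => Fin.ext hbb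
    -- The mirror image: peaks to the left lie on the left chain, where b is preceded by b - 1, and
    -- the two chains exchange roles.
    have key := h S A t ht x (finOf x) (fun q => finOf x (n - 1 - q)) x (n - 1 - x) hL hR hLx hRx hLR
      (fun i => by
        rcases lt_trichotomy i x with h3 | h3 | h3
        · exact .inr (.inl (hcovL i h3))
        · exact .inl h3
        · exact .inr (.inr (hcovR i h3)))
      (fun y => -y) (fun _ => p) (by fun_prop) (by fun_prop) (fun i => -σ i) σ σ p a.1 a.2.1 a.2.2
      (P.image fun b : Fin n => (b : ℕ)) (fun β => permTail π (π (finOf x β)))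
      (fun β hβ => by
        obtain ⟨b, hb, rfl⟩ := Finset.mem_image.1 hβ
        obtain ⟨h3, h4, h5, h6⟩ := hP b hb
        have h3' : (b : ℕ) < x := h3
        simp only [finOf_coe, hmem]
        have hnext : (finOf x ((b : ℕ) - 1) : ℕ) + 1 = b := by
          rw [finOf_val (by omega)]; omega
        refine ⟨h4, fun hh => ?_, le_rfl, (h6 _ hnext).not_ge, fun i hi hiM => ?_⟩
        · obtain ⟨b', hb', hbb⟩ := Finset.mem_image.1 hh
          have hb1 : (b' : ℕ) + 1 = b := by omega
          have h7 := (hP b' hb').2.2.1 b (by rw [Fin.lt_def]; omega) h3.le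
          exact (h6 b' hb1).not_gt h7
        · refine (h5 _ ?_ ?_).not_ge
          · rw [Fin.lt_def, finOf_val (by omega)]; omega
          · rw [Fin.le_def, finOf_val (by omega)]; omega)
      (fun β hβ => by
        obtain ⟨b, hb, rfl⟩ := Finset.mem_image.1 hβ
        exact (hP b hb).1) (rootFactor S t p a) hr
    rw [Finset.card_image_of_injOn hinj, show (x : ℕ) + (n - 1 - x) = n - 1 by omega] at key
    refine le_trans (le_of_eq (lintegral_congr fun k => ?_)) key
    rw [Finset.prod_image hinj, treeIntegrand]
    simp only [finOf_coe]
    ring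

end

/-! ### From products of resolvents to the tree integrand -/

section

variable {d n : ℕ} {S : Model d} {K : Constants} {t : ℝ}

lemma tailSet_of_le {j : ℕ} (h : n ≤ j) : tailSet n j = ∅ :=
  Finset.filter_eq_empty_iff.2 fun i _ => by have := i.2; omega

lemma permTail_of_le (π : Equiv.Perm (Fin n)) {j : ℕ} (h : n ≤ j) : permTail π j = ∅ :=
  Finset.filter_eq_empty_iff.2 fun i _ => by have := (π i).2; omega

@[simp] lemma En_empty (p : Mom d) (σ : Fin n → ℤˣ) (k : Fin n → Mom d) :
    S.En p ∅ σ k = S.e p := by simp [Model.En]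

/-- The energies of the two histories of a pairing. -/
def histEnergy (S : Model d) (p : Mom d) (σ : Fin n → ℤˣ) (k : Fin n → Mom d) (j : ℕ) : ℝ :=
  S.En p (tailSet n j) σ k

/-- The energies of the conjugate history of a pairing. -/
def conjEnergy (S : Model d) (π : Equiv.Perm (Fin n)) (p : Mom d) (σ : Fin n → ℤˣ)
    (k : Fin n → Mom d) (j : ℕ) : ℝ := S.En p (permTail π j) σ k

/-- The resolvents of the conjugate history that are kept. -/
def keptIdx (π : Equiv.Perm (Fin n)) (P : Finset (Fin n)) : Finset ℕ :=
  insert n (P.image fun b => (π b : ℕ))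

lemma n_notMem_image (π : Equiv.Perm (Fin n)) (P : Finset (Fin n)) :
    n ∉ P.image fun b => (π b : ℕ) := fun h => by
  obtain ⟨b, _, hb⟩ := Finset.mem_image.1 h
  have := (π b).2; omega

lemma injOn_perm_val (π : Equiv.Perm (Fin n)) (P : Finset (Fin n)) :
    Set.InjOn (fun b => (π b : ℕ)) (P : Set (Fin n)) := fun b _ b' _ h => π.injective (Fin.ext h)

lemma card_keptIdx (π : Equiv.Perm (Fin n)) (P : Finset (Fin n)) :
    (keptIdx π P).card = P.card + 1 := by
  rw [keptIdx, Finset.card_insert_of_notMem (n_notMem_image π P),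
    Finset.card_image_of_injOn (injOn_perm_val π P)]

lemma keptIdx_subset (π : Equiv.Perm (Fin n)) (P : Finset (Fin n)) :
    keptIdx π P ⊆ Finset.range (n + 1) := fun j hj => by
  rw [Finset.mem_range]
  rcases Finset.mem_insert.1 hj with rfl | h
  · omega
  · obtain ⟨b, _, rfl⟩ := Finset.mem_image.1 h
    have := (π b).2; omega

/-- The resolvents that remain, in the sheared variables. -/
lemma resProd_le_treeIntegrand (A : Assumptions K S) {π : Equiv.Perm (Fin n)} {x : Fin n}
    {P : Finset (Fin n)} (hP : RightPeaks π x P ∨ LeftPeaks π x P) (σ : Fin n → ℤˣ) (p : Mom d)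
    (k : Fin n → Mom d) (a : ℝ × ℝ × ℝ) :
    ENNReal.ofReal ((∏ i, wt (d + 1) (k i)) * wt (d + 1) (∑ i, k i)) *
      ((ENNReal.ofReal (jw a.1) * resProd t (Finset.range ((x : ℕ) + 1))
        (fun j => histEnergy S p σ k j - ∑ i, sgn (σ i) * S.ω (k i)) a.1) *
      ((ENNReal.ofReal (jw a.2.1) * resProd t (Finset.Ico ((x : ℕ) + 1) (n + 1)) (histEnergy S p σ k) a.2.1) *
      (ENNReal.ofReal (jw a.2.2) * resProd t (keptIdx π P) (conjEnergy S π p σ k) a.2.2))) ≤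
      treeIntegrand S t π x P σ p a (Function.update k x (p + ∑ i, k i)) := by
  have hx := x.2
  set k' := Function.update k x (p + ∑ i, k i) with hk'
  have hk'x : k' x = p + ∑ i, k i := Function.update_self _ _ _
  have hkL : ∀ q < (x : ℕ), k' (finOf x q) = k (finOf x q) := fun q hq =>
    Function.update_of_ne (fun h => by
      have := congrArg Fin.val h
      rw [finOf_val (by omega)] at this; omega) _ _
  have hkR : ∀ q < n - 1 - (x : ℕ), k' (finOf x (n - 1 - q)) = k (finOf x (n - 1 - q)) := fun q hq =>
    Function.update_of_ne (fun h => by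
      have := congrArg Fin.val h
      rw [finOf_val (by omega)] at this; omega) _ _
  have e1 : resProd t (Finset.range ((x : ℕ) + 1))
      (fun j => histEnergy S p σ k j - ∑ i, sgn (σ i) * S.ω (k i)) a.1 =
      ENNReal.ofReal (rh t (a.1 - S.e (-(p + ∑ i, k i)))) * ∏ q ∈ Finset.range x, res t a.1
        (fun k => S.En (-(k x)) ((Finset.range (q + 1)).image (finOf x)) (fun i => -σ i) k) k' := by
    unfold resProd histEnergy
    simp only [En_tailSet_sub A]
    rw [Finset.prod_range_succ', mul_comm]
    congr 1
    · have : (tailSet n 0)ᶜ = ∅ := by simp [tailSet]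
      rw [this, En_empty]
    · refine Finset.prod_congr rfl fun q hq => ?_
      have hq' := Finset.mem_range.1 hq
      rw [res, hk'x, image_finOf_range x (by omega), hk', En_update_of_notMem]
      rw [Finset.mem_compl, not_not, tailSet, Finset.mem_filter]
      exact ⟨Finset.mem_univ _, by omega⟩
  have e2 : resProd t (Finset.Ico ((x : ℕ) + 1) (n + 1)) (histEnergy S p σ k) a.2.1 =
      ENNReal.ofReal (rh t (a.2.1 - S.e p)) * ∏ q ∈ Finset.range (n - 1 - x), res t a.2.1
        (fun k => S.En p ((Finset.range (q + 1)).image fun q => finOf x (n - 1 - q)) σ k) k' := by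
    unfold resProd histEnergy
    rw [prod_Ico_split]
    congr 1
    · rw [tailSet_of_le le_rfl, En_empty]
    · refine Finset.prod_congr rfl fun q hq => ?_
      have hq' := Finset.mem_range.1 hq
      rw [res, image_finOf_reflect x (by omega), hk', En_update_of_notMem]
      rw [tailSet, Finset.mem_filter]
      exact fun h => by have := h.2; omega
  have e3 : resProd t (keptIdx π P) (conjEnergy S π p σ k) a.2.2 =
      ENNReal.ofReal (rh t (a.2.2 - S.e p)) *
        ∏ b ∈ P, res t a.2.2 (S.En p (permTail π (π b)) σ) k' := by
    unfold resProd conjEnergy keptIdx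
    rw [Finset.prod_insert (n_notMem_image π P), Finset.prod_image (injOn_perm_val π P)]
    congr 1
    · rw [permTail_of_le π le_rfl, En_empty]
    · refine Finset.prod_congr rfl fun b hb => ?_
      rw [res, hk', En_update_of_notMem]
      -- The energies of the peaks do not contain k_x, so replacing k_x by the left-end momentum
      -- does not change them.
      have hxb : π x < π b := by
        rcases hP with hP | hP
        · exact (hP b hb).2.2.1 x le_rfl (hP b hb).1
        · exact (hP b hb).2.2.1 x (hP b hb).1 le_rfl
      rw [permTail, Finset.mem_filter]
      exact fun h => (not_le.2 hxb) h.2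
  have hw : ENNReal.ofReal (∏ i, wt (d + 1) (k i)) ≤
      (∏ q ∈ Finset.range x, ENNReal.ofReal (wt (d + 1) (k' (finOf x q)))) *
        ∏ q ∈ Finset.range (n - 1 - x), ENNReal.ofReal (wt (d + 1) (k' (finOf x (n - 1 - q)))) := by
    rw [ENNReal.ofReal_prod_of_nonneg fun i _ => (wt_pos _ _).le, prod_fin_split x]
    -- The weight of k_x is given up; the weight of ∑ k takes its place in the new variable.
    refine (mul_le_of_le_one_left (by simp) (ENNReal.ofReal_le_one.2 (wt_le_one _ _))).trans
      (le_of_eq ?_)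
    congr 1
    · exact Finset.prod_congr rfl fun q hq => by rw [hkL q (Finset.mem_range.1 hq)]
    · exact Finset.prod_congr rfl fun q hq => by rw [hkR q (Finset.mem_range.1 hq)]
  rw [e1, e2, e3, treeIntegrand, hk'x, rootFactor, add_sub_cancel_left]
  unfold chainFactor
  rw [Finset.prod_mul_distrib, Finset.prod_mul_distrib,
    ENNReal.ofReal_mul (Finset.prod_nonneg fun i _ => (wt_pos _ _).le)]
  refine (mul_le_mul_left (mul_le_mul_left hw _) _).trans (le_of_eq ?_)
  ring

/-- The constant in the pointwise bound of the integrand of a pairing. -/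
def pairingConst (K : Constants) (d n m : ℕ) (t b : ℝ) : ℝ :=
  4 ^ (2 * n + 8) * t ^ (n + 1 - m) *
    ((5 * growthBound K + 1) ^ 8 * b ^ 16 * (4 ^ 8 * 2 ^ (d + 1)) ^ n)

/-- Pointwise in k, the three groups of resolvents with their variables α become one integral over
ℝ³, and the phonon weights absorb the powers of the energy bound. -/
lemma pairing_integrand_le (A : Assumptions K S) (hd : 3 ≤ d) (ht : 1 ≤ t) (hn : 3 ≤ n)
    {π : Equiv.Perm (Fin n)} {x : Fin n} {P : Finset (Fin n)}
    (hP : RightPeaks π x P ∨ LeftPeaks π x P) (σ : Fin n → ℤˣ) (p : Mom d) (k : Fin n → Mom d) :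
    (∏ i, ENNReal.ofReal (wt (4 * d + 23) (k i))) *
        ((∫⁻ α, ∏ j ∈ Finset.range (n + 1), ENNReal.ofReal (rr t (α - histEnergy S p σ k j))) *
          ∫⁻ α, ∏ j ∈ Finset.range (n + 1), ENNReal.ofReal (rr t (α - conjEnergy S π p σ k j))) ≤
      ENNReal.ofReal (pairingConst K d n P.card t (bracket p)) * ∫⁻ a, treeIntegrand S t π x P σ p a
        (Function.update k x (p + ∑ i, k i)) := by
  have ht0 : 0 < t := by linarith
  have hb := bracket_pos p
  have hcard : P.card ≤ n := by simpa using Finset.card_le_univ P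
  have hG := growthBound_pos K
  have hD : pairingConst K d n P.card t (bracket p) = 4 ^ (2 * n + 8) * t ^ (n + 1 - P.card) *
    ((5 * growthBound K + 1) ^ 8 * bracket p ^ 16 * (4 ^ 8 * 2 ^ (d + 1)) ^ n) := rfl
  have hD0 : 0 ≤ pairingConst K d n P.card t (bracket p) := by rw [hD]; positivity
  set D := pairingConst K d n P.card t (bracket p)
  have h1 := resolvent_products_le ht hn x.2 (E := histEnergy S p σ k)
    (E' := conjEnergy S π p σ k) (one_le_energyBound (K := K) p k)
    (abs_sum_sgn_le_energyBound A hd Finset.univ σ p k) (fun j => abs_En_le A hd _ σ p k)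
    (fun j => abs_En_le A hd _ σ p k) (keptIdx_subset π P)
  rw [card_keptIdx, show n + 2 - (P.card + 1) = n + 1 - P.card by omega] at h1
  have h2 := prod_wt_mul_energyBound_le (K := K) p k hd
  rw [Fintype.card_fin] at h2
  have hm : ∀ (s : Finset ℕ) (f : ℕ → ℝ), Measurable fun α => ENNReal.ofReal (jw α) * resProd t s f α :=
    fun s f => Measurable.mul (by fun_prop) (measurable_resProd ht0 s f)
  set f₁ : ℕ → ℝ := fun j => histEnergy S p σ k j - ∑ i, sgn (σ i) * S.ω (k i)
  have h3 : ENNReal.ofReal ((∏ i, wt (d + 1) (k i)) * wt (d + 1) (∑ i, k i)) *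
      (resInt t (Finset.range ((x : ℕ) + 1)) f₁ *
      resInt t (Finset.Ico ((x : ℕ) + 1) (n + 1)) (histEnergy S p σ k) *
      resInt t (keptIdx π P) (conjEnergy S π p σ k)) ≤
      ∫⁻ a, treeIntegrand S t π x P σ p a (Function.update k x (p + ∑ i, k i)) := by
    refine le_trans (le_of_eq ?_) (lintegral_mono fun a => resProd_le_treeIntegrand A hP σ p k a)
    have hm2 : Measurable fun b : ℝ × ℝ =>
        (ENNReal.ofReal (jw b.1) * resProd t (Finset.Ico ((x : ℕ) + 1) (n + 1)) (histEnergy S p σ k) b.1) *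
        (ENNReal.ofReal (jw b.2) * resProd t (keptIdx π P) (conjEnergy S π p σ k) b.2) :=
      ((hm _ _).comp measurable_fst).mul ((hm _ _).comp measurable_snd)
    have hm3 : Measurable fun a : ℝ × ℝ × ℝ =>
        (ENNReal.ofReal (jw a.1) * resProd t (Finset.range ((x : ℕ) + 1)) f₁ a.1) *
        ((ENNReal.ofReal (jw a.2.1) *
          resProd t (Finset.Ico ((x : ℕ) + 1) (n + 1)) (histEnergy S p σ k) a.2.1) *
        (ENNReal.ofReal (jw a.2.2) * resProd t (keptIdx π P) (conjEnergy S π p σ k) a.2.2)) :=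
      ((hm _ _).comp measurable_fst).mul (hm2.comp measurable_snd)
    rw [lintegral_const_mul _ hm3, Measure.volume_eq_prod,
      lintegral_prod_mul (hm _ f₁).aemeasurable hm2.aemeasurable, Measure.volume_eq_prod,
      lintegral_prod_mul (hm _ _).aemeasurable (hm _ _).aemeasurable]
    simp only [resInt]
    ring
  have hw0 : 0 ≤ (∏ i, wt (d + 1) (k i)) * wt (d + 1) (∑ i, k i) :=
    mul_nonneg (Finset.prod_nonneg fun i _ => (wt_pos _ _).le) (wt_pos _ _).le
  have hw1 : 0 ≤ ∏ i, wt (4 * d + 23) (k i) := Finset.prod_nonneg fun i _ => (wt_pos _ _).le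
  refine (mul_le_mul_right h1 _).trans ?_
  rw [← mul_assoc, ← ENNReal.ofReal_prod_of_nonneg fun i _ => (wt_pos _ _).le,
    ← ENNReal.ofReal_mul hw1]
  refine le_trans (mul_le_mul_left (ENNReal.ofReal_le_ofReal (?_ : _ ≤ D *
    ((∏ i, wt (d + 1) (k i)) * wt (d + 1) (∑ i, k i)))) _) ?_
  · calc _ = 4 ^ (2 * n + 8) * t ^ (n + 1 - P.card) *
          ((∏ i, wt (4 * d + 23) (k i)) * energyBound K p k ^ 8) := by ring
      _ ≤ 4 ^ (2 * n + 8) * t ^ (n + 1 - P.card) * ((5 * growthBound K + 1) ^ 8 * bracket p ^ 16 *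
          (4 ^ 8 * 2 ^ (d + 1)) ^ n * ((∏ i, wt (d + 1) (k i)) * wt (d + 1) (∑ i, k i))) :=
        mul_le_mul_of_nonneg_left h2 (by positivity)
      _ = _ := by rw [hD]; ring
  · rw [ENNReal.ofReal_mul hD0, mul_assoc]
    exact mul_le_mul_right h3 _

lemma lintegral_lintegral_shear {Y : Type*} [MeasureSpace Y] [SFinite (volume : Measure Y)]
    {F : Y → (Fin n → Mom d) → ℝ≥0∞} (hF : Measurable fun y : Y × (Fin n → Mom d) => F y.1 y.2)
    (x : Fin n) (p : Mom d) (D : ℝ≥0∞) :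
    ∫⁻ k, D * ∫⁻ a, F a (Function.update k x (p + ∑ i, k i)) = D * ∫⁻ a, ∫⁻ k, F a k := by
  have hmsh : Measurable fun k : Fin n → Mom d => Function.update k x (p + ∑ i, k i) := by
    refine measurable_pi_lambda _ fun i => ?_
    by_cases hi : i = x
    · subst hi; simp only [Function.update_self]; fun_prop
    · simp only [Function.update_of_ne hi]; fun_prop
  have hmq : Measurable fun z : (Fin n → Mom d) × Y =>
      F z.2 (Function.update z.1 x (p + ∑ i, z.1 i)) :=
    hF.comp (measurable_snd.prodMk (hmsh.comp measurable_fst))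
  have hma : ∀ a, Measurable (F a) := fun a => hF.comp (measurable_const.prodMk measurable_id)
  rw [lintegral_const_mul _ hmq.lintegral_prod_right', lintegral_lintegral_swap
    (f := fun k a => F a (Function.update k x (p + ∑ i, k i))) hmq.aemeasurable]
  exact congrArg _ (lintegral_congr fun a => lintegral_shear x p (hma a))

lemma measurable_lintegral_rootFactor (A : Assumptions K S) (hd : 3 ≤ d) (ht : 0 < t) (p : Mom d) :
    Measurable fun a => ∫⁻ y, rootFactor S t p a y := by
  have h1 := (A.e_growth hd).continuous.measurable
  have h2 := (continuous_rh ht).measurable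
  have hm : Measurable fun z : (ℝ × ℝ × ℝ) × Mom d => rootFactor S t p z.1 z.2 := by
    unfold rootFactor; fun_prop
  exact hm.lintegral_prod_right'

/-- Bookkeeping: the n - 1 + m logarithms of the chains and the 3 of the root add up to n + m + 2,
and n-independent constants are raised to the power n. -/
lemma pairingConst_mul_le {C₁ I b l : ℝ} (hC₁ : 1 ≤ C₁) (hI : 1 ≤ I) (hb : 0 < b) (hl : 1 ≤ l)
    (ht : 0 < t) (hn : 3 ≤ n) {m : ℕ} (hm : m ≤ n) :
    pairingConst K d n m t b * ((C₁ * l) ^ (n - 1 + m) * (I * (10 * l) ^ 3)) ≤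
      ((4 ^ 8 * (5 * growthBound K + 1) ^ 8 * I * 10 ^ 3) *
        (4 ^ 2 * (4 ^ 8 * 2 ^ (d + 1)) * C₁ ^ 2)) ^ n * b ^ 16 * t ^ (n + 1 - m) * l ^ (n + m + 2) := by
  have hG : 1 ≤ 5 * growthBound K + 1 := by linarith [growthBound_pos K]
  unfold pairingConst
  set G := 5 * growthBound K + 1
  set c₀ : ℝ := 4 ^ 8 * G ^ 8 * I * 10 ^ 3 with hc₀
  have hc₀1 : 1 ≤ c₀ := by
    have : 1 ≤ G ^ 8 := one_le_pow₀ hG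
    have h4 : (1 : ℝ) ≤ 4 ^ 8 * G ^ 8 * I := one_le_mul_of_one_le_of_one_le
      (one_le_mul_of_one_le_of_one_le (by norm_num) this) hI
    rw [hc₀]; linarith
  have e1 : C₁ ^ (n - 1 + m) ≤ (C₁ ^ 2) ^ n := by
    rw [← pow_mul]; exact pow_le_pow_right₀ hC₁ (by omega)
  have e2 : c₀ ≤ c₀ ^ n := le_self_pow₀ hc₀1 (by omega)
  calc _ = c₀ * ((4 ^ 2) ^ n * (4 ^ 8 * 2 ^ (d + 1)) ^ n * C₁ ^ (n - 1 + m)) *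
        b ^ 16 * t ^ (n + 1 - m) * (l ^ (n - 1 + m) * l ^ 3) := by
        rw [hc₀, mul_pow C₁, mul_pow (10 : ℝ), pow_add 4, pow_mul]; ring
    _ ≤ c₀ ^ n * ((4 ^ 2) ^ n * (4 ^ 8 * 2 ^ (d + 1)) ^ n * (C₁ ^ 2) ^ n) *
        b ^ 16 * t ^ (n + 1 - m) * (l ^ (n - 1 + m) * l ^ 3) := by gcongr
    _ = _ := by
        rw [← pow_add, show n - 1 + m + 3 = n + m + 2 by omega, mul_pow c₀,
          mul_pow (4 ^ 2 * (4 ^ 8 * 2 ^ (d + 1)) : ℝ), mul_pow (4 ^ 2 : ℝ)]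

/-- The momentum integral of a pairing in which the conjugate history gains at the peaks `P`. -/
theorem pairing_integral_bound (hd : 3 ≤ d) (K : Constants) : ∃ C : ℝ, 1 ≤ C ∧
    ∀ S : Model d, Assumptions K S → ∀ t : ℝ, 1 ≤ t → ∀ n : ℕ, 3 ≤ n →
    ∀ (π : Equiv.Perm (Fin n)) (x : Fin n) (P : Finset (Fin n)),
      RightPeaks π x P ∨ LeftPeaks π x P → ∀ (σ : Fin n → ℤˣ) (p : Mom d),
      ∫⁻ k : Fin n → Mom d, (∏ i, ENNReal.ofReal (wt (4 * d + 23) (k i))) *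
        ((∫⁻ α, ∏ j ∈ Finset.range (n + 1), ENNReal.ofReal (rr t (α - histEnergy S p σ k j))) *
          ∫⁻ α, ∏ j ∈ Finset.range (n + 1), ENNReal.ofReal (rr t (α - conjEnergy S π p σ k j))) ≤
      ENNReal.ofReal (C ^ n * bracket p ^ 16 * t ^ (n + 1 - P.card) *
        logStar t ^ (n + P.card + 2)) := by
  obtain ⟨C₁, hC₁, h⟩ := lintegral_treeIntegrand_le (d := d) hd K
  obtain ⟨I, hI⟩ : ∃ I : ℝ, (∫⁻ y : Mom d, ENNReal.ofReal (wt (d + 1) y)) ≤ ENNReal.ofReal I ∧ 1 ≤ I := by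
    have hi := (integrable_wt (d := d) (a := d + 1) (by omega))
    refine ⟨max 1 (∫ y : Mom d, wt (d + 1) y), ?_, le_max_left _ _⟩
    rw [← ofReal_integral_eq_lintegral_ofReal hi (Eventually.of_forall fun y => (wt_pos _ _).le)]
    exact ENNReal.ofReal_le_ofReal (le_max_right _ _)
  have hG : 1 ≤ 5 * growthBound K + 1 := by linarith [growthBound_pos K]
  refine ⟨(4 ^ 8 * (5 * growthBound K + 1) ^ 8 * I * 10 ^ 3) *
    (4 ^ 2 * (4 ^ 8 * 2 ^ (d + 1)) * C₁ ^ 2), ?_, ?_⟩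
  · have h1 : 1 ≤ (5 * growthBound K + 1) ^ 8 := one_le_pow₀ hG
    have h2 : (1 : ℝ) ≤ 2 ^ (d + 1) := one_le_pow₀ (by norm_num)
    have h3 : 1 ≤ C₁ ^ 2 := one_le_pow₀ hC₁
    refine one_le_mul_of_one_le_of_one_le (one_le_mul_of_one_le_of_one_le
      (one_le_mul_of_one_le_of_one_le (one_le_mul_of_one_le_of_one_le (by norm_num) h1) hI.2)
      (by norm_num)) (one_le_mul_of_one_le_of_one_le (one_le_mul_of_one_le_of_one_le (by norm_num)
      (one_le_mul_of_one_le_of_one_le (by norm_num) h2)) h3)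
  intro S A t ht n hn π x P hP σ p
  have ht0 : 0 < t := by linarith
  have hl := logStar_ge_one t
  have hb := bracket_pos p
  have hcard : P.card ≤ n := by simpa using Finset.card_le_univ P
  have hI0 : 0 ≤ I := by linarith [hI.2]
  have hD0 : 0 ≤ pairingConst K d n P.card t (bracket p) := by unfold pairingConst; positivity
  refine (lintegral_mono fun k => pairing_integrand_le A hd ht hn hP σ p k).trans ?_
  rw [lintegral_lintegral_shear (measurable_treeIntegrand A hd ht0 π x P σ p)]
  have h5 : ∫⁻ a, ∫⁻ k, treeIntegrand S t π x P σ p a k ≤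
      ENNReal.ofReal (C₁ * logStar t) ^ (n - 1 + P.card) *
        (ENNReal.ofReal I * ENNReal.ofReal (10 * logStar t) ^ 3) := by
    refine (lintegral_mono fun a => h S A t ht n π x P hP σ p a).trans ?_
    rw [lintegral_const_mul _ (measurable_lintegral_rootFactor A hd ht0 p)]
    exact mul_le_mul_right ((lintegral_rootFactor_le A hd ht p).trans (mul_le_mul_left hI.1 _)) _
  refine (mul_le_mul_right h5 _).trans ?_
  rw [← ENNReal.ofReal_pow (by positivity), ← ENNReal.ofReal_pow (by positivity),
    ← ENNReal.ofReal_mul hI0, ← ENNReal.ofReal_mul (by positivity), ← ENNReal.ofReal_mul hD0]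
  exact ENNReal.ofReal_le_ofReal (pairingConst_mul_le hC₁ hI.2 hb hl ht0 hn hcard)

end

/-! ### Staircases -/

section

variable {n κ : ℕ} {π : Equiv.Perm (Fin n)}

lemma height_eq {a : ℕ} (h1 : 1 ≤ a) (h2 : a ≤ n) :
    height π a = (π ⟨a - 1, by omega⟩ : ℕ) + 1 := by
  simp [height, h1, h2]

lemma height_coe_succ (i : Fin n) : height π (i + 1) = (π i : ℕ) + 1 := by
  rw [height_eq (by omega) (by omega)]
  simp

lemma height_injOn {a b : ℕ} (ha : 1 ≤ a ∧ a ≤ n) (hb : 1 ≤ b ∧ b ≤ n)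
    (h : height π a = height π b) : a = b := by
  rw [height_eq ha.1 ha.2, height_eq hb.1 hb.2] at h
  have h1 := π.injective (Fin.ext (Nat.succ_injective h))
  have h2 := congrArg Fin.val h1
  simp only at h2
  omega

/-- An interval without high peaks stays below the maximum of its endpoints. -/
lemma height_le_of_no_peak {u v c : ℕ} (hu : 1 ≤ u) (hv : v ≤ n)
    (hp : ¬ ∃ m, IsPeak π m ∧ u < m ∧ m < v ∧ c < height π m) (hcu : height π u ≤ c)
    (hcv : height π v ≤ c) {i : ℕ} (hi : u ≤ i) (hi' : i ≤ v) : height π i ≤ c := by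
  by_contra hcon
  -- Heights are distinct, so a maximum in the interior would be a peak higher than c.
  obtain ⟨m, hm, hmax⟩ := Finset.exists_max_image (Finset.Icc u v) (height π)
    ⟨i, Finset.mem_Icc.2 ⟨hi, hi'⟩⟩
  rw [Finset.mem_Icc] at hm
  have hmi := hmax i (Finset.mem_Icc.2 ⟨hi, hi'⟩)
  have hmu : m ≠ u := by rintro rfl; omega
  have hmv : m ≠ v := by rintro rfl; omega
  have hlt : ∀ l, u ≤ l → l ≤ v → l ≠ m → height π l < height π m := fun l h1 h2 h3 =>
    lt_of_le_of_ne (hmax l (Finset.mem_Icc.2 ⟨h1, h2⟩)) fun h =>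
      h3 (height_injOn ⟨by omega, by omega⟩ ⟨by omega, by omega⟩ h)
  exact hp ⟨m, ⟨by omega, by omega, hlt _ (by omega) (by omega) (by omega),
    hlt _ (by omega) (by omega) (by omega)⟩, by omega, by omega, by omega⟩

lemma IsUpStair.lt {a h : ℕ} (H : IsUpStair π a h) {i : ℕ} (h1 : a ≤ i) (h2 : i < a + h) :
    height π i < height π (a + h) := by
  have key : ∀ l, ∀ i, i < l → l ≤ h → height π (a + i) < height π (a + l) := by
    intro l
    induction l with
    | zero => intro i hi; omega
    | succ l ih =>
      intro i hi hl
      have h3 := H.2.2.2 l (by omega)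
      rcases Nat.lt_succ_iff_lt_or_eq.1 hi with h4 | rfl
      · exact (ih i h4 (by omega)).trans h3
      · exact h3
  have := key h (i - a) (by omega) le_rfl
  rwa [show a + (i - a) = i by omega] at this

lemma IsDownStair.lt {a h : ℕ} (H : IsDownStair π a h) {i : ℕ} (h1 : a < i) (h2 : i ≤ a + h) :
    height π i < height π a := by
  have key : ∀ l, 1 ≤ l → l ≤ h → height π (a + l) < height π a := by
    intro l
    induction l with
    | zero => intro hi; omega
    | succ l ih =>
      intro _ hl
      have h3 := H.2.2.2 l (by omega)
      rcases Nat.eq_zero_or_pos l with rfl | h4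
      · exact h3
      · exact h3.trans (ih h4 (by omega))
  have := key (i - a) (by omega) (by omega)
  rwa [show a + (i - a) = i by omega] at this

namespace IsIncreasingStaircase

variable {a h : Fin κ → ℕ} (H : IsIncreasingStaircase π κ a h)
include H

lemma start_le {j : ℕ} (hj : j < κ) : a ⟨0, by omega⟩ ≤ a ⟨j, hj⟩ := by
  induction j with
  | zero => exact le_rfl
  | succ j ih =>
    have := H.disjoint ⟨j, by omega⟩ ⟨j + 1, hj⟩ rfl
    have := ih (by omega)
    omega

/-- Induction on the stairs. Up to the previous top the hypothesis applies. Between that top and the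
start of the next stair there is no higher peak, and the start lies below that top, so
`height_le_of_no_peak` applies. Along the stair itself heights increase. -/
lemma height_lt {j : ℕ} (hj : j < κ) {i : ℕ} (h1 : a ⟨0, by omega⟩ ≤ i)
    (h2 : i < a ⟨j, hj⟩ + h ⟨j, hj⟩) : height π i < height π (a ⟨j, hj⟩ + h ⟨j, hj⟩) := by
  induction j generalizing i with
  | zero => exact (H.stair _).lt h1 h2
  | succ j ih =>
    have hj' : j < κ := by omega
    have hinc := H.increasing ⟨j, hj'⟩ ⟨j + 1, hj⟩ rfl
    have hov := H.overlap ⟨j, hj'⟩ ⟨j + 1, hj⟩ rfl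
    have hdis := H.disjoint ⟨j, hj'⟩ ⟨j + 1, hj⟩ rfl
    have hst := H.stair ⟨j + 1, hj⟩
    have hst' := H.stair ⟨j, hj'⟩
    rcases lt_or_ge i (a ⟨j, hj'⟩ + h ⟨j, hj'⟩) with h3 | h3
    · exact (ih hj' h1 h3).trans hinc
    · rcases lt_or_ge i (a ⟨j + 1, hj⟩) with h4 | h4
      · refine lt_of_le_of_lt (height_le_of_no_peak (u := a ⟨j, hj'⟩ + h ⟨j, hj'⟩)
          (v := a ⟨j + 1, hj⟩) ?_ ?_ ?_ le_rfl hov.2.le h3 h4.le) hinc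
        · have := hst'.2.1; omega
        · have := hst.2.2.1; omega
        · rintro ⟨m, hm, h5, h6, h7⟩
          exact H.no_peak ⟨j, hj'⟩ ⟨j + 1, hj⟩ rfl ⟨m, hm, by omega, h6, h7⟩
      · exact hst.lt h4 h2

lemma top_injective : Function.Injective fun j => a j + h j := by
  have key : ∀ i j : ℕ, ∀ (hi : i < κ) (hj : j < κ), i < j →
      a ⟨i, hi⟩ + h ⟨i, hi⟩ < a ⟨j, hj⟩ + h ⟨j, hj⟩ := by
    intro i j hi hj hij
    induction j with
    | zero => omega
    | succ j ih =>
      have h1 := H.disjoint ⟨j, by omega⟩ ⟨j + 1, hj⟩ rfl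
      rcases Nat.lt_succ_iff_lt_or_eq.1 hij with h2 | rfl
      · have := ih (by omega) h2; omega
      · omega
  intro i j hij
  have hij' : a i + h i = a j + h j := hij
  rcases lt_trichotomy (i : ℕ) j with h1 | h1 | h1
  · have := key i j i.2 j.2 h1; simp only [Fin.eta] at this; omega
  · exact Fin.ext h1
  · have := key j i j.2 i.2 h1; simp only [Fin.eta] at this; omega

lemma exists_rightPeaks (hκ : 1 ≤ κ) :
    ∃ x P, P.card = κ ∧ RightPeaks π x P := by
  have h0 := H.stair ⟨0, hκ⟩
  have hn : a ⟨0, hκ⟩ - 1 < n := by have := h0.2.1; have := h0.2.2.1; have := h0.1; omega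
  have hb : ∀ j, a j + h j - 1 < n := fun j => by have := (H.peak j).2.1; omega
  have hinj : Function.Injective fun j : Fin κ => (⟨a j + h j - 1, hb j⟩ : Fin n) := fun i j hij => by
    have := congrArg Fin.val hij
    simp only at this
    refine H.top_injective (?_ : a i + h i = a j + h j)
    have := (H.peak i).1; have := (H.peak j).1; omega
  -- x is the start of the first stair and P the set of all tops; stairs are labelled from 1 and
  -- `Fin n` from 0.
  refine ⟨⟨a ⟨0, hκ⟩ - 1, hn⟩, Finset.univ.image fun j => ⟨a j + h j - 1, hb j⟩, ?_, ?_⟩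
  · rw [Finset.card_image_of_injective _ hinj, Finset.card_univ, Fintype.card_fin]
  · intro b hb'
    obtain ⟨j, -, rfl⟩ := Finset.mem_image.1 hb'
    have hp := H.peak j
    have hs := H.start_le j.2
    have hst := H.stair j
    have h01 := h0.2.1
    simp only [Fin.eta] at hs
    have hval : height π (a j + h j) = (π ⟨a j + h j - 1, hb j⟩ : ℕ) + 1 :=
      height_eq (by have := hp.1; omega) hp.2.1.le
    have hlt : ∀ i : Fin n, height π (i + 1) < height π (a j + h j) →
        π i < π ⟨a j + h j - 1, hb j⟩ := fun i hi => by
      rw [height_coe_succ, hval] at hi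
      rw [Fin.lt_def]; omega
    refine ⟨?_, ?_, fun i h1 h2 => hlt i ?_, fun i hi => hlt i ?_⟩
    · rw [Fin.lt_def]; have := hst.1; simp only; omega
    · have := hp.2.1; have := hp.1; simp only; omega
    · rw [Fin.le_def] at h1; rw [Fin.lt_def] at h2
      simp only at h1 h2
      exact H.height_lt j.2 (by omega) (by simp only [Fin.eta]; omega)
    · simp only at hi
      have := hp.1
      rw [show (i : ℕ) + 1 = a j + h j + 1 by omega]
      exact hp.2.2.2

end IsIncreasingStaircase

namespace IsDecreasingStaircase

variable {a h : Fin κ → ℕ} (H : IsDecreasingStaircase π κ a h)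
include H

lemma le_end {j l : ℕ} (hjl : j + l < κ) :
    a ⟨j, by omega⟩ + h ⟨j, by omega⟩ ≤ a ⟨j + l, hjl⟩ + h ⟨j + l, hjl⟩ := by
  induction l with
  | zero => exact le_rfl
  | succ l ih =>
    have := H.disjoint ⟨j + l, by omega⟩ ⟨j + (l + 1), hjl⟩ rfl
    have := ih (by omega)
    omega

/-- Induction on the number l of stairs after the m-th one, by the mirror image of the increasing
case. -/
lemma height_lt {m l : ℕ} (hl : m + l + 1 = κ) {i : ℕ} (h1 : a ⟨m, by omega⟩ < i)
    (h2 : i ≤ a ⟨m + l, by omega⟩ + h ⟨m + l, by omega⟩) :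
    height π i < height π (a ⟨m, by omega⟩) := by
  induction l generalizing m i with
  | zero => exact (H.stair _).lt h1 h2
  | succ l ih =>
    have hj : m + 1 < κ := by omega
    have hj' : m < κ := by omega
    have hdec := H.decreasing ⟨m, hj'⟩ ⟨m + 1, hj⟩ rfl
    have hov := H.overlap ⟨m, hj'⟩ ⟨m + 1, hj⟩ rfl
    have hdis := H.disjoint ⟨m, hj'⟩ ⟨m + 1, hj⟩ rfl
    have hst := H.stair ⟨m + 1, hj⟩
    have hst' := H.stair ⟨m, hj'⟩
    rcases le_or_gt i (a ⟨m, hj'⟩ + h ⟨m, hj'⟩) with h3 | h3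
    · exact hst'.lt h1 h3
    · rcases le_or_gt i (a ⟨m + 1, hj⟩) with h4 | h4
      · refine lt_of_le_of_lt (height_le_of_no_peak (u := a ⟨m, hj'⟩ + h ⟨m, hj'⟩)
          (v := a ⟨m + 1, hj⟩) ?_ ?_ ?_ hov.2.le le_rfl h3.le h4) hdec
        · have := hst'.2.1; omega
        · have := hst.2.2.1; omega
        · rintro ⟨q, hq, h5, h6, h7⟩
          exact H.no_peak ⟨m, hj'⟩ ⟨m + 1, hj⟩ rfl ⟨q, hq, by omega, h6, h7⟩
      · refine (ih (m := m + 1) (by omega) h4 ?_).trans hdec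
        have e : (⟨m + 1 + l, by omega⟩ : Fin κ) = ⟨m + (l + 1), by omega⟩ := Fin.ext (by simp; omega)
        rw [e]; exact h2

lemma bottom_injective : Function.Injective a := by
  have key : ∀ i j : ℕ, ∀ (hi : i < κ) (hj : j < κ), i < j → a ⟨i, hi⟩ < a ⟨j, hj⟩ := by
    intro i j hi hj hij
    induction j with
    | zero => omega
    | succ j ih =>
      have h1 := H.disjoint ⟨j, by omega⟩ ⟨j + 1, hj⟩ rfl
      rcases Nat.lt_succ_iff_lt_or_eq.1 hij with h2 | rfl
      · have := ih (by omega) h2; omega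
      · omega
  intro i j hij
  rcases lt_trichotomy (i : ℕ) j with h1 | h1 | h1
  · have := key i j i.2 j.2 h1; simp only [Fin.eta] at this; omega
  · exact Fin.ext h1
  · have := key j i j.2 i.2 h1; simp only [Fin.eta] at this; omega

lemma exists_leftPeaks (hκ : 1 ≤ κ) :
    ∃ x P, P.card = κ ∧ LeftPeaks π x P := by
  have hlast : κ - 1 < κ := by omega
  have h0 := H.stair ⟨κ - 1, hlast⟩
  have hn : a ⟨κ - 1, hlast⟩ + h ⟨κ - 1, hlast⟩ - 1 < n := by
    have := h0.2.1; have := h0.2.2.1; have := h0.1; omega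
  have hb : ∀ j, a j - 1 < n := fun j => by have := (H.peak j).2.1; omega
  have hinj : Function.Injective fun j : Fin κ => (⟨a j - 1, hb j⟩ : Fin n) := fun i j hij => by
    have := congrArg Fin.val hij
    simp only at this
    refine H.bottom_injective ?_
    have := (H.peak i).1; have := (H.peak j).1; omega
  -- x is the lower end of the last stair and P the set of all tops, which lie to its left.
  refine ⟨⟨a ⟨κ - 1, hlast⟩ + h ⟨κ - 1, hlast⟩ - 1, hn⟩, Finset.univ.image fun j => ⟨a j - 1, hb j⟩,
    ?_, ?_⟩
  · rw [Finset.card_image_of_injective _ hinj, Finset.card_univ, Fintype.card_fin]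
  · intro b hb'
    obtain ⟨j, -, rfl⟩ := Finset.mem_image.1 hb'
    have hp := H.peak j
    have hj := j.2
    have e : (⟨(j : ℕ) + (κ - 1 - j), by omega⟩ : Fin κ) = ⟨κ - 1, hlast⟩ := Fin.ext (by simp; omega)
    have hs := H.le_end (j := j) (l := κ - 1 - j) (by omega)
    rw [e] at hs
    simp only [Fin.eta] at hs
    have hst := H.stair j
    have hval : height π (a j) = (π ⟨a j - 1, hb j⟩ : ℕ) + 1 :=
      height_eq (by have := hp.1; omega) hp.2.1.le
    have hlt : ∀ i : Fin n, height π (i + 1) < height π (a j) →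
        π i < π ⟨a j - 1, hb j⟩ := fun i hi => by
      rw [height_coe_succ, hval] at hi
      rw [Fin.lt_def]; omega
    refine ⟨?_, ?_, fun i h1 h2 => hlt i ?_, fun i hi => hlt i ?_⟩
    · rw [Fin.lt_def]; have := hst.1; have := hst.2.1; simp only; omega
    · have := hp.1; simp only; omega
    · rw [Fin.lt_def] at h1; rw [Fin.le_def] at h2
      simp only at h1 h2
      have := H.height_lt (m := j) (l := κ - 1 - j) (by omega) (i := i + 1)
        (by simp only [Fin.eta]; omega) (by rw [e]; have := hst.2.1; have := h0.2.1; omega)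
      simpa only [Fin.eta] using this
    · simp only at hi
      have := hp.1
      rw [show (i : ℕ) + 1 = a j - 1 by omega]
      exact hp.2.2.1

end IsDecreasingStaircase

/-- A staircase provides `κ` positions at which the conjugate history gains. -/
theorem exists_peaks (hκ : 1 ≤ κ) (h : (∃ a h : Fin κ → ℕ, IsIncreasingStaircase π κ a h) ∨
    ∃ a h : Fin κ → ℕ, IsDecreasingStaircase π κ a h) :
    3 ≤ n ∧ ∃ x P, P.card = κ ∧ (RightPeaks π x P ∨ LeftPeaks π x P) := by
  rcases h with ⟨a, h, H⟩ | ⟨a, h, H⟩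
  · obtain ⟨x, P, hP, hR⟩ := H.exists_rightPeaks hκ
    have hp := H.peak ⟨0, hκ⟩
    exact ⟨by have := hp.1; have := hp.2.1; omega, x, P, hP, .inl hR⟩
  · obtain ⟨x, P, hP, hR⟩ := H.exists_leftPeaks hκ
    have hp := H.peak ⟨0, hκ⟩
    exact ⟨by have := hp.1; have := hp.2.1; omega, x, P, hP, .inr hR⟩

end

/-! ### The resolvent of a uniformly convex phase, averaged over the momentum -/

/-- A bounded primitive of `x / (x² + η²) - x / (x² + 1)`. -/
def logRatio (η x : ℝ) : ℝ := (Real.log (x ^ 2 + η ^ 2) - Real.log (x ^ 2 + 1)) / 2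

/-- The derivative of `logRatio`. -/
def logRatio' (η x : ℝ) : ℝ := x / (x ^ 2 + η ^ 2) - x / (x ^ 2 + 1)

section

variable {η : ℝ}

lemma hasDerivAt_logRatio (hη : 0 < η) (x : ℝ) : HasDerivAt (logRatio η) (logRatio' η x) x := by
  have h : ∀ c : ℝ, 0 < c → HasDerivAt (fun x : ℝ => Real.log (x ^ 2 + c)) (2 * x / (x ^ 2 + c)) x :=
    fun c hc => by
      have := ((hasDerivAt_pow 2 x).add_const c).log (by positivity)
      simpa using this
  exact (((h (η ^ 2) (by positivity)).sub (h 1 one_pos)).div_const 2).congr_deriv (by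
    unfold logRatio'; ring)

lemma continuous_logRatio' (hη : 0 < η) : Continuous (logRatio' η) := by
  unfold logRatio'
  exact (Continuous.div (by fun_prop) (by fun_prop) fun x => by positivity).sub
    (Continuous.div (by fun_prop) (by fun_prop) fun x => by positivity)

lemma abs_div_sq_add_le (x : ℝ) (hη : 0 < η) : |x / (x ^ 2 + η ^ 2)| ≤ η⁻¹ := by
  rw [abs_div, abs_of_pos (show 0 < x ^ 2 + η ^ 2 by positivity), div_le_iff₀ (by positivity),
    inv_mul_eq_div, le_div_iff₀ hη]
  nlinarith [sq_abs x, sq_nonneg (|x| - η), abs_nonneg x]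

lemma abs_logRatio'_le (hη : 0 < η) (x : ℝ) : |logRatio' η x| ≤ η⁻¹ + 1 := by
  have h1 := abs_div_sq_add_le x hη
  have h2 := abs_div_sq_add_le x one_pos
  rw [one_pow, inv_one] at h2
  exact (abs_sub _ _).trans (add_le_add h1 h2)

lemma abs_logRatio (hη : 0 < η) (hη1 : η ≤ 1) (x : ℝ) :
    |logRatio η x| = Real.log ((x ^ 2 + 1) / (x ^ 2 + η ^ 2)) / 2 := by
  have h0 : 0 < x ^ 2 + η ^ 2 := by positivity
  have h1 : Real.log (x ^ 2 + η ^ 2) ≤ Real.log (x ^ 2 + 1) := Real.log_le_log h0 (by nlinarith)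
  rw [Real.log_div (by positivity) h0.ne', logRatio, abs_of_nonpos (by linarith)]
  ring

/-- Crude in η; it serves only integrability and the boundary terms of the integration by parts. -/
lemma abs_logRatio_le (hη : 0 < η) (hη1 : η ≤ 1) (x : ℝ) : |logRatio η x| ≤ η⁻¹ ^ 2 := by
  rw [abs_logRatio hη hη1]
  have h0 : 0 < x ^ 2 + η ^ 2 := by positivity
  have h1 : (x ^ 2 + 1) / (x ^ 2 + η ^ 2) ≤ η⁻¹ ^ 2 := by
    rw [div_le_iff₀ h0, inv_pow, inv_mul_eq_div, le_div_iff₀ (by positivity)]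
    have : η ^ 2 ≤ 1 := by nlinarith
    nlinarith [sq_nonneg x]
  have h2 := Real.log_le_sub_one_of_pos (show 0 < (x ^ 2 + 1) / (x ^ 2 + η ^ 2) by positivity)
  have h3 : 0 ≤ η⁻¹ ^ 2 := by positivity
  linarith

/-- A logarithm is dominated by any negative power. The power is such that a quadratic contact |x| ≥
c s² still leaves the integrable singularity s^{-1/2}, uniformly in η. -/
lemma abs_logRatio_le_inv_sqrt (hη : 0 < η) (hη1 : η ≤ 1) {c s x : ℝ} (hc : 0 < c) (hs : 0 < s)
    (h : c * s ^ 2 ≤ |x|) : |logRatio η x| ≤ 4 * (1 + c⁻¹) * (Real.sqrt s)⁻¹ := by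
  rw [abs_logRatio hη hη1]
  have hx : 0 < |x| := lt_of_lt_of_le (by positivity) h
  have hx2 : 0 < x ^ 2 := by rw [← sq_abs]; positivity
  set w := Real.sqrt s with hw
  have hw0 : 0 < w := Real.sqrt_pos.2 hs
  have hws : w ^ 2 = s := Real.sq_sqrt hs.le
  set B := 1 + c⁻¹ with hB
  have hc' : 0 < c⁻¹ := by positivity
  have hB1 : 1 ≤ B := by linarith
  -- The eighth power appears because x^{-2} ≤ c^{-2} s^{-4} and s = w².
  have h1 : (x ^ 2 + 1) / (x ^ 2 + η ^ 2) ≤ (1 + B / w) ^ 8 := by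
    have h2 : (x ^ 2 + 1) / (x ^ 2 + η ^ 2) ≤ 1 + (x ^ 2)⁻¹ := by
      rw [div_le_iff₀ (by positivity)]
      have : (x ^ 2)⁻¹ * x ^ 2 = 1 := inv_mul_cancel₀ hx2.ne'
      nlinarith [sq_nonneg η, mul_nonneg (inv_nonneg.2 hx2.le) (sq_nonneg η)]
    have h3 : (x ^ 2)⁻¹ ≤ (B / w) ^ 8 := by
      rw [div_pow, ← one_div, div_le_div_iff₀ hx2 (by positivity)]
      have h4 : c ^ 2 * w ^ 8 ≤ x ^ 2 := by
        have h5 : (c * s ^ 2) ^ 2 ≤ |x| ^ 2 := by gcongr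
        rw [sq_abs, ← hws] at h5
        nlinarith
      have h6 : 1 ≤ B ^ 8 * c ^ 2 := by
        have h7 : 1 ≤ B * c := by rw [hB, add_mul, inv_mul_cancel₀ hc.ne']; linarith
        calc (1 : ℝ) ≤ B ^ 6 * (B * c) ^ 2 :=
              one_le_mul_of_one_le_of_one_le (one_le_pow₀ hB1) (one_le_pow₀ h7)
          _ = _ := by ring
      calc 1 * w ^ 8 ≤ (B ^ 8 * c ^ 2) * w ^ 8 := by gcongr
        _ = B ^ 8 * (c ^ 2 * w ^ 8) := by ring
        _ ≤ B ^ 8 * x ^ 2 := by gcongr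
    have h8 : 0 ≤ B / w := by positivity
    calc _ ≤ 1 + (B / w) ^ 8 := h2.trans (by linarith)
      _ ≤ (1 + B / w) ^ 8 := by
        have : ∀ y : ℝ, 0 ≤ y → 1 + y ^ 8 ≤ (1 + y) ^ 8 := fun y hy => by
          have e : (1 + y) ^ 8 = 1 + y ^ 8 + (8 * y + 28 * y ^ 2 + 56 * y ^ 3 + 70 * y ^ 4 +
            56 * y ^ 5 + 28 * y ^ 6 + 8 * y ^ 7) := by ring
          rw [e]
          have : 0 ≤ 8 * y + 28 * y ^ 2 + 56 * y ^ 3 + 70 * y ^ 4 +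
            56 * y ^ 5 + 28 * y ^ 6 + 8 * y ^ 7 := by positivity
          linarith
        exact this _ h8
  have h9 : Real.log ((x ^ 2 + 1) / (x ^ 2 + η ^ 2)) ≤ 8 * (B / w) := by
    refine (Real.log_le_log (by positivity) h1).trans ?_
    rw [Real.log_pow]
    have := Real.log_le_sub_one_of_pos (show 0 < 1 + B / w by positivity)
    push_cast
    linarith
  rw [div_eq_mul_inv B w] at h9
  linarith

end

lemma lintegral_inv_sqrt_lt_top :
    ∫⁻ x in Set.Ioc (0 : ℝ) 1, ENNReal.ofReal (Real.sqrt x)⁻¹ < ⊤ := by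
  have h1 := (intervalIntegral.intervalIntegrable_rpow' (a := 0) (b := 1)
    (r := -(1 / 2 : ℝ)) (by norm_num)).1
  refine lt_of_le_of_lt (le_of_eq ?_) h1.lintegral_lt_top
  refine setLIntegral_congr_fun measurableSet_Ioc fun x hx => ?_
  rw [Real.rpow_neg hx.1.le, Real.sqrt_eq_rpow]

/-- Uniformity in the two centres matters: a is the component of k₀ along the ray and b the root of
the phase, and neither is under control. -/
lemma lintegral_jw_inv_sqrt : ∃ C : ℝ, 0 ≤ C ∧ ∀ a b : ℝ,
    ∫⁻ r, ENNReal.ofReal (jw (r + a)) * ENNReal.ofReal (Real.sqrt |r - b|)⁻¹ ≤ ENNReal.ofReal C := by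
  set F : ℝ → ℝ≥0∞ := (Set.Ioc (0 : ℝ) 1).indicator fun x => ENNReal.ofReal (Real.sqrt x)⁻¹ with hF
  have hFm : Measurable F := Measurable.indicator (by fun_prop) measurableSet_Ioc
  set I := ∫⁻ x, F x with hI
  have hIt : I ≠ ⊤ := by
    rw [hI, hF, lintegral_indicator measurableSet_Ioc]; exact lintegral_inv_sqrt_lt_top.ne
  refine ⟨Real.pi + 2 * I.toReal, by positivity, fun a b => ?_⟩
  have hpt : ∀ r, ENNReal.ofReal (jw (r + a)) * ENNReal.ofReal (Real.sqrt |r - b|)⁻¹ ≤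
      ENNReal.ofReal (jw (r + a)) + (F (r - b) + F (b - r)) := fun r => by
    have hj : ENNReal.ofReal (jw (r + a)) ≤ 1 := ENNReal.ofReal_le_one.2 (by
      unfold jw; exact inv_le_one_of_one_le₀ (by nlinarith [sq_nonneg (r + a)]))
    rcases le_or_gt 1 |r - b| with h1 | h1
    · refine le_trans (mul_le_of_le_one_right (by simp) (ENNReal.ofReal_le_one.2 ?_)) le_self_add
      exact inv_le_one_of_one_le₀ (Real.one_le_sqrt.2 h1)
    · refine le_trans (mul_le_of_le_one_left (by simp) hj) (le_trans ?_ le_add_self)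
      rcases lt_trichotomy r b with h2 | h2 | h2
      · have h3 : |r - b| = b - r := by rw [abs_of_neg (by linarith)]; ring
        rw [h3] at h1 ⊢
        have : F (b - r) = ENNReal.ofReal (Real.sqrt (b - r))⁻¹ :=
          Set.indicator_of_mem (Set.mem_Ioc.2 ⟨by linarith, h1.le⟩) _
        rw [this]; exact le_add_self
      · simp [h2]
      · have h3 : |r - b| = r - b := abs_of_pos (by linarith)
        rw [h3] at h1 ⊢
        have : F (r - b) = ENNReal.ofReal (Real.sqrt (r - b))⁻¹ :=
          Set.indicator_of_mem (Set.mem_Ioc.2 ⟨by linarith, h1.le⟩) _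
        rw [this]; exact le_self_add
  refine (lintegral_mono hpt).trans ?_
  have hm1 : Measurable fun r => ENNReal.ofReal (jw (r + a)) := by fun_prop
  have hm2 : Measurable fun r => F (r - b) := hFm.comp (by fun_prop)
  rw [lintegral_add_left hm1, lintegral_add_left hm2,
    lintegral_add_right_eq_self (fun r => ENNReal.ofReal (jw r)) a, lintegral_jw,
    lintegral_sub_right_eq_self F b, lintegral_sub_left_eq_self F b, ← hI,
    ENNReal.ofReal_add Real.pi_pos.le (by positivity), ENNReal.ofReal_mul (by norm_num),
    ENNReal.ofReal_toReal hIt, ENNReal.ofReal_ofNat, two_mul]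

/-- The Poisson kernel has mass `π`. -/
lemma lintegral_poisson {η : ℝ} (hη : 0 < η) (θ : ℝ) :
    ∫⁻ y, ENNReal.ofReal (η / ((θ - y) ^ 2 + η ^ 2)) = ENNReal.ofReal Real.pi := by
  rw [lintegral_sub_left_eq_self (fun y => ENNReal.ofReal (η / (y ^ 2 + η ^ 2))) θ]
  have e : ∀ y : ℝ, η / (y ^ 2 + η ^ 2) = η⁻¹ * (1 + (η⁻¹ * y) ^ 2)⁻¹ := fun y => by
    field_simp; ring
  simp only [e]
  have hi : Integrable fun y : ℝ => (1 + (η⁻¹ * y) ^ 2)⁻¹ :=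
    integrable_inv_one_add_sq.comp_mul_left' (inv_ne_zero hη.ne')
  rw [← ofReal_integral_eq_lintegral_ofReal (hi.const_mul _)
    (Eventually.of_forall fun y => by positivity), integral_const_mul,
    Measure.integral_comp_mul_left (fun y : ℝ => (1 + y ^ 2)⁻¹), integral_univ_inv_one_add_sq]
  congr 1
  rw [inv_inv, abs_of_pos hη, smul_eq_mul]
  field_simp

namespace ConvexPhase

variable {d : ℕ} {c₃ c₄ : ℝ} {Φ : Mom d → ℝ} {k₀ : Mom d} (h : ConvexPhase c₃ c₄ Φ k₀)
include h

/-- By `le_radial'`, Φ - (c₃/2) r² increases along the ray, and r² - s² ≥ (r - s)² for 0 ≤ s ≤ r. -/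
lemma sub_radial_le {u : Mom d} (hu : ‖u‖ = 1) {r s : ℝ} (hs : 0 ≤ s) (hsr : s ≤ r) :
    c₃ / 2 * (r - s) ^ 2 ≤ Φ (k₀ + r • u) - Φ (k₀ + s • u) := by
  have hmono : MonotoneOn (fun r : ℝ => Φ (k₀ + r • u) - c₃ / 2 * r ^ 2) (Set.Ici 0) := by
    have hd : ∀ r : ℝ, HasDerivAt (fun r : ℝ => Φ (k₀ + r • u) - c₃ / 2 * r ^ 2)
        (fderiv ℝ Φ (k₀ + r • u) u - c₃ * r) r := fun r => by
      refine ((h.hasDerivAt_radial u r).sub ((hasDerivAt_pow 2 r).const_mul (c₃ / 2))).congr_deriv ?_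
      simp; ring
    refine monotoneOn_of_deriv_nonneg (convex_Ici 0)
      (fun r _ => (hd r).continuousAt.continuousWithinAt)
      (fun r _ => (hd r).differentiableAt.differentiableWithinAt) fun r hr => ?_
    rw [interior_Ici] at hr
    rw [(hd r).deriv]
    linarith [h.le_radial' hu (le_of_lt hr)]
  have h1 := hmono (Set.mem_Ici.2 hs) (Set.mem_Ici.2 (hs.trans hsr)) hsr
  simp only at h1
  nlinarith [h.pos, mul_nonneg h.pos.le (mul_nonneg hs (sub_nonneg.2 hsr))]

/-- If θ is not above the minimum, s = 0 works; otherwise Φ takes the value θ on the ray by the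
intermediate value theorem. In both cases `sub_radial_le` provides quadratic separation, so θ - Φ
satisfies the hypothesis of `abs_logRatio_le_inv_sqrt`. -/
lemma exists_root {u : Mom d} (hu : ‖u‖ = 1) (θ : ℝ) : ∃ s : ℝ, ∀ r, 0 ≤ r →
    c₃ / 2 * |r - s| ^ 2 ≤ |θ - Φ (k₀ + r • u)| := by
  have hc : Continuous fun r : ℝ => Φ (k₀ + r • u) := by
    have := h.smooth.continuous; fun_prop
  have h3 := h.pos
  rcases le_or_gt θ (Φ (k₀ + (0 : ℝ) • u)) with h0 | h0
  · refine ⟨0, fun r hr => ?_⟩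
    have h1 := h.sub_radial_le hu le_rfl hr
    rw [abs_sub_comm θ, sq_abs]
    exact (h1.trans (sub_le_sub_left h0 _)).trans (le_abs_self _)
  · obtain ⟨R, hR0, hR⟩ : ∃ R : ℝ, 0 ≤ R ∧ θ ≤ Φ (k₀ + R • u) := by
      set y := θ - Φ (k₀ + (0 : ℝ) • u) with hy
      have hy0 : 0 < y := by linarith
      refine ⟨1 + 2 * y / c₃, by positivity, ?_⟩
      have h1 := h.sub_radial_le hu le_rfl (show (0 : ℝ) ≤ 1 + 2 * y / c₃ by positivity)
      have h2 : y ≤ c₃ / 2 * (1 + 2 * y / c₃ - 0) ^ 2 := by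
        have h4 : c₃ / 2 * (1 + 2 * y / c₃ - 0) ^ 2 =
          y + (c₃ / 2 + 2 * y + c₃ / 2 * (2 * y / c₃) ^ 2 - y) := by field_simp; ring
        rw [h4]
        have : 0 ≤ c₃ / 2 * (2 * y / c₃) ^ 2 := by positivity
        linarith
      linarith
    obtain ⟨s, hs, hsθ⟩ := intermediate_value_Icc hR0 hc.continuousOn ⟨h0.le, hR⟩
    simp only at hsθ
    refine ⟨s, fun r hr => ?_⟩
    rw [sq_abs]
    rcases le_total s r with hsr | hsr
    · have h1 := h.sub_radial_le hu hs.1 hsr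
      rw [abs_sub_comm, ← hsθ]
      exact h1.trans (le_abs_self _)
    · have h1 := h.sub_radial_le hu hr hsr
      refine le_trans ?_ (le_abs_self _)
      nlinarith

end ConvexPhase

/-! ### Decay along rays -/

section

variable {d : ℕ}

lemma wt_two_le_jw (v : Mom d) {u : Mom d} (hu : ‖u‖ = 1) (r : ℝ) :
    wt 2 (v + r • u) ≤ jw (r + inner ℝ u v) := by
  unfold wt jw
  rw [bracket_sq]
  refine inv_anti₀ (by positivity) ?_
  have h1 : r + inner ℝ u v = inner ℝ u (v + r • u) := by
    rw [inner_add_right, inner_smul_right, real_inner_self_eq_norm_sq, hu]; ring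
  have h2 := abs_real_inner_le_norm u (v + r • u)
  rw [hu, one_mul] at h2
  rw [h1]
  nlinarith [sq_abs (inner ℝ u (v + r • u)), abs_nonneg (inner ℝ u (v + r • u)),
    norm_nonneg (v + r • u)]

lemma one_le_sWeight (hd : 3 ≤ d) (v : Mom d) {u : Mom d} (hu : ‖u‖ = 1) : 1 ≤ sWeight v u := by
  unfold sWeight
  rw [ENNReal.one_le_inv]
  exact ENNReal.rpow_le_one (ENNReal.ofReal_le_one.2 ((perp_le_norm v u).trans hu.le))
    (by linarith [sExp_pos hd])

/-- The weight along a ray, uniformly in the starting point. -/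
lemma ray_weight_le (hd : 3 ≤ d) (v : Mom d) {u : Mom d} (hu : ‖u‖ = 1) {r : ℝ} (hr : 0 < r) :
    ENNReal.ofReal ((r ^ (d - 3) + r ^ (d - 2)) * wt (4 * d + 23) (v + r • u)) ≤
      3 * sWeight v u * ENNReal.ofReal (jw (r + inner ℝ u v)) := by
  set k := v + r • u with hk
  have hw := wt_pos (d - 2) k
  have h1 : r ^ (d - 3) ≤ 1 + r ^ (d - 2) := by
    rcases le_total r 1 with h | h
    · have := pow_le_one₀ (n := d - 3) hr.le h
      have : 0 ≤ r ^ (d - 2) := by positivity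
      linarith
    · have : r ^ (d - 3) ≤ r ^ (d - 2) := pow_le_pow_right₀ h (by omega)
      linarith
  have h2 : wt (4 * d + 23) k ≤ wt (d - 2) k * jw (r + inner ℝ u v) := by
    have h3 : wt (4 * d + 23) k ≤ wt (d - 2 + 2) k := wt_anti (by omega) k
    rw [wt_add (d - 2) 2] at h3
    exact h3.trans (mul_le_mul_of_nonneg_left (wt_two_le_jw v hu r) hw.le)
  have h4 : ENNReal.ofReal (r ^ (d - 2) * wt (d - 2) k) ≤ sWeight v u := by
    refine le_trans ?_ (pow_div_le_sWeight hd v hu hr)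
    rw [ENNReal.ofReal_mul (by positivity)]
    refine mul_le_mul_right ?_ _
    unfold wt
    rw [ENNReal.ofReal_inv_of_pos (pow_pos (bracket_pos k) _), ENNReal.ofReal_pow (bracket_pos k).le]
    gcongr
    exact norm_le_bracket k
  calc _ ≤ ENNReal.ofReal ((1 + r ^ (d - 2) * wt (d - 2) k + r ^ (d - 2) * wt (d - 2) k) *
        jw (r + inner ℝ u v)) := by
        refine ENNReal.ofReal_le_ofReal ?_
        have h5 : r ^ (d - 3) + r ^ (d - 2) ≤ 1 + r ^ (d - 2) + r ^ (d - 2) := by linarith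
        refine (mul_le_mul h5 h2 (wt_pos _ _).le (by positivity)).trans ?_
        have h6 := wt_le_one (d - 2) k
        have h7 := (jw_pos (r + inner ℝ u v)).le
        have : (1 + r ^ (d - 2) + r ^ (d - 2)) * (wt (d - 2) k * jw (r + inner ℝ u v)) =
          (wt (d - 2) k + r ^ (d - 2) * wt (d - 2) k + r ^ (d - 2) * wt (d - 2) k) *
            jw (r + inner ℝ u v) := by ring
        rw [this]
        gcongr
    _ = (1 + ENNReal.ofReal (r ^ (d - 2) * wt (d - 2) k) +
          ENNReal.ofReal (r ^ (d - 2) * wt (d - 2) k)) * ENNReal.ofReal (jw (r + inner ℝ u v)) := by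
        rw [ENNReal.ofReal_mul (by positivity), ENNReal.ofReal_add (by positivity) (by positivity),
          ENNReal.ofReal_add (by positivity) (by positivity), ENNReal.ofReal_one]
    _ ≤ (sWeight v u + sWeight v u + sWeight v u) * ENNReal.ofReal (jw (r + inner ℝ u v)) := by
        gcongr
        exact one_le_sWeight hd v hu
    _ = _ := by ring

/-- Integrability of the weight along a ray, without uniformity. -/
lemma ray_weight_le_jw (hd : 3 ≤ d) (v : Mom d) {u : Mom d} (hu : ‖u‖ = 1) {r : ℝ} (hr : 0 < r)
    {j : ℕ} (hj : j ≤ d) :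
    r ^ j * wt (4 * d + 23) (v + r • u) ≤ (2 * bracket v) ^ (4 * d + 23) * jw r := by
  have h1 := wt_add_le (4 * d + 23) (v + r • u) (-v)
  rw [add_neg_cancel_comm, bracket_neg] at h1
  have hb : r ≤ bracket (r • u) := by
    have := norm_le_bracket (r • u)
    rwa [norm_smul, hu, mul_one, Real.norm_of_nonneg hr.le] at this
  have h2 : r ^ j * wt (4 * d + 23) (r • u) ≤ jw r := by
    have h3 : wt (4 * d + 23) (r • u) ≤ wt (j + 2) (r • u) := wt_anti (by omega) _
    have h4 : wt 2 (r • u) = jw r := by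
      unfold wt jw; rw [bracket_sq, norm_smul, hu, mul_one, Real.norm_of_nonneg hr.le, add_comm]
    have h5 : r ^ j * wt j (r • u) ≤ 1 := by
      unfold wt
      rw [← div_eq_mul_inv]
      exact div_le_one_of_le₀ (by gcongr) (pow_pos (bracket_pos _) _).le
    calc _ ≤ r ^ j * wt (j + 2) (r • u) := by gcongr
      _ = (r ^ j * wt j (r • u)) * jw r := by rw [wt_add, h4]; ring
      _ ≤ 1 * jw r := by have := (jw_pos r).le; gcongr
      _ = _ := one_mul _
  have h6 : 0 ≤ (2 * bracket v) ^ (4 * d + 23) := by have := bracket_pos v; positivity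
  calc _ ≤ r ^ j * ((2 * bracket v) ^ (4 * d + 23) * wt (4 * d + 23) (r • u)) := by gcongr
    _ = (2 * bracket v) ^ (4 * d + 23) * (r ^ j * wt (4 * d + 23) (r • u)) := by ring
    _ ≤ _ := by gcongr

end

namespace SmoothDecay

variable {d a : ℕ} {c : ℝ} {f : Mom d → ℝ} (hf : SmoothDecay c a f)
include hf

lemma const_nonneg : 0 ≤ c := by
  have h1 := (hf.nonneg 0).trans (hf.bound0 0)
  exact nonneg_of_mul_nonneg_left h1 (wt_pos a 0)

lemma integrable (ha : d < a) : Integrable f :=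
  ((integrable_wt ha).const_mul c).mono' hf.smooth.continuous.aestronglyMeasurable
    (Eventually.of_forall fun k => by
      rw [Real.norm_of_nonneg (hf.nonneg k)]; exact hf.bound0 k)

lemma hasDerivAt_radial (v u : Mom d) (r : ℝ) :
    HasDerivAt (fun r : ℝ => f (v + r • u)) (fderiv ℝ f (v + r • u) u) r := by
  have h1 : HasDerivAt (fun r : ℝ => v + r • u) u r := by
    simpa using ((hasDerivAt_id r).smul_const u).const_add v
  exact ((hf.smooth.differentiable (by norm_num)) _).hasFDerivAt.comp_hasDerivAt r h1

end SmoothDecay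

/-! ### Integration by parts along rays -/

section

variable {d : ℕ} {c c₃ c₄ : ℝ} {Φ f : Mom d → ℝ} {k₀ : Mom d}

/-- The amplitude `r^{d-1} f / ∂_r Φ` along a ray. -/
def rayAmp (Φ f : Mom d → ℝ) (k₀ u : Mom d) (r : ℝ) : ℝ :=
  r ^ (d - 1) * f (k₀ + r • u) / fderiv ℝ Φ (k₀ + r • u) u

/-- The derivative of `rayAmp`. -/
def rayAmp' (Φ f : Mom d → ℝ) (k₀ u : Mom d) (r : ℝ) : ℝ :=
  ((((d - 1 : ℕ) : ℝ) * r ^ (d - 1 - 1) * f (k₀ + r • u) +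
    r ^ (d - 1) * fderiv ℝ f (k₀ + r • u) u) * fderiv ℝ Φ (k₀ + r • u) u -
    r ^ (d - 1) * f (k₀ + r • u) * fderiv ℝ (fderiv ℝ Φ) (k₀ + r • u) u u) /
    fderiv ℝ Φ (k₀ + r • u) u ^ 2

variable (h : ConvexPhase c₃ c₄ Φ k₀) (hf : SmoothDecay c (4 * d + 23) f)
include h hf

lemma hasDerivAt_rayAmp {u : Mom d} (hu : ‖u‖ = 1) {r : ℝ} (hr : 0 < r) :
    HasDerivAt (rayAmp Φ f k₀ u) (rayAmp' Φ f k₀ u r) r := by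
  have hg : 0 < fderiv ℝ Φ (k₀ + r • u) u :=
    lt_of_lt_of_le (mul_pos h.pos hr) (h.le_radial' hu hr.le)
  exact ((hasDerivAt_pow (d - 1) r).mul (hf.hasDerivAt_radial k₀ u r)).div
    (h.hasDerivAt_radial' u r) hg.ne'

lemma abs_rayAmp_le (hd : 3 ≤ d) {u : Mom d} (hu : ‖u‖ = 1) {r : ℝ} (hr : 0 < r) :
    |rayAmp Φ f k₀ u r| ≤ c / c₃ * (r ^ (d - 2) * wt (4 * d + 23) (k₀ + r • u)) := by
  have h3 := h.pos
  have hc := hf.const_nonneg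
  have hg := h.le_radial' hu hr.le
  have hg0 : 0 < fderiv ℝ Φ (k₀ + r • u) u := lt_of_lt_of_le (mul_pos h3 hr) hg
  have hf0 := hf.nonneg (k₀ + r • u)
  have hw := wt_pos (4 * d + 23) (k₀ + r • u)
  unfold rayAmp
  rw [abs_of_nonneg (by positivity), div_le_iff₀ hg0]
  have e : r ^ (d - 1) = r ^ (d - 2) * r := by rw [← pow_succ]; congr 1; omega
  calc _ ≤ r ^ (d - 2) * r * (c * wt (4 * d + 23) (k₀ + r • u)) := by
        rw [e]; gcongr; exact hf.bound0 _
    _ = c / c₃ * (r ^ (d - 2) * wt (4 * d + 23) (k₀ + r • u)) * (c₃ * r) := by field_simp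
    _ ≤ _ := by gcongr

/-- Since ∂_r Φ ≥ c₃ r, division by it costs one power of r. Differentiating either r^{d-1} or ∂_r Φ
costs another, which leaves r^{d-3}, harmless for d ≥ 3; differentiating f leaves r^{d-2}. -/
lemma abs_rayAmp'_le (hd : 3 ≤ d) {u : Mom d} (hu : ‖u‖ = 1) {r : ℝ} (hr : 0 < r) :
    |rayAmp' Φ f k₀ u r| ≤ c * (d / c₃ + c₄ / c₃ ^ 2) *
      ((r ^ (d - 3) + r ^ (d - 2)) * wt (4 * d + 23) (k₀ + r • u)) := by
  have h3 := h.pos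
  have hc := hf.const_nonneg
  have hg := h.le_radial' hu hr.le
  have hl := h.lower (k₀ + r • u) u
  have hup := h.upper (k₀ + r • u) u
  have hfd := hf.bound1 (k₀ + r • u)
  have hf0 := hf.nonneg (k₀ + r • u)
  have hfb := hf.bound0 (k₀ + r • u)
  have hfu : |fderiv ℝ f (k₀ + r • u) u| ≤ c * wt (4 * d + 23) (k₀ + r • u) := by
    have := (fderiv ℝ f (k₀ + r • u)).le_opNorm u
    rw [hu, mul_one] at this
    exact this.trans hfd
  rw [hu, one_pow, mul_one] at hl hup
  have hw := wt_pos (4 * d + 23) (k₀ + r • u)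
  have hrg : 0 < c₃ * r := mul_pos h3 hr
  unfold rayAmp'
  set g := fderiv ℝ Φ (k₀ + r • u) u
  set g2 := fderiv ℝ (fderiv ℝ Φ) (k₀ + r • u) u u
  set m := f (k₀ + r • u)
  set m' := fderiv ℝ f (k₀ + r • u) u
  set w := wt (4 * d + 23) (k₀ + r • u)
  have hg0 : 0 < g := lt_of_lt_of_le hrg hg
  have hg2 : 0 ≤ g2 := h3.le.trans hl
  have hc4 : 0 ≤ c₄ := hg2.trans hup
  have hd0 : (0 : ℝ) ≤ (d - 1 : ℕ) := Nat.cast_nonneg _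
  have e1 : r ^ (d - 1) = r ^ (d - 3) * r ^ 2 := by rw [← pow_add]; congr 1; omega
  have e2 : r ^ (d - 1 - 1) = r ^ (d - 3) * r := by rw [← pow_succ]; congr 1; omega
  have e3 : r ^ (d - 2) = r ^ (d - 3) * r := by rw [← pow_succ]; congr 1; omega
  have hp : 0 ≤ r ^ (d - 3) := by positivity
  have hcd : ((d - 1 : ℕ) : ℝ) = d - 1 := by rw [Nat.cast_sub (by omega)]; simp
  have hdd : (3 : ℝ) ≤ d := by exact_mod_cast hd
  rw [e1, e2, e3]
  set q := r ^ (d - 3)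
  have t1 : |(((d - 1 : ℕ) : ℝ) * (q * r) * m + q * r ^ 2 * m') * g - q * r ^ 2 * m * g2| ≤
      (((d : ℝ) - 1) * (q * r) * (c * w) + q * r ^ 2 * (c * w)) * g + q * r ^ 2 * (c * w) * c₄ := by
    refine (abs_sub _ _).trans (add_le_add ?_ ?_)
    · rw [abs_mul, abs_of_pos hg0]
      refine mul_le_mul_of_nonneg_right ((abs_add_le _ _).trans (add_le_add ?_ ?_)) hg0.le
      · rw [abs_of_nonneg (by positivity), hcd]
        have : (0 : ℝ) ≤ d - 1 := by linarith
        gcongr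
      · rw [abs_mul, abs_of_nonneg (by positivity : 0 ≤ q * r ^ 2)]
        gcongr
    · rw [abs_of_nonneg (by positivity)]
      gcongr
  rw [abs_div, abs_of_pos (by positivity : 0 < g ^ 2), div_le_iff₀ (by positivity)]
  refine t1.trans ?_
  have s1 : (((d : ℝ) - 1) * (q * r) * (c * w) + q * r ^ 2 * (c * w)) * g ≤
      c * (d / c₃) * ((q + q * r) * w) * g ^ 2 := by
    have : ((d : ℝ) - 1) * (q * r) * (c * w) + q * r ^ 2 * (c * w) ≤
        c * (d / c₃) * ((q + q * r) * w) * (c₃ * r) := by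
      have e : c * (d / c₃) * ((q + q * r) * w) * (c₃ * r) = c * d * ((q + q * r) * w) * r := by
        field_simp
      rw [e]
      have h1 : 0 ≤ q * r * (c * w) := by positivity
      have h2 : 0 ≤ q * r ^ 2 * (c * w) := by positivity
      nlinarith
    calc _ ≤ c * (d / c₃) * ((q + q * r) * w) * (c₃ * r) * g := by gcongr
      _ ≤ c * (d / c₃) * ((q + q * r) * w) * g * g := by gcongr
      _ = _ := by ring
  have s2 : q * r ^ 2 * (c * w) * c₄ ≤ c * (c₄ / c₃ ^ 2) * ((q + q * r) * w) * g ^ 2 := by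
    calc _ = c * (c₄ / c₃ ^ 2) * (q * w) * (c₃ * r) ^ 2 := by field_simp
      _ ≤ c * (c₄ / c₃ ^ 2) * ((q + q * r) * w) * g ^ 2 := by
        have : 0 ≤ q * r := by positivity
        gcongr
        linarith
  linarith

lemma continuousOn_rayAmp' {u : Mom d} (hu : ‖u‖ = 1) :
    ContinuousOn (rayAmp' Φ f k₀ u) (Set.Ioi 0) := by
  have h1 : Continuous fun r : ℝ => fderiv ℝ Φ (k₀ + r • u) u :=
    continuous_iff_continuousAt.2 fun r => (h.hasDerivAt_radial' u r).continuousAt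
  have h2 : Continuous fun r : ℝ => f (k₀ + r • u) := by
    have := hf.smooth.continuous; fun_prop
  have h3 : Continuous fun r : ℝ => fderiv ℝ f (k₀ + r • u) u := by
    have := hf.smooth.continuous_fderiv (by norm_num); fun_prop
  have h4 : Continuous fun r : ℝ => fderiv ℝ (fderiv ℝ Φ) (k₀ + r • u) u u := by
    have h5 : ContDiff ℝ 1 (fderiv ℝ Φ) := h.smooth.fderiv_right (by norm_num)
    have := h5.continuous_fderiv (by norm_num); fun_prop
  unfold rayAmp'
  have h6 : Continuous fun r : ℝ => ((d - 1 : ℕ) : ℝ) * r ^ (d - 1 - 1) := by fun_prop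
  have h7 : Continuous fun r : ℝ => r ^ (d - 1) := by fun_prop
  refine ContinuousOn.div (((((h6.mul h2).add (h7.mul h3)).mul h1).sub
    ((h7.mul h2).mul h4)).continuousOn) (h1.pow 2).continuousOn fun r hr => ?_
  exact pow_ne_zero 2 (lt_of_lt_of_le (mul_pos h.pos hr) (h.le_radial' hu (le_of_lt hr))).ne'

/-- Integration by parts along a ray. -/
lemma ray_integral_eq (hd : 3 ≤ d) {u : Mom d} (hu : ‖u‖ = 1) {η θ : ℝ} (hη : 0 < η) (hη1 : η ≤ 1) :
    ∫ r in Set.Ioi (0 : ℝ), r ^ (d - 1) *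
      (f (k₀ + r • u) * logRatio' η (θ - Φ (k₀ + r • u))) =
    ∫ r in Set.Ioi (0 : ℝ), rayAmp' Φ f k₀ u r * logRatio η (θ - Φ (k₀ + r • u)) := by
  have h3 := h.pos
  have hc := hf.const_nonneg
  set D := (2 * bracket k₀) ^ (4 * d + 23) with hD
  have hD0 : 0 ≤ D := by have := bracket_pos k₀; positivity
  have hj : IntegrableOn jw (Set.Ioi 0) := by
    have : Integrable jw := integrable_inv_one_add_sq
    exact this.integrableOn
  have hgc : Continuous fun r : ℝ => Φ (k₀ + r • u) := by
    have := h.smooth.continuous; fun_prop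
  have hfc : Continuous fun r : ℝ => f (k₀ + r • u) := by
    have := hf.smooth.continuous; fun_prop
  have hv : ∀ r : ℝ, HasDerivAt (fun r : ℝ => logRatio η (θ - Φ (k₀ + r • u)))
      (logRatio' η (θ - Φ (k₀ + r • u)) * -fderiv ℝ Φ (k₀ + r • u) u) r := fun r =>
    (hasDerivAt_logRatio hη _).comp r ((h.hasDerivAt_radial u r).const_sub θ)
  have hvc : Continuous fun r : ℝ => logRatio η (θ - Φ (k₀ + r • u)) :=
    continuous_iff_continuousAt.2 fun r => (hv r).continuousAt
  have hlc : Continuous fun r : ℝ => logRatio' η (θ - Φ (k₀ + r • u)) :=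
    (continuous_logRatio' hη).comp (continuous_const.sub hgc)
  have e : ∀ r ∈ Set.Ioi (0 : ℝ), rayAmp Φ f k₀ u r *
      (logRatio' η (θ - Φ (k₀ + r • u)) * -fderiv ℝ Φ (k₀ + r • u) u) =
      -(r ^ (d - 1) * (f (k₀ + r • u) * logRatio' η (θ - Φ (k₀ + r • u)))) := fun r hr => by
    have hg0 : fderiv ℝ Φ (k₀ + r • u) u ≠ 0 :=
      (lt_of_lt_of_le (mul_pos h3 hr) (h.le_radial' hu (le_of_lt hr))).ne'
    unfold rayAmp
    field_simp
  have hi1 : IntegrableOn (fun r => r ^ (d - 1) *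
      (f (k₀ + r • u) * logRatio' η (θ - Φ (k₀ + r • u)))) (Set.Ioi 0) := by
    refine (hj.const_mul (c * D * (η⁻¹ + 1))).mono' ?_ ?_
    · exact ((continuous_pow (d - 1)).mul (hfc.mul hlc)).aestronglyMeasurable
    · refine (ae_restrict_iff' measurableSet_Ioi).2 (Eventually.of_forall fun r hr => ?_)
      have hr' : (0 : ℝ) < r := hr
      have h5 := ray_weight_le_jw hd k₀ hu hr' (show d - 1 ≤ d by omega)
      rw [Real.norm_eq_abs, abs_mul, abs_mul, abs_of_pos (pow_pos hr' _),
        abs_of_nonneg (hf.nonneg _)]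
      calc _ ≤ r ^ (d - 1) * ((c * wt (4 * d + 23) (k₀ + r • u)) * (η⁻¹ + 1)) := by
            have := wt_pos (4 * d + 23) (k₀ + r • u)
            gcongr
            · exact hf.bound0 _
            · exact abs_logRatio'_le hη _
        _ = c * (r ^ (d - 1) * wt (4 * d + 23) (k₀ + r • u)) * (η⁻¹ + 1) := by ring
        _ ≤ c * (D * jw r) * (η⁻¹ + 1) := by gcongr
        _ = _ := by ring
  have hi2 : IntegrableOn (rayAmp' Φ f k₀ u * fun r => logRatio η (θ - Φ (k₀ + r • u)))
      (Set.Ioi 0) := by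
    have hE : 0 ≤ c * (d / c₃ + c₄ / c₃ ^ 2) := by
      have h6 := (h.lower k₀ u).trans (h.upper k₀ u)
      rw [hu, one_pow, mul_one, mul_one] at h6
      have : 0 ≤ c₄ := h3.le.trans h6
      positivity
    refine (hj.const_mul (c * (d / c₃ + c₄ / c₃ ^ 2) * (2 * D) * η⁻¹ ^ 2)).mono' ?_ ?_
    · exact ((continuousOn_rayAmp' h hf hu).mul hvc.continuousOn).aestronglyMeasurable
        measurableSet_Ioi
    · refine (ae_restrict_iff' measurableSet_Ioi).2 (Eventually.of_forall fun r hr => ?_)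
      have hr' : (0 : ℝ) < r := hr
      have h5 := ray_weight_le_jw hd k₀ hu hr' (show d - 3 ≤ d by omega)
      have h6 := ray_weight_le_jw hd k₀ hu hr' (show d - 2 ≤ d by omega)
      rw [Pi.mul_apply, Real.norm_eq_abs, abs_mul]
      calc _ ≤ c * (d / c₃ + c₄ / c₃ ^ 2) *
            ((r ^ (d - 3) + r ^ (d - 2)) * wt (4 * d + 23) (k₀ + r • u)) * η⁻¹ ^ 2 := by
            have := wt_pos (4 * d + 23) (k₀ + r • u)
            gcongr
            · exact abs_rayAmp'_le h hf hd hu hr'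
            · exact abs_logRatio_le hη hη1 _
        _ ≤ c * (d / c₃ + c₄ / c₃ ^ 2) * (2 * (D * jw r)) * η⁻¹ ^ 2 := by
            refine mul_le_mul_of_nonneg_right (mul_le_mul_of_nonneg_left ?_ hE) (by positivity)
            rw [add_mul]
            linarith
        _ = _ := by ring
  have hbd : ∀ r, 0 < r → |rayAmp Φ f k₀ u r * logRatio η (θ - Φ (k₀ + r • u))| ≤
      c / c₃ * (r ^ (d - 2) * wt (4 * d + 23) (k₀ + r • u)) * η⁻¹ ^ 2 := fun r hr => by
    rw [abs_mul]
    have := wt_pos (4 * d + 23) (k₀ + r • u)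
    gcongr
    · exact abs_rayAmp_le h hf hd hu hr
    · exact abs_logRatio_le hη hη1 _
  -- No boundary term at the critical point: the amplitude is O(r^{d-2}) and d ≥ 3.
  have hz : Tendsto (rayAmp Φ f k₀ u * fun r => logRatio η (θ - Φ (k₀ + r • u)))
      (nhdsWithin 0 (Set.Ioi 0)) (nhds 0) := by
    have hlim : Tendsto (fun r : ℝ => c / c₃ * (r ^ (d - 2) * 1) * η⁻¹ ^ 2)
        (nhdsWithin 0 (Set.Ioi 0)) (nhds 0) := by
      have : Continuous fun r : ℝ => c / c₃ * (r ^ (d - 2) * 1) * η⁻¹ ^ 2 := by fun_prop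
      have h7 := (this.tendsto 0).mono_left (nhdsWithin_le_nhds (s := Set.Ioi (0 : ℝ)))
      simpa [zero_pow (show d - 2 ≠ 0 by omega)] using h7
    refine squeeze_zero_norm' ?_ hlim
    filter_upwards [self_mem_nhdsWithin] with r hr
    have hr' : (0 : ℝ) < r := hr
    refine (hbd r hr').trans ?_
    gcongr
    exact wt_le_one _ _
  have hinf : Tendsto (rayAmp Φ f k₀ u * fun r => logRatio η (θ - Φ (k₀ + r • u)))
      atTop (nhds 0) := by
    have hlim : Tendsto (fun r : ℝ => c / c₃ * (D * r⁻¹) * η⁻¹ ^ 2) atTop (nhds 0) := by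
      have := ((tendsto_inv_atTop_zero (𝕜 := ℝ)).const_mul D).const_mul (c / c₃)
      have := this.mul_const (η⁻¹ ^ 2)
      rwa [mul_zero, mul_zero, zero_mul] at this
    refine squeeze_zero_norm' ?_ hlim
    filter_upwards [eventually_ge_atTop 1] with r hr
    have hr' : (0 : ℝ) < r := by linarith
    refine (hbd r hr').trans ?_
    have h6 := ray_weight_le_jw hd k₀ hu hr' (show d - 2 ≤ d by omega)
    have h8 : jw r ≤ r⁻¹ := by
      unfold jw; exact inv_anti₀ hr' (by nlinarith)
    have h9 : r ^ (d - 2) * wt (4 * d + 23) (k₀ + r • u) ≤ D * r⁻¹ := h6.trans (by gcongr)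
    exact mul_le_mul_of_nonneg_right (mul_le_mul_of_nonneg_left h9 (by positivity)) (by positivity)
  have hi1' : IntegrableOn (rayAmp Φ f k₀ u * fun r =>
      logRatio' η (θ - Φ (k₀ + r • u)) * -fderiv ℝ Φ (k₀ + r • u) u) (Set.Ioi 0) :=
    hi1.neg.congr_fun (fun r hr => (e r hr).symm) measurableSet_Ioi
  have key := integral_Ioi_mul_deriv_eq_deriv_mul
    (fun r hr => hasDerivAt_rayAmp h hf hu hr) (fun r _ => hv r) hi1' hi2 hz hinf
  rw [setIntegral_congr_fun measurableSet_Ioi e, integral_neg, sub_zero, zero_sub, neg_inj] at key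
  exact key

end

/-! ### The averaged resolvent is bounded uniformly in η -/

section

variable {d : ℕ}

lemma norm_le_toReal_of_enorm_le {E : Type*} [NormedAddCommGroup E] {x : E} {C : ℝ≥0∞} (hC : C ≠ ⊤)
    (h : ‖x‖ₑ ≤ C) : ‖x‖ ≤ C.toReal := by
  rw [← toReal_enorm]; exact ENNReal.toReal_mono hC h

/-- One ray of the oscillatory part of the averaged resolvent. -/
lemma enorm_ray_integral_le (hd : 3 ≤ d) {c c₃ c₄ : ℝ} {Φ f : Mom d → ℝ} {k₀ : Mom d}
    (h : ConvexPhase c₃ c₄ Φ k₀) (hf : SmoothDecay c (4 * d + 23) f) {J : ℝ}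
    (hJ : ∀ a b : ℝ, ∫⁻ r, ENNReal.ofReal (jw (r + a)) * ENNReal.ofReal (Real.sqrt |r - b|)⁻¹ ≤
      ENNReal.ofReal J) {u : Mom d} (hu : ‖u‖ = 1) {η θ : ℝ} (hη : 0 < η) (hη1 : η ≤ 1) :
    ‖∫ r in Set.Ioi (0 : ℝ), r ^ (d - 1) *
      (f (k₀ + r • u) * logRatio' η (θ - Φ (k₀ + r • u)))‖ₑ ≤
    ENNReal.ofReal (c * (d / c₃ + c₄ / c₃ ^ 2)) * ENNReal.ofReal (4 * (1 + (c₃ / 2)⁻¹)) * 3 *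
      ENNReal.ofReal J * sWeight k₀ u := by
  have h3 := h.pos
  have hc := hf.const_nonneg
  have hc4 : 0 ≤ c₄ := by
    have h6 := (h.lower k₀ u).trans (h.upper k₀ u)
    rw [hu, one_pow, mul_one, mul_one] at h6
    exact h3.le.trans h6
  have hE : 0 ≤ c * (d / c₃ + c₄ / c₃ ^ 2) := by positivity
  obtain ⟨s, hs⟩ := h.exists_root hu θ
  rw [ray_integral_eq h hf hd hu hη hη1]
  refine (enorm_integral_le_lintegral_enorm _).trans ?_
  set D := ENNReal.ofReal (c * (d / c₃ + c₄ / c₃ ^ 2)) * ENNReal.ofReal (4 * (1 + (c₃ / 2)⁻¹)) * 3 *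
    sWeight k₀ u with hD
  -- At r = s the inverse square root takes the default value 0, so the pointwise bound could fail
  -- there.
  have hne : ∀ᵐ r : ℝ, r ≠ s := by simp [ae_iff]
  have hpt : ∀ᵐ r ∂(volume.restrict (Set.Ioi (0 : ℝ))),
      ‖rayAmp' Φ f k₀ u r * logRatio η (θ - Φ (k₀ + r • u))‖ₑ ≤
      D * (ENNReal.ofReal (jw (r + inner ℝ u k₀)) * ENNReal.ofReal (Real.sqrt |r - s|)⁻¹) := by
    rw [ae_restrict_iff' measurableSet_Ioi]
    filter_upwards [hne] with r hrs hr
    have hr' : (0 : ℝ) < r := hr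
    have h1 := abs_rayAmp'_le h hf hd hu hr'
    have h2 := abs_logRatio_le_inv_sqrt hη hη1 (show 0 < c₃ / 2 by positivity)
      (abs_pos.2 (sub_ne_zero.2 hrs)) (hs r hr'.le)
    rw [enorm_mul, Real.enorm_eq_ofReal_abs, Real.enorm_eq_ofReal_abs]
    calc _ ≤ ENNReal.ofReal (c * (d / c₃ + c₄ / c₃ ^ 2) *
          ((r ^ (d - 3) + r ^ (d - 2)) * wt (4 * d + 23) (k₀ + r • u))) *
          ENNReal.ofReal (4 * (1 + (c₃ / 2)⁻¹) * (Real.sqrt |r - s|)⁻¹) :=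
        mul_le_mul' (ENNReal.ofReal_le_ofReal h1) (ENNReal.ofReal_le_ofReal h2)
      _ = ENNReal.ofReal (c * (d / c₃ + c₄ / c₃ ^ 2)) *
          ENNReal.ofReal ((r ^ (d - 3) + r ^ (d - 2)) * wt (4 * d + 23) (k₀ + r • u)) *
          (ENNReal.ofReal (4 * (1 + (c₃ / 2)⁻¹)) * ENNReal.ofReal (Real.sqrt |r - s|)⁻¹) := by
        rw [ENNReal.ofReal_mul hE, ENNReal.ofReal_mul (p := 4 * (1 + (c₃ / 2)⁻¹)) (by positivity)]
      _ ≤ ENNReal.ofReal (c * (d / c₃ + c₄ / c₃ ^ 2)) *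
          (3 * sWeight k₀ u * ENNReal.ofReal (jw (r + inner ℝ u k₀))) *
          (ENNReal.ofReal (4 * (1 + (c₃ / 2)⁻¹)) * ENNReal.ofReal (Real.sqrt |r - s|)⁻¹) := by
        gcongr
        exact ray_weight_le hd k₀ hu hr'
      _ = _ := by rw [hD]; ring
  refine (lintegral_mono_ae hpt).trans ?_
  have hm : Measurable fun r => ENNReal.ofReal (jw (r + inner ℝ u k₀)) *
      ENNReal.ofReal (Real.sqrt |r - s|)⁻¹ := by fun_prop
  rw [lintegral_const_mul _ hm]
  refine (mul_le_mul_right ((setLIntegral_le_lintegral _ _).trans (hJ _ _)) _).trans (le_of_eq ?_)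
  rw [hD]; ring

/-- In polar coordinates about k₀ every ray is bounded by a constant times the angular weight, whose
integral over the sphere does not depend on k₀. -/
lemma logRatio'_integral_bound (hd : 3 ≤ d) (c c₃ c₄ : ℝ) : ∃ C : ℝ, 0 ≤ C ∧
    ∀ (Φ f : Mom d → ℝ) (k₀ : Mom d), ConvexPhase c₃ c₄ Φ k₀ → SmoothDecay c (4 * d + 23) f →
    ∀ θ η : ℝ, 0 < η → η ≤ 1 → |∫ k, f k * logRatio' η (θ - Φ k)| ≤ C := by
  obtain ⟨J, -, hJ⟩ := lintegral_jw_inv_sqrt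
  obtain ⟨Cs, hCs, hs⟩ := sphere_weight_bound hd
  set D := ENNReal.ofReal (c * (d / c₃ + c₄ / c₃ ^ 2)) * ENNReal.ofReal (4 * (1 + (c₃ / 2)⁻¹)) * 3 *
    ENNReal.ofReal J with hD
  have hDt : D ≠ ⊤ := by
    rw [hD]
    exact ENNReal.mul_ne_top (ENNReal.mul_ne_top (ENNReal.mul_ne_top ENNReal.ofReal_ne_top
      ENNReal.ofReal_ne_top) (by simp)) ENNReal.ofReal_ne_top
  refine ⟨(D * Cs).toReal, ENNReal.toReal_nonneg, fun Φ f k₀ h hf θ η hη hη1 => ?_⟩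
  rw [← Real.norm_eq_abs]
  refine norm_le_toReal_of_enorm_le (ENNReal.mul_ne_top hDt hCs) ?_
  have hΦ := h.smooth.continuous
  have hfc := hf.smooth.continuous
  have hl := continuous_logRatio' hη
  have hi : Integrable fun k => f k * logRatio' η (θ - Φ k) := by
    refine (hf.integrable (by omega)).mul_bdd (c := η⁻¹ + 1) ?_ ?_
    · exact (hl.comp (continuous_const.sub hΦ)).aestronglyMeasurable
    · exact Eventually.of_forall fun k => abs_logRatio'_le hη _
  have hi' : Integrable fun k => f (k₀ + k) * logRatio' η (θ - Φ (k₀ + k)) := hi.comp_add_left k₀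
  rw [← integral_add_left_eq_self _ k₀, integral_polar hd hi']
  refine (enorm_integral_le_lintegral_enorm _).trans ?_
  have hu : ∀ u : USphere d, ‖(u : Mom d)‖ = 1 := fun u => by simp
  refine (lintegral_mono fun u => enorm_ray_integral_le hd h hf hJ (hu u) hη hη1).trans ?_
  have hm2 : Measurable fun u : USphere d => sWeight k₀ u :=
    (measurable_sWeight k₀).comp measurable_subtype_coe
  rw [lintegral_const_mul _ hm2]
  exact mul_le_mul_right (hs k₀) _

/-- This is `coarea_bound` for the Poisson kernel, whose mass π depends neither on η nor on θ. -/
lemma poisson_integral_bound (hd : 3 ≤ d) (c c₃ c₄ : ℝ) : ∃ C : ℝ, 0 ≤ C ∧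
    ∀ (Φ f : Mom d → ℝ) (k₀ : Mom d), ConvexPhase c₃ c₄ Φ k₀ → SmoothDecay c (4 * d + 23) f →
    ∀ θ η : ℝ, 0 < η → |∫ k, f k * (η / ((θ - Φ k) ^ 2 + η ^ 2))| ≤ C := by
  obtain ⟨C, -, hC⟩ := coarea_bound hd
  set D := ENNReal.ofReal c * (ENNReal.ofReal (C / c₃) * ENNReal.ofReal Real.pi) with hD
  have hDt : D ≠ ⊤ := ENNReal.mul_ne_top ENNReal.ofReal_ne_top
    (ENNReal.mul_ne_top ENNReal.ofReal_ne_top ENNReal.ofReal_ne_top)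
  refine ⟨D.toReal, ENNReal.toReal_nonneg, fun Φ f k₀ h hf θ η hη => ?_⟩
  rw [← Real.norm_eq_abs]
  refine norm_le_toReal_of_enorm_le hDt ((enorm_integral_le_lintegral_enorm _).trans ?_)
  have hΦ := h.smooth.continuous
  have hψ : Measurable fun y : ℝ => ENNReal.ofReal (η / ((θ - y) ^ 2 + η ^ 2)) := by fun_prop
  have key := hC c₃ c₄ Φ k₀ h _ hψ
  rw [lintegral_poisson hη] at key
  have hm : Measurable fun k => (ENNReal.ofReal ‖k‖ ^ (d - 2))⁻¹ *
      ENNReal.ofReal (η / ((θ - Φ k) ^ 2 + η ^ 2)) :=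
    Measurable.mul (by fun_prop) (hψ.comp hΦ.measurable)
  refine le_trans ?_ (mul_le_mul_right key _)
  rw [← lintegral_const_mul _ hm]
  refine lintegral_mono fun k => ?_
  have h1 : 0 ≤ η / ((θ - Φ k) ^ 2 + η ^ 2) := by positivity
  rw [Real.enorm_eq_ofReal (mul_nonneg (hf.nonneg k) h1), ENNReal.ofReal_mul (hf.nonneg k),
    ← mul_assoc]
  refine mul_le_mul_left ?_ _
  refine (ENNReal.ofReal_le_ofReal (hf.bound0 k)).trans ?_
  rw [ENNReal.ofReal_mul hf.const_nonneg]
  refine mul_le_mul_right ?_ _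
  refine (ENNReal.ofReal_le_ofReal (wt_anti (show d - 2 ≤ 4 * d + 23 by omega) k)).trans ?_
  unfold wt
  rw [ENNReal.ofReal_inv_of_pos (pow_pos (bracket_pos k) _), ENNReal.ofReal_pow (bracket_pos k).le]
  gcongr
  exact norm_le_bracket k

/-- The real part is a Poisson kernel. From the imaginary part the bounded function x/(x² + 1) is
split off, so that the singular remainder has the primitive `logRatio`, which vanishes at infinity.
-/
lemma div_resolvent_eq {η : ℝ} (hη : 0 < η) (a x : ℝ) :
    (a : ℂ) / ((η : ℂ) - Complex.I * (x : ℂ)) = ((a * (η / (x ^ 2 + η ^ 2)) : ℝ) : ℂ) +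
      Complex.I * ((a * (x / (x ^ 2 + 1)) + a * logRatio' η x : ℝ) : ℂ) := by
  have h1 : x / (x ^ 2 + 1) + logRatio' η x = x / (x ^ 2 + η ^ 2) := by unfold logRatio'; ring
  rw [← mul_add, h1]
  have h2 : ((x : ℂ) ^ 2 + (η : ℂ) ^ 2) ≠ 0 := by
    exact_mod_cast (show x ^ 2 + η ^ 2 ≠ 0 by positivity)
  have h3 : (η : ℂ) - Complex.I * (x : ℂ) ≠ 0 := fun h => by
    have := congrArg Complex.re h
    simp at this
    exact hη.ne' this
  push_cast
  rw [div_eq_iff h3]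
  field_simp
  have := Complex.I_sq
  linear_combination ((a : ℂ) * x ^ 2) * this

/-- The resolvent of a uniformly convex phase, averaged with a smooth amplitude, is bounded. -/
theorem resolvent_transform_bound (hd : 3 ≤ d) (c c₃ c₄ : ℝ) : ∃ C : ℝ, 0 ≤ C ∧
    ∀ (Φ f : Mom d → ℝ) (k₀ : Mom d), ConvexPhase c₃ c₄ Φ k₀ → SmoothDecay c (4 * d + 23) f →
    ∀ θ η : ℝ, 0 < η → η ≤ 1 →
      ‖∫ k, (f k : ℂ) / ((η : ℂ) - Complex.I * ((θ - Φ k : ℝ) : ℂ))‖ ≤ C := by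
  obtain ⟨C₁, hC₁, h₁⟩ := logRatio'_integral_bound (d := d) hd c c₃ c₄
  obtain ⟨C₂, hC₂, h₂⟩ := poisson_integral_bound (d := d) hd c c₃ c₄
  refine ⟨C₂ + (|c| * ∫ k : Mom d, wt (4 * d + 23) k) + C₁, ?_, ?_⟩
  · have : 0 ≤ ∫ k : Mom d, wt (4 * d + 23) k := integral_nonneg fun k => (wt_pos _ _).le
    positivity
  intro Φ f k₀ h hf θ η hη hη1
  have hΦ := h.smooth.continuous
  have hx : Continuous fun k => θ - Φ k := continuous_const.sub hΦ
  have hfi := hf.integrable (by omega)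
  have i1 : Integrable fun k => f k * (η / ((θ - Φ k) ^ 2 + η ^ 2)) := by
    refine hfi.mul_bdd (c := η⁻¹) ?_ (Eventually.of_forall fun k => ?_)
    · exact (Continuous.div continuous_const (by fun_prop) fun k => by positivity).aestronglyMeasurable
    · rw [Real.norm_of_nonneg (by positivity), div_le_iff₀ (by positivity), inv_mul_eq_div,
        le_div_iff₀ hη]
      nlinarith [sq_nonneg (θ - Φ k)]
  have i2 : Integrable fun k => f k * ((θ - Φ k) / ((θ - Φ k) ^ 2 + 1)) := by
    refine hfi.mul_bdd (c := 1) ?_ (Eventually.of_forall fun k => ?_)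
    · exact (Continuous.div hx (by fun_prop) fun k => by positivity).aestronglyMeasurable
    · have := abs_div_sq_add_le (θ - Φ k) one_pos
      rwa [one_pow, inv_one] at this
  have i3 : Integrable fun k => f k * logRatio' η (θ - Φ k) := by
    refine hfi.mul_bdd (c := η⁻¹ + 1) ?_ (Eventually.of_forall fun k => abs_logRatio'_le hη _)
    exact ((continuous_logRatio' hη).comp hx).aestronglyMeasurable
  simp only [div_resolvent_eq hη]
  rw [integral_add i1.ofReal ((i2.add i3).ofReal.const_mul _), integral_const_mul, integral_complex_ofReal,
    integral_complex_ofReal, integral_add i2 i3]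
  have b2 : |∫ k, f k * ((θ - Φ k) / ((θ - Φ k) ^ 2 + 1))| ≤ |c| * ∫ k : Mom d, wt (4 * d + 23) k := by
    rw [← integral_const_mul, ← Real.norm_eq_abs]
    refine norm_integral_le_of_norm_le ((integrable_wt (d := d) (a := 4 * d + 23) (by omega)).const_mul |c|)
      (Eventually.of_forall fun k => ?_)
    have := abs_div_sq_add_le (θ - Φ k) one_pos
    rw [one_pow, inv_one] at this
    rw [Real.norm_eq_abs, abs_mul, abs_of_nonneg (hf.nonneg k)]
    have hw := wt_pos (4 * d + 23) k
    calc _ ≤ f k * 1 := mul_le_mul_of_nonneg_left this (hf.nonneg k)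
      _ ≤ c * wt (4 * d + 23) k := by rw [mul_one]; exact hf.bound0 k
      _ ≤ _ := by gcongr; exact le_abs_self c
  refine (norm_add_le _ _).trans ?_
  rw [norm_mul, Complex.norm_I, one_mul, Complex.norm_real, Complex.norm_real, Real.norm_eq_abs,
    Real.norm_eq_abs]
  have b1 := h₂ Φ f k₀ h hf θ η hη
  have b3 := h₁ Φ f k₀ h hf θ η hη hη1
  have b4 := abs_add_le (∫ k, f k * ((θ - Φ k) / ((θ - Φ k) ^ 2 + 1)))
    (∫ k, f k * logRatio' η (θ - Φ k))
  linarith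

/-- The bound for the Laplace transform of the correlation function. -/
theorem correlation_transform_bound (hd : 3 ≤ d) (K : Constants) (β : ℝ) : ∃ C : ℝ, 1 ≤ C ∧
    ∀ S : Model d, S.β = β → Assumptions K S → ∀ (σ : ℤˣ) (p : Mom d) (θ η : ℝ), 0 < η → η ≤ 1 →
      ‖∫ k, (S.M k σ : ℂ) / ((η : ℂ) - Complex.I * ((θ - S.Phi σ p k : ℝ) : ℂ))‖ ≤ C := by
  obtain ⟨C, hC, h⟩ := resolvent_transform_bound (d := d) hd (mBound K β) K.c₃ K.c₄
  refine ⟨C + 1, by linarith, fun S hβ A σ p θ η hη hη1 => ?_⟩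
  obtain ⟨k₀, hk⟩ := A.exists_convexPhase hd σ p
  have hM := A.M_decay hd σ
  rw [hβ] at hM
  exact (h _ _ k₀ hk hM θ η hη hη1).trans (by linarith)

end

/-! ### Time integrals by Fourier inversion -/

section

open FourierTransform

variable {N : ℕ}

/-- The convolution of `N + 1` functions, evaluated at `τ`. -/
def multiConv (g : Fin (N + 1) → ℝ → ℂ) (τ : ℝ) : ℂ :=
  ∫ s : Fin N → ℝ, g 0 (τ - ∑ i, s i) * ∏ i : Fin N, g i.succ (s i)

lemma integrable_prod_succ {g : Fin (N + 1) → ℝ → ℂ} (hg : ∀ b, Integrable (g b)) :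
    Integrable fun s : Fin N → ℝ => ∏ i : Fin N, g i.succ (s i) :=
  Integrable.fintype_prod fun i => hg i.succ

lemma integrable_translate_mul {Y : Type*} [MeasurableSpace Y] {ν : Measure Y} [SFinite ν]
    {g : ℝ → ℂ} {G : Y → ℂ} {a : Y → ℝ} (ha : Measurable a) (hg : Measurable g)
    (hG : Measurable G) (hgi : Integrable g) (hGi : Integrable G ν) :
    Integrable (fun z : ℝ × Y => g (z.1 - a z.2) * G z.2) ((volume : Measure ℝ).prod ν) := by
  have h1 : Measurable fun z : ℝ × Y => z.1 - a z.2 := by fun_prop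
  have hmeas : Measurable fun z : ℝ × Y => g (z.1 - a z.2) * G z.2 :=
    (hg.comp h1).mul (hG.comp measurable_snd)
  rw [integrable_prod_iff' hmeas.aestronglyMeasurable]
  refine ⟨Eventually.of_forall fun s => (hgi.comp_sub_right (a s)).mul_const (G s), ?_⟩
  refine (hGi.norm.const_mul (∫ x, ‖g x‖)).congr (Eventually.of_forall fun s => ?_)
  simp only [norm_mul]
  rw [integral_mul_const, integral_sub_right_eq_self (fun x => ‖g x‖)]

lemma integrable_multiConv_kernel {g : Fin (N + 1) → ℝ → ℂ} (hm : ∀ b, Measurable (g b))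
    (hg : ∀ b, Integrable (g b)) :
    Integrable (fun z : ℝ × (Fin N → ℝ) => g 0 (z.1 - ∑ i, z.2 i) * ∏ i : Fin N, g i.succ (z.2 i))
      ((volume : Measure ℝ).prod volume) :=
by
  have h1 : Measurable fun s : Fin N → ℝ => ∑ i, s i := by fun_prop
  have h2 : Measurable fun s : Fin N → ℝ => ∏ i : Fin N, g i.succ (s i) :=
    Finset.measurable_prod _ fun i _ => (hm i.succ).comp (measurable_pi_apply i)
  have h3 := integrable_prod_succ hg
  exact integrable_translate_mul h1 (hm 0) h2 (hg 0) h3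

lemma integrable_multiConv {g : Fin (N + 1) → ℝ → ℂ} (hm : ∀ b, Measurable (g b))
    (hg : ∀ b, Integrable (g b)) : Integrable (multiConv g) :=
  (integrable_multiConv_kernel hm hg).integral_prod_left

/-- The Fourier transform of a convolution is the product of the Fourier transforms. -/
lemma fourier_multiConv {g : Fin (N + 1) → ℝ → ℂ} (hm : ∀ b, Measurable (g b))
    (hg : ∀ b, Integrable (g b)) (w : ℝ) : 𝓕 (multiConv g) w = ∏ b, 𝓕 (g b) w := by
  set ch : ℝ → ℂ := fun v => Complex.exp (↑(-2 * Real.pi * v * w) * Complex.I) with hch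
  have hch_add : ∀ u v, ch (u + v) = ch u * ch v := fun u v => by
    simp only [hch, ← Complex.exp_add]; congr 1; push_cast; ring
  have hch_norm : ∀ v, ‖ch v‖ = 1 := fun v => Complex.norm_exp_ofReal_mul_I _
  have hch_cont : Continuous ch := by simp only [hch]; fun_prop
  have hch_sum : ∀ s : Fin N → ℝ, ch (∑ i, s i) = ∏ i, ch (s i) := fun s => by
    simp only [hch, ← Complex.exp_sum]
    congr 1
    rw [← Finset.sum_mul]
    push_cast
    rw [Finset.mul_sum, Finset.sum_mul]
  simp only [Real.fourier_real_eq_integral_exp_smul, smul_eq_mul]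
  change ∫ v, ch v * multiConv g v = ∏ b, ∫ v, ch v * g b v
  have hk := integrable_multiConv_kernel hm hg
  have hk' : Integrable (fun z : ℝ × (Fin N → ℝ) => ch z.1 *
      (g 0 (z.1 - ∑ i, z.2 i) * ∏ i : Fin N, g i.succ (z.2 i)))
      ((volume : Measure ℝ).prod volume) :=
    hk.bdd_mul (c := 1) (hch_cont.comp continuous_fst).aestronglyMeasurable
      (Eventually.of_forall fun z => (hch_norm _).le)
  calc ∫ v, ch v * multiConv g v
      = ∫ v, ∫ s : Fin N → ℝ, ch v * (g 0 (v - ∑ i, s i) * ∏ i : Fin N, g i.succ (s i)) := by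
        refine integral_congr_ae (Eventually.of_forall fun v => ?_)
        simp only [multiConv]
        rw [integral_const_mul]
    _ = ∫ s : Fin N → ℝ, ∫ v, ch v * (g 0 (v - ∑ i, s i) * ∏ i : Fin N, g i.succ (s i)) :=
        integral_integral_swap hk'
    _ = ∫ s : Fin N → ℝ, (∫ v, ch v * g 0 v) * ∏ i : Fin N, (ch (s i) * g i.succ (s i)) := by
        refine integral_congr_ae (Eventually.of_forall fun s => ?_)
        simp only []
        rw [Finset.prod_mul_distrib, ← hch_sum,
          ← integral_sub_right_eq_self (fun v => ch v * g 0 v) (∑ i, s i), ← integral_mul_const]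
        refine integral_congr_ae (Eventually.of_forall fun v => ?_)
        have := hch_add (v - ∑ i, s i) (∑ i, s i)
        rw [sub_add_cancel] at this
        simp only [this]
        ring
    _ = _ := by
        rw [integral_const_mul, Fin.prod_univ_succ]
        congr 1
        exact integral_fintype_prod_volume_eq_prod fun (i : Fin N) x => ch x * g i.succ x

lemma volume_sum_eq (hN : 0 < N) (t : ℝ) : volume {s : Fin N → ℝ | ∑ i, s i = t} = 0 := by
  have hsum : {s : Fin N → ℝ | ∑ i, s i = t} =
      (AffineSubspace.comap (∑ i, LinearMap.proj i : (Fin N → ℝ) →ₗ[ℝ] ℝ).toAffineMap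
        (AffineSubspace.mk' t ⊥) : Set (Fin N → ℝ)) := by
    ext s
    simp [AffineSubspace.mem_mk', sub_eq_zero]
  rw [hsum]
  refine Measure.addHaar_affineSubspace _ _ fun h => ?_
  -- If the hyperplane were the whole space it would contain this point, whose coordinates add up to
  -- t + 1.
  have h1 : (fun _ => (t + 1) / N : Fin N → ℝ) ∈ {s : Fin N → ℝ | ∑ i, s i = t} := by
    rw [hsum, h]; trivial
  have hN' : (N : ℝ) ≠ 0 := by positivity
  simp only [Set.mem_setOf_eq, Finset.sum_const, Finset.card_univ, Fintype.card_fin,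
    nsmul_eq_mul] at h1
  rw [mul_div_cancel₀ _ hN'] at h1
  linarith

/-- The damped functions jump at 0, but the jump of the factor g 0 is met only on the hyperplane ∑
s_i = t, a null set for N > 0. Continuity at t makes Fourier inversion valid pointwise. -/
lemma continuousAt_multiConv (hN : 0 < N) {g : Fin (N + 1) → ℝ → ℂ} (hm : ∀ b, Measurable (g b))
    (hg : ∀ b, Integrable (g b)) {B : ℝ} (hB : ∀ x, ‖g 0 x‖ ≤ B)
    (hc : ∀ x, x ≠ 0 → ContinuousAt (g 0) x) (t : ℝ) : ContinuousAt (multiConv g) t := by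
  have hmp : Measurable fun s : Fin N → ℝ => ∏ i : Fin N, g i.succ (s i) :=
    Finset.measurable_prod _ fun i _ => (hm i.succ).comp (measurable_pi_apply i)
  refine continuousAt_of_dominated (bound := fun s => B * ‖∏ i : Fin N, g i.succ (s i)‖)
    (Eventually.of_forall fun τ => ?_) (Eventually.of_forall fun τ => Eventually.of_forall fun s => ?_)
    ((integrable_prod_succ hg).norm.const_mul _) ?_
  · have h1 : Measurable fun s : Fin N → ℝ => τ - ∑ i, s i := by fun_prop
    exact (((hm 0).comp h1).mul hmp).aestronglyMeasurable
  · rw [norm_mul]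
    exact mul_le_mul_of_nonneg_right (hB _) (norm_nonneg _)
  · have h0 : ∀ᵐ s : Fin N → ℝ, ¬ ∑ i, s i = t := by
      rw [ae_iff]; simpa using volume_sum_eq hN t
    filter_upwards [h0] with s hs
    refine ContinuousAt.mul ?_ continuousAt_const
    exact ContinuousAt.comp (f := fun τ : ℝ => τ - ∑ i, s i) (hc _ (sub_ne_zero.2 (Ne.symm hs)))
      (by fun_prop)

/-- The Laplace transform at `η - iα`. -/
def lap (η : ℝ) (f : ℝ → ℂ) (α : ℝ) : ℂ :=
  ∫ s : ℝ in Set.Ioi 0, Complex.exp ((-η + Complex.I * α) * s) * f s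

/-- The damped restriction of a function to the positive half-line. -/
def damped (η : ℝ) (f : ℝ → ℂ) : ℝ → ℂ :=
  (Set.Ici 0).indicator fun s : ℝ => Complex.exp (-η * s) * f s

lemma measurable_damped {η : ℝ} {f : ℝ → ℂ} (hf : Continuous f) : Measurable (damped η f) := by
  refine Measurable.indicator (Continuous.measurable ?_) measurableSet_Ici
  fun_prop

lemma norm_damped_le {η B : ℝ} (hη : 0 < η) {f : ℝ → ℂ} (hB : ∀ s, ‖f s‖ ≤ B) (s : ℝ) :
    ‖damped η f s‖ ≤ (Set.Ici 0).indicator (fun s => B * Real.exp (-η * s)) s := by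
  unfold damped
  rw [norm_indicator_eq_indicator_norm]
  refine Set.indicator_le_indicator ?_
  rw [norm_mul, mul_comm, Complex.norm_exp]
  have : ((-η : ℂ) * s).re = -η * s := by simp
  rw [this]
  exact mul_le_mul_of_nonneg_right (hB s) (Real.exp_nonneg _)

lemma integrable_damped {η B : ℝ} (hη : 0 < η) {f : ℝ → ℂ} (hf : Continuous f)
    (hB : ∀ s, ‖f s‖ ≤ B) : Integrable (damped η f) := by
  refine Integrable.mono' ?_ (measurable_damped hf).aestronglyMeasurable
    (Eventually.of_forall (norm_damped_le hη hB))
  rw [integrable_indicator_iff measurableSet_Ici, integrableOn_Ici_iff_integrableOn_Ioi]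
  exact (integrableOn_exp_mul_Ioi (by linarith) 0).const_mul B

lemma fourier_damped (η : ℝ) (f : ℝ → ℂ) (w : ℝ) :
    𝓕 (damped η f) w = lap η f (-2 * Real.pi * w) := by
  rw [Real.fourier_real_eq_integral_exp_smul, lap, ← MeasureTheory.integral_Ici_eq_integral_Ioi,
    ← integral_indicator measurableSet_Ici]
  refine integral_congr_ae (Eventually.of_forall fun s => ?_)
  simp only [damped, Set.indicator, Set.mem_Ici, smul_eq_mul]
  split_ifs
  · rw [← mul_assoc, ← Complex.exp_add]
    congr 2; push_cast; ring
  · simp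

/-- The times add up to t, so the damping factors combine to e^{-ηt}; the supports in [0, ∞) cut out
the simplex. -/
lemma multiConv_damped (η t : ℝ) (f : Fin (N + 1) → ℝ → ℂ) :
    multiConv (fun b => damped η (f b)) t =
      Complex.exp (-η * t) * timeIntegral N t fun s => ∏ b, f b (s b) := by
  have hms : MeasurableSet {s : Fin N → ℝ | (∀ i, 0 ≤ s i) ∧ ∑ i, s i ≤ t} := by
    have h1 : Measurable fun s : Fin N → ℝ => ∑ i, s i := by fun_prop
    have h2 : MeasurableSet {s : Fin N → ℝ | ∀ i, 0 ≤ s i} := by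
      rw [Set.setOf_forall]
      exact MeasurableSet.iInter fun i => measurableSet_le measurable_const (measurable_pi_apply i)
    exact h2.inter (measurableSet_le h1 measurable_const)
  rw [timeIntegral, ← integral_const_mul, ← integral_indicator hms, multiConv]
  refine integral_congr_ae (Eventually.of_forall fun s => ?_)
  simp only [damped, Set.indicator, Set.mem_Ici, Set.mem_setOf_eq]
  by_cases h : (∀ i, 0 ≤ s i) ∧ ∑ i, s i ≤ t
  · rw [if_pos h, if_pos (sub_nonneg.2 h.2)]
    have : ∀ i, (if 0 ≤ s i then Complex.exp (-η * s i) * f i.succ (s i) else 0) =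
        Complex.exp (-η * s i) * f i.succ (s i) := fun i => if_pos (h.1 i)
    simp only [this]
    rw [Fin.prod_univ_succ, Finset.prod_mul_distrib, ← Complex.exp_sum]
    simp only [Fin.cons_zero, Fin.cons_succ]
    rw [← Finset.mul_sum]
    have e : Complex.exp (-η * t) = Complex.exp (-η * ((t - ∑ i, s i : ℝ) : ℂ)) *
        Complex.exp (-η * ∑ i, (s i : ℂ)) := by
      rw [← Complex.exp_add]; congr 1; push_cast; ring
    rw [e]; ring
  · rw [if_neg h]
    rcases not_and_or.1 h with h | h
    · obtain ⟨i, hi⟩ := not_forall.1 h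
      rw [Finset.prod_eq_zero (Finset.mem_univ i) (if_neg hi), mul_zero]
    · rw [if_neg (by linarith), zero_mul]

/-- **Time integrals in terms of resolvents.** -/
theorem enorm_timeIntegral_le (hN : 0 < N) {η B t : ℝ} (hη : 0 < η) {f : Fin (N + 1) → ℝ → ℂ}
    (hf : ∀ b, Continuous (f b)) (hB : ∀ b s, ‖f b s‖ ≤ B) :
    ‖timeIntegral N t fun s => ∏ b, f b (s b)‖ₑ ≤
      ENNReal.ofReal (Real.exp (η * t)) * ∫⁻ α, ∏ b, ‖lap η (f b) α‖ₑ := by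
  set g : Fin (N + 1) → ℝ → ℂ := fun b => damped η (f b) with hgdef
  have hm : ∀ b, Measurable (g b) := fun b => measurable_damped (hf b)
  have hg : ∀ b, Integrable (g b) := fun b => integrable_damped hη (hf b) (hB b)
  have hB0 : 0 ≤ B := (norm_nonneg _).trans (hB 0 0)
  have hcont : ContinuousAt (multiConv g) t := by
    refine continuousAt_multiConv hN hm hg (B := B) (fun x => ?_) (fun x hx => ?_) t
    · refine (norm_damped_le hη (hB 0) x).trans ?_
      refine Set.indicator_apply_le' (fun hx => ?_) fun _ => hB0
      have : Real.exp (-η * x) ≤ 1 := Real.exp_le_one_iff.2 (by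
        have := mul_nonneg hη.le (Set.mem_Ici.1 hx); linarith)
      nlinarith
    · refine ContinuousOn.continuousAt_indicator (Continuous.continuousOn ?_) ?_
      · have := hf 0
        fun_prop
      · rwa [frontier_Ici]
  have hfour : ∀ w, 𝓕 (multiConv g) w = ∏ b, lap η (f b) (-2 * Real.pi * w) := fun w => by
    rw [fourier_multiConv hm hg]
    exact Finset.prod_congr rfl fun b _ => fourier_damped _ _ _
  have hpi : (-2 * Real.pi) ≠ 0 := by have := Real.pi_pos; linarith
  have hsub : ∫⁻ w, ‖𝓕 (multiConv g) w‖ₑ ≤ ∫⁻ α, ∏ b, ‖lap η (f b) α‖ₑ := by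
    have he : ∀ w, ‖𝓕 (multiConv g) w‖ₑ =
        (fun α => ∏ b, ‖lap η (f b) α‖ₑ) ((-2 * Real.pi) * w) := fun w => by
      simp only [hfour, enorm_eq_nnnorm, nnnorm_prod, ENNReal.ofNNReal_finsetProd]
    simp only [he]
    have hemb : MeasurableEmbedding fun w : ℝ => (-2 * Real.pi) * w :=
      (Homeomorph.mulLeft₀ _ hpi).measurableEmbedding
    rw [← hemb.lintegral_map (fun α => ∏ b, ‖lap η (f b) α‖ₑ), Real.map_volume_mul_left hpi,
      lintegral_smul_measure, smul_eq_mul]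
    -- The change of variables from frequency to α produces 1/(2π), which is dropped.
    refine mul_le_of_le_one_left' (ENNReal.ofReal_le_one.2 ?_)
    have := Real.pi_gt_three
    rw [abs_inv, abs_mul, abs_of_pos Real.pi_pos, abs_neg, abs_two]
    exact inv_le_one_of_one_le₀ (by linarith)
  -- If the right side is infinite there is nothing to prove; otherwise the Fourier transform is
  -- integrable and inversion applies.
  by_cases htop : ∫⁻ α, ∏ b, ‖lap η (f b) α‖ₑ = ⊤
  · rw [htop, ENNReal.mul_top (by simp [Real.exp_pos])]
    exact le_top
  have hfc : Continuous (𝓕 (multiConv g)) :=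
    VectorFourier.fourierIntegral_continuous Real.continuous_fourierChar
      (by exact continuous_inner) (integrable_multiConv hm hg)
  have hfi : Integrable (𝓕 (multiConv g)) :=
    ⟨hfc.aestronglyMeasurable, (hsub.trans_lt (lt_top_iff_ne_top.2 htop))⟩
  have hinv := (integrable_multiConv hm hg).fourierInv_fourier_eq hfi hcont
  have hbound : ‖multiConv g t‖ₑ ≤ ∫⁻ α, ∏ b, ‖lap η (f b) α‖ₑ := by
    rw [← hinv, Real.fourierInv_eq']
    refine (enorm_integral_le_lintegral_enorm _).trans (le_trans (le_of_eq ?_) hsub)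
    refine lintegral_congr fun w => ?_
    rw [enorm_smul, ← ofReal_norm_eq_enorm (Complex.exp _), Complex.norm_exp_ofReal_mul_I]
    simp
  have hT : timeIntegral N t (fun s => ∏ b, f b (s b)) =
      Complex.exp (η * t) * multiConv g t := by
    rw [multiConv_damped, ← mul_assoc, ← Complex.exp_add]
    simp
  rw [hT, enorm_mul]
  refine mul_le_mul' (le_of_eq ?_) hbound
  rw [← ofReal_norm_eq_enorm, Complex.norm_exp]
  simp

end

/-! ### Immediate reabsorptions: one block of times for each j -/

section

variable {n N : ℕ} {m : Fin (n + 1) → ℕ}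

/-- The integrand of a history, for given energies and correlation functions. -/
def blockProd (N : ℕ) (m : Fin (n + 1) → ℕ) (E : Fin (n + 1) → ℝ) (T : Fin (n + 1) → ℝ → ℂ)
    (s : Fin (N + 1) → ℝ) : ℂ :=
  ∏ j : Fin (n + 1),
    ((∏ b ∈ outerIdx N m j, Complex.exp (-Complex.I * (s b : ℂ) * (E j : ℂ))) *
      ∏ b ∈ innerIdx N m j, T j (s b))

lemma position_succ_le {i j : Fin (n + 1)} (h : i < j) :
    position m i + 2 * m i + 1 ≤ position m j := by
  have hs : insert i (Finset.univ.filter fun l => l < i) ⊆ Finset.univ.filter fun l => l < j := by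
    intro l hl
    rcases Finset.mem_insert.1 hl with rfl | hl
    · simpa using h
    · simp only [Finset.mem_filter, Finset.mem_univ, true_and] at hl ⊢
      exact hl.trans h
  have := Finset.sum_le_sum_of_subset (f := m) hs
  rw [Finset.sum_insert (by simp)] at this
  have h' : (i : ℕ) < j := h
  unfold position
  omega

lemma position_succ {i : Fin (n + 1)} (h : (i : ℕ) + 1 < n + 1) :
    position m ⟨(i : ℕ) + 1, h⟩ = position m i + 2 * m i + 1 := by
  have hs : (Finset.univ.filter fun l : Fin (n + 1) => l < ⟨(i : ℕ) + 1, h⟩) =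
      insert i (Finset.univ.filter fun l => l < i) := by
    ext l
    simp only [Finset.mem_filter, Finset.mem_univ, true_and, Finset.mem_insert, Fin.lt_def,
      Fin.ext_iff]
    omega
  unfold position
  rw [hs, Finset.sum_insert (by simp)]
  simp only
  omega

lemma position_last (hm : m ∈ patterns n N) :
    position m (Fin.last n) + 2 * m (Fin.last n) = N := by
  have hs : (Finset.univ : Finset (Fin (n + 1))) =
      insert (Fin.last n) (Finset.univ.filter fun l => l < Fin.last n) := by
    ext l
    simp only [Finset.mem_filter, Finset.mem_univ, true_and, Finset.mem_insert, true_iff]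
    exact (Fin.le_last l).eq_or_lt
  have h : n + 2 * ∑ j, m j = N := hm
  rw [hs, Finset.sum_insert (by simp)] at h
  unfold position
  simp only [Fin.val_last]
  omega

lemma mem_block_iff {j : Fin (n + 1)} {b : Fin (N + 1)} :
    b ∈ outerIdx N m j ∪ innerIdx N m j ↔
      position m j ≤ b ∧ (b : ℕ) ≤ position m j + 2 * m j := by
  simp only [Finset.mem_union, outerIdx, innerIdx, Finset.mem_filter, Finset.mem_univ, true_and]
  constructor
  · rintro (⟨i, hi, h⟩ | ⟨i, hi, h⟩) <;> omega
  · rintro ⟨h1, h2⟩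
    obtain ⟨i, hi | hi⟩ := Nat.even_or_odd' ((b : ℕ) - position m j)
    · exact Or.inl ⟨i, by omega, by omega⟩
    · exact Or.inr ⟨i, by omega, by omega⟩

lemma disjoint_outer_inner (j : Fin (n + 1)) : Disjoint (outerIdx N m j) (innerIdx N m j) := by
  rw [Finset.disjoint_left]
  intro b h1 h2
  simp only [outerIdx, innerIdx, Finset.mem_filter, Finset.mem_univ, true_and] at h1 h2
  obtain ⟨i, _, hi⟩ := h1
  obtain ⟨i', _, hi'⟩ := h2
  omega

/-- The block is the last one that starts at or before b; the next block starts right after its end.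
-/
lemma exists_block (hm : m ∈ patterns n N) (b : Fin (N + 1)) :
    ∃ j, b ∈ outerIdx N m j ∪ innerIdx N m j := by
  have h0 : position m 0 ≤ b := by simp [position]
  have hne : (Finset.univ.filter fun j => position m j ≤ b).Nonempty :=
    ⟨0, by simpa using h0⟩
  refine ⟨Finset.max' _ hne, mem_block_iff.2 ?_⟩
  set j := Finset.max' _ hne with hj
  have h1 : position m j ≤ b := (Finset.mem_filter.1 (Finset.max'_mem _ hne)).2
  refine ⟨h1, ?_⟩
  by_cases hl : (j : ℕ) + 1 < n + 1
  · by_contra hlt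
    have h2 := position_succ (m := m) hl
    have h3 : (⟨(j : ℕ) + 1, hl⟩ : Fin (n + 1)) ≤ j :=
      Finset.le_max' _ _ (Finset.mem_filter.2 ⟨Finset.mem_univ _, by omega⟩)
    rw [Fin.le_def] at h3
    simp at h3
  · have : j = Fin.last n := Fin.ext (by have := j.2; simp only [Fin.val_last]; omega)
    rw [this, position_last hm]
    exact Nat.lt_succ_iff.1 b.2

lemma block_unique {i j : Fin (n + 1)} {b : Fin (N + 1)}
    (hi : b ∈ outerIdx N m i ∪ innerIdx N m i) (hj : b ∈ outerIdx N m j ∪ innerIdx N m j) :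
    i = j := by
  rw [mem_block_iff] at hi hj
  rcases lt_trichotomy i j with h | h | h
  · have := position_succ_le (m := m) h; omega
  · exact h
  · have := position_succ_le (m := m) h; omega

/-- The block that contains an index. -/
def block (hm : m ∈ patterns n N) (b : Fin (N + 1)) : Fin (n + 1) := (exists_block hm b).choose

lemma block_eq_iff (hm : m ∈ patterns n N) {b : Fin (N + 1)} {j : Fin (n + 1)} :
    block hm b = j ↔ b ∈ outerIdx N m j ∪ innerIdx N m j :=
  ⟨fun h => h ▸ (exists_block hm b).choose_spec, fun h => block_unique (exists_block hm b).choose_spec h⟩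

lemma prod_eq_prod_blocks {R : Type*} [CommMonoid R] (hm : m ∈ patterns n N)
    (F : Fin (N + 1) → R) :
    ∏ b, F b = ∏ j, ((∏ b ∈ outerIdx N m j, F b) * ∏ b ∈ innerIdx N m j, F b) := by
  rw [← Finset.prod_fiberwise Finset.univ (block hm) F]
  refine Finset.prod_congr rfl fun j _ => ?_
  rw [← Finset.prod_union (disjoint_outer_inner j)]
  refine Finset.prod_congr ?_ fun _ _ => rfl
  ext b
  simp only [Finset.mem_filter, Finset.mem_univ, true_and]
  exact block_eq_iff hm

lemma card_innerIdx_le (j : Fin (n + 1)) : (innerIdx N m j).card ≤ m j := by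
  refine (Finset.card_le_card_of_injOn (s := innerIdx N m j) (t := Finset.range (m j))
    (fun b : Fin (N + 1) => ((b : ℕ) - position m j) / 2) ?_ ?_).trans (Finset.card_range _).le
  · intro b hb
    obtain ⟨i, hi, h⟩ := (Finset.mem_filter.1 hb).2
    simp only [Finset.coe_range, Set.mem_Iio]
    omega
  · intro b hb b' hb' h
    obtain ⟨i, hi, h1⟩ := (Finset.mem_filter.1 hb).2
    obtain ⟨i', hi', h2⟩ := (Finset.mem_filter.1 hb').2
    simp only at h
    exact Fin.ext (by omega)

lemma card_outerIdx_le (j : Fin (n + 1)) : (outerIdx N m j).card ≤ m j + 1 := by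
  refine (Finset.card_le_card_of_injOn (s := outerIdx N m j) (t := Finset.range (m j + 1))
    (fun b : Fin (N + 1) => ((b : ℕ) - position m j) / 2) ?_ ?_).trans (Finset.card_range _).le
  · intro b hb
    obtain ⟨i, hi, h⟩ := (Finset.mem_filter.1 hb).2
    simp only [Finset.coe_range, Set.mem_Iio]
    omega
  · intro b hb b' hb' h
    obtain ⟨i, hi, h1⟩ := (Finset.mem_filter.1 hb).2
    obtain ⟨i', hi', h2⟩ := (Finset.mem_filter.1 hb').2
    simp only at h
    exact Fin.ext (by omega)

lemma outerIdx_nonempty (hm : m ∈ patterns n N) (j : Fin (n + 1)) : (outerIdx N m j).Nonempty := by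
  have h : position m j ≤ N := by
    rcases (Fin.le_last j).eq_or_lt with h | h
    · have := position_last hm; rw [h]; omega
    · have := position_succ_le (m := m) h; have := position_last hm; omega
  exact ⟨⟨position m j, by omega⟩, Finset.mem_filter.2 ⟨Finset.mem_univ _, 0, by simp⟩⟩

/-- The factor of a history that depends on the time `s_b`. -/
def blockFactor (hm : m ∈ patterns n N) (E : Fin (n + 1) → ℝ) (T : Fin (n + 1) → ℝ → ℂ)
    (b : Fin (N + 1)) (s : ℝ) : ℂ :=
  if b ∈ outerIdx N m (block hm b) then
    Complex.exp (-Complex.I * (s : ℂ) * (E (block hm b) : ℂ)) else T (block hm b) s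

lemma blockFactor_outer (hm : m ∈ patterns n N) (E : Fin (n + 1) → ℝ) (T : Fin (n + 1) → ℝ → ℂ)
    {j : Fin (n + 1)} {b : Fin (N + 1)} (hb : b ∈ outerIdx N m j) :
    blockFactor hm E T b = fun s : ℝ => Complex.exp (-Complex.I * (s : ℂ) * (E j : ℂ)) := by
  have hj : block hm b = j := (block_eq_iff hm).2 (Finset.mem_union_left _ hb)
  funext s
  rw [blockFactor, hj, if_pos hb]

lemma blockFactor_inner (hm : m ∈ patterns n N) (E : Fin (n + 1) → ℝ) (T : Fin (n + 1) → ℝ → ℂ)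
    {j : Fin (n + 1)} {b : Fin (N + 1)} (hb : b ∈ innerIdx N m j) :
    blockFactor hm E T b = T j := by
  have hj : block hm b = j := (block_eq_iff hm).2 (Finset.mem_union_right _ hb)
  funext s
  rw [blockFactor, hj, if_neg (Finset.disjoint_right.1 (disjoint_outer_inner j) hb)]

lemma blockProd_eq (hm : m ∈ patterns n N) (E : Fin (n + 1) → ℝ) (T : Fin (n + 1) → ℝ → ℂ)
    (s : Fin (N + 1) → ℝ) : blockProd N m E T s = ∏ b, blockFactor hm E T b (s b) := by
  rw [prod_eq_prod_blocks hm, blockProd]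
  refine Finset.prod_congr rfl fun j _ => ?_
  congr 1
  · exact Finset.prod_congr rfl fun b hb => by rw [blockFactor_outer hm E T hb]
  · exact Finset.prod_congr rfl fun b hb => by rw [blockFactor_inner hm E T hb]

lemma continuous_blockFactor (hm : m ∈ patterns n N) (E : Fin (n + 1) → ℝ)
    {T : Fin (n + 1) → ℝ → ℂ} (hT : ∀ j, Continuous (T j)) (b : Fin (N + 1)) :
    Continuous (blockFactor hm E T b) := by
  unfold blockFactor
  split_ifs
  · fun_prop
  · exact hT _

lemma norm_exp_neg_I (s E : ℝ) : ‖Complex.exp (-Complex.I * (s : ℂ) * (E : ℂ))‖ = 1 := by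
  rw [Complex.norm_exp]; simp

lemma norm_blockFactor_le (hm : m ∈ patterns n N) (E : Fin (n + 1) → ℝ)
    {T : Fin (n + 1) → ℝ → ℂ} {B : ℝ} (hB1 : 1 ≤ B) (hB : ∀ j s, ‖T j s‖ ≤ B) (b : Fin (N + 1))
    (s : ℝ) : ‖blockFactor hm E T b s‖ ≤ B := by
  unfold blockFactor
  split_ifs
  · rw [norm_exp_neg_I]; exact hB1
  · exact hB _ _

/-- The Laplace transform of an oscillating exponential is a resolvent. -/
lemma norm_lap_exp {t : ℝ} (ht : 0 < t) (E α : ℝ) :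
    ‖lap t⁻¹ (fun s : ℝ => Complex.exp (-Complex.I * (s : ℂ) * (E : ℂ))) α‖ = rr t (α - E) := by
  have h : lap t⁻¹ (fun s : ℝ => Complex.exp (-Complex.I * (s : ℂ) * (E : ℂ))) α =
      ∫ s : ℝ in Set.Ioi 0, Complex.exp ((-(t⁻¹ : ℝ) + Complex.I * ((α - E : ℝ) : ℂ)) * s) := by
    unfold lap
    refine integral_congr_ae (Eventually.of_forall fun s => ?_)
    simp only [← Complex.exp_add]
    congr 1; push_cast; ring
  have hre : (-(t⁻¹ : ℝ) + Complex.I * ((α - E : ℝ) : ℂ) : ℂ).re = -t⁻¹ := by simp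
  have him : (-(t⁻¹ : ℝ) + Complex.I * ((α - E : ℝ) : ℂ) : ℂ).im = α - E := by simp
  have hneg : (-(t⁻¹ : ℝ) + Complex.I * ((α - E : ℝ) : ℂ) : ℂ).re < 0 := by
    rw [hre]; have := inv_pos.2 ht; linarith
  rw [h, integral_exp_mul_complex_Ioi hneg, norm_div, norm_neg]
  simp only [Complex.ofReal_zero, mul_zero, Complex.exp_zero, norm_one]
  rw [rr, one_div, Complex.norm_def, Complex.normSq_apply, hre, him]
  congr 2; ring

/-- **A history in terms of resolvents.** -/
theorem enorm_timeIntegral_blockProd_le (hm : m ∈ patterns n N) (hN : 0 < N) {t B C : ℝ}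
    (ht : 1 ≤ t) (hC : 1 ≤ C) (E : Fin (n + 1) → ℝ) {T : Fin (n + 1) → ℝ → ℂ} (hB1 : 1 ≤ B)
    (hT : ∀ j, Continuous (T j)) (hB : ∀ j s, ‖T j s‖ ≤ B)
    (hlap : ∀ j α, ‖lap t⁻¹ (T j) α‖ ≤ C) :
    ‖timeIntegral N t (blockProd N m E T)‖ₑ ≤
      ENNReal.ofReal (Real.exp 1 * (C * t) ^ (∑ j, m j)) *
        ∫⁻ α, ∏ j, ENNReal.ofReal (rr t (α - E j)) := by
  have ht0 : 0 < t := by linarith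
  have h1 := enorm_timeIntegral_le hN (t := t) (inv_pos.2 ht0)
    (continuous_blockFactor hm E hT) (norm_blockFactor_le hm E hB1 hB)
  have h2 : (blockProd N m E T) = fun s => ∏ b, blockFactor hm E T b (s b) := by
    funext s; exact blockProd_eq hm E T s
  rw [h2]
  refine h1.trans ?_
  -- With η = 1/t the factor e^{ηt} is the constant e.
  rw [inv_mul_cancel₀ ht0.ne', ENNReal.ofReal_mul (Real.exp_nonneg _), mul_assoc]
  refine mul_le_mul_right ?_ _
  rw [← lintegral_const_mul' _ _ ENNReal.ofReal_ne_top]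
  refine lintegral_mono fun α => ?_
  have hrr : ∀ j, rr t (α - E j) ≤ t := fun j => rr_le ht0 _
  have hexp : (C * t) ^ (∑ j, m j) = ∏ j, (t ^ m j * C ^ m j) := by
    rw [← Finset.prod_pow_eq_pow_sum]
    exact Finset.prod_congr rfl fun j _ => by rw [mul_pow, mul_comm]
  rw [prod_eq_prod_blocks hm, hexp, ENNReal.ofReal_prod_of_nonneg (fun j _ => by positivity),
    ← Finset.prod_mul_distrib]
  refine Finset.prod_le_prod' fun j _ => ?_
  have hout : ∏ b ∈ outerIdx N m j, ‖lap t⁻¹ (blockFactor hm E T b) α‖ₑ ≤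
      ENNReal.ofReal (t ^ m j) * ENNReal.ofReal (rr t (α - E j)) := by
    have : ∀ b ∈ outerIdx N m j, ‖lap t⁻¹ (blockFactor hm E T b) α‖ₑ =
        ENNReal.ofReal (rr t (α - E j)) := fun b hb => by
      rw [blockFactor_outer hm E T hb, ← ofReal_norm_eq_enorm, norm_lap_exp ht0]
    rw [Finset.prod_congr rfl this, Finset.prod_const]
    -- All outer times of a block carry the same resolvent. One copy is kept, and the others, at
    -- most m j of them, are bounded by t.
    obtain ⟨c, hc⟩ := Nat.exists_eq_succ_of_ne_zero
      (Finset.card_pos.2 (outerIdx_nonempty hm j)).ne'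
    have hc' := card_outerIdx_le (N := N) (m := m) j
    rw [hc, pow_succ]
    refine mul_le_mul_left ?_ _
    rw [← ENNReal.ofReal_pow (rr_nonneg _ _)]
    refine ENNReal.ofReal_le_ofReal ((pow_le_pow_left₀ (rr_nonneg _ _) (hrr j) c).trans ?_)
    exact pow_le_pow_right₀ ht (by omega)
  have hin : ∏ b ∈ innerIdx N m j, ‖lap t⁻¹ (blockFactor hm E T b) α‖ₑ ≤
      ENNReal.ofReal (C ^ m j) := by
    calc _ ≤ ∏ b ∈ innerIdx N m j, ENNReal.ofReal C := Finset.prod_le_prod' fun b hb => by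
          rw [blockFactor_inner hm E T hb, ← ofReal_norm_eq_enorm]
          exact ENNReal.ofReal_le_ofReal (hlap j α)
      _ ≤ _ := by
          rw [Finset.prod_const, ← ENNReal.ofReal_pow (by linarith)]
          exact ENNReal.ofReal_le_ofReal (pow_le_pow_right₀ hC (card_innerIdx_le j))
  refine (mul_le_mul' hout hin).trans (le_of_eq ?_)
  rw [ENNReal.ofReal_mul (by positivity)]
  ring

end

/-! ### Rounded momenta and the Laplace transform of Θ -/

section

variable {d : ℕ}

/-- The inverse of the volume of a cell of `L Λ_L^*`. -/
def cellConst (d : ℕ) : ℝ := (Real.sqrt (2 * Real.pi) ^ d)⁻¹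

lemma cellConst_pos : 0 < cellConst d := by
  have : 0 < Real.sqrt (2 * Real.pi) := Real.sqrt_pos.2 (by positivity)
  unfold cellConst; positivity

lemma cellConst_le_one : cellConst d ≤ 1 := by
  refine inv_le_one_of_one_le₀ (one_le_pow₀ ?_)
  rw [Real.one_le_sqrt]
  have := Real.pi_gt_three; linarith

/-- `r` moves points by at most `ε`. -/
structure IsRounding (ε : ℝ) (r : Mom d → Mom d) : Prop where
  measurable : Measurable r
  le : ∀ k, ‖r k - k‖ ≤ ε

lemma isRounding_id : IsRounding 0 (id : Mom d → Mom d) := ⟨measurable_id, fun k => by simp⟩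

/-- The factor lost in weights when a point is moved by at most `√d`. -/
def roundConst (d : ℕ) : ℝ := 2 * (1 + Real.sqrt d)

lemma one_le_roundConst : 1 ≤ roundConst d := by
  unfold roundConst; linarith [Real.sqrt_nonneg (d : ℝ)]

lemma IsRounding.two_mul_bracket_le {ε : ℝ} {r : Mom d → Mom d} (h : IsRounding ε r)
    (hε : ε ≤ Real.sqrt d) (k : Mom d) : 2 * bracket (r k - k) ≤ roundConst d := by
  unfold roundConst
  have := bracket_le_one_add (r k - k)
  linarith [h.le k]

lemma IsRounding.bracket_le {ε : ℝ} {r : Mom d → Mom d} (h : IsRounding ε r)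
    (hε : ε ≤ Real.sqrt d) (k : Mom d) : bracket (r k) ≤ roundConst d * bracket k := by
  have h1 := bracket_add_le (r k - k) k
  rw [sub_add_cancel] at h1
  exact h1.trans (mul_le_mul_of_nonneg_right (h.two_mul_bracket_le hε k) (bracket_pos k).le)

lemma IsRounding.wt_le {ε : ℝ} {r : Mom d → Mom d} (h : IsRounding ε r)
    (hε : ε ≤ Real.sqrt d) (a : ℕ) (k : Mom d) : wt a (r k) ≤ roundConst d ^ a * wt a k := by
  have h1 := wt_add_le a (r k) (k - r k)
  rw [add_sub_cancel, ← bracket_neg, neg_sub] at h1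
  refine h1.trans (mul_le_mul_of_nonneg_right ?_ (wt_pos a k).le)
  have := bracket_pos (r k - k)
  exact pow_le_pow_left₀ (by positivity) (h.two_mul_bracket_le hε k) a

namespace Model

variable (S : Model d)

/-- The correlation function with the interaction momentum moved by `r`. -/
def thetaMap (r : Mom d → Mom d) (s : ℝ) (p : Mom d) (Ω : ℝ) : ℂ :=
  ∑ σ : ℤˣ, (cellConst d : ℂ) * ∫ k,
    Complex.exp (-Complex.I * (s : ℂ) * ((S.Phi σ p (r k) + Ω : ℝ) : ℂ)) * (S.M (r k) σ : ℂ)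

end Model

variable {K : Constants} {S : Model d}

/-- A bound for the interaction after rounding. -/
def roundM (d : ℕ) (K : Constants) (β : ℝ) : ℝ := mBound K β * roundConst d ^ (4 * d + 23)

lemma Assumptions.M_round_le (A : Assumptions K S) (hd : 3 ≤ d) {ε : ℝ} {r : Mom d → Mom d}
    (h : IsRounding ε r) (hε : ε ≤ Real.sqrt d) (σ : ℤˣ) (k : Mom d) :
    S.M (r k) σ ≤ roundM d K S.β * wt (4 * d + 23) k := by
  have hM := A.M_decay hd σ
  refine (hM.bound0 (r k)).trans ?_
  rw [roundM, mul_assoc]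
  exact mul_le_mul_of_nonneg_left (h.wt_le hε _ k) hM.const_nonneg

lemma Assumptions.mBound_nonneg (A : Assumptions K S) (hd : 3 ≤ d) : 0 ≤ mBound K S.β :=
  (A.M_decay hd 1).const_nonneg

lemma Assumptions.roundM_nonneg (A : Assumptions K S) (hd : 3 ≤ d) : 0 ≤ roundM d K S.β := by
  have := A.mBound_nonneg hd
  have := one_le_roundConst (d := d)
  unfold roundM; positivity

/-- A bound for the correlation function. -/
def thetaBound (d : ℕ) (K : Constants) (β : ℝ) : ℝ :=
  2 * (roundM d K β * ∫ k : Mom d, wt (4 * d + 23) k) + 1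

lemma Assumptions.one_le_thetaBound (A : Assumptions K S) (hd : 3 ≤ d) :
    1 ≤ thetaBound d K S.β := by
  have := A.roundM_nonneg hd
  have : 0 ≤ ∫ k : Mom d, wt (4 * d + 23) k := integral_nonneg fun k => (wt_pos _ _).le
  have : 0 ≤ roundM d K S.β * ∫ k : Mom d, wt (4 * d + 23) k := by positivity
  unfold thetaBound; linarith

lemma Assumptions.continuous_Phi (A : Assumptions K S) (hd : 3 ≤ d) (σ : ℤˣ) (p : Mom d) :
    Continuous (S.Phi σ p) := (A.Phi_contDiff hd σ p).continuous

lemma Assumptions.norm_theta_integrand_le (A : Assumptions K S) (hd : 3 ≤ d) {ε : ℝ}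
    {r : Mom d → Mom d} (h : IsRounding ε r) (hε : ε ≤ Real.sqrt d) (σ : ℤˣ) (s : ℝ) (p : Mom d)
    (Ω : ℝ) (k : Mom d) :
    ‖Complex.exp (-Complex.I * (s : ℂ) * ((S.Phi σ p (r k) + Ω : ℝ) : ℂ)) * (S.M (r k) σ : ℂ)‖ ≤
      roundM d K S.β * wt (4 * d + 23) k := by
  rw [norm_mul, norm_exp_neg_I, one_mul, Complex.norm_real,
    Real.norm_of_nonneg ((A.M_decay hd σ).nonneg _)]
  exact A.M_round_le hd h hε σ k

lemma Assumptions.measurable_theta_integrand (A : Assumptions K S) (hd : 3 ≤ d)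
    {r : Mom d → Mom d} (hr : Measurable r) (σ : ℤˣ) (s : ℝ) (p : Mom d) (Ω : ℝ) :
    Measurable fun k => Complex.exp (-Complex.I * (s : ℂ) * ((S.Phi σ p (r k) + Ω : ℝ) : ℂ)) *
      (S.M (r k) σ : ℂ) := by
  have h1 : Measurable fun k => S.Phi σ p (r k) := (A.continuous_Phi hd σ p).measurable.comp hr
  have h2 : Measurable fun k => S.M (r k) σ :=
    (A.M_decay hd σ).smooth.continuous.measurable.comp hr
  fun_prop

lemma Assumptions.integrable_theta_integrand (A : Assumptions K S) (hd : 3 ≤ d) {ε : ℝ}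
    {r : Mom d → Mom d} (h : IsRounding ε r) (hε : ε ≤ Real.sqrt d) (σ : ℤˣ) (s : ℝ) (p : Mom d)
    (Ω : ℝ) : Integrable fun k =>
      Complex.exp (-Complex.I * (s : ℂ) * ((S.Phi σ p (r k) + Ω : ℝ) : ℂ)) * (S.M (r k) σ : ℂ) :=
  ((integrable_wt (d := d) (a := 4 * d + 23) (by omega)).const_mul _).mono'
    (A.measurable_theta_integrand hd h.measurable σ s p Ω).aestronglyMeasurable
    (Eventually.of_forall (A.norm_theta_integrand_le hd h hε σ s p Ω))

lemma Assumptions.continuous_thetaMap (A : Assumptions K S) (hd : 3 ≤ d) {ε : ℝ}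
    {r : Mom d → Mom d} (h : IsRounding ε r) (hε : ε ≤ Real.sqrt d) (p : Mom d) (Ω : ℝ) :
    Continuous fun s => S.thetaMap r s p Ω := by
  unfold Model.thetaMap
  refine continuous_finsetSum _ fun σ _ => continuous_const.mul ?_
  refine continuous_of_dominated (bound := fun k => roundM d K S.β * wt (4 * d + 23) k)
    (fun s => (A.measurable_theta_integrand hd h.measurable σ s p Ω).aestronglyMeasurable)
    (fun s => Eventually.of_forall (A.norm_theta_integrand_le hd h hε σ s p Ω))
    ((integrable_wt (d := d) (a := 4 * d + 23) (by omega)).const_mul _)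
    (Eventually.of_forall fun k => by fun_prop)

lemma Assumptions.norm_thetaMap_le (A : Assumptions K S) (hd : 3 ≤ d) {ε : ℝ}
    {r : Mom d → Mom d} (h : IsRounding ε r) (hε : ε ≤ Real.sqrt d) (s : ℝ) (p : Mom d) (Ω : ℝ) :
    ‖S.thetaMap r s p Ω‖ ≤ thetaBound d K S.β := by
  have h1 : ∀ σ : ℤˣ, ‖(cellConst d : ℂ) * ∫ k,
      Complex.exp (-Complex.I * (s : ℂ) * ((S.Phi σ p (r k) + Ω : ℝ) : ℂ)) * (S.M (r k) σ : ℂ)‖ ≤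
      roundM d K S.β * ∫ k : Mom d, wt (4 * d + 23) k := fun σ => by
    rw [norm_mul, Complex.norm_real, Real.norm_of_nonneg cellConst_pos.le, ← integral_const_mul]
    refine (mul_le_of_le_one_left (norm_nonneg _) cellConst_le_one).trans ?_
    exact norm_integral_le_of_norm_le
      ((integrable_wt (d := d) (a := 4 * d + 23) (by omega)).const_mul _)
      (Eventually.of_forall (A.norm_theta_integrand_le hd h hε σ s p Ω))
  refine (norm_sum_le _ _).trans ((Finset.sum_le_sum fun σ _ => h1 σ).trans ?_)
  simp only [Finset.sum_const, Finset.card_univ, Fintype.card_units_int, nsmul_eq_mul]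
  unfold thetaBound
  push_cast; linarith

/-- The Laplace transform of an oscillating integral. -/
lemma lap_integral_exp {Y : Type*} [MeasurableSpace Y] {ν : Measure Y} [SFinite ν] {η : ℝ}
    (hη : 0 < η) {φ : Y → ℝ} (hφ : Measurable φ) {w : Y → ℂ} (hw : Integrable w ν) (α : ℝ) :
    lap η (fun s : ℝ => ∫ k, Complex.exp (-Complex.I * (s : ℂ) * (φ k : ℂ)) * w k ∂ν) α =
      ∫ k, w k / ((η : ℂ) - Complex.I * ((α - φ k : ℝ) : ℂ)) ∂ν := by
  have hmeas : Measurable fun z : ℝ × Y =>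
      Complex.exp ((-η + Complex.I * α) * z.1) * Complex.exp (-Complex.I * (z.1 : ℂ) * (φ z.2 : ℂ)) := by
    fun_prop
  have hexp : Integrable (fun s : ℝ => (Real.exp (-η * s) : ℂ))
      ((volume : Measure ℝ).restrict (Set.Ioi 0)) :=
    (integrableOn_exp_mul_Ioi (by linarith) 0).ofReal
  have hint : Integrable (fun z : ℝ × Y => Complex.exp ((-η + Complex.I * α) * z.1) *
      Complex.exp (-Complex.I * (z.1 : ℂ) * (φ z.2 : ℂ)) * w z.2)
      (((volume : Measure ℝ).restrict (Set.Ioi 0)).prod ν) := by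
    refine (hexp.mul_prod hw).mono (hmeas.aestronglyMeasurable.mul
      hw.aestronglyMeasurable.comp_snd) (Eventually.of_forall fun z => le_of_eq ?_)
    rw [norm_mul, norm_mul, norm_mul, norm_exp_neg_I, mul_one]
    congr 1
    rw [Complex.norm_exp, Complex.norm_real, Real.norm_of_nonneg (Real.exp_nonneg _)]
    simp
  unfold lap
  have h1 : ∀ s : ℝ, Complex.exp ((-η + Complex.I * α) * s) *
      (∫ k, Complex.exp (-Complex.I * (s : ℂ) * (φ k : ℂ)) * w k ∂ν) =
      ∫ k, Complex.exp ((-η + Complex.I * α) * s) *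
        Complex.exp (-Complex.I * (s : ℂ) * (φ k : ℂ)) * w k ∂ν := fun s => by
    rw [← integral_const_mul]
    simp only [mul_assoc]
  simp only [h1]
  rw [integral_integral_swap hint]
  refine integral_congr_ae (Eventually.of_forall fun k => ?_)
  simp only []
  rw [integral_mul_const]
  have hre : (-(η : ℂ) + Complex.I * ((α - φ k : ℝ) : ℂ)).re = -η := by simp
  have hneg : (-(η : ℂ) + Complex.I * ((α - φ k : ℝ) : ℂ)).re < 0 := by rw [hre]; linarith
  have h2 : ∀ s : ℝ, Complex.exp ((-η + Complex.I * α) * s) *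
      Complex.exp (-Complex.I * (s : ℂ) * (φ k : ℂ)) =
      Complex.exp ((-(η : ℂ) + Complex.I * ((α - φ k : ℝ) : ℂ)) * s) := fun s => by
    rw [← Complex.exp_add]; congr 1; push_cast; ring
  simp only [h2]
  rw [integral_exp_mul_complex_Ioi hneg]
  simp only [Complex.ofReal_zero, mul_zero, Complex.exp_zero]
  have h3 : (-(η : ℂ) + Complex.I * ((α - φ k : ℝ) : ℂ)) =
      -((η : ℂ) - Complex.I * ((α - φ k : ℝ) : ℂ)) := by ring
  rw [h3, neg_div_neg_eq, div_mul_eq_mul_div, one_mul]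

lemma lap_const_mul (η : ℝ) (c : ℂ) (f : ℝ → ℂ) (α : ℝ) :
    lap η (fun s => c * f s) α = c * lap η f α := by
  unfold lap
  rw [← integral_const_mul]
  refine integral_congr_ae (Eventually.of_forall fun s => ?_)
  simp only []
  ring

lemma integrable_lap {η B : ℝ} (hη : 0 < η) {f : ℝ → ℂ} (hf : Continuous f) (hB : ∀ s, ‖f s‖ ≤ B)
    (α : ℝ) : IntegrableOn (fun s : ℝ => Complex.exp ((-η + Complex.I * α) * s) * f s)
      (Set.Ioi 0) := by
  have hc : Continuous fun s : ℝ => Complex.exp ((-η + Complex.I * α) * s) * f s := by fun_prop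
  refine Integrable.mono' ((integrableOn_exp_mul_Ioi (show -η < 0 by linarith) 0).const_mul B)
    hc.aestronglyMeasurable (Eventually.of_forall fun s => ?_)
  rw [norm_mul, Complex.norm_exp, mul_comm]
  have : ((-(η : ℂ) + Complex.I * α) * s).re = -η * s := by simp
  rw [this]
  exact mul_le_mul_of_nonneg_right (hB s) (Real.exp_nonneg _)

/-- The Laplace transform of the correlation function is bounded. -/
theorem norm_lap_theta_le (hd : 3 ≤ d) (K : Constants) (β : ℝ) : ∃ C : ℝ, 1 ≤ C ∧
    ∀ S : Model d, S.β = β → Assumptions K S → ∀ (p : Mom d) (Ω t α : ℝ), 1 ≤ t →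
      ‖lap t⁻¹ (fun s => S.thetaMap id s p Ω) α‖ ≤ C := by
  obtain ⟨C, hC, h⟩ := correlation_transform_bound (d := d) hd K β
  refine ⟨2 * C, by linarith, fun S hβ A p Ω t α ht => ?_⟩
  have ht0 : 0 < t := by linarith
  have hη := inv_pos.2 ht0
  have hε : (0 : ℝ) ≤ Real.sqrt d := Real.sqrt_nonneg _
  -- The energy Ω only shifts the spectral parameter to α - Ω, over which the bound for the averaged
  -- resolvent is uniform.
  have hsum : lap t⁻¹ (fun s => S.thetaMap id s p Ω) α = ∑ σ : ℤˣ, (cellConst d : ℂ) *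
      ∫ k, (S.M k σ : ℂ) / (((t⁻¹ : ℝ) : ℂ) - Complex.I * (((α - Ω) - S.Phi σ p k : ℝ) : ℂ)) := by
    unfold Model.thetaMap
    have h1 : ∀ σ : ℤˣ, (cellConst d : ℂ) *
      ∫ k, (S.M k σ : ℂ) / (((t⁻¹ : ℝ) : ℂ) - Complex.I * (((α - Ω) - S.Phi σ p k : ℝ) : ℂ)) =
      lap t⁻¹ (fun s => (cellConst d : ℂ) * ∫ k,
        Complex.exp (-Complex.I * (s : ℂ) * ((S.Phi σ p k + Ω : ℝ) : ℂ)) * (S.M k σ : ℂ)) α := by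
      intro σ
      rw [lap_const_mul]
      refine congrArg _ (Eq.trans ?_ (lap_integral_exp (φ := fun k => S.Phi σ p k + Ω) hη
        ((A.continuous_Phi hd σ p).measurable.add_const Ω)
        ((A.M_decay hd σ).integrable (by omega)).ofReal α).symm)
      refine integral_congr_ae (Eventually.of_forall fun k => ?_)
      simp only []
      congr 4; ring
    simp only [h1]
    unfold lap
    rw [← integral_finset_sum]
    · refine integral_congr_ae (Eventually.of_forall fun s => ?_)
      simp only [id]
      rw [Finset.mul_sum]
    · intro σ _
      refine integrable_lap (B := roundM d K S.β * ∫ k : Mom d, wt (4 * d + 23) k) hη ?_ ?_ α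
      · refine continuous_const.mul ?_
        exact continuous_of_dominated (bound := fun k => roundM d K S.β * wt (4 * d + 23) k)
          (fun s => (A.measurable_theta_integrand hd measurable_id σ s p Ω).aestronglyMeasurable)
          (fun s => Eventually.of_forall (A.norm_theta_integrand_le hd isRounding_id hε σ s p Ω))
          ((integrable_wt (d := d) (a := 4 * d + 23) (by omega)).const_mul _)
          (Eventually.of_forall fun k => by fun_prop)
      · intro s
        rw [norm_mul, Complex.norm_real, Real.norm_of_nonneg cellConst_pos.le, ← integral_const_mul]
        refine (mul_le_of_le_one_left (norm_nonneg _) cellConst_le_one).trans ?_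
        exact norm_integral_le_of_norm_le
          ((integrable_wt (d := d) (a := 4 * d + 23) (by omega)).const_mul _)
          (Eventually.of_forall (A.norm_theta_integrand_le hd isRounding_id hε σ s p Ω))
  rw [hsum]
  have h2 : ∀ σ : ℤˣ, ‖(cellConst d : ℂ) *
      ∫ k, (S.M k σ : ℂ) / (((t⁻¹ : ℝ) : ℂ) - Complex.I * (((α - Ω) - S.Phi σ p k : ℝ) : ℂ))‖ ≤ C := by
    intro σ
    rw [norm_mul, Complex.norm_real, Real.norm_of_nonneg cellConst_pos.le]
    exact (mul_le_of_le_one_left (norm_nonneg _) cellConst_le_one).trans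
      (h S hβ A σ p _ _ hη (inv_le_one_of_one_le₀ ht))
  refine (norm_sum_le _ _).trans ((Finset.sum_le_sum fun σ _ => h2 σ).trans (le_of_eq ?_))
  simp [Fintype.card_units_int]

end

/-! ### Dependence of time integrals on their factors -/

section

/-- Telescoping: one factor is exchanged at a time while the others are bounded by B. -/
lemma norm_prod_sub_prod_le {ι : Type*} (s : Finset ι) {f g : ι → ℂ} {B δ : ℝ} (hB : 1 ≤ B)
    (hf : ∀ i ∈ s, ‖f i‖ ≤ B) (hg : ∀ i ∈ s, ‖g i‖ ≤ B) (h : ∀ i ∈ s, ‖f i - g i‖ ≤ δ) :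
    ‖∏ i ∈ s, f i - ∏ i ∈ s, g i‖ ≤ s.card * B ^ s.card * δ := by
  classical
  induction s using Finset.induction_on with
  | empty => simp
  | insert a s ha ih =>
    have ih' := ih (fun i hi => hf i (Finset.mem_insert_of_mem hi))
      (fun i hi => hg i (Finset.mem_insert_of_mem hi))
      (fun i hi => h i (Finset.mem_insert_of_mem hi))
    have h1 := h a (Finset.mem_insert_self a s)
    have h2 := hf a (Finset.mem_insert_self a s)
    have hδ : 0 ≤ δ := (norm_nonneg _).trans h1
    have hB0 : 0 ≤ B := by linarith
    rw [Finset.prod_insert ha, Finset.prod_insert ha, Finset.card_insert_of_notMem ha]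
    have e : f a * ∏ i ∈ s, f i - g a * ∏ i ∈ s, g i =
        f a * (∏ i ∈ s, f i - ∏ i ∈ s, g i) + (f a - g a) * ∏ i ∈ s, g i := by ring
    have h3 : ‖∏ i ∈ s, g i‖ ≤ B ^ s.card := by
      rw [norm_prod, ← Finset.prod_const]
      exact Finset.prod_le_prod (fun i _ => norm_nonneg _)
        fun i hi => hg i (Finset.mem_insert_of_mem hi)
    rw [e]
    refine (norm_add_le _ _).trans ?_
    rw [norm_mul, norm_mul]
    have h4 : ‖f a‖ * ‖∏ i ∈ s, f i - ∏ i ∈ s, g i‖ ≤ B * (s.card * B ^ s.card * δ) :=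
      mul_le_mul h2 ih' (norm_nonneg _) hB0
    have h5 : ‖f a - g a‖ * ‖∏ i ∈ s, g i‖ ≤ δ * B ^ s.card :=
      mul_le_mul h1 h3 (norm_nonneg _) hδ
    have h6 : δ * B ^ s.card ≤ δ * B ^ (s.card + 1) :=
      mul_le_mul_of_nonneg_left (pow_le_pow_right₀ hB (by omega)) hδ
    push_cast
    calc _ ≤ B * (s.card * B ^ s.card * δ) + δ * B ^ (s.card + 1) := by linarith
      _ = _ := by ring

variable {n N : ℕ} {m : Fin (n + 1) → ℕ}

lemma volume_simplex_le (N : ℕ) {t : ℝ} (ht : 0 < t) :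
    volume {s : Fin N → ℝ | (∀ i, 0 ≤ s i) ∧ ∑ i, s i ≤ t} ≤ ENNReal.ofReal (t ^ N) := by
  have h : {s : Fin N → ℝ | (∀ i, 0 ≤ s i) ∧ ∑ i, s i ≤ t} ⊆ Set.Icc 0 fun _ => t := by
    rintro s ⟨h1, h2⟩
    refine ⟨h1, fun i => ?_⟩
    exact (Finset.single_le_sum (f := s) (fun j _ => h1 j) (Finset.mem_univ i)).trans h2
  refine (measure_mono h).trans ?_
  rw [Real.volume_Icc_pi, ENNReal.ofReal_pow ht.le]
  simp

lemma volume_real_simplex_le (N : ℕ) {t : ℝ} (ht : 0 < t) :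
    volume.real {s : Fin N → ℝ | (∀ i, 0 ≤ s i) ∧ ∑ i, s i ≤ t} ≤ t ^ N :=
  ENNReal.toReal_le_of_le_ofReal (by positivity) (volume_simplex_le N ht)

lemma volume_simplex_lt_top (N : ℕ) {t : ℝ} (ht : 0 < t) :
    volume {s : Fin N → ℝ | (∀ i, 0 ≤ s i) ∧ ∑ i, s i ≤ t} < ⊤ :=
  (volume_simplex_le N ht).trans_lt ENNReal.ofReal_lt_top

lemma norm_timeIntegral_le {t X : ℝ} (ht : 0 < t) {F : (Fin (N + 1) → ℝ) → ℂ}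
    (hF : ∀ s, ‖F s‖ ≤ X) : ‖timeIntegral N t F‖ ≤ X * t ^ N := by
  have hX : 0 ≤ X := (norm_nonneg _).trans (hF 0)
  exact (norm_setIntegral_le_of_norm_le_const (volume_simplex_lt_top N ht) fun s _ => hF _).trans
    (mul_le_mul_of_nonneg_left (volume_real_simplex_le N ht) hX)

lemma continuous_cons_simplex (t : ℝ) :
    Continuous fun s : Fin N → ℝ => (Fin.cons (t - ∑ i, s i) s : Fin (N + 1) → ℝ) := by
  refine continuous_pi fun b => ?_
  refine Fin.cases ?_ (fun i => ?_) b
  · simp only [Fin.cons_zero]; fun_prop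
  · simp only [Fin.cons_succ]; fun_prop

lemma norm_timeIntegral_sub_le {t X Y : ℝ} (ht : 0 < t) {F G : (Fin (N + 1) → ℝ) → ℂ}
    (hF : Continuous F) (hG : Continuous G) (hFX : ∀ s, ‖F s‖ ≤ X) (hGX : ∀ s, ‖G s‖ ≤ X)
    (hY : 0 ≤ Y) (h : ∀ s, (∀ b, 0 ≤ s b ∧ s b ≤ t) → ‖F s - G s‖ ≤ Y) :
    ‖timeIntegral N t F - timeIntegral N t G‖ ≤ Y * t ^ N := by
  have hi : ∀ H : (Fin (N + 1) → ℝ) → ℂ, Continuous H → (∀ s, ‖H s‖ ≤ X) →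
      IntegrableOn (fun s : Fin N → ℝ => H (Fin.cons (t - ∑ i, s i) s))
        {s : Fin N → ℝ | (∀ i, 0 ≤ s i) ∧ ∑ i, s i ≤ t} := fun H hH hb =>
    Measure.integrableOn_of_bounded (M := X) (volume_simplex_lt_top N ht).ne
      (hH.comp (continuous_cons_simplex t)).aestronglyMeasurable
      (Eventually.of_forall fun s => hb _)
  unfold timeIntegral
  rw [← integral_sub (hi F hF hFX) (hi G hG hGX)]
  refine (norm_setIntegral_le_of_norm_le_const (volume_simplex_lt_top N ht) fun s hs => ?_).trans
    (mul_le_mul_of_nonneg_left (volume_real_simplex_le N ht) hY)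
  refine h _ fun b => ?_
  obtain ⟨h1, h2⟩ := hs
  refine Fin.cases ?_ (fun i => ?_) b
  · simp only [Fin.cons_zero]
    exact ⟨by linarith, by have := Finset.sum_nonneg fun i (_ : i ∈ Finset.univ) => h1 i; linarith⟩
  · simp only [Fin.cons_succ]
    exact ⟨h1 i, (Finset.single_le_sum (f := s) (fun j _ => h1 j) (Finset.mem_univ i)).trans h2⟩

lemma norm_blockProd_le (hm : m ∈ patterns n N) (E : Fin (n + 1) → ℝ) {T : Fin (n + 1) → ℝ → ℂ}
    {B : ℝ} (hB1 : 1 ≤ B) (hB : ∀ j s, ‖T j s‖ ≤ B) (s : Fin (N + 1) → ℝ) :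
    ‖blockProd N m E T s‖ ≤ B ^ (N + 1) := by
  rw [blockProd_eq hm, norm_prod]
  calc _ ≤ ∏ _b : Fin (N + 1), B := Finset.prod_le_prod (fun _ _ => norm_nonneg _)
        fun b _ => norm_blockFactor_le hm E hB1 hB b _
    _ = _ := by simp

lemma continuous_blockProd (hm : m ∈ patterns n N) (E : Fin (n + 1) → ℝ)
    {T : Fin (n + 1) → ℝ → ℂ} (hT : ∀ j, Continuous (T j)) : Continuous (blockProd N m E T) := by
  have : blockProd N m E T = fun s => ∏ b, blockFactor hm E T b (s b) := by
    funext s; exact blockProd_eq hm E T s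
  rw [this]
  exact continuous_finset_prod _ fun b _ =>
    (continuous_blockFactor hm E hT b).comp (continuous_apply b)

lemma norm_exp_sub_exp_le {s a b : ℝ} (hs : 0 ≤ s) :
    ‖Complex.exp (-Complex.I * (s : ℂ) * (a : ℂ)) - Complex.exp (-Complex.I * (s : ℂ) * (b : ℂ))‖ ≤
      s * |a - b| := by
  have e : Complex.exp (-Complex.I * (s : ℂ) * (a : ℂ)) - Complex.exp (-Complex.I * (s : ℂ) * (b : ℂ))
      = Complex.exp (-Complex.I * (s : ℂ) * (b : ℂ)) *
        (Complex.exp (Complex.I * ((-(s * (a - b)) : ℝ) : ℂ)) - 1) := by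
    rw [mul_sub, mul_one, ← Complex.exp_add]
    congr 2; push_cast; ring
  rw [e, norm_mul, norm_exp_neg_I, one_mul]
  refine (Real.norm_exp_I_mul_ofReal_sub_one_le).trans ?_
  rw [Real.norm_eq_abs, abs_neg, abs_mul, abs_of_nonneg hs]

/-- Histories depend continuously on the energies and correlation functions. -/
lemma norm_timeIntegral_blockProd_sub_le (hm : m ∈ patterns n N) {t B δ : ℝ} (ht : 0 < t)
    (hB1 : 1 ≤ B) (hδ : 0 ≤ δ) {E E' : Fin (n + 1) → ℝ} {T T' : Fin (n + 1) → ℝ → ℂ}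
    (hT : ∀ j, Continuous (T j)) (hT' : ∀ j, Continuous (T' j)) (hB : ∀ j s, ‖T j s‖ ≤ B)
    (hB' : ∀ j s, ‖T' j s‖ ≤ B) (hE : ∀ j, t * |E j - E' j| ≤ δ)
    (hTT : ∀ j s, 0 ≤ s → s ≤ t → ‖T j s - T' j s‖ ≤ δ) :
    ‖timeIntegral N t (blockProd N m E T) - timeIntegral N t (blockProd N m E' T')‖ ≤
      ((N + 1 : ℕ) * B ^ (N + 1) * δ) * t ^ N := by
  refine norm_timeIntegral_sub_le ht (continuous_blockProd hm E hT) (continuous_blockProd hm E' hT')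
    (norm_blockProd_le hm E hB1 hB) (norm_blockProd_le hm E' hB1 hB') (by positivity) fun s hs => ?_
  rw [blockProd_eq hm, blockProd_eq hm]
  have := norm_prod_sub_prod_le (Finset.univ : Finset (Fin (N + 1)))
    (f := fun b => blockFactor hm E T b (s b)) (g := fun b => blockFactor hm E' T' b (s b)) hB1
    (fun b _ => norm_blockFactor_le hm E hB1 hB b _)
    (fun b _ => norm_blockFactor_le hm E' hB1 hB' b _) (δ := δ) fun b _ => ?_
  · simpa using this
  · obtain ⟨h0, h1⟩ := hs b
    simp only [blockFactor]
    split_ifs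
    · refine (norm_exp_sub_exp_le h0).trans ((mul_le_mul_of_nonneg_right h1 (abs_nonneg _)).trans ?_)
      exact hE _
    · exact hTT _ _ h0 h1

end

/-! ### Continuum and rounded histories -/

section

variable {d n N : ℕ} {S : Model d} {K : Constants} {m : Fin (n + 1) → ℕ}

namespace Model

/-- The history with the momenta in the correlation functions moved by `r`. -/
def histMap (S : Model d) (r : Mom d → Mom d) (N : ℕ) (m : Fin (n + 1) → ℕ) (t : ℝ) (p : Mom d)
    (k : Fin n → Mom d) (σ : Fin n → ℤˣ) : ℂ :=
  timeIntegral N t (blockProd N m (fun j => S.e (momentum p k j) + S.Omega k σ j)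
    fun j s => S.thetaMap r s (momentum p k j) (S.Omega k σ j))

end Model

lemma Assumptions.norm_histMap_le (A : Assumptions K S) (hd : 3 ≤ d) (hm : m ∈ patterns n N)
    {t ε : ℝ} (ht : 0 < t) {r : Mom d → Mom d} (h : IsRounding ε r) (hε : ε ≤ Real.sqrt d)
    (p : Mom d) (k : Fin n → Mom d) (σ : Fin n → ℤˣ) :
    ‖S.histMap r N m t p k σ‖ ≤ thetaBound d K S.β ^ (N + 1) * t ^ N :=
  norm_timeIntegral_le ht (norm_blockProd_le hm _ (A.one_le_thetaBound hd)
    fun _ _ => A.norm_thetaMap_le hd h hε _ _ _)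

/-- The continuum history in terms of resolvents. -/
theorem enorm_histMap_le (hd : 3 ≤ d) (K : Constants) (β : ℝ) : ∃ C : ℝ, 1 ≤ C ∧
    ∀ S : Model d, S.β = β → Assumptions K S → ∀ (n N : ℕ) (m : Fin (n + 1) → ℕ),
      m ∈ patterns n N → 0 < N → ∀ (t : ℝ), 1 ≤ t → ∀ (p : Mom d) (k : Fin n → Mom d)
      (σ : Fin n → ℤˣ), ‖S.histMap id N m t p k σ‖ₑ ≤
        ENNReal.ofReal (Real.exp 1 * (C * t) ^ (∑ j, m j)) *
          ∫⁻ α, ∏ j ∈ Finset.range (n + 1), ENNReal.ofReal (rr t (α - histEnergy S p σ k j)) := by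
  obtain ⟨C, hC, h⟩ := norm_lap_theta_le (d := d) hd K β
  refine ⟨C, hC, fun S hβ A n N m hm hN t ht p k σ => ?_⟩
  have hε : (0 : ℝ) ≤ Real.sqrt d := Real.sqrt_nonneg _
  have h1 := enorm_timeIntegral_blockProd_le hm hN ht hC
    (fun j => S.e (momentum p k j) + S.Omega k σ j)
    (T := fun j s => S.thetaMap id s (momentum p k j) (S.Omega k σ j)) (A.one_le_thetaBound hd)
    (fun j => A.continuous_thetaMap hd isRounding_id hε _ _)
    (fun j s => A.norm_thetaMap_le hd isRounding_id hε _ _ _)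
    (fun j α => h S hβ A _ _ t α ht)
  refine h1.trans (le_of_eq ?_)
  congr 1
  refine lintegral_congr fun α => ?_
  rw [Finset.prod_range]
  rfl

end

/-! ### The error made by rounding momenta in a history -/

section

variable {d n N : ℕ} {S : Model d} {K : Constants} {m : Fin (n + 1) → ℕ}

/-- A weight that dominates all momenta of a history. -/
def momWeight (p : Mom d) (k : Fin n → Mom d) : ℝ := 2 * bracket p * ∏ i, (2 * bracket (k i))

lemma one_le_two_mul_bracket (x : Mom d) : 1 ≤ 2 * bracket x := by linarith [one_le_bracket x]

lemma one_le_momWeight (p : Mom d) (k : Fin n → Mom d) : 1 ≤ momWeight p k :=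
  one_le_mul_of_one_le_of_one_le (one_le_two_mul_bracket p)
    (Finset.one_le_prod fun i _ => one_le_two_mul_bracket (k i))

lemma bracket_momentum_le (p : Mom d) (k : Fin n → Mom d) (A : Finset (Fin n)) :
    bracket (p + ∑ i ∈ A, k i) ≤ momWeight p k := by
  have hp := bracket_pos p
  refine (bracket_add_le _ _).trans ?_
  unfold momWeight
  refine mul_le_mul_of_nonneg_left ((bracket_sum_le A k).trans ?_) (by positivity)
  exact Finset.prod_le_prod_of_subset_of_one_le (Finset.subset_univ A)
    (fun i _ => by have := bracket_pos (k i); positivity)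
    fun i _ _ => one_le_two_mul_bracket (k i)

lemma bracket_le_momWeight (p : Mom d) (k : Fin n → Mom d) (i : Fin n) :
    bracket (k i) ≤ momWeight p k := by
  have h1 : 2 * bracket (k i) ≤ ∏ i, (2 * bracket (k i)) := by
    rw [← Finset.mul_prod_erase _ _ (Finset.mem_univ i)]
    have := bracket_pos (k i)
    exact le_mul_of_one_le_right (by positivity)
      (Finset.one_le_prod fun i _ => one_le_two_mul_bracket (k i))
  have h2 := one_le_two_mul_bracket p
  have h3 := bracket_pos (k i)
  unfold momWeight
  nlinarith

variable {ε : ℝ} {r : Mom d → Mom d}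

lemma IsRounding.momWeight_le (h : IsRounding ε r) (hε : ε ≤ Real.sqrt d) (p : Mom d)
    (k : Fin n → Mom d) : momWeight p (fun i => r (k i)) ≤ roundConst d ^ n * momWeight p k := by
  unfold momWeight
  have hp := bracket_pos p
  have h1 : ∏ i, (2 * bracket (r (k i))) ≤ ∏ i, (roundConst d * (2 * bracket (k i))) :=
    Finset.prod_le_prod (fun i _ => by have := bracket_pos (r (k i)); positivity)
      fun i _ => by linarith [h.bracket_le hε (k i)]
  have h2 : ∏ i, (roundConst d * (2 * bracket (k i))) =
      roundConst d ^ n * ∏ i, (2 * bracket (k i)) := by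
    rw [Finset.prod_mul_distrib, Finset.prod_const, Finset.card_univ, Fintype.card_fin]
  rw [h2] at h1
  calc _ ≤ 2 * bracket p * (roundConst d ^ n * ∏ i, (2 * bracket (k i))) :=
        mul_le_mul_of_nonneg_left h1 (by positivity)
    _ = _ := by ring

lemma IsRounding.norm_momentum_sub_le (h : IsRounding ε r) (p : Mom d) (k : Fin n → Mom d)
    (A : Finset (Fin n)) :
    ‖(p + ∑ i ∈ A, r (k i)) - (p + ∑ i ∈ A, k i)‖ ≤ n * ε := by
  rw [add_sub_add_left_eq_sub, ← Finset.sum_sub_distrib]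
  have hε : 0 ≤ ε := (norm_nonneg _).trans (h.le 0)
  refine (norm_sum_le _ _).trans ((Finset.sum_le_sum fun i _ => h.le (k i)).trans ?_)
  rw [Finset.sum_const, nsmul_eq_mul]
  have : A.card ≤ n := (Finset.card_le_univ A).trans (by simp)
  gcongr

/-- The ratio between momentum weights before and after rounding. -/
def weightRatio (d n : ℕ) : ℝ := roundConst d ^ n + roundConst d + 1

lemma weightRatio_nonneg : 0 ≤ weightRatio d n := by
  have := one_le_roundConst (d := d)
  unfold weightRatio; positivity

lemma Assumptions.abs_e_round_sub_le (A : Assumptions K S) (hd : 3 ≤ d) (h : IsRounding ε r)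
    (hε : ε ≤ Real.sqrt d) (p : Mom d) (k : Fin n → Mom d) (T : Finset (Fin n)) :
    |S.e (p + ∑ i ∈ T, r (k i)) - S.e (p + ∑ i ∈ T, k i)| ≤
      growthBound K * weightRatio d n * n * momWeight p k * ε := by
  have hg := (A.e_growth hd).nonneg
  have h1 := (A.e_growth hd).sub_le (p + ∑ i ∈ T, r (k i)) (p + ∑ i ∈ T, k i)
  have h2 := (bracket_momentum_le p (fun i => r (k i)) T).trans (h.momWeight_le hε p k)
  have h3 := bracket_momentum_le p k T
  have h4 := h.norm_momentum_sub_le p k T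
  have h5 := one_le_momWeight p k
  have h6 := one_le_roundConst (d := d)
  have h7 : bracket (p + ∑ i ∈ T, r (k i)) + bracket (p + ∑ i ∈ T, k i) ≤
      weightRatio d n * momWeight p k := by
    unfold weightRatio; nlinarith
  have h8 := bracket_pos (p + ∑ i ∈ T, r (k i))
  have h9 := bracket_pos (p + ∑ i ∈ T, k i)
  calc _ ≤ _ := h1
    _ ≤ growthBound K * (weightRatio d n * momWeight p k) * (n * ε) :=
        mul_le_mul (mul_le_mul_of_nonneg_left h7 hg) h4 (norm_nonneg _)
          (mul_nonneg hg ((add_pos h8 h9).le.trans h7))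
    _ = _ := by ring

lemma Assumptions.abs_Omega_round_sub_le (A : Assumptions K S) (hd : 3 ≤ d) (h : IsRounding ε r)
    (hε : ε ≤ Real.sqrt d) (p : Mom d) (k : Fin n → Mom d) (σ : Fin n → ℤˣ)
    (T : Finset (Fin n)) :
    |∑ i ∈ T, sgn (σ i) * S.ω (r (k i)) - ∑ i ∈ T, sgn (σ i) * S.ω (k i)| ≤
      growthBound K * weightRatio d n * n * momWeight p k * ε := by
  have hg := (A.e_growth hd).nonneg
  have hε0 : 0 ≤ ε := (norm_nonneg _).trans (h.le 0)
  have hV := one_le_momWeight p k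
  have hw := weightRatio_nonneg (d := d) (n := n)
  rw [← Finset.sum_sub_distrib]
  refine (Finset.abs_sum_le_sum_abs _ _).trans ?_
  have h1 : ∀ i ∈ T, |sgn (σ i) * S.ω (r (k i)) - sgn (σ i) * S.ω (k i)| ≤
      growthBound K * weightRatio d n * momWeight p k * ε := by
    intro i _
    rw [← mul_sub, abs_mul, abs_sgn, one_mul]
    have h2 := (A.ω_growth hd).sub_le (r (k i)) (k i)
    have h3 := h.bracket_le hε (k i)
    have h4 := bracket_le_momWeight p k i
    have h5 := bracket_pos (k i)
    have h5' := bracket_pos (r (k i))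
    have h6 := one_le_roundConst (d := d)
    have h7 : bracket (r (k i)) + bracket (k i) ≤ weightRatio d n * momWeight p k := by
      have h8 : 0 ≤ roundConst d ^ n := by positivity
      have h9 : roundConst d * bracket (k i) ≤ roundConst d * momWeight p k :=
        mul_le_mul_of_nonneg_left h4 (by linarith)
      unfold weightRatio; nlinarith
    calc _ ≤ _ := h2
      _ ≤ growthBound K * (weightRatio d n * momWeight p k) * ε :=
          mul_le_mul (mul_le_mul_of_nonneg_left h7 hg) (h.le _) (norm_nonneg _)
            (mul_nonneg hg ((add_pos h5' h5).le.trans h7))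
      _ = _ := by ring
  refine (Finset.sum_le_sum h1).trans ?_
  rw [Finset.sum_const, nsmul_eq_mul]
  have h10 : (T.card : ℝ) ≤ n := by
    exact_mod_cast (Finset.card_le_univ T).trans (by simp)
  calc _ ≤ n * (growthBound K * weightRatio d n * momWeight p k * ε) :=
        mul_le_mul_of_nonneg_right h10 (by positivity)
    _ = _ := by ring

lemma wt_le_of_norm_sub_le (a : ℕ) {x y : Mom d} (h : ‖x - y‖ ≤ Real.sqrt d) :
    wt a x ≤ roundConst d ^ a * wt a y := by
  have h1 := wt_add_le a x (y - x)
  rw [add_sub_cancel, ← bracket_neg, neg_sub] at h1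
  refine h1.trans (mul_le_mul_of_nonneg_right ?_ (wt_pos a y).le)
  have := bracket_pos (x - y)
  refine pow_le_pow_left₀ (by positivity) ?_ a
  unfold roundConst
  linarith [bracket_le_one_add (x - y)]

lemma Assumptions.abs_M_round_sub_le (A : Assumptions K S) (hd : 3 ≤ d) (h : IsRounding ε r)
    (hε : ε ≤ Real.sqrt d) (σ : ℤˣ) (q : Mom d) :
    |S.M (r q) σ - S.M q σ| ≤ roundM d K S.β * wt (4 * d + 23) q * ε := by
  have hε0 : 0 ≤ ε := (norm_nonneg _).trans (h.le 0)
  have hM := A.M_decay hd σ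
  have hR := A.roundM_nonneg hd
  have hw := wt_pos (4 * d + 23) q
  have key := Convex.norm_image_sub_le_of_norm_fderiv_le (f := fun k => S.M k σ) (𝕜 := ℝ)
    (s := Metric.closedBall q ε) (C := roundM d K S.β * wt (4 * d + 23) q) (x := q) (y := r q)
    (fun z _ => (hM.smooth.differentiable (by norm_num)) z) (fun z hz => ?_)
    (convex_closedBall q ε) (Metric.mem_closedBall_self hε0)
    (by rw [Metric.mem_closedBall, dist_eq_norm]; exact h.le q)
  · rw [Real.norm_eq_abs] at key
    exact key.trans (mul_le_mul_of_nonneg_left (h.le q) (by positivity))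
  · rw [Metric.mem_closedBall, dist_eq_norm] at hz
    refine (hM.bound1 z).trans ?_
    rw [roundM, mul_assoc]
    exact mul_le_mul_of_nonneg_left (wt_le_of_norm_sub_le _ (hz.trans hε)) hM.const_nonneg

lemma Assumptions.abs_Phi_round_sub_le (A : Assumptions K S) (hd : 3 ≤ d) (h : IsRounding ε r)
    (hε : ε ≤ Real.sqrt d) {κ X : ℝ} {P P' : Mom d} (hP : bracket P ≤ X)
    (hP' : bracket P' ≤ X) (hPP : ‖P' - P‖ ≤ κ * ε) (σ : ℤˣ) (q : Mom d) :
    |S.Phi σ P' (r q) - S.Phi σ P q| ≤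
      growthBound K * (4 * roundConst d * (2 + κ)) * X * bracket q * ε := by
  have hg := (A.e_growth hd).nonneg
  have hε0 : 0 ≤ ε := (norm_nonneg _).trans (h.le 0)
  have hR := one_le_roundConst (d := d)
  have hq := one_le_bracket q
  have hX : 1 ≤ X := (one_le_bracket P).trans hP
  have hr := h.bracket_le hε q
  have h1 := (A.e_growth hd).sub_le (r q + P') (q + P)
  have h2 := (A.ω_growth hd).sub_le (r q) q
  have h3 : bracket (r q + P') ≤ 2 * (roundConst d * bracket q) * X := by
    refine (bracket_add_le _ _).trans ?_
    have := bracket_pos P'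
    have := bracket_pos (r q)
    gcongr
  have h4 : bracket (q + P) ≤ 2 * (roundConst d * bracket q) * X := by
    refine (bracket_add_le _ _).trans ?_
    have := bracket_pos P
    have : bracket q ≤ roundConst d * bracket q := le_mul_of_one_le_left (by linarith) hR
    gcongr
  have h5 : ‖r q + P' - (q + P)‖ ≤ (1 + κ) * ε := by
    have : r q + P' - (q + P) = (r q - q) + (P' - P) := by abel
    rw [this]
    refine (norm_add_le _ _).trans ?_
    linarith [h.le q]
  have h6 : bracket (r q) + bracket q ≤ 4 * roundConst d * bracket q * X := by
    have h7 : bracket q ≤ roundConst d * bracket q := le_mul_of_one_le_left (by linarith) hR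
    have h8 : roundConst d * bracket q ≤ roundConst d * bracket q * X :=
      le_mul_of_one_le_right (by positivity) hX
    linarith
  have p1 := bracket_pos (r q + P')
  have p2 := bracket_pos (q + P)
  have p3 := bracket_pos (r q)
  have h9 : |S.e (r q + P') - S.e (q + P)| ≤
      growthBound K * (4 * roundConst d * bracket q * X) * ((1 + κ) * ε) :=
    h1.trans (mul_le_mul (mul_le_mul_of_nonneg_left (by linarith) hg) h5 (norm_nonneg _)
      (by positivity))
  have h10 : |S.ω (r q) - S.ω q| ≤ growthBound K * (4 * roundConst d * bracket q * X) * ε :=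
    h2.trans (mul_le_mul (mul_le_mul_of_nonneg_left h6 hg) (h.le q) (norm_nonneg _)
      (by positivity))
  have e : S.Phi σ P' (r q) - S.Phi σ P q =
      (S.e (r q + P') - S.e (q + P)) + sgn σ * (S.ω (r q) - S.ω q) := by
    simp only [Model.Phi]; ring
  rw [e]
  refine (abs_add_le _ _).trans ?_
  rw [abs_mul, abs_sgn, one_mul]
  calc _ ≤ _ := add_le_add h9 h10
    _ = _ := by ring

/-- The correlation function depends continuously on the rounding. -/
lemma Assumptions.norm_thetaMap_sub_le (A : Assumptions K S) (hd : 3 ≤ d) {κ κ' t : ℝ}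
    (hκ : 0 ≤ κ) (hκ' : 0 ≤ κ') (ht : 0 ≤ t) :
    ∃ D : ℝ, 0 ≤ D ∧ ∀ (ε : ℝ) (r : Mom d → Mom d), IsRounding ε r → ε ≤ Real.sqrt d →
      ∀ (X : ℝ) (P P' : Mom d) (Ω Ω' : ℝ), bracket P ≤ X → bracket P' ≤ X → ‖P' - P‖ ≤ κ * ε →
        |Ω' - Ω| ≤ κ' * X * ε → ∀ s, 0 ≤ s → s ≤ t →
          ‖S.thetaMap r s P' Ω' - S.thetaMap id s P Ω‖ ≤ D * X * ε := by
  have hg := (A.e_growth hd).nonneg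
  have hR := one_le_roundConst (d := d)
  have hRM := A.roundM_nonneg hd
  set D₁ : ℝ := growthBound K * (4 * roundConst d * (2 + κ)) + κ' with hD₁
  have hD₁0 : 0 ≤ D₁ := by positivity
  -- One power of the weight is spent on the factor ⟨q⟩ in the Lipschitz bound for the phase.
  set I : ℝ := ∫ k : Mom d, wt (4 * d + 22) k with hI
  have hI0 : 0 ≤ I := integral_nonneg fun k => (wt_pos _ _).le
  refine ⟨2 * (roundM d K S.β * (1 + t * D₁) * I), by positivity, ?_⟩
  intro ε r h hε X P P' Ω Ω' hP hP' hPP hΩ s hs hst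
  have hε0 : 0 ≤ ε := (norm_nonneg _).trans (h.le 0)
  have hX : 1 ≤ X := (one_le_bracket P).trans hP
  have h0 : (0 : ℝ) ≤ Real.sqrt d := Real.sqrt_nonneg _
  have key : ∀ (σ : ℤˣ) (q : Mom d),
      ‖Complex.exp (-Complex.I * (s : ℂ) * ((S.Phi σ P' (r q) + Ω' : ℝ) : ℂ)) * (S.M (r q) σ : ℂ) -
        Complex.exp (-Complex.I * (s : ℂ) * ((S.Phi σ P (id q) + Ω : ℝ) : ℂ)) * (S.M (id q) σ : ℂ)‖ ≤
      roundM d K S.β * (1 + t * D₁) * X * ε * wt (4 * d + 22) q := by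
    intro σ q
    have hq := one_le_bracket q
    have hw := wt_pos (4 * d + 23) q
    have hwq : wt (4 * d + 23) q * bracket q = wt (4 * d + 22) q := by
      have := wt_mul_pow (4 * d + 22) 1 q
      rwa [pow_one] at this
    simp only [id]
    set e' := Complex.exp (-Complex.I * (s : ℂ) * ((S.Phi σ P' (r q) + Ω' : ℝ) : ℂ)) with he'
    set e := Complex.exp (-Complex.I * (s : ℂ) * ((S.Phi σ P q + Ω : ℝ) : ℂ)) with he
    have hsplit : e' * (S.M (r q) σ : ℂ) - e * (S.M q σ : ℂ) =
        e' * ((S.M (r q) σ - S.M q σ : ℝ) : ℂ) + (e' - e) * (S.M q σ : ℂ) := by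
      push_cast; ring
    rw [hsplit]
    refine (norm_add_le _ _).trans ?_
    rw [norm_mul, norm_mul, he', norm_exp_neg_I, one_mul, Complex.norm_real, Complex.norm_real,
      Real.norm_eq_abs, Real.norm_of_nonneg ((A.M_decay hd σ).nonneg q)]
    have b1 := A.abs_M_round_sub_le hd h hε σ q
    have b2 : ‖e' - e‖ ≤ t * (D₁ * X * bracket q * ε) := by
      refine (norm_exp_sub_exp_le hs).trans ?_
      have c1 := A.abs_Phi_round_sub_le hd h hε hP hP' hPP σ q
      have c2 : |S.Phi σ P' (r q) + Ω' - (S.Phi σ P q + Ω)| ≤ D₁ * X * bracket q * ε := by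
        rw [add_sub_add_comm]
        refine (abs_add_le _ _).trans ?_
        have c3 : κ' * X * ε ≤ κ' * X * ε * bracket q := le_mul_of_one_le_right (by positivity) hq
        rw [hD₁]
        calc _ ≤ _ := add_le_add c1 (hΩ.trans c3)
          _ = _ := by ring
      exact mul_le_mul hst c2 (abs_nonneg _) ht
    have b3 : S.M q σ ≤ roundM d K S.β * wt (4 * d + 23) q := A.M_round_le hd isRounding_id h0 σ q
    have b4 : ‖e' - e‖ * S.M q σ ≤
        t * (D₁ * X * bracket q * ε) * (roundM d K S.β * wt (4 * d + 23) q) :=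
      mul_le_mul b2 b3 ((A.M_decay hd σ).nonneg q) (by positivity)
    have b5 : roundM d K S.β * wt (4 * d + 23) q * ε ≤
        roundM d K S.β * (wt (4 * d + 23) q * bracket q) * X * ε := by
      have : wt (4 * d + 23) q ≤ wt (4 * d + 23) q * bracket q * X := by
        rw [mul_assoc]
        exact le_mul_of_one_le_right hw.le (one_le_mul_of_one_le_of_one_le hq hX)
      calc _ ≤ roundM d K S.β * (wt (4 * d + 23) q * bracket q * X) * ε := by gcongr
        _ = _ := by ring
    rw [← hwq]
    calc _ ≤ _ := add_le_add (b1.trans b5) b4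
      _ = _ := by ring
  have hsum : S.thetaMap r s P' Ω' - S.thetaMap id s P Ω = ∑ σ : ℤˣ, (cellConst d : ℂ) * ∫ q,
      (Complex.exp (-Complex.I * (s : ℂ) * ((S.Phi σ P' (r q) + Ω' : ℝ) : ℂ)) * (S.M (r q) σ : ℂ) -
        Complex.exp (-Complex.I * (s : ℂ) * ((S.Phi σ P (id q) + Ω : ℝ) : ℂ)) *
          (S.M (id q) σ : ℂ)) := by
    unfold Model.thetaMap
    rw [← Finset.sum_sub_distrib]
    refine Finset.sum_congr rfl fun σ _ => ?_
    rw [← mul_sub, integral_sub (A.integrable_theta_integrand hd h hε σ s P' Ω')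
      (A.integrable_theta_integrand hd isRounding_id h0 σ s P Ω)]
  rw [hsum]
  have hterm : ∀ σ : ℤˣ, ‖(cellConst d : ℂ) * ∫ q,
      (Complex.exp (-Complex.I * (s : ℂ) * ((S.Phi σ P' (r q) + Ω' : ℝ) : ℂ)) * (S.M (r q) σ : ℂ) -
        Complex.exp (-Complex.I * (s : ℂ) * ((S.Phi σ P (id q) + Ω : ℝ) : ℂ)) *
          (S.M (id q) σ : ℂ))‖ ≤ roundM d K S.β * (1 + t * D₁) * X * ε * I := fun σ => by
    rw [norm_mul, Complex.norm_real, Real.norm_of_nonneg cellConst_pos.le, hI, ← integral_const_mul]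
    refine (mul_le_of_le_one_left (norm_nonneg _) cellConst_le_one).trans ?_
    exact norm_integral_le_of_norm_le
      ((integrable_wt (d := d) (a := 4 * d + 22) (by omega)).const_mul _)
      (Eventually.of_forall (key σ))
  refine (norm_sum_le _ _).trans ((Finset.sum_le_sum fun σ _ => hterm σ).trans (le_of_eq ?_))
  simp only [Finset.sum_const, Finset.card_univ, Fintype.card_units_int, nsmul_eq_mul]
  push_cast; ring

/-- A history on a fine lattice is close to the continuum history. -/
theorem Assumptions.norm_histMap_sub_le (A : Assumptions K S) (hd : 3 ≤ d)
    (hm : m ∈ patterns n N) {t : ℝ} (ht : 0 < t) :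
    ∃ D : ℝ, 0 ≤ D ∧ ∀ (ε : ℝ) (r : Mom d → Mom d), IsRounding ε r → ε ≤ Real.sqrt d →
      ∀ (p : Mom d) (k : Fin n → Mom d) (σ : Fin n → ℤˣ),
        ‖S.histMap r N m t p (fun i => r (k i)) σ - S.histMap id N m t p k σ‖ ≤
          D * momWeight p k * ε := by
  have hg := (A.e_growth hd).nonneg
  have hw := weightRatio_nonneg (d := d) (n := n)
  have hR := one_le_roundConst (d := d)
  set D₀ : ℝ := growthBound K * weightRatio d n * n with hD₀
  have hD₀0 : 0 ≤ D₀ := by positivity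
  obtain ⟨D, hD, h⟩ := A.norm_thetaMap_sub_le hd (κ := n) (κ' := D₀) (t := t) (by positivity)
    hD₀0 ht.le
  have hB := A.one_le_thetaBound hd
  set B := thetaBound d K S.β with hBdef
  have hB0 : 0 ≤ B := by linarith
  -- The first term controls the change of the correlation functions, the second that of the
  -- oscillating exponentials.
  set D₂ : ℝ := D * weightRatio d n + t * (2 * D₀) with hD₂
  have hD₂0 : 0 ≤ D₂ := by positivity
  refine ⟨(N + 1 : ℕ) * B ^ (N + 1) * D₂ * t ^ N, by positivity, fun ε r hr hε p k σ => ?_⟩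
  have hε0 : 0 ≤ ε := (norm_nonneg _).trans (hr.le 0)
  have hV := one_le_momWeight p k
  have h0 : (0 : ℝ) ≤ Real.sqrt d := Real.sqrt_nonneg _
  have key := norm_timeIntegral_blockProd_sub_le hm ht hB (δ := D₂ * momWeight p k * ε)
    (by positivity)
    (E := fun j => S.e (momentum p (fun i => r (k i)) j) + S.Omega (fun i => r (k i)) σ j)
    (E' := fun j => S.e (momentum p k j) + S.Omega k σ j)
    (T := fun j s => S.thetaMap r s (momentum p (fun i => r (k i)) j)
      (S.Omega (fun i => r (k i)) σ j))
    (T' := fun j s => S.thetaMap id s (momentum p k j) (S.Omega k σ j))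
    (fun j => A.continuous_thetaMap hd hr hε _ _)
    (fun j => A.continuous_thetaMap hd isRounding_id h0 _ _)
    (fun j s => A.norm_thetaMap_le hd hr hε _ _ _)
    (fun j s => A.norm_thetaMap_le hd isRounding_id h0 _ _ _) (fun j => ?_) fun j s hs hst => ?_
  · refine key.trans (le_of_eq ?_)
    ring
  · have h1 := A.abs_e_round_sub_le hd hr hε p k
      (Finset.univ.filter fun l : Fin n => (j : ℕ) ≤ (l : ℕ))
    have h2 := A.abs_Omega_round_sub_le hd hr hε p k σ
      (Finset.univ.filter fun l : Fin n => (j : ℕ) ≤ (l : ℕ))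
    have h3 : |S.e (momentum p (fun i => r (k i)) j) + S.Omega (fun i => r (k i)) σ j -
        (S.e (momentum p k j) + S.Omega k σ j)| ≤ 2 * D₀ * momWeight p k * ε := by
      rw [add_sub_add_comm]
      refine (abs_add_le _ _).trans ?_
      calc _ ≤ _ := add_le_add h1 h2
        _ = _ := by rw [hD₀]; ring
    have h4 : 0 ≤ D * weightRatio d n * momWeight p k * ε := by positivity
    calc _ ≤ t * (2 * D₀ * momWeight p k * ε) := mul_le_mul_of_nonneg_left h3 ht.le
      _ ≤ t * (2 * D₀ * momWeight p k * ε) + D * weightRatio d n * momWeight p k * ε := by linarith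
      _ = _ := by rw [hD₂]; ring
  · have hX : momWeight p k ≤ weightRatio d n * momWeight p k := by
      refine le_mul_of_one_le_left (by linarith) ?_
      have : 0 ≤ roundConst d ^ n := by positivity
      unfold weightRatio; linarith
    have hX' : roundConst d ^ n * momWeight p k ≤ weightRatio d n * momWeight p k := by
      refine mul_le_mul_of_nonneg_right ?_ (by linarith)
      unfold weightRatio; linarith
    have h2 := A.abs_Omega_round_sub_le hd hr hε p k σ
      (Finset.univ.filter fun l : Fin n => (j : ℕ) ≤ (l : ℕ))
    have h5 := h ε r hr hε (weightRatio d n * momWeight p k) (momentum p k j)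
      (momentum p (fun i => r (k i)) j) (S.Omega k σ j) (S.Omega (fun i => r (k i)) σ j)
      ((bracket_momentum_le p k _).trans hX)
      (((bracket_momentum_le p (fun i => r (k i)) _).trans (hr.momWeight_le hε p k)).trans hX')
      (hr.norm_momentum_sub_le p k _)
      (h2.trans (mul_le_mul_of_nonneg_right (mul_le_mul_of_nonneg_left hX hD₀0) hε0)) s hs hst
    have h6 : 0 ≤ t * (2 * D₀) * momWeight p k * ε := by positivity
    calc _ ≤ _ := h5
      _ ≤ D * (weightRatio d n * momWeight p k) * ε + t * (2 * D₀) * momWeight p k * ε := by linarith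
      _ = _ := by rw [hD₂]; ring

end

/-! ### Lattice sums as integrals of step functions -/

section

variable {d : ℕ}

/-- The lattice spacing of `Λ_L^*`. -/
def spacing (L : ℝ) : ℝ := Real.sqrt (2 * Real.pi) / L

lemma spacing_pos {L : ℝ} (hL : 0 < L) : 0 < spacing L := by
  have : 0 < Real.sqrt (2 * Real.pi) := Real.sqrt_pos.2 (by positivity)
  unfold spacing; positivity

lemma tendsto_spacing : Tendsto spacing atTop (nhds 0) := tendsto_const_nhds.div_atTop tendsto_id

lemma cellConst_mul_spacing_pow (L : ℝ) : cellConst d * spacing L ^ d = (L ^ d)⁻¹ := by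
  have : Real.sqrt (2 * Real.pi) ≠ 0 := (Real.sqrt_pos.2 (by positivity)).ne'
  rw [cellConst, spacing, div_pow]
  field_simp

/-- The index of the cell that contains a point. -/
def cellIdx (L : ℝ) (x : Mom d) : DualLat d := fun i => ⌊x i / spacing L⌋

/-- The lattice point of the cell that contains a point. -/
def latRound (L : ℝ) (x : Mom d) : Mom d := latPt L (cellIdx L x)

lemma measurable_cellIdx (L : ℝ) : Measurable (cellIdx L : Mom d → DualLat d) := by
  refine measurable_pi_lambda _ fun i => Int.measurable_floor.comp ?_
  fun_prop

lemma isRounding_latRound {L : ℝ} (hL : 0 < L) :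
    IsRounding (Real.sqrt d * spacing L) (latRound L : Mom d → Mom d) := by
  refine ⟨(measurable_of_countable (latPt L)).comp (measurable_cellIdx L), fun x => ?_⟩
  have hs := spacing_pos hL
  rw [EuclideanSpace.norm_eq]
  have h1 : ∀ i, ‖(latRound L x - x) i‖ ^ 2 ≤ spacing L ^ 2 := fun i => by
    refine pow_le_pow_left₀ (norm_nonneg _) ?_ 2
    have e : (latRound L x - x) i = spacing L * ⌊x i / spacing L⌋ - x i := rfl
    have h2 := Int.floor_le (x i / spacing L)
    have h3 := Int.lt_floor_add_one (x i / spacing L)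
    rw [le_div_iff₀ hs] at h2
    rw [div_lt_iff₀ hs] at h3
    rw [e, Real.norm_eq_abs, abs_le]
    constructor <;> nlinarith
  refine (Real.sqrt_le_sqrt (Finset.sum_le_sum fun i _ => h1 i)).trans (le_of_eq ?_)
  rw [Finset.sum_const, Finset.card_univ, Fintype.card_fin, nsmul_eq_mul,
    Real.sqrt_mul (by positivity), Real.sqrt_sq hs.le]

lemma volume_cell {L : ℝ} (hL : 0 < L) (z : DualLat d) :
    volume ((cellIdx L : Mom d → DualLat d) ⁻¹' {z}) = ENNReal.ofReal (spacing L ^ d) := by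
  have hs := spacing_pos hL
  have h1 : (cellIdx L : Mom d → DualLat d) ⁻¹' {z} = (WithLp.ofLp : Mom d → Fin d → ℝ) ⁻¹'
      Set.univ.pi fun i => Set.Ico (spacing L * z i) (spacing L * z i + spacing L) := by
    ext x
    simp only [Set.mem_preimage, Set.mem_singleton_iff, Set.mem_pi, Set.mem_univ, true_implies,
      Set.mem_Ico, funext_iff, cellIdx, Int.floor_eq_iff, le_div_iff₀ hs, div_lt_iff₀ hs]
    refine forall_congr' fun i => ?_
    rw [mul_comm (z i : ℝ), add_mul, one_mul, mul_comm (z i : ℝ)]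
  rw [h1, (PiLp.volume_preserving_ofLp (Fin d)).measure_preimage
    (MeasurableSet.univ_pi fun i => measurableSet_Ico).nullMeasurableSet, volume_pi_pi]
  simp only [Real.volume_Ico, add_sub_cancel_left, Finset.prod_const, Finset.card_univ,
    Fintype.card_fin]
  rw [ENNReal.ofReal_pow hs.le]

/-- Lattice sums as integrals of step functions. -/
lemma lintegral_cellIdx {n : ℕ} {L : ℝ} (hL : 0 < L) (G : (Fin n → DualLat d) → ℝ≥0∞) :
    ∫⁻ k : Fin n → Mom d, G (fun i => cellIdx L (k i)) =
      (∑' z, G z) * ENNReal.ofReal (spacing L ^ d) ^ n := by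
  have hm : Measurable fun (k : Fin n → Mom d) (i : Fin n) => cellIdx L (k i) :=
    measurable_pi_lambda _ fun i => (measurable_cellIdx L).comp (measurable_pi_apply i)
  rw [← lintegral_map (f := G) (measurable_of_countable G) hm, lintegral_countable',
    ← ENNReal.tsum_mul_right]
  refine tsum_congr fun z => ?_
  congr 1
  rw [Measure.map_apply hm (measurableSet_singleton z)]
  have h1 : (fun (k : Fin n → Mom d) (i : Fin n) => cellIdx L (k i)) ⁻¹' {z} =
      Set.univ.pi fun i => (cellIdx L : Mom d → DualLat d) ⁻¹' {z i} := by
    ext k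
    simp [funext_iff]
  rw [h1, volume_pi_pi]
  simp [volume_cell hL]

/-- The rounded integrand is constant on cells of volume `spacing L ^ d`, and `cellConst d` corrects
this volume to L^{-d}. -/
lemma latIntegral_eq {L : ℝ} (hL : 0 < L) (F : Mom d → ℂ)
    (hF : Integrable fun q => F (latRound L q)) :
    latIntegral L F = (cellConst d : ℂ) * ∫ q, F (latRound L q) := by
  have hm := measurable_cellIdx (d := d) L
  have hFm : AEStronglyMeasurable (fun z => F (latPt L z)) (volume.map (cellIdx L : Mom d → DualLat d)) :=
    (measurable_of_countable _).aestronglyMeasurable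
  have h1 : ∫ q, F (latRound L q) = ∑' z, ((spacing L ^ d : ℝ) : ℂ) * F (latPt L z) := by
    have h2 : ∫ q, F (latRound L q) = ∫ z, F (latPt L z) ∂(volume.map (cellIdx L)) :=
      (integral_map hm.aemeasurable hFm).symm
    rw [h2, integral_countable' ((integrable_map_measure hFm hm.aemeasurable).2 hF)]
    refine tsum_congr fun z => ?_
    rw [Measure.real, Measure.map_apply hm (measurableSet_singleton z), volume_cell hL,
      ENNReal.toReal_ofReal (pow_nonneg (spacing_pos hL).le d), Complex.real_smul]
  rw [h1, tsum_mul_left, ← mul_assoc, ← Complex.ofReal_mul, cellConst_mul_spacing_pow, latIntegral]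
  push_cast; rfl

variable {n N : ℕ} {S : Model d} {K : Constants} {m : Fin (n + 1) → ℕ}

lemma sqrt_mul_spacing_le {L : ℝ} (h : spacing L ≤ 1) : Real.sqrt d * spacing L ≤ Real.sqrt d :=
  mul_le_of_le_one_right (Real.sqrt_nonneg _) h

lemma Assumptions.Theta_eq (A : Assumptions K S) (hd : 3 ≤ d) {L : ℝ} (hL : 0 < L)
    (h1 : spacing L ≤ 1) (s : ℝ) (p : Mom d) (Ω : ℝ) :
    S.Theta L s p Ω = S.thetaMap (latRound L) s p Ω := by
  unfold Model.Theta Model.thetaMap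
  exact Finset.sum_congr rfl fun σ _ => latIntegral_eq hL _
    (A.integrable_theta_integrand hd (isRounding_latRound hL) (sqrt_mul_spacing_le h1) σ s p Ω)

lemma Assumptions.history_eq (A : Assumptions K S) (hd : 3 ≤ d) {L : ℝ} (hL : 0 < L)
    (h1 : spacing L ≤ 1) (t : ℝ) (p : Mom d) (k : Fin n → Mom d) (σ : Fin n → ℤˣ) :
    S.history N L m t p k σ = S.histMap (latRound L) N m t p k σ := by
  unfold Model.history Model.histMap blockProd
  simp only [A.Theta_eq hd hL h1]

lemma norm_conjHistory (L t : ℝ) (p : Mom d) (k : Fin n → Mom d) (σ : Fin n → ℤˣ) :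
    ‖S.conjHistory N L m t p k σ‖ = ‖S.history N L m t p k σ‖ := by
  have h : S.conjHistory N L m t p k σ = star (S.history N L m t p k σ) := by
    unfold Model.conjHistory Model.history timeIntegral
    rw [← starRingEnd_apply, ← integral_conj]
    refine integral_congr_ae (Eventually.of_forall fun s => ?_)
    have he : ∀ x E : ℝ, (starRingEnd ℂ) (Complex.exp (-Complex.I * (x : ℂ) * (E : ℂ))) =
        Complex.exp (Complex.I * (x : ℂ) * (E : ℂ)) := fun x E => by
      rw [← Complex.exp_conj]; simp
    simp only [map_prod, map_mul, he]
    rfl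
  rw [h, norm_star]

end

/-! ### Integrating out the delta functions -/

section

variable {d n N : ℕ} {S : Model d} {K : Constants} {m m' : Fin (n + 1) → ℕ}

lemma IsDensityMatrix.diag {L : ℝ} {g : DualLat d → DualLat d → ℂ} (hg : IsDensityMatrix L g)
    (p : DualLat d) : 0 ≤ g p p := by
  simpa using hg.posSemidef.2 (Finsupp.single p 1)

lemma IsDensityMatrix.enorm_diag {L : ℝ} {g : DualLat d → DualLat d → ℂ}
    (hg : IsDensityMatrix L g) (p : DualLat d) : ‖g p p‖ₑ = ENNReal.ofReal (g p p).re := by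
  have h := Complex.eq_re_of_ofReal_le (r := 0) (by simpa using hg.diag p)
  rw [h, ← ofReal_norm_eq_enorm, Complex.norm_real,
    Real.norm_of_nonneg (Complex.le_def.1 (hg.diag p)).1, Complex.ofReal_re]

namespace Model

/-- The sum over the phonon momenta of a pairing, for fixed electron momentum and signs. -/
def momSum (S : Model d) (N : ℕ) (L : ℝ) (m m' : Fin (n + 1) → ℕ) (π : Equiv.Perm (Fin n)) (t : ℝ)
    (p : Mom d) (σ : Fin n → ℤˣ) : ℝ≥0∞ :=
  ENNReal.ofReal (L ^ d)⁻¹ ^ n * ∑' z : Fin n → DualLat d,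
    (∏ j, ENNReal.ofReal (S.M (latPt L (z j)) (σ j))) *
      (‖S.history N L m t p (fun j => latPt L (z j)) σ‖ₑ *
        ‖S.history N L m' t p (fun j => latPt L (z (π.symm j))) (fun l => σ (π.symm l))‖ₑ)

end Model

lemma enorm_prod (s : Finset (Fin n)) (f : Fin n → ℂ) : ‖∏ i ∈ s, f i‖ₑ = ∏ i ∈ s, ‖f i‖ₑ := by
  simp only [enorm_eq_nnnorm, nnnorm_prod, ENNReal.ofNNReal_finsetProd]

lemma Assumptions.enorm_M (A : Assumptions K S) (hd : 3 ≤ d) (k : Mom d) (σ : ℤˣ) :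
    ‖(S.M k σ : ℂ)‖ₑ = ENNReal.ofReal (S.M k σ) := by
  rw [← ofReal_norm_eq_enorm, Complex.norm_real, Real.norm_of_nonneg ((A.M_decay hd σ).nonneg k)]

/-- The delta functions of a pairing are integrated out. -/
theorem Assumptions.enorm_pairingValue_le (A : Assumptions K S) (hd : 3 ≤ d) {L : ℝ} (hL : 0 < L)
    {g : DualLat d → DualLat d → ℂ} (hg : IsDensityMatrix L g) (lam t : ℝ)
    (π : Equiv.Perm (Fin n)) :
    ‖S.pairingValue N L g lam m m' π t‖ₑ ≤ ENNReal.ofReal ((lam ^ 2) ^ N) *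
      ∑ σ : Fin n → ℤˣ, ∑' p, ENNReal.ofReal ((g p p).re / L ^ d) *
        S.momSum N L m m' π t (latPt L p) σ := by
  have hLd : (0 : ℝ) < L ^ d := by positivity
  unfold Model.pairingValue
  rw [enorm_mul]
  refine mul_le_mul' (le_of_eq ?_) ((enorm_sum_le _ _).trans (Finset.sum_le_sum fun σ _ => ?_))
  · rw [← ofReal_norm_eq_enorm, norm_pow, Complex.norm_real, pow_mul, Real.norm_eq_abs, sq_abs]
  rw [enorm_mul]
  set c : ℝ≥0∞ := ENNReal.ofReal (L ^ d)⁻¹ with hc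
  set u : ℝ≥0∞ := ENNReal.ofReal (L ^ d) with hu
  have hcu : c * u = 1 := by
    rw [hc, hu, ← ENNReal.ofReal_mul (by positivity), inv_mul_cancel₀ hLd.ne', ENNReal.ofReal_one]
  have hcn : ‖(((L : ℂ) ^ d)⁻¹) ^ (2 * n + 2)‖ₑ = c ^ (2 * n + 2) := by
    rw [← ofReal_norm_eq_enorm, norm_pow, norm_inv, norm_pow, Complex.norm_real,
      Real.norm_of_nonneg hL.le, ENNReal.ofReal_pow (by positivity)]
  set F : DualLat d × DualLat d × (Fin n → DualLat d) × (Fin n → DualLat d) → ℂ := fun x =>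
    (∏ j : Fin n, (S.M (latPt L (x.2.2.1 j)) (σ j) : ℂ) *
            (latDelta L (x.2.2.1 j - x.2.2.2 (π j)) : ℂ)) *
          ((latDelta L (x.1 - x.2.1) : ℂ) * g x.1 x.2.1) *
          S.Y N L m m' π t (latPt L x.1) (latPt L x.2.1)
            (fun j => latPt L (x.2.2.1 j)) (fun j => latPt L (x.2.2.2 j)) σ with hF
  -- The delta functions confine the sum to the image of this injection: the two electron momenta
  -- agree, and the phonon momenta of the second history are those of the first permuted by π.
  set ι : DualLat d × (Fin n → DualLat d) →
      DualLat d × DualLat d × (Fin n → DualLat d) × (Fin n → DualLat d) :=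
    fun y => (y.1, y.1, y.2, fun l => y.2 (π.symm l)) with hι
  have hinj : Function.Injective ι := fun y y' h => by
    simp only [hι, Prod.mk.injEq] at h
    exact Prod.ext h.1 h.2.2.1
  have hsupp : Function.support (fun x => ‖F x‖ₑ) ⊆ Set.range ι := by
    intro x hx
    have hx' : F x ≠ 0 := by simpa using hx
    have h1 : x.1 = x.2.1 := by
      by_contra hne
      refine hx' ?_
      have : latDelta L (x.1 - x.2.1) = 0 := if_neg (sub_ne_zero.2 hne)
      simp only [hF, this, Complex.ofReal_zero, zero_mul, mul_zero]
    have h2 : ∀ j, x.2.2.1 j = x.2.2.2 (π j) := by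
      by_contra! hne
      obtain ⟨j, hj⟩ := hne
      refine hx' ?_
      have : latDelta L (x.2.2.1 j - x.2.2.2 (π j)) = 0 := if_neg (sub_ne_zero.2 hj)
      simp only [hF]
      rw [Finset.prod_eq_zero (Finset.mem_univ j) (by rw [this]; simp), zero_mul, zero_mul]
    refine ⟨(x.1, x.2.2.1), ?_⟩
    refine Prod.ext rfl (Prod.ext h1 (Prod.ext rfl (funext fun l => ?_)))
    simp [hι, h2]
  have hval : ∀ y : DualLat d × (Fin n → DualLat d), ‖F (ι y)‖ₑ = u ^ (n + 1) *
      (ENNReal.ofReal (g y.1 y.1).re * ((∏ j, ENNReal.ofReal (S.M (latPt L (y.2 j)) (σ j))) *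
      (‖S.history N L m t (latPt L y.1) (fun j => latPt L (y.2 j)) σ‖ₑ *
        ‖S.history N L m' t (latPt L y.1) (fun j => latPt L (y.2 (π.symm j)))
          (fun l => σ (π.symm l))‖ₑ))) := by
    intro y
    have hδ : (latDelta L (0 : DualLat d)) = L ^ d := if_pos rfl
    have hδu : ‖((L ^ d : ℝ) : ℂ)‖ₑ = u := by
      rw [← ofReal_norm_eq_enorm, Complex.norm_real, Real.norm_of_nonneg hLd.le]
    have hconj : ∀ (p : Mom d) (k : Fin n → Mom d) (s : Fin n → ℤˣ),
        ‖S.conjHistory N L m' t p k s‖ₑ = ‖S.history N L m' t p k s‖ₑ := fun p k s => by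
      rw [← ofReal_norm_eq_enorm, norm_conjHistory, ofReal_norm_eq_enorm]
    simp only [hF, hι, Equiv.symm_apply_apply, sub_self, hδ, Model.Y]
    rw [enorm_mul, enorm_mul, enorm_mul, enorm_mul, enorm_prod, hconj, hδu, hg.enorm_diag]
    simp only [enorm_mul, hδu, A.enorm_M hd]
    rw [Finset.prod_mul_distrib, Finset.prod_const, Finset.card_univ, Fintype.card_fin]
    ring
  refine (mul_le_mul' hcn.le enorm_tsum_le_tsum_enorm).trans (le_of_eq ?_)
  rw [← hinj.tsum_eq hsupp]
  simp only [hval]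
  rw [ENNReal.tsum_mul_left, ENNReal.tsum_prod']
  simp only [ENNReal.tsum_mul_left, Model.momSum]
  have hdiv : ∀ p, ENNReal.ofReal ((g p p).re / L ^ d) = c * ENNReal.ofReal (g p p).re := fun p => by
    rw [div_eq_inv_mul, ENNReal.ofReal_mul (by positivity)]
  simp only [hdiv]
  -- The n + 1 delta functions, each of size L^d, cancel half of the 2n + 2 volume factors.
  have hpow : c ^ (2 * n + 2) * u ^ (n + 1) = c ^ (n + 1) := by
    rw [show 2 * n + 2 = (n + 1) + (n + 1) by ring, pow_add, mul_assoc, ← mul_pow, hcu, one_pow,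
      mul_one]
  rw [← mul_assoc, hpow, ← ENNReal.tsum_mul_left]
  refine tsum_congr fun p => ?_
  rw [pow_succ]
  ring

end

/-! ### Momentum sums and their continuum limit -/

section

variable {d n N : ℕ} {S : Model d} {K : Constants} {m m' : Fin (n + 1) → ℕ}

lemma momWeight_perm (π : Equiv.Perm (Fin n)) (p : Mom d) (k : Fin n → Mom d) :
    momWeight p (fun j => k (π j)) = momWeight p k := by
  unfold momWeight
  rw [Equiv.prod_comp π fun i => 2 * bracket (k i)]

lemma enorm_mul_enorm_le {a b a₀ b₀ : ℂ} {X δ δ' : ℝ} (ha : ‖a - a₀‖ ≤ δ) (hb : ‖b - b₀‖ ≤ δ')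
    (hbX : ‖b‖ ≤ X) (haX : ‖a₀‖ ≤ X) :
    ‖a‖ₑ * ‖b‖ₑ ≤ ‖a₀‖ₑ * ‖b₀‖ₑ + ENNReal.ofReal (X * (δ + δ')) := by
  have hX : 0 ≤ X := (norm_nonneg _).trans hbX
  have h1 : ‖a * b‖ ≤ ‖a₀ * b₀‖ + X * (δ + δ') := by
    have e : a * b = a₀ * b₀ + ((a - a₀) * b + a₀ * (b - b₀)) := by ring
    rw [e]
    refine (norm_add_le _ _).trans (add_le_add_right ((norm_add_le _ _).trans ?_) _)
    rw [norm_mul, norm_mul, mul_add, mul_comm X δ]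
    exact add_le_add (mul_le_mul ha hbX (norm_nonneg _) ((norm_nonneg _).trans ha))
      (mul_le_mul haX hb (norm_nonneg _) hX)
  rw [← enorm_mul, ← enorm_mul, ← ofReal_norm_eq_enorm, ← ofReal_norm_eq_enorm (a₀ * b₀)]
  exact (ENNReal.ofReal_le_ofReal h1).trans ENNReal.ofReal_add_le

lemma lintegral_prod_ofReal {f : Mom d → ℝ} (hf : Integrable f) (h0 : ∀ k, 0 ≤ f k) (n : ℕ) :
    ∫⁻ k : Fin n → Mom d, ∏ i, ENNReal.ofReal (f (k i)) = ENNReal.ofReal ((∫ k, f k) ^ n) := by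
  have hi : Integrable fun k : Fin n → Mom d => ∏ i, f (k i) := Integrable.fintype_prod fun _ => hf
  have h1 : ∀ k : Fin n → Mom d, ∏ i, ENNReal.ofReal (f (k i)) = ENNReal.ofReal (∏ i, f (k i)) :=
    fun k => (ENNReal.ofReal_prod_of_nonneg fun i _ => h0 _).symm
  simp only [h1]
  rw [← ofReal_integral_eq_lintegral_ofReal hi
    (Eventually.of_forall fun k => Finset.prod_nonneg fun i _ => h0 _)]
  congr 1
  rw [integral_fintype_prod_volume_eq_pow, Fintype.card_fin]

lemma integrable_weight_bracket (c : ℝ) :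
    Integrable fun k : Mom d => c * wt (4 * d + 23) k * (2 * bracket k) := by
  have h : (fun k : Mom d => c * wt (4 * d + 23) k * (2 * bracket k)) =
      fun k => 2 * c * wt (4 * d + 22) k := by
    funext k
    have := wt_mul_pow (4 * d + 22) 1 k
    rw [pow_one] at this
    rw [← this]; ring
  rw [h]
  exact (integrable_wt (by omega)).const_mul _

/-- Momentum sums converge to integrals. -/
theorem Assumptions.momSum_le (A : Assumptions K S) (hd : 3 ≤ d) (hm : m ∈ patterns n N)
    (hm' : m' ∈ patterns n N) (π : Equiv.Perm (Fin n)) {t : ℝ} (ht : 0 < t) :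
    ∃ D : ℝ, 0 ≤ D ∧ ∀ L : ℝ, 0 < L → spacing L ≤ 1 → ∀ (p : Mom d) (σ : Fin n → ℤˣ),
      S.momSum N L m m' π t p σ ≤
        (∫⁻ k : Fin n → Mom d, (∏ i, ENNReal.ofReal (roundM d K S.β * wt (4 * d + 23) (k i))) *
          (‖S.histMap id N m t p k σ‖ₑ *
            ‖S.histMap id N m' t p (fun j => k (π.symm j)) (fun j => σ (π.symm j))‖ₑ)) +
        ENNReal.ofReal (D * bracket p * spacing L) := by
  obtain ⟨D₁, hD₁, h₁⟩ := A.norm_histMap_sub_le hd hm ht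
  obtain ⟨D₂, hD₂, h₂⟩ := A.norm_histMap_sub_le hd hm' ht
  have hR := A.roundM_nonneg hd
  have hB := A.one_le_thetaBound hd
  set X : ℝ := thetaBound d K S.β ^ (N + 1) * t ^ N with hX
  have hX0 : 0 ≤ X := by positivity
  set J : ℝ := ∫ k : Mom d, roundM d K S.β * wt (4 * d + 23) k * (2 * bracket k) with hJ
  have hJ0 : 0 ≤ J := integral_nonneg fun k => by
    have := bracket_pos k
    have := wt_pos (4 * d + 23) k
    positivity
  set Q : ℝ := X * (D₁ + D₂) * Real.sqrt d with hQ
  have hQ0 : 0 ≤ Q := by positivity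
  refine ⟨Q * 2 * J ^ n, by positivity, fun L hL hL1 p σ => ?_⟩
  have hs := spacing_pos hL
  have hr := isRounding_latRound (d := d) hL
  have hε := sqrt_mul_spacing_le (d := d) hL1
  have h0 : (0 : ℝ) ≤ Real.sqrt d := Real.sqrt_nonneg _
  have hp := bracket_pos p
  set G : (Fin n → DualLat d) → ℝ≥0∞ := fun z =>
    (∏ j, ENNReal.ofReal (S.M (latPt L (z j)) (σ j))) *
      (‖S.history N L m t p (fun j => latPt L (z j)) σ‖ₑ *
        ‖S.history N L m' t p (fun j => latPt L (z (π.symm j))) (fun l => σ (π.symm l))‖ₑ) with hG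
  have hsum : S.momSum N L m m' π t p σ ≤ ∫⁻ k : Fin n → Mom d, G fun i => cellIdx L (k i) := by
    rw [lintegral_cellIdx hL, Model.momSum, mul_comm]
    refine mul_le_mul_right ?_ _
    refine pow_le_pow_left' (ENNReal.ofReal_le_ofReal ?_) n
    rw [← cellConst_mul_spacing_pow]
    -- For an upper bound the cell constant, which is at most 1, is simply dropped in the sums over
    -- k.
    exact mul_le_of_le_one_left (by positivity) cellConst_le_one
  refine hsum.trans ?_
  have hpt : ∀ k : Fin n → Mom d, G (fun i => cellIdx L (k i)) ≤
      (∏ i, ENNReal.ofReal (roundM d K S.β * wt (4 * d + 23) (k i))) *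
          (‖S.histMap id N m t p k σ‖ₑ *
            ‖S.histMap id N m' t p (fun j => k (π.symm j)) (fun j => σ (π.symm j))‖ₑ) +
        ENNReal.ofReal (Q * 2 * bracket p * spacing L) *
          ∏ i, ENNReal.ofReal (roundM d K S.β * wt (4 * d + 23) (k i) * (2 * bracket (k i))) := by
    intro k
    have a1 := h₁ _ _ hr hε p k σ
    have a2 := h₂ _ _ hr hε p (fun j => k (π.symm j)) (fun j => σ (π.symm j))
    rw [momWeight_perm] at a2
    have a3 := A.norm_histMap_le hd hm' ht hr hε p (fun i => latRound L (k (π.symm i)))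
      (fun j => σ (π.symm j))
    have a4 := A.norm_histMap_le hd hm ht isRounding_id h0 p k σ
    have a5 := enorm_mul_enorm_le a1 a2 a3 a4
    have a6 : ∏ i, ENNReal.ofReal (S.M (latRound L (k i)) (σ i)) ≤
        ∏ i, ENNReal.ofReal (roundM d K S.β * wt (4 * d + 23) (k i)) :=
      Finset.prod_le_prod' fun i _ => ENNReal.ofReal_le_ofReal (A.M_round_le hd hr hε _ _)
    have a7 : G (fun i => cellIdx L (k i)) =
        (∏ i, ENNReal.ofReal (S.M (latRound L (k i)) (σ i))) *
        (‖S.histMap (latRound L) N m t p (fun i => latRound L (k i)) σ‖ₑ *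
          ‖S.histMap (latRound L) N m' t p (fun i => latRound L (k (π.symm i)))
            (fun j => σ (π.symm j))‖ₑ) := by
      simp only [hG]
      rw [A.history_eq hd hL hL1, A.history_eq hd hL hL1]
      rfl
    rw [a7]
    refine (mul_le_mul' a6 a5).trans ?_
    rw [mul_add]
    refine add_le_add_right (le_of_eq ?_) _
    -- The error grows with the momenta only through a product of brackets, integrable against the
    -- phonon weights; what remains is one power of ⟨p⟩ and the lattice spacing.
    have e1 : X * (D₁ * momWeight p k * (Real.sqrt d * spacing L) +
        D₂ * momWeight p k * (Real.sqrt d * spacing L)) =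
        (Q * 2 * bracket p * spacing L) * ∏ i, (2 * bracket (k i)) := by
      rw [hQ, momWeight]; ring
    rw [e1, ENNReal.ofReal_mul (by positivity), mul_left_comm]
    congr 1
    rw [ENNReal.ofReal_prod_of_nonneg fun i _ => by have := bracket_pos (k i); positivity,
      ← Finset.prod_mul_distrib]
    refine Finset.prod_congr rfl fun i _ => ?_
    have := wt_pos (4 * d + 23) (k i)
    rw [ENNReal.ofReal_mul (p := roundM d K S.β * wt (4 * d + 23) (k i)) (by positivity)]
  refine (lintegral_mono hpt).trans ?_
  have hmeas : Measurable fun k : Fin n → Mom d =>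
      ENNReal.ofReal (Q * 2 * bracket p * spacing L) *
        ∏ i, ENNReal.ofReal (roundM d K S.β * wt (4 * d + 23) (k i) * (2 * bracket (k i))) := by
    refine Measurable.const_mul (Finset.measurable_prod _ fun i _ => ?_) _
    have h1 : Measurable fun k : Mom d =>
        ENNReal.ofReal (roundM d K S.β * wt (4 * d + 23) k * (2 * bracket k)) := by
      have c1 := (continuous_wt (d := d) (4 * d + 23)).measurable
      have c2 := (continuous_bracket (d := d)).measurable
      fun_prop
    exact h1.comp (measurable_pi_apply i)
  rw [lintegral_add_right _ hmeas]
  refine add_le_add_right (le_of_eq ?_) _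
  rw [lintegral_const_mul' _ _ ENNReal.ofReal_ne_top,
    lintegral_prod_ofReal (integrable_weight_bracket (roundM d K S.β)) (fun k => by
      have := bracket_pos k
      have := wt_pos (4 * d + 23) k
      positivity), ← ENNReal.ofReal_mul (by positivity)]
  congr 1
  rw [← hJ]; ring

end

/-! ### The continuum bound for a staircase -/

section

variable {d n N : ℕ} {S : Model d} {K : Constants} {m m' : Fin (n + 1) → ℕ}

/-- The indices l ≥ j are the images under π of the i with π i ≥ j, so the second history, in terms
of the momenta of the first, sees the sets `permTail`. -/
lemma histEnergy_perm (π : Equiv.Perm (Fin n)) (p : Mom d) (σ : Fin n → ℤˣ) (k : Fin n → Mom d)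
    (j : ℕ) : histEnergy S p (fun i => σ (π.symm i)) (fun i => k (π.symm i)) j =
      conjEnergy S π p σ k j := by
  have h : tailSet n j = (permTail π j).map π.toEmbedding := by
    ext l
    simp only [tailSet, permTail, Finset.mem_filter, Finset.mem_univ, true_and, Finset.mem_map_equiv,
      Equiv.apply_symm_apply]
  simp [histEnergy, conjEnergy, Model.En, h]

/-- The bound for the continuum pairing integral at large times. -/
lemma lintegral_hist_le (hd : 3 ≤ d) (K : Constants) (β : ℝ) : ∃ C : ℝ, 1 ≤ C ∧
    ∀ S : Model d, S.β = β → Assumptions K S → ∀ t : ℝ, 1 ≤ t → ∀ n N : ℕ, 3 ≤ n →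
    ∀ m ∈ patterns n N, ∀ m' ∈ patterns n N, ∀ (π : Equiv.Perm (Fin n)) (x : Fin n)
      (P : Finset (Fin n)), RightPeaks π x P ∨ LeftPeaks π x P → ∀ (σ : Fin n → ℤˣ) (p : Mom d),
      ∫⁻ k : Fin n → Mom d, (∏ i, ENNReal.ofReal (roundM d K β * wt (4 * d + 23) (k i))) *
          (‖S.histMap id N m t p k σ‖ₑ *
            ‖S.histMap id N m' t p (fun j => k (π.symm j)) (fun j => σ (π.symm j))‖ₑ) ≤
      ENNReal.ofReal (C ^ N * (t ^ (2 - (P.card : ℤ)) * t ^ N * logStar t ^ (n + P.card + 2)) *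
        bracket p ^ 16) := by
  obtain ⟨C₁, hC₁, h₁⟩ := enorm_histMap_le (d := d) hd K β
  obtain ⟨C₂, hC₂, h₂⟩ := pairing_integral_bound (d := d) hd K
  set R : ℝ := max 1 (roundM d K β) with hR
  have hR1 : 1 ≤ R := le_max_left _ _
  refine ⟨R * 9 * C₁ * C₂, ?_, ?_⟩
  · exact one_le_mul_of_one_le_of_one_le (one_le_mul_of_one_le_of_one_le
      (one_le_mul_of_one_le_of_one_le hR1 (by norm_num)) hC₁) hC₂
  intro S hβ A t ht n N hn m hm m' hm' π x P hP σ p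
  have hm0 : n + 2 * ∑ j, m j = N := hm
  have hm0' : n + 2 * ∑ j, m' j = N := hm'
  have ht0 : 0 < t := by linarith
  have hN : 0 < N := by omega
  have hR0 : 0 ≤ roundM d K β := hβ ▸ A.roundM_nonneg hd
  have hl := logStar_ge_one t
  have hb := one_le_bracket p
  set M := ∑ j, m j with hM
  -- Both histories contain the same number of reabsorptions, namely (N - n)/2.
  have hMM : ∑ j, m' j = M := by omega
  have hκ : P.card ≤ n := (Finset.card_le_univ P).trans (by simp)
  set e₁ : ℝ := Real.exp 1 * (C₁ * t) ^ M with he₁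
  have he₁0 : 0 ≤ e₁ := by positivity
  have hpt : ∀ k : Fin n → Mom d, (∏ i, ENNReal.ofReal (roundM d K β * wt (4 * d + 23) (k i))) *
          (‖S.histMap id N m t p k σ‖ₑ *
            ‖S.histMap id N m' t p (fun j => k (π.symm j)) (fun j => σ (π.symm j))‖ₑ) ≤
      ENNReal.ofReal (roundM d K β ^ n * e₁ ^ 2) * ((∏ i, ENNReal.ofReal (wt (4 * d + 23) (k i))) *
        ((∫⁻ α, ∏ j ∈ Finset.range (n + 1), ENNReal.ofReal (rr t (α - histEnergy S p σ k j))) *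
          ∫⁻ α, ∏ j ∈ Finset.range (n + 1), ENNReal.ofReal (rr t (α - conjEnergy S π p σ k j)))) := by
    intro k
    have a1 := h₁ S hβ A n N m hm hN t ht p k σ
    have a2 := h₁ S hβ A n N m' hm' hN t ht p (fun j => k (π.symm j)) (fun j => σ (π.symm j))
    simp only [histEnergy_perm] at a2
    rw [hMM] at a2
    have a3 : ∏ i, ENNReal.ofReal (roundM d K β * wt (4 * d + 23) (k i)) =
        ENNReal.ofReal (roundM d K β ^ n) * ∏ i, ENNReal.ofReal (wt (4 * d + 23) (k i)) := by
      simp only [ENNReal.ofReal_mul hR0]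
      rw [Finset.prod_mul_distrib, Finset.prod_const, Finset.card_univ, Fintype.card_fin,
        ENNReal.ofReal_pow hR0]
    rw [a3]
    refine (mul_le_mul_right (mul_le_mul' a1 a2) _).trans (le_of_eq ?_)
    rw [ENNReal.ofReal_mul (p := roundM d K β ^ n) (by positivity), ENNReal.ofReal_pow he₁0]
    ring
  refine (lintegral_mono hpt).trans ?_
  rw [lintegral_const_mul' _ _ ENNReal.ofReal_ne_top]
  refine (mul_le_mul_right (h₂ S A t ht n hn π x P hP σ p) _).trans ?_
  rw [← ENNReal.ofReal_mul (by positivity)]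
  refine ENNReal.ofReal_le_ofReal ?_
  have hz : t ^ (2 - (P.card : ℤ)) * t ^ N = t ^ (N + 2 - P.card) := by
    rw [← zpow_natCast t N, ← zpow_natCast t (N + 2 - P.card), ← zpow_add₀ ht0.ne']
    congr 1
    omega
  have hexp : Real.exp 1 ^ 2 ≤ 9 := by
    have := Real.exp_one_lt_d9
    have := Real.exp_pos 1
    nlinarith
  have c1 : roundM d K β ^ n ≤ R ^ N :=
    (pow_le_pow_left₀ hR0 (le_max_right _ _) n).trans (pow_le_pow_right₀ hR1 (by omega))
  have c2 : Real.exp 1 ^ 2 ≤ 9 ^ N :=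
    hexp.trans ((pow_one (9 : ℝ)).symm.le.trans (pow_le_pow_right₀ (by norm_num) hN))
  have c3 : C₁ ^ (M * 2) ≤ C₁ ^ N := pow_le_pow_right₀ hC₁ (by omega)
  have c4 : C₂ ^ n ≤ C₂ ^ N := pow_le_pow_right₀ hC₂ (by omega)
  -- Since 2M = N - n, the exponent on the left is N + 1 - |P|; for t ≥ 1 this leaves a factor t to
  -- spare.
  have c5 : t ^ (M * 2) * t ^ (n + 1 - P.card) ≤ t ^ (N + 2 - P.card) := by
    rw [← pow_add]; exact pow_le_pow_right₀ ht (by omega)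
  rw [hz]
  have hR0' : 0 ≤ R := by linarith
  calc roundM d K β ^ n * e₁ ^ 2 * (C₂ ^ n * bracket p ^ 16 * t ^ (n + 1 - P.card) *
        logStar t ^ (n + P.card + 2))
      = (roundM d K β ^ n * Real.exp 1 ^ 2 * C₁ ^ (M * 2) * C₂ ^ n) *
        ((t ^ (M * 2) * t ^ (n + 1 - P.card)) * logStar t ^ (n + P.card + 2)) * bracket p ^ 16 := by
        rw [he₁, mul_pow, mul_pow, mul_pow, ← pow_mul, ← pow_mul]; ring
    _ ≤ (R ^ N * 9 ^ N * C₁ ^ N * C₂ ^ N) *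
        (t ^ (N + 2 - P.card) * logStar t ^ (n + P.card + 2)) * bracket p ^ 16 := by
        gcongr
    _ = _ := by rw [mul_pow, mul_pow, mul_pow]

/-- The bound for the continuum pairing integral at small times. -/
lemma lintegral_hist_le_of_lt_one (hd : 3 ≤ d) (K : Constants) (β : ℝ) : ∃ C : ℝ, 1 ≤ C ∧
    ∀ S : Model d, S.β = β → Assumptions K S → ∀ t : ℝ, 0 < t → t < 1 → ∀ n N : ℕ, 0 < N → n ≤ N →
    ∀ m ∈ patterns n N, ∀ m' ∈ patterns n N, ∀ (π : Equiv.Perm (Fin n)) (κ : ℕ), 1 ≤ κ →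
    ∀ (σ : Fin n → ℤˣ) (p : Mom d),
      ∫⁻ k : Fin n → Mom d, (∏ i, ENNReal.ofReal (roundM d K β * wt (4 * d + 23) (k i))) *
          (‖S.histMap id N m t p k σ‖ₑ *
            ‖S.histMap id N m' t p (fun j => k (π.symm j)) (fun j => σ (π.symm j))‖ₑ) ≤
      ENNReal.ofReal (C ^ N * (t ^ (2 - (κ : ℤ)) * t ^ N * logStar t ^ (n + κ + 2)) *
        bracket p ^ 16) := by
  set J : ℝ := ∫ k : Mom d, roundM d K β * wt (4 * d + 23) k with hJ
  refine ⟨max 1 J * max 1 (thetaBound d K β) ^ 4, one_le_mul_of_one_le_of_one_le (le_max_left _ _)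
    (one_le_pow₀ (le_max_left _ _)), ?_⟩
  intro S hβ A t ht0 ht n N hN hn m hm m' hm' π κ hκ σ p
  have hR0 : 0 ≤ roundM d K β := hβ ▸ A.roundM_nonneg hd
  have hB1 : 1 ≤ thetaBound d K β := hβ ▸ A.one_le_thetaBound hd
  have h0 : (0 : ℝ) ≤ Real.sqrt d := Real.sqrt_nonneg _
  have hl := logStar_ge_one t
  have hb := one_le_bracket p
  set B := thetaBound d K β with hB
  have hX : ∀ μ ∈ patterns n N, ∀ (k : Fin n → Mom d) (s : Fin n → ℤˣ),
      ‖S.histMap id N μ t p k s‖ₑ ≤ ENNReal.ofReal (B ^ (N + 1) * t ^ N) := fun μ hμ k s => by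
    rw [← ofReal_norm_eq_enorm]
    have := A.norm_histMap_le hd hμ ht0 isRounding_id h0 p k s
    rw [hβ] at this
    exact ENNReal.ofReal_le_ofReal this
  have hJ0 : 0 ≤ J := integral_nonneg fun k => mul_nonneg hR0 (wt_pos _ k).le
  calc _ ≤ ∫⁻ k : Fin n → Mom d, (∏ i, ENNReal.ofReal (roundM d K β * wt (4 * d + 23) (k i))) *
        (ENNReal.ofReal (B ^ (N + 1) * t ^ N) * ENNReal.ofReal (B ^ (N + 1) * t ^ N)) :=
        lintegral_mono fun k => mul_le_mul_right (mul_le_mul' (hX m hm _ _) (hX m' hm' _ _)) _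
    _ = ENNReal.ofReal (J ^ n * ((B ^ (N + 1) * t ^ N) * (B ^ (N + 1) * t ^ N))) := by
        rw [lintegral_mul_const' _ _ (ENNReal.mul_ne_top ENNReal.ofReal_ne_top ENNReal.ofReal_ne_top),
          lintegral_prod_ofReal ((integrable_wt (by omega)).const_mul _)
            (fun k => mul_nonneg hR0 (wt_pos _ k).le),
          ENNReal.ofReal_mul (p := J ^ n) (by positivity),
          ENNReal.ofReal_mul (p := B ^ (N + 1) * t ^ N) (by positivity)]
    _ ≤ _ := by
        refine ENNReal.ofReal_le_ofReal ?_
        have c1 : J ^ n ≤ max 1 J ^ N := (pow_le_pow_left₀ hJ0 (le_max_right _ _) n).trans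
          (pow_le_pow_right₀ (le_max_left _ _) hn)
        have c2 : B ^ (2 * (N + 1)) ≤ max 1 B ^ (4 * N) :=
          (pow_le_pow_left₀ (by linarith) (le_max_right _ _) _).trans
            (pow_le_pow_right₀ (le_max_left _ _) (by omega))
        -- For t < 1 the comparison is reversed, and 2N ≥ N + 2 - κ because N and κ are at least 1.
        have c3 : t ^ (2 * N) ≤ t ^ (2 - (κ : ℤ)) * t ^ N := by
          rw [← zpow_natCast t N, ← zpow_natCast t (2 * N), ← zpow_add₀ ht0.ne']
          refine zpow_le_zpow_right_of_le_one₀ ht0 ht.le ?_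
          push_cast
          omega
        have c4 : 1 ≤ logStar t ^ (n + κ + 2) := one_le_pow₀ hl
        have c5 : 1 ≤ bracket p ^ 16 := one_le_pow₀ hb
        have hM1 : (0 : ℝ) ≤ max 1 J := zero_le_one.trans (le_max_left _ _)
        have hM2 : (0 : ℝ) ≤ max 1 B := zero_le_one.trans (le_max_left _ _)
        calc J ^ n * ((B ^ (N + 1) * t ^ N) * (B ^ (N + 1) * t ^ N))
            = J ^ n * B ^ (2 * (N + 1)) * t ^ (2 * N) := by ring
          _ ≤ max 1 J ^ N * max 1 B ^ (4 * N) * (t ^ (2 - (κ : ℤ)) * t ^ N) := by gcongr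
          _ ≤ max 1 J ^ N * max 1 B ^ (4 * N) * (t ^ (2 - (κ : ℤ)) * t ^ N) *
              logStar t ^ (n + κ + 2) * bracket p ^ 16 := by
              rw [mul_assoc _ _ (bracket p ^ 16)]
              exact le_mul_of_one_le_right (by positivity)
                (one_le_mul_of_one_le_of_one_le c4 c5)
          _ = _ := by rw [mul_pow, ← pow_mul]; ring

/-- The bound for the continuum pairing integral. -/
theorem lintegral_hist_le_of_staircase (hd : 3 ≤ d) (K : Constants) (β : ℝ) : ∃ C : ℝ, 1 ≤ C ∧
    ∀ S : Model d, S.β = β → Assumptions K S → ∀ t : ℝ, 0 < t → ∀ n N : ℕ,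
    ∀ m ∈ patterns n N, ∀ m' ∈ patterns n N, ∀ (π : Equiv.Perm (Fin n)) (κ : ℕ), 1 ≤ κ →
    ((∃ a h : Fin κ → ℕ, IsIncreasingStaircase π κ a h) ∨
      (∃ a h : Fin κ → ℕ, IsDecreasingStaircase π κ a h)) → ∀ (σ : Fin n → ℤˣ) (p : Mom d),
      ∫⁻ k : Fin n → Mom d, (∏ i, ENNReal.ofReal (roundM d K β * wt (4 * d + 23) (k i))) *
          (‖S.histMap id N m t p k σ‖ₑ *
            ‖S.histMap id N m' t p (fun j => k (π.symm j)) (fun j => σ (π.symm j))‖ₑ) ≤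
      ENNReal.ofReal (C ^ N * (t ^ (2 - (κ : ℤ)) * t ^ N * logStar t ^ (n + κ + 2)) *
        bracket p ^ 16) := by
  obtain ⟨C₁, hC₁, h₁⟩ := lintegral_hist_le (d := d) hd K β
  obtain ⟨C₂, hC₂, h₂⟩ := lintegral_hist_le_of_lt_one (d := d) hd K β
  refine ⟨max C₁ C₂, hC₁.trans (le_max_left _ _), ?_⟩
  intro S hβ A t ht n N m hm m' hm' π κ hκ hst σ p
  obtain ⟨hn, x, P, hPκ, hP⟩ := exists_peaks hκ hst
  have hm0 : n + 2 * ∑ j, m j = N := hm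
  have hl := logStar_ge_one t
  have hb := one_le_bracket p
  have hmono : ∀ c : ℝ, 1 ≤ c → c ≤ max C₁ C₂ →
      ENNReal.ofReal (c ^ N * (t ^ (2 - (κ : ℤ)) * t ^ N * logStar t ^ (n + κ + 2)) *
        bracket p ^ 16) ≤
      ENNReal.ofReal (max C₁ C₂ ^ N * (t ^ (2 - (κ : ℤ)) * t ^ N * logStar t ^ (n + κ + 2)) *
        bracket p ^ 16) := fun c hc hc' => ENNReal.ofReal_le_ofReal (by gcongr)
  rcases le_or_gt 1 t with h | h
  · have := h₁ S hβ A t h n N hn m hm m' hm' π x P hP σ p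
    rw [hPκ] at this
    exact this.trans (hmono C₁ hC₁ (le_max_left _ _))
  · exact (h₂ S hβ A t ht h n N (by omega) (by omega) m hm m' hm' π κ hκ σ p).trans
      (hmono C₂ hC₂ (le_max_right _ _))

/-- The contribution of a pairing in a large box, up to discretisation errors. -/
theorem Assumptions.enorm_pairingValue_le_moment (A : Assumptions K S) (hd : 3 ≤ d)
    (hm : m ∈ patterns n N) (hm' : m' ∈ patterns n N) (π : Equiv.Perm (Fin n)) {t Z : ℝ}
    (ht : 0 < t) (hZ : 0 ≤ Z)
    (h : ∀ (σ : Fin n → ℤˣ) (p : Mom d),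
      ∫⁻ k : Fin n → Mom d, (∏ i, ENNReal.ofReal (roundM d K S.β * wt (4 * d + 23) (k i))) *
          (‖S.histMap id N m t p k σ‖ₑ *
            ‖S.histMap id N m' t p (fun j => k (π.symm j)) (fun j => σ (π.symm j))‖ₑ) ≤
      ENNReal.ofReal (Z * bracket p ^ 16)) :
    ∃ D : ℝ, 0 ≤ D ∧ ∀ L : ℝ, 0 < L → spacing L ≤ 1 → ∀ g : DualLat d → DualLat d → ℂ,
      IsDensityMatrix L g → ∀ lam : ℝ, ‖S.pairingValue N L g lam m m' π t‖ₑ ≤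
        ENNReal.ofReal ((lam ^ 2) ^ N * 2 ^ n * (Z + D * spacing L)) * moment L g := by
  obtain ⟨D, hD, hsum⟩ := A.momSum_le hd hm hm' π ht
  refine ⟨D, hD, fun L hL hL1 g hg lam => ?_⟩
  have hs := spacing_pos hL
  have hLd : (0 : ℝ) < L ^ d := by positivity
  refine (A.enorm_pairingValue_le hd hL hg lam t π).trans ?_
  have hmom : ∀ (p : Mom d) (σ : Fin n → ℤˣ), S.momSum N L m m' π t p σ ≤
      ENNReal.ofReal (Z + D * spacing L) * ENNReal.ofReal (bracket p ^ (3 * d + 12)) := by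
    intro p σ
    have hb := one_le_bracket p
    refine (hsum L hL hL1 p σ).trans ((add_le_add_left (h σ p) _).trans ?_)
    have hb0 := bracket_pos p
    rw [← ENNReal.ofReal_add (by positivity) (by positivity), ← ENNReal.ofReal_mul (by positivity)]
    refine ENNReal.ofReal_le_ofReal ?_
    -- The available moment has order 3d + 12 ≥ 16.
    have h1 : bracket p ^ 16 ≤ bracket p ^ (3 * d + 12) := pow_le_pow_right₀ hb (by omega)
    have h2 : bracket p ≤ bracket p ^ (3 * d + 12) := le_self_pow₀ hb (by omega)
    calc _ ≤ Z * bracket p ^ (3 * d + 12) + D * bracket p ^ (3 * d + 12) * spacing L := by gcongr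
      _ = _ := by ring
  have hterm : ∀ σ : Fin n → ℤˣ, ∑' p, ENNReal.ofReal ((g p p).re / L ^ d) *
      S.momSum N L m m' π t (latPt L p) σ ≤ ENNReal.ofReal (Z + D * spacing L) * moment L g := by
    intro σ
    rw [moment, ← ENNReal.tsum_mul_left]
    refine ENNReal.tsum_le_tsum fun p => ?_
    have hre : 0 ≤ (g p p).re := (Complex.le_def.1 (hg.diag p)).1
    refine (mul_le_mul_right (hmom (latPt L p) σ) _).trans (le_of_eq ?_)
    rw [mul_left_comm, ← ENNReal.ofReal_mul (by positivity)]
    congr 2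
    ring
  refine (mul_le_mul_right (Finset.sum_le_sum fun σ _ => hterm σ) _).trans (le_of_eq ?_)
  rw [Finset.sum_const, Finset.card_univ, Fintype.card_fun, Fintype.card_units_int, Fintype.card_fin,
    nsmul_eq_mul, ENNReal.ofReal_mul (by positivity), ENNReal.ofReal_mul (by positivity)]
  have h2 : ((2 ^ n : ℕ) : ℝ≥0∞) = ENNReal.ofReal (2 ^ n) := by
    rw [← ENNReal.ofReal_natCast]; push_cast; rfl
  rw [h2]
  ring

end

end Phonon

end

/-! ### The limit L → ∞ -/

theorem mainTheorem7 (d : ℕ) (hd : 3 ≤ d) (K : Constants) (β : ℝ) :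
    ∃ C : ℝ, 0 < C ∧
      ∀ S : Model d, S.β = β → Assumptions K S → (¬ ∃ c : ℝ, ∀ k, S.ω k = c) →
      ∀ γ : ℝ → DualLat d → DualLat d → ℂ, (∀ L : ℝ, 0 < L → IsDensityMatrix L (γ L)) →
        limsup (fun L : ℝ => moment L (γ L)) atTop ≤ ENNReal.ofReal K.c₈ →
      ∀ (n N : ℕ), n ≤ N → ∀ m ∈ patterns n N, ∀ m' ∈ patterns n N,
      ∀ (π : Equiv.Perm (Fin n)) (κ : ℕ), 1 ≤ κ →
        ((∃ a h : Fin κ → ℕ, IsIncreasingStaircase π κ a h) ∨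
          (∃ a h : Fin κ → ℕ, IsDecreasingStaircase π κ a h)) →
      ∀ (lam t : ℝ), 0 < t →
        limsup (fun L : ℝ => ‖S.pairingValue N L (γ L) lam m m' π t‖ₑ) atTop ≤
          ENNReal.ofReal (t ^ (2 - (κ : ℤ)) * (C * lam ^ 2 * t) ^ N *
            logStar t ^ (n + κ + 2)) := by
  obtain ⟨C₁, hC₁, h₁⟩ := lintegral_hist_le_of_staircase (d := d) hd K β
  have hc₈ : 1 ≤ max 1 K.c₈ := le_max_left _ _
  -- The factor 2 accounts for the 2^n choices of signs. A staircase forces n ≥ 3, so N ≥ 1 and the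
  -- single factor K.c₈ fits into an N-th power.
  refine ⟨2 * C₁ * max 1 K.c₈, by positivity, ?_⟩
  intro S hβ A _ γ hγ hmom n N hnN m hm m' hm' π κ hκ hst lam t ht
  have hn := (exists_peaks hκ hst).1
  have hl := logStar_ge_one t
  set Z : ℝ := C₁ ^ N * (t ^ (2 - (κ : ℤ)) * t ^ N * logStar t ^ (n + κ + 2)) with hZ
  have hZ0 : 0 ≤ Z := by positivity
  obtain ⟨D, hD, h⟩ := A.enorm_pairingValue_le_moment hd hm hm' π ht hZ0 (fun σ p => by
    rw [hβ]; exact h₁ S hβ A t ht n N m hm m' hm' π κ hκ hst σ p)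
  set u : ℝ → ℝ≥0∞ := fun L =>
    ENNReal.ofReal ((lam ^ 2) ^ N * 2 ^ n * (Z + D * spacing L)) with hu
  have hlim : Tendsto u atTop (nhds (ENNReal.ofReal ((lam ^ 2) ^ N * 2 ^ n * Z))) := by
    refine ENNReal.tendsto_ofReal ?_
    have := ((tendsto_spacing.const_mul D).const_add Z).const_mul ((lam ^ 2) ^ N * 2 ^ n)
    simpa using this
  have hev : ∀ᶠ L : ℝ in atTop, ‖S.pairingValue N L (γ L) lam m m' π t‖ₑ ≤
      (u * fun L => moment L (γ L)) L := by
    filter_upwards [eventually_gt_atTop 0, tendsto_spacing.eventually_le_const one_pos] with L hL hL1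
    exact h L hL hL1 (γ L) (hγ L hL) lam
  have hmt : limsup (fun L : ℝ => moment L (γ L)) atTop ≠ ⊤ :=
    (hmom.trans_lt ENNReal.ofReal_lt_top).ne
  -- The prefactor converges to a finite limit and the moments have finite limsup, so the limsup of
  -- the product is at most the product of the limsups.
  refine (limsup_le_limsup hev).trans ((ENNReal.limsup_mul_le' (Or.inr hmt)
    (Or.inl (by rw [hlim.limsup_eq]; exact ENNReal.ofReal_ne_top))).trans ?_)
  rw [hlim.limsup_eq]
  refine (mul_le_mul_right hmom _).trans ?_
  rw [← ENNReal.ofReal_mul (by positivity)]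
  refine ENNReal.ofReal_le_ofReal ?_
  have c1 : (2 : ℝ) ^ n ≤ 2 ^ N := pow_le_pow_right₀ (by norm_num) hnN
  have c2 : K.c₈ ≤ max 1 K.c₈ ^ N := (le_max_right _ _).trans (le_self_pow₀ hc₈ (by omega))
  calc (lam ^ 2) ^ N * 2 ^ n * Z * K.c₈
      ≤ (lam ^ 2) ^ N * 2 ^ n * Z * max 1 K.c₈ ^ N := mul_le_mul_of_nonneg_left c2 (by positivity)
    _ ≤ (lam ^ 2) ^ N * 2 ^ N * Z * max 1 K.c₈ ^ N := by gcongr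
    _ = _ := by rw [hZ, mul_pow, mul_pow, mul_pow, mul_pow]; ring
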